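/- Lemma 2.1 (Strichartz estimates for the KP group). Let $\omega_\pm(\xi,\mu)=\xi^3\mp\mu^2/\xi$ for $\xi\neq0$, and let $U_\pm(t)$ be the unitary group on $L^2(\mathbb{R}^2)$ given by $\mathcal{F}_{x,y}[U_\pm(t)\phi](\xi,\mu)=e^{it\omega_\pm(\xi,\mu)}\widehat{\phi}(\xi,\mu)$. For $\gamma\in\mathbb{R}$ let $D_x^{-\gamma}$ be the Fourier multiplier with symbol $|\xi|^{-\gamma}$. A pair $(q,r)$ is called admissible if $2\le q,r\le\infty$, $\frac12\left(\frac12-\frac1r\right)\le\frac1q\le\frac12-\frac1r$ and $(q,r)\notin\{(2,\infty),(4,\infty)\}$; put $\beta(q,r)=3\left(\frac12-\frac1r-\frac1q\right)$. Write $p'$ for the conjugate exponent of $p$, and $L^q_TL^r_{xy}=L^q((0,T);L^r(\mathbb{R}^2))$. For $n\in\mathbb{N}$ let $P_n$ be the Fourier multiplier with symbol the indicator function of $\{1/n\le|\xi|\le n,\ |\mu|\le n\}$. Let $(q,r)$ and $(\tilde q,\tilde r)$ be admissible pairs. Then there is a constant $C$, independent of $T\in(0,\infty]$, of $\phi$ and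 of $f$, such that for either choice of the sign the following holds for all $T\in(0,\infty]$. (i) For every $\phi\in L^2(\mathbb{R}^2)$, $$\left\|D_x^{-\beta(q,r)}U_\pm(t)\phi\right\|_{L^q_TL^r_{xy}}\le C\,\|\phi\|_{L^2}.$$ (ii) For every $f\in L^{\tilde q'}_TL^{\tilde r'}_{xy}$, $$\left\|\int_0^tD_x^{-\beta(q,r)-\beta(\tilde q,\tilde r)}U_\pm(t-t')f(t')\,dt'\right\|_{L^q_TL^r_{xy}}\le C\,\|f\|_{L^{\tilde q'}_TL^{\tilde r'}_{xy}}.$$ Here, as $|\xi|^{-\gamma}$ is singular on the line $\xi=0$, the functions on the left-hand sides are understood as the limits in $L^q_TL^r_{xy}$, as $n\to\infty$, of the same expressions with $D_x^{-\gamma}$ replaced by $D_x^{-\gamma}P_n$; the existence of these limits is part of the claim. (In (ii), $D_x^{-\gamma}P_nU_\pm(s)$ acts on $L^{\tilde r'}(\mathbb{R}^2)$ by convolution with its kernel, which belongs to $L^2\cap L^\infty$.) -/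

import Mathlib

open MeasureTheory FourierTransform Filter Topology
open scoped ENNReal NNReal

noncomputable section

namespace KP

/-- The plane `ℝ²` of the space variables `(x, y) = (z 0, z 1)`, or of the frequencies
`(ξ, μ)`. -/
abbrev Plane : Type := EuclideanSpace ℝ (Fin 2)

/-- The dispersion relation `ω_±(ξ, μ) = ξ³ ∓ μ² / ξ`; the upper sign is `ε = 1` (KP-II), the
lower sign is `ε = -1` (KP-I). -/
def omega (ε ξ μ : ℝ) : ℝ := ξ ^ 3 - ε * (μ ^ 2 / ξ)

/-- The multiplier `e^{i t ω_±}` of the free evolution. Mathlib's Fourier transform uses the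
character `e^{-2πi⟨z, ζ⟩}`, so its variable `ζ` is the frequency `(ξ, μ) = 2πζ` of the transform
with character `e^{-i(xξ + yμ)}`. -/
def flowSymbol (ε t : ℝ) (ζ : Plane) : ℂ :=
  Complex.exp (Complex.I * ((t * omega ε (2 * Real.pi * ζ 0) (2 * Real.pi * ζ 1) : ℝ) : ℂ))

lemma norm_flowSymbol (ε t : ℝ) (ζ : Plane) : ‖flowSymbol ε t ζ‖ = 1 := by
  rw [flowSymbol, mul_comm, Complex.norm_exp_ofReal_mul_I]

lemma measurable_flowSymbol (ε t : ℝ) : Measurable (flowSymbol ε t) := by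
  unfold flowSymbol omega
  fun_prop

lemma memLp_flowSymbol_mul (ε t : ℝ) (g : Lp ℂ 2 (volume : Measure Plane)) :
    MemLp (fun ζ => flowSymbol ε t ζ * g ζ) 2 (volume : Measure Plane) := by
  refine (Lp.memLp g).of_le
    ((measurable_flowSymbol ε t).aestronglyMeasurable.mul (Lp.aestronglyMeasurable g)) ?_
  exact Eventually.of_forall fun ζ => by rw [norm_mul, norm_flowSymbol, one_mul]

/-- The free KP group on `L²(ℝ²)`: `U_±(t) φ = 𝓕⁻¹ (e^{i t ω_±} 𝓕 φ)`. -/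
def flow (ε t : ℝ) (φ : Lp ℂ 2 (volume : Measure Plane)) : Lp ℂ 2 (volume : Measure Plane) :=
  𝓕⁻ ((memLp_flowSymbol_mul ε t (𝓕 φ)).toLp _)

/-- The frequency box `{1/n ≤ |ξ| ≤ n, |μ| ≤ n}`, in the variable `ζ = (ξ, μ) / (2π)`. -/
def freqBox (n : ℕ) : Set Plane :=
  {ζ | (n : ℝ)⁻¹ ≤ |2 * Real.pi * ζ 0| ∧ |2 * Real.pi * ζ 0| ≤ n ∧ |2 * Real.pi * ζ 1| ≤ n}

/-- The multiplier `|ξ|^{-γ}` of `D_x^{-γ}`, cut off to the frequency box number `n`. -/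
def dxSymbol (γ : ℝ) (n : ℕ) : Plane → ℂ :=
  (freqBox n).indicator fun ζ => ((|2 * Real.pi * ζ 0| ^ (-γ) : ℝ) : ℂ)

/-- The operator `D_x^{-γ}`, cut off to the frequency box number `n`, on `L²(ℝ²)`. The function
`dxSymbol γ n * 𝓕 g` is integrable, so that the inverse Fourier integral converges absolutely. -/
def dxTrunc (γ : ℝ) (n : ℕ) (g : Lp ℂ 2 (volume : Measure Plane)) (z : Plane) : ℂ :=
  𝓕⁻ (fun ζ => dxSymbol γ n ζ * (𝓕 g : Lp ℂ 2 (volume : Measure Plane)) ζ) z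

/-- The convolution kernel of `D_x^{-γ} U_±(t)`, cut off to the frequency box number `n`. It is in
`L^p(ℝ²)` for every `p ∈ [2, ∞]`, so it can be convolved with every function in `L^{p'}(ℝ²)`. -/
def kernelTrunc (ε γ : ℝ) (n : ℕ) (t : ℝ) : Plane → ℂ :=
  𝓕⁻ (fun ζ => dxSymbol γ n ζ * flowSymbol ε t ζ)

theorem fourierInv_toLp_ae_eq (h : Plane → ℂ) (h1 : Integrable h) (h2 : MemLp h 2 (volume : Measure Plane)) :
    ((𝓕⁻ (h2.toLp h) : Lp ℂ 2 (volume : Measure Plane)) : Plane → ℂ) =ᵐ[volume] 𝓕⁻ h := by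
  refine ae_eq_of_integral_contDiff_smul_eq ((Lp.memLp _).locallyIntegrable (by norm_num)) ?_ ?_
  · apply Continuous.locallyIntegrable
    rw [Real.fourierInv_eq_fourier_comp_neg]
    exact VectorFourier.fourierIntegral_continuous Real.continuous_fourierChar
      (by exact continuous_inner) h1.comp_neg
  · intro g hg hgs
    have hgs' : HasCompactSupport (fun x => (g x : ℂ)) := hgs.comp_left (g := fun x : ℝ => (x : ℂ)) (by simp)
    have hg' : ContDiff ℝ (⊤ : ℕ∞) (fun x => (g x : ℂ)) := Complex.ofRealCLM.contDiff.comp hg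
    let ψ := hgs'.toSchwartzMap hg'
    have e1 := congrArg (fun T => T ψ) (Lp.fourierInv_toTemperedDistribution_eq (h2.toLp h))
    simp only [TemperedDistribution.fourierInv_apply, Lp.toTemperedDistribution_apply] at e1
    have e2 : ∀ x, ψ x = (g x : ℂ) := fun x => by simp [ψ]
    simp only [e2] at e1
    have e3 : ∫ x, (g x) • (𝓕⁻ (h2.toLp h) : Lp ℂ 2 (volume : Measure Plane)) x
      = ∫ x, (g x : ℂ) • (𝓕⁻ (h2.toLp h) : Lp ℂ 2 (volume : Measure Plane)) x := by simp
    rw [e3, ← e1]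
    have e4 : ∫ x, (𝓕⁻ ψ) x • (h2.toLp h) x = ∫ x, (𝓕⁻ (fun x => (g x:ℂ))) x • h x := by
      apply integral_congr_ae
      filter_upwards [h2.coeFn_toLp] with x hx
      rw [hx, SchwartzMap.fourierInv_coe]; congr 2
    rw [e4]
    have hgi : Integrable (fun x => (g x : ℂ)) := hg'.continuous.integrable_of_hasCompactSupport hgs'
    have := VectorFourier.integral_fourierIntegral_smul_eq_flip (L := -(innerₗ Plane))
      (μ := volume) (ν := volume) Real.continuous_fourierChar (by simp only [LinearMap.neg_apply]; exact continuous_inner.neg) hgi h1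
    have k1 : ∀ f : Plane → ℂ, VectorFourier.fourierIntegral Real.fourierChar volume (-(innerₗ Plane)) f = 𝓕⁻ f := by
      intro f; ext w; rw [Real.fourierInv_eq]; simp [VectorFourier.fourierIntegral]
    have k2 : ∀ f : Plane → ℂ, VectorFourier.fourierIntegral Real.fourierChar volume (-(innerₗ Plane)).flip f = 𝓕⁻ f := by
      intro f; ext w; rw [Real.fourierInv_eq]; simp [VectorFourier.fourierIntegral, real_inner_comm]
    rw [k1, k2] at this
    rw [this]; simp

theorem measurable_dxSymbol (γ : ℝ) (n : ℕ) : Measurable (dxSymbol γ n) := by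
  unfold dxSymbol freqBox
  apply Measurable.indicator
  · fun_prop
  · measurability

theorem measurable_dxSymbol_mul (ε γ t : ℝ) (n : ℕ) : Measurable (fun ζ => dxSymbol γ n ζ * flowSymbol ε t ζ) :=
  (measurable_dxSymbol γ n).mul (measurable_flowSymbol ε t)

theorem volume_freqBox_lt_top (n : ℕ) : volume (freqBox n) < ∞ := by
  refine (measure_mono (?_ : _ ⊆ Metric.closedBall (0:Plane) (2*n))).trans_lt measure_closedBall_lt_top
  intro ζ hζ
  obtain ⟨-, h1, h2⟩ := hζ
  rw [mem_closedBall_zero_iff, EuclideanSpace.norm_eq, Real.sqrt_le_left (by positivity)]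
  simp only [Fin.sum_univ_two, Real.norm_eq_abs]
  have hp : 1 ≤ 2 * Real.pi := by have := Real.pi_gt_three; linarith
  rw [abs_mul, abs_of_pos (by linarith)] at h1 h2
  have a := abs_nonneg (ζ 0); have b := abs_nonneg (ζ 1)
  have : |ζ 0| ≤ n := by nlinarith
  have : |ζ 1| ≤ n := by nlinarith
  nlinarith

theorem exists_norm_dxSymbol_le (γ : ℝ) (n : ℕ) : ∃ C, ∀ ζ, ‖dxSymbol γ n ζ‖ ≤ C := by
  refine ⟨(n:ℝ)^|γ| + 1, fun ζ => ?_⟩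
  unfold dxSymbol
  by_cases h : ζ ∈ freqBox n
  · rw [Set.indicator_of_mem h, Complex.norm_real, Real.norm_eq_abs, abs_of_nonneg (by positivity)]
    obtain ⟨h0, h1, h2⟩ := h
    set a := |2 * Real.pi * ζ 0|
    rcases Nat.eq_zero_or_pos n with hn | hn
    · subst hn
      have : a = 0 := le_antisymm (by simpa using h1) (abs_nonneg _)
      rw [this]
      by_cases hγ : γ = 0
      · simp [hγ]
      · rw [Real.zero_rpow (by simpa using hγ)]; positivity
    · have hn' : (1:ℝ) ≤ n := by exact_mod_cast hn
      have ha : 0 < a := lt_of_lt_of_le (by positivity) h0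
      have : a ^ (-γ) ≤ (n:ℝ)^|γ| := by
        rcases le_total 0 γ with hγ | hγ
        · rw [abs_of_nonneg hγ, Real.rpow_neg ha.le, ← Real.inv_rpow ha.le]
          apply Real.rpow_le_rpow (by positivity) _ hγ
          exact (inv_le_comm₀ (by positivity) ha).1 h0
        · rw [abs_of_nonpos hγ]
          exact Real.rpow_le_rpow ha.le h1 (by linarith)
      linarith
  · rw [Set.indicator_of_notMem h, norm_zero]; positivity

theorem memLp_dxSymbol_mul (ε γ t : ℝ) (n : ℕ) (p : ℝ≥0∞) : MemLp (fun ζ => dxSymbol γ n ζ * flowSymbol ε t ζ) p (volume : Measure Plane) := by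
  obtain ⟨C, hC⟩ := exists_norm_dxSymbol_le γ n
  have hms : MeasurableSet (freqBox n) := by unfold freqBox; measurability
  have : (fun ζ => dxSymbol γ n ζ * flowSymbol ε t ζ) = (freqBox n).indicator (fun ζ => dxSymbol γ n ζ * flowSymbol ε t ζ) := by
    ext ζ
    by_cases h : ζ ∈ freqBox n
    · simp [h]
    · simp [h, dxSymbol]
  rw [this, memLp_indicator_iff_restrict hms]
  have : IsFiniteMeasure ((volume : Measure Plane).restrict (freqBox n)) := ⟨by simpa using volume_freqBox_lt_top n⟩
  refine MemLp.of_bound (measurable_dxSymbol_mul ε γ t n).aestronglyMeasurable C (Eventually.of_forall fun ζ => ?_)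
  rw [norm_mul, norm_flowSymbol, mul_one]; exact hC ζ

/-- On `L²(ℝ²)`, convolution with `kernelTrunc` is `D_x^{-γ} U_±(t)` cut off in frequency. -/
theorem dxTrunc_flow_eq_convolution (ε γ t : ℝ) (n : ℕ) (φ : Lp ℂ 2 (volume : Measure Plane)) (z : Plane) :
    dxTrunc γ n (flow ε t φ) z = ∫ w, kernelTrunc ε γ n t (z - w) * φ w := by
  set M := fun ζ => dxSymbol γ n ζ * flowSymbol ε t ζ with hM
  let h : Plane → ℂ := fun ζ => (starRingEnd ℂ) (Real.fourierChar (inner ℝ ζ z) * M ζ)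
  have hh : ∀ p, MemLp h p (volume : Measure Plane) := fun p => by
    refine (memLp_dxSymbol_mul ε γ t n p).of_le ?_ (Eventually.of_forall fun ζ => by simp only [h, RCLike.norm_conj, norm_mul, Circle.norm_coe, one_mul, hM, le_refl])
    have : Measurable h := by
      have := measurable_dxSymbol_mul ε γ t n
      have h3 : Measurable fun ζ : Plane => (Real.fourierChar (inner ℝ ζ z) : ℂ) := by
        apply Continuous.measurable
        exact continuous_induced_dom.comp (Real.continuous_fourierChar.comp (by fun_prop))
      exact Complex.continuous_conj.measurable.comp (h3.mul this)
    exact this.aestronglyMeasurable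
  have s1 : dxTrunc γ n (flow ε t φ) z = inner ℂ ((hh 2).toLp h) (𝓕 φ) := by
    rw [dxTrunc, Real.fourierInv_eq, L2.inner_def]
    apply integral_congr_ae
    have : 𝓕 (flow ε t φ) = (memLp_flowSymbol_mul ε t (𝓕 φ)).toLp _ := fourier_fourierInv_eq _
    rw [this]
    filter_upwards [(hh 2).coeFn_toLp, (memLp_flowSymbol_mul ε t (𝓕 φ)).coeFn_toLp] with ζ a b
    rw [a, b]
    simp [h, hM, Circle.smul_def]; ring
  have s2 : inner ℂ ((hh 2).toLp h) (𝓕 φ) = inner ℂ (𝓕⁻ ((hh 2).toLp h)) φ := by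
    rw [← Lp.inner_fourier_eq (𝓕⁻ ((hh 2).toLp h)) φ, fourier_fourierInv_eq]
  rw [s1, s2, L2.inner_def]
  apply integral_congr_ae
  filter_upwards [fourierInv_toLp_ae_eq h (memLp_one_iff_integrable.1 (hh 1)) (hh 2)] with w hw
  rw [hw]
  have : (starRingEnd ℂ) (𝓕⁻ h w) = kernelTrunc ε γ n t (z - w) := by
    rw [kernelTrunc, Real.fourierInv_eq, Real.fourierInv_eq, ← integral_conj]
    congr 1; ext ζ
    have e : Real.fourierChar (inner ℝ ζ (z - w)) = Real.fourierChar (inner ℝ ζ z) * (Real.fourierChar (inner ℝ ζ w))⁻¹ := by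
      rw [inner_sub_right, sub_eq_add_neg, AddChar.map_add_eq_mul, AddChar.map_neg_eq_inv]
    rw [e]
    simp only [h, Circle.smul_def, smul_eq_mul, map_mul, Complex.conj_conj, Circle.coe_mul, Circle.coe_inv_eq_conj, hM]
    ring
  simp [this, mul_comm]

/-- The retarded integral `∫₀ᵗ D_x^{-γ} U_±(t - s) f(s) ds`, cut off to the frequency box
number `n`. -/
def duhamelTrunc (ε γ : ℝ) (n : ℕ) (f : ℝ → Plane → ℂ) (t : ℝ) (z : Plane) : ℂ :=
  ∫ s in (0 : ℝ)..t, ∫ w, kernelTrunc ε γ n (t - s) (z - w) * f s w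

/-- The time interval `(0, T)`, where `T ∈ (0, ∞]`. -/
def timeInterval (T : ℝ≥0∞) : Set ℝ := {t | 0 < t ∧ ENNReal.ofReal t < T}

/-- The norm of `L^q_T L^r_{xy} = L^q((0, T); L^r(ℝ²))`. -/
def mixedNorm (q r T : ℝ≥0∞) (u : ℝ → Plane → ℂ) : ℝ≥0∞ :=
  eLpNorm (fun t => eLpNorm (u t) r volume) q (volume.restrict (timeInterval T))

/-- Joint measurability on `(0, T) × ℝ²`. -/
def MeasurableOnStrip (T : ℝ≥0∞) (u : ℝ → Plane → ℂ) : Prop :=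
  AEStronglyMeasurable (Function.uncurry u)
    ((volume.restrict (timeInterval T)).prod (volume : Measure Plane))

/-- `u = D_x^{-γ} U_±(t) φ` in `L^q_T L^r_{xy}`. For `γ ≥ 1/2` and `φ ∈ L²` the function
`|ξ|^{-γ} e^{itω} 𝓕 φ` need not be locally integrable; as usual, `D_x^{-γ} U_±(t) φ` is the limit in
`L^q_T L^r_{xy}` of its truncations to the frequencies `1/n ≤ |ξ| ≤ n`, `|μ| ≤ n`. -/
def IsDxFlow (ε γ : ℝ) (q r T : ℝ≥0∞) (φ : Lp ℂ 2 (volume : Measure Plane))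
    (u : ℝ → Plane → ℂ) : Prop :=
  MeasurableOnStrip T u ∧
    Tendsto (fun n : ℕ => mixedNorm q r T fun t z => dxTrunc γ n (flow ε t φ) z - u t z)
      atTop (𝓝 0)

/-- `u = ∫₀ᵗ D_x^{-γ} U_±(t - s) f(s) ds` in `L^q_T L^r_{xy}`, in the same sense. -/
def IsDxDuhamel (ε γ : ℝ) (q r T : ℝ≥0∞) (f u : ℝ → Plane → ℂ) : Prop :=
  MeasurableOnStrip T u ∧
    Tendsto (fun n : ℕ => mixedNorm q r T fun t z => duhamelTrunc ε γ n f t z - u t z)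
      atTop (𝓝 0)

/-- Admissible pairs; `(q⁻¹).toReal` is `1 / q`, with `1 / ∞ = 0`. -/
def IsAdmissible (q r : ℝ≥0∞) : Prop :=
  2 ≤ q ∧ 2 ≤ r ∧
    1 / 2 * (1 / 2 - (r⁻¹).toReal) ≤ (q⁻¹).toReal ∧ (q⁻¹).toReal ≤ 1 / 2 - (r⁻¹).toReal ∧
    (q, r) ≠ (2, ∞) ∧ (q, r) ≠ (4, ∞)

/-- The exponent `β(q, r) = 3 (1/2 - 1/r - 1/q)`. -/
def beta (q r : ℝ≥0∞) : ℝ := 3 * (1 / 2 - (r⁻¹).toReal - (q⁻¹).toReal)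

end KP

end

noncomputable section

namespace KP

/-! ### Riesz–Thorin interpolation for bilinear forms -/

/-- The analytic family `x ↦ (x / |x|) |x| ^ (p (1 + z) / 2)` of the complex interpolation method. -/
def phasePow (p : ℝ) (x z : ℂ) : ℂ :=
  if x = 0 then 0 else x / ‖x‖ * Complex.exp (Real.log ‖x‖ * (p * (1 + z) / 2))

lemma norm_phasePow {p : ℝ} {x z : ℂ} (h : p * (1 + z.re) / 2 ≠ 0) :
    ‖phasePow p x z‖ = ‖x‖ ^ (p * (1 + z.re) / 2) := by
  unfold phasePow
  split_ifs with hx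
  · simp [hx, Real.zero_rpow h]
  · have hx' : 0 < ‖x‖ := norm_pos_iff.2 hx
    rw [norm_mul, norm_div, Complex.norm_real, norm_norm, div_self hx'.ne', one_mul,
      Complex.norm_exp, Real.rpow_def_of_pos hx', Complex.re_ofReal_mul]
    have : (p * (1 + z) / 2 : ℂ) = ((p / 2 : ℝ) : ℂ) * (1 + z) := by push_cast; ring
    rw [this, Complex.re_ofReal_mul]
    congr 2
    simp only [Complex.add_re, Complex.one_re]; ring

lemma phasePow_self {p θ : ℝ} (h : p * (1 + θ) / 2 = 1) (x : ℂ) : phasePow p x θ = x := by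
  unfold phasePow
  split_ifs with hx
  · exact hx.symm
  · have hx' : 0 < ‖x‖ := norm_pos_iff.2 hx
    have : (p * (1 + θ) / 2 : ℂ) = 1 := by exact_mod_cast h
    rw [this, mul_one, ← Complex.ofReal_exp, Real.exp_log hx']
    field_simp [hx'.ne']

lemma differentiable_phasePow (p : ℝ) (x : ℂ) : Differentiable ℂ (phasePow p x) := by
  unfold phasePow
  split_ifs <;> fun_prop

/-- The Riesz–Thorin theorem between `L¹ × L¹` and `L² × L²`, for bilinear forms on finite
weighted spaces. -/
lemma riesz_thorin_finite {ι κ : Type*} (s : Finset ι) (s' : Finset κ)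
    (b : ι → κ → ℂ) (m : ι → ℝ) (n : κ → ℝ)
    (hm : ∀ i, 0 ≤ m i) (hn : ∀ i, 0 ≤ n i) {A M θ p : ℝ} (hA : 0 ≤ A) (hM : 0 ≤ M)
    (hθ0 : 0 ≤ θ) (hθ1 : θ ≤ 1) (hp : p * (1 + θ) = 2)
    (h1 : ∀ (x : ι → ℂ) (y : κ → ℂ), ‖∑ i ∈ s, ∑ j ∈ s', x i * y j * b i j‖ ≤
      A * (∑ i ∈ s, ‖x i‖ * m i) * (∑ j ∈ s', ‖y j‖ * n j))
    (h2 : ∀ (x : ι → ℂ) (y : κ → ℂ), ‖∑ i ∈ s, ∑ j ∈ s', x i * y j * b i j‖ ≤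
      M * (∑ i ∈ s, ‖x i‖ ^ 2 * m i) ^ (1 / 2 : ℝ) * (∑ j ∈ s', ‖y j‖ ^ 2 * n j) ^ (1 / 2 : ℝ))
    (x : ι → ℂ) (y : κ → ℂ) :
    ‖∑ i ∈ s, ∑ j ∈ s', x i * y j * b i j‖ ≤ A ^ θ * M ^ (1 - θ) *
      (∑ i ∈ s, ‖x i‖ ^ p * m i) ^ (1 / p) * (∑ j ∈ s', ‖y j‖ ^ p * n j) ^ (1 / p) := by
  have hp0 : 0 < p := by
    by_contra! h
    nlinarith
  set X := ∑ i ∈ s, ‖x i‖ ^ p * m i with hX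
  set Y := ∑ j ∈ s', ‖y j‖ ^ p * n j with hY
  have hX0 : 0 ≤ X := Finset.sum_nonneg fun i _ => mul_nonneg (by positivity) (hm i)
  have hY0 : 0 ≤ Y := Finset.sum_nonneg fun i _ => mul_nonneg (by positivity) (hn i)
  let Φ : ℂ → ℂ := fun z => ∑ i ∈ s, ∑ j ∈ s', phasePow p (x i) z * phasePow p (y j) z * b i j
  have hΦd : Differentiable ℂ Φ := by
    have := differentiable_phasePow p
    fun_prop
  have hΦθ : Φ θ = ∑ i ∈ s, ∑ j ∈ s', x i * y j * b i j := by
    simp only [Φ, phasePow_self (show p * (1 + θ) / 2 = 1 by rw [hp]; norm_num)]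
  -- On Re z = 0 the family has modulus |x|^(p/2), on Re z = 1 it has modulus |x|^p. So the L² bound
  -- on the left edge and the L¹ bound on the right edge both involve only the sums X and Y of p-th
  -- powers.
  have key := Complex.HadamardThreeLines.norm_le_interp_of_mem_verticalClosedStrip₀₁' Φ
    (z := (θ : ℂ)) (a := M * X ^ (1 / 2 : ℝ) * Y ^ (1 / 2 : ℝ)) (b := A * X * Y) ?_
    hΦd.diffContOnCl ?_ ?_ ?_
  · rw [hΦθ, Complex.ofReal_re] at key
    refine key.trans (le_of_eq ?_)
    rw [Real.mul_rpow (by positivity) (by positivity), Real.mul_rpow (by positivity) (by positivity),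
      Real.mul_rpow (by positivity) (by positivity), Real.mul_rpow (by positivity) (by positivity),
      ← Real.rpow_mul hX0, ← Real.rpow_mul hY0]
    -- The interpolated powers of X and Y add up to 1/p: this is the relation p(1 + θ) = 2.
    have e : 1 / p = 1 / 2 * (1 - θ) + θ := by
      rw [div_eq_iff hp0.ne']; nlinarith
    rw [e, Real.rpow_add_of_nonneg hX0 (by nlinarith) hθ0,
      Real.rpow_add_of_nonneg hY0 (by nlinarith) hθ0]
    ring
  · simp [Complex.HadamardThreeLines.verticalClosedStrip, hθ0, hθ1]
  · refine ⟨∑ i ∈ s, ∑ j ∈ s', (max 1 ‖x i‖) ^ p * (max 1 ‖y j‖) ^ p * ‖b i j‖, ?_⟩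
    rintro _ ⟨z, hz, rfl⟩
    have hz' : 0 ≤ z.re ∧ z.re ≤ 1 := hz
    have hb : ∀ c : ℂ, ‖phasePow p c z‖ ≤ (max 1 ‖c‖) ^ p := fun c => by
      rw [norm_phasePow (by nlinarith [hz'.1])]
      calc ‖c‖ ^ (p * (1 + z.re) / 2) ≤ (max 1 ‖c‖) ^ (p * (1 + z.re) / 2) :=
            Real.rpow_le_rpow (norm_nonneg _) (le_max_right _ _) (by nlinarith [hz'.1])
        _ ≤ _ := Real.rpow_le_rpow_of_exponent_le (le_max_left _ _) (by nlinarith [hz'.2])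
    refine (norm_sum_le _ _).trans (Finset.sum_le_sum fun i _ => (norm_sum_le _ _).trans
      (Finset.sum_le_sum fun j _ => ?_))
    rw [norm_mul, norm_mul]
    gcongr
    · exact hb _
    · exact hb _
  · intro z hz
    have hz' : z.re = 0 := hz
    refine (h2 _ _).trans (le_of_eq ?_)
    have hb : ∀ c : ℂ, ‖phasePow p c z‖ ^ 2 = ‖c‖ ^ p := fun c => by
      rw [norm_phasePow (by rw [hz']; linarith), hz', ← Real.rpow_natCast, ← Real.rpow_mul (norm_nonneg _)]
      congr 1; push_cast; ring
    simp only [hb, hX, hY]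
  · intro z hz
    have hz' : z.re = 1 := hz
    refine (h1 _ _).trans (le_of_eq ?_)
    have hb : ∀ c : ℂ, ‖phasePow p c z‖ = ‖c‖ ^ p := fun c => by
      rw [norm_phasePow (by rw [hz']; linarith), hz']
      congr 1; ring
    simp only [hb, hX, hY]

lemma eLpNorm_comp_simpleFunc_toReal {α : Type*} [MeasurableSpace α] {μ : Measure α}
    (f : SimpleFunc α ℂ) (hf : f.FinMeasSupp μ) (x : ℂ → ℂ) (hx : x 0 = 0) {p : ℝ} (hp : 0 < p) :
    (eLpNorm (fun a => x (f a)) (ENNReal.ofReal p) μ).toReal =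
      (∑ c ∈ f.range, ‖x c‖ ^ p * μ.real (f ⁻¹' {c})) ^ (1 / p) := by
  have hp' : ENNReal.ofReal p ≠ 0 := by simpa using hp
  have hm : MemLp (f.map x) (ENNReal.ofReal p) μ :=
    (SimpleFunc.memLp_iff_finMeasSupp hp' ENNReal.ofReal_ne_top).2 (hf.map hx)
  have hfi : Integrable f μ := SimpleFunc.integrable_iff_finMeasSupp.2 hf
  have hm' : MemLp (fun a => x (f a)) (ENNReal.ofReal p) μ := hm
  rw [hm'.eLpNorm_eq_integral_rpow_norm hp' ENNReal.ofReal_ne_top, ENNReal.toReal_ofReal hp.le,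
    ENNReal.toReal_ofReal (by positivity), one_div]
  congr 1
  have hInteg := hm.integrable_norm_rpow hp' ENNReal.ofReal_ne_top
  rw [ENNReal.toReal_ofReal hp.le] at hInteg
  have := SimpleFunc.map_integral f (fun c : ℂ => ‖x c‖ ^ p) hfi (by simp [hp.ne', hx])
  rw [SimpleFunc.integral_eq_integral _ hInteg] at this
  simpa [mul_comm] using this

/-- Membership in `L¹ ∩ L²`. -/
def MemL12 {α : Type*} [MeasurableSpace α] (f : α → ℂ) (μ : Measure α) : Prop :=
  MemLp f 1 μ ∧ MemLp f 2 μ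

/-- A bilinear form on `L¹ ∩ L²`. -/
structure IsBilinL12 {α : Type*} [MeasurableSpace α] (μ : Measure α)
    (B : (α → ℂ) → (α → ℂ) → ℂ) : Prop where
  add_left : ∀ f f' g, MemL12 f μ → MemL12 f' μ → MemL12 g μ → B (f + f') g = B f g + B f' g
  smul_left : ∀ (c : ℂ) f g, MemL12 f μ → MemL12 g μ → B (c • f) g = c * B f g
  add_right : ∀ f g g', MemL12 f μ → MemL12 g μ → MemL12 g' μ → B f (g + g') = B f g + B f g'
  smul_right : ∀ (c : ℂ) f g, MemL12 f μ → MemL12 g μ → B f (c • g) = c * B f g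

section

variable {α : Type*} [MeasurableSpace α] {μ : Measure α}

lemma MemL12.zero : MemL12 (0 : α → ℂ) μ := ⟨MemLp.zero, MemLp.zero⟩

lemma MemL12.sub {f g : α → ℂ} (hf : MemL12 f μ) (hg : MemL12 g μ) : MemL12 (f - g) μ :=
  ⟨hf.1.sub hg.1, hf.2.sub hg.2⟩

lemma MemL12.smul {f : α → ℂ} (c : ℂ) (hf : MemL12 f μ) : MemL12 (c • f) μ :=
  ⟨hf.1.const_smul c, hf.2.const_smul c⟩

lemma MemL12.sum {ι : Type*} {s : Finset ι} {f : ι → α → ℂ} (h : ∀ i ∈ s, MemL12 (f i) μ) :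
    MemL12 (∑ i ∈ s, f i) μ :=
  ⟨memLp_finsetSum' s fun i hi => (h i hi).1, memLp_finsetSum' s fun i hi => (h i hi).2⟩

namespace IsBilinL12

variable {B : (α → ℂ) → (α → ℂ) → ℂ}

lemma sum_left {ι : Type*} (hB : IsBilinL12 μ B) (s : Finset ι) (f : ι → α → ℂ) (g : α → ℂ)
    (h : ∀ i ∈ s, MemL12 (f i) μ) (hg : MemL12 g μ) :
    B (∑ i ∈ s, f i) g = ∑ i ∈ s, B (f i) g := by
  classical
  induction s using Finset.induction_on with
  | empty => simpa using hB.smul_left 0 0 g MemL12.zero hg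
  | insert a s ha ih =>
    rw [Finset.sum_insert ha, Finset.sum_insert ha, hB.add_left _ _ _ (h a (by simp))
      (MemL12.sum fun i hi => h i (by simp [hi])) hg, ih fun i hi => h i (by simp [hi])]

lemma sum_right {ι : Type*} (hB : IsBilinL12 μ B) (s : Finset ι) (f : α → ℂ) (g : ι → α → ℂ)
    (hf : MemL12 f μ) (h : ∀ i ∈ s, MemL12 (g i) μ) :
    B f (∑ i ∈ s, g i) = ∑ i ∈ s, B f (g i) := by
  classical
  induction s using Finset.induction_on with
  | empty => simpa using hB.smul_right 0 f 0 hf MemL12.zero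
  | insert a s ha ih =>
    rw [Finset.sum_insert ha, Finset.sum_insert ha, hB.add_right _ _ _ hf (h a (by simp))
      (MemL12.sum fun i hi => h i (by simp [hi])), ih fun i hi => h i (by simp [hi])]

lemma sub_left (hB : IsBilinL12 μ B) (f f' g : α → ℂ) (hf : MemL12 f μ) (hf' : MemL12 f' μ) (hg : MemL12 g μ) :
    B (f - f') g = B f g - B f' g := by
  rw [eq_sub_iff_add_eq, ← hB.add_left _ _ _ (hf.sub hf') hf' hg, sub_add_cancel]

lemma sub_right (hB : IsBilinL12 μ B) (f g g' : α → ℂ) (hf : MemL12 f μ) (hg : MemL12 g μ) (hg' : MemL12 g' μ) :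
    B f (g - g') = B f g - B f g' := by
  rw [eq_sub_iff_add_eq, ← hB.add_right _ _ _ hf (hg.sub hg') hg', sub_add_cancel]

end IsBilinL12

lemma simpleFunc_comp_eq_sum (f : SimpleFunc α ℂ) (x : ℂ → ℂ) (hx : x 0 = 0) :
    (fun a => x (f a)) =
      ∑ c ∈ f.range.erase 0, x c • (f ⁻¹' {c}).indicator (fun _ => (1 : ℂ)) := by
  classical
  ext a
  rw [Finset.sum_apply]
  by_cases h : f a = 0
  · rw [h, hx, Finset.sum_eq_zero]
    intro c hc
    have : f a ≠ c := by rw [h]; exact (Finset.ne_of_mem_erase hc).symm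
    simp [this]
  · rw [Finset.sum_eq_single_of_mem (f a) (by simp [h])]
    · simp
    · intro c _ hc
      simp [hc.symm]

lemma SimpleFunc.FinMeasSupp.memL12 {f : SimpleFunc α ℂ} (hf : f.FinMeasSupp μ) : MemL12 f μ :=
  ⟨(SimpleFunc.memLp_iff_finMeasSupp (by simp) (by simp)).2 hf,
    (SimpleFunc.memLp_iff_finMeasSupp (by simp) (by simp)).2 hf⟩

lemma riesz_thorin_simpleFunc {B : (α → ℂ) → (α → ℂ) → ℂ} (hB : IsBilinL12 μ B)
    {A M θ p : ℝ} (hA : 0 ≤ A) (hM : 0 ≤ M) (hθ0 : 0 ≤ θ) (hθ1 : θ ≤ 1) (hp : p * (1 + θ) = 2)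
    (h1 : ∀ f g, MemL12 f μ → MemL12 g μ →
      ‖B f g‖ ≤ A * (eLpNorm f 1 μ).toReal * (eLpNorm g 1 μ).toReal)
    (h2 : ∀ f g, MemL12 f μ → MemL12 g μ →
      ‖B f g‖ ≤ M * (eLpNorm f 2 μ).toReal * (eLpNorm g 2 μ).toReal)
    (f g : SimpleFunc α ℂ) (hf : f.FinMeasSupp μ) (hg : g.FinMeasSupp μ) :
    ‖B f g‖ ≤ A ^ θ * M ^ (1 - θ) * (eLpNorm f (ENNReal.ofReal p) μ).toReal *
      (eLpNorm g (ENNReal.ofReal p) μ).toReal := by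
  classical
  have hp0 : 0 < p := by
    by_contra! h
    nlinarith
  let e : SimpleFunc α ℂ → ℂ → α → ℂ := fun f c => (f ⁻¹' {c}).indicator (fun _ => (1 : ℂ))
  have he : ∀ f : SimpleFunc α ℂ, f.FinMeasSupp μ → ∀ c ∈ f.range.erase 0, MemL12 (e f c) μ := by
    intro f hf c hc
    have hc0 : c ≠ 0 := Finset.ne_of_mem_erase hc
    have hfin : μ (f ⁻¹' {c}) ≠ ∞ := (hf.meas_preimage_singleton_ne_zero hc0).ne
    exact ⟨memLp_indicator_const _ (f.measurableSet_fiber c) _ (Or.inr hfin),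
      memLp_indicator_const _ (f.measurableSet_fiber c) _ (Or.inr hfin)⟩
  -- The finite inequality quantifies over arbitrary coefficients. Forcing the value 0 at 0 keeps
  -- the support of finite measure whatever the coefficients are.
  let cut : (ℂ → ℂ) → ℂ → ℂ := fun x c => if c = 0 then 0 else x c
  have hcut0 : ∀ x, cut x 0 = 0 := fun x => by simp [cut]
  have hsum : ∀ (f : SimpleFunc α ℂ) (x : ℂ → ℂ),
      (fun a => cut x (f a)) = ∑ c ∈ f.range.erase 0, x c • e f c := fun f x => by
    rw [simpleFunc_comp_eq_sum f _ (hcut0 x)]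
    refine Finset.sum_congr rfl fun c hc => ?_
    simp [cut, Finset.ne_of_mem_erase hc, e]
  have hmem : ∀ f : SimpleFunc α ℂ, f.FinMeasSupp μ → ∀ x, MemL12 (fun a => cut x (f a)) μ :=
    fun f hf x => SimpleFunc.FinMeasSupp.memL12 (f := f.map (cut x)) (hf.map (hcut0 x))
  have hBs : ∀ x y : ℂ → ℂ, ∑ c ∈ f.range.erase 0, ∑ d ∈ g.range.erase 0,
      x c * y d * B (e f c) (e g d) = B (fun a => cut x (f a)) (fun a => cut y (g a)) := by
    intro x y
    have hgy : MemL12 (∑ d ∈ g.range.erase 0, y d • e g d) μ :=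
      MemL12.sum fun d hd => (he g hg d hd).smul _
    rw [hsum, hsum, hB.sum_left _ _ _ (fun c hc => (he f hf c hc).smul _) hgy]
    refine Finset.sum_congr rfl fun c hc => ?_
    rw [hB.smul_left _ _ _ (he f hf c hc) hgy,
      hB.sum_right _ _ _ (he f hf c hc) (fun d hd => (he g hg d hd).smul _), Finset.mul_sum]
    refine Finset.sum_congr rfl fun d hd => ?_
    rw [hB.smul_right _ _ _ (he f hf c hc) (he g hg d hd), mul_assoc]
  have hnorm : ∀ f : SimpleFunc α ℂ, f.FinMeasSupp μ → ∀ (x : ℂ → ℂ) (s : ℝ), 0 < s →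
      (eLpNorm (fun a => cut x (f a)) (ENNReal.ofReal s) μ).toReal =
        (∑ c ∈ f.range.erase 0, ‖x c‖ ^ s * μ.real (f ⁻¹' {c})) ^ (1 / s) := by
    intro f hf x s hs
    rw [eLpNorm_comp_simpleFunc_toReal f hf _ (hcut0 x) hs,
      ← Finset.sum_erase (a := 0) _ (by simp [cut, hs.ne'])]
    congr 1
    refine Finset.sum_congr rfl fun c hc => ?_
    simp [cut, Finset.ne_of_mem_erase hc]
  have hid : ∀ f : SimpleFunc α ℂ, (fun a => cut id (f a)) = f := fun f => by
    ext a
    simp only [cut, id]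
    split_ifs with h
    · exact h.symm
    · rfl
  have key := riesz_thorin_finite (f.range.erase 0) (g.range.erase 0)
    (fun c d => B (e f c) (e g d)) (fun c => μ.real (f ⁻¹' {c})) (fun c => μ.real (g ⁻¹' {c}))
    (fun _ => measureReal_nonneg) (fun _ => measureReal_nonneg) hA hM hθ0 hθ1 hp ?_ ?_ id id
  · rw [hBs, hid, hid] at key
    have ef := hnorm f hf id p hp0
    have eg := hnorm g hg id p hp0
    rw [hid] at ef eg
    rw [ef, eg]
    exact key
  · intro x y
    rw [hBs]
    have := h1 _ _ (hmem f hf x) (hmem g hg y)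
    have ef := hnorm f hf x 1 one_pos
    have eg := hnorm g hg y 1 one_pos
    simp only [ENNReal.ofReal_one, Real.rpow_one, div_one] at ef eg
    rwa [ef, eg] at this
  · intro x y
    rw [hBs]
    have := h2 _ _ (hmem f hf x) (hmem g hg y)
    have ef := hnorm f hf x 2 two_pos
    have eg := hnorm g hg y 2 two_pos
    simp only [ENNReal.ofReal_ofNat, Real.rpow_ofNat] at ef eg
    rwa [ef, eg] at this

lemma tendsto_eLpNorm_toReal_of_tendsto_sub {p : ℝ≥0∞} (hp : 1 ≤ p) {f : ℕ → α → ℂ} {g : α → ℂ}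
    (hf : ∀ n, MemLp (f n) p μ) (hg : MemLp g p μ)
    (h : Tendsto (fun n => eLpNorm (f n - g) p μ) atTop (𝓝 0)) :
    Tendsto (fun n => (eLpNorm (f n) p μ).toReal) atTop (𝓝 (eLpNorm g p μ).toReal) := by
  have : Fact (1 ≤ p) := ⟨hp⟩
  have h2 : Tendsto (fun n => (hf n).toLp (f n)) atTop (𝓝 (hg.toLp g)) :=
    (Lp.tendsto_Lp_iff_tendsto_eLpNorm'' f hf g hg).2 h
  simpa only [Lp.norm_toLp] using h2.norm

/-- Pointwise |f|^p ≤ |f|^a + |f|^b, according to whether |f| is below or above 1. -/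
lemma memLp_of_memLp_of_memLp {f : α → ℂ} {a b p : ℝ≥0∞} (ha0 : a ≠ 0) (hb : b ≠ ∞) (hap : a ≤ p)
    (hpb : p ≤ b) (h1 : MemLp f a μ) (h2 : MemLp f b μ) : MemLp f p μ := by
  have hpt : p ≠ ∞ := ne_top_of_le_ne_top hb hpb
  have hat : a ≠ ∞ := ne_top_of_le_ne_top hpt hap
  have hp0 : p ≠ 0 := fun h => ha0 (le_antisymm (h ▸ hap) zero_le)
  have hb0 : b ≠ 0 := fun h => hp0 (le_antisymm (h ▸ hpb) zero_le)
  refine ⟨h1.1, ?_⟩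
  rw [eLpNorm_lt_top_iff_lintegral_rpow_enorm_lt_top hp0 hpt]
  have l1 := (eLpNorm_lt_top_iff_lintegral_rpow_enorm_lt_top ha0 hat).1 h1.2
  have l2 := (eLpNorm_lt_top_iff_lintegral_rpow_enorm_lt_top hb0 hb).1 h2.2
  refine lt_of_le_of_lt ?_ (ENNReal.add_lt_top.2 ⟨l1, l2⟩)
  rw [← lintegral_add_left' (h1.1.enorm.pow_const _)]
  refine lintegral_mono fun x => ?_
  rcases le_total ‖f x‖ₑ 1 with h | h
  · exact (ENNReal.rpow_le_rpow_of_exponent_ge h (ENNReal.toReal_mono hpt hap)).trans le_self_add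
  · exact (ENNReal.rpow_le_rpow_of_exponent_le h (ENNReal.toReal_mono hb hpb)).trans le_add_self

lemma MemL12.memLp {f : α → ℂ} (hf : MemL12 f μ) {p : ℝ≥0∞} (h1 : 1 ≤ p) (h2 : p ≤ 2) :
    MemLp f p μ := 
  memLp_of_memLp_of_memLp one_ne_zero (by simp) h1 h2 hf.1 hf.2

/-- The Riesz–Thorin theorem for bilinear forms bounded on `L¹ × L¹` and on `L² × L²`. -/
lemma riesz_thorin {B : (α → ℂ) → (α → ℂ) → ℂ} (hB : IsBilinL12 μ B)
    {A M θ p : ℝ} (hA : 0 ≤ A) (hM : 0 ≤ M) (hθ0 : 0 ≤ θ) (hθ1 : θ ≤ 1) (hp : p * (1 + θ) = 2)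
    (h1 : ∀ f g, MemL12 f μ → MemL12 g μ →
      ‖B f g‖ ≤ A * (eLpNorm f 1 μ).toReal * (eLpNorm g 1 μ).toReal)
    (h2 : ∀ f g, MemL12 f μ → MemL12 g μ →
      ‖B f g‖ ≤ M * (eLpNorm f 2 μ).toReal * (eLpNorm g 2 μ).toReal)
    (f g : α → ℂ) (hfm : Measurable f) (hgm : Measurable g) (hf : MemL12 f μ) (hg : MemL12 g μ) :
    ‖B f g‖ ≤ A ^ θ * M ^ (1 - θ) * (eLpNorm f (ENNReal.ofReal p) μ).toReal *
      (eLpNorm g (ENNReal.ofReal p) μ).toReal := by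
  have hp1 : 1 ≤ p := by nlinarith
  have hp2 : p ≤ 2 := by nlinarith
  have hp1' : 1 ≤ ENNReal.ofReal p := by simpa using ENNReal.ofReal_le_ofReal hp1
  have hp2' : ENNReal.ofReal p ≤ 2 := by simpa using ENNReal.ofReal_le_ofReal hp2
  let ap : ∀ h : α → ℂ, Measurable h → ℕ → SimpleFunc α ℂ := fun h hm n =>
    SimpleFunc.approxOn h hm (Set.range h ∪ {0}) 0 (by simp) n
  have hap : ∀ h hm, MemL12 h μ → ∀ n, (ap h hm n).FinMeasSupp μ := fun h hm hh n =>
    (SimpleFunc.memLp_iff_finMeasSupp (p := 1) (by simp) (by simp)).1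
      (SimpleFunc.memLp_approxOn_range hm hh.1 n)
  have hapL : ∀ h hm (_ : MemL12 h μ) (s : ℝ≥0∞), 1 ≤ s → s ≤ 2 →
      Tendsto (fun n => eLpNorm (⇑(ap h hm n) - h) s μ) atTop (𝓝 0) := fun h hm hh s hs1 hs2 =>
    SimpleFunc.tendsto_approxOn_range_Lp_eLpNorm (ne_top_of_le_ne_top (by simp) hs2) hm
      (hh.memLp hs1 hs2).2
  have hapN : ∀ h hm (_ : MemL12 h μ) (s : ℝ≥0∞), 1 ≤ s → s ≤ 2 →
      Tendsto (fun n => (eLpNorm (ap h hm n) s μ).toReal) atTop (𝓝 (eLpNorm h s μ).toReal) :=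
    fun h hm hh s hs1 hs2 => tendsto_eLpNorm_toReal_of_tendsto_sub hs1
      (fun n => (SimpleFunc.FinMeasSupp.memL12 (hap h hm hh n)).memLp hs1 hs2) (hh.memLp hs1 hs2)
      (hapL h hm hh s hs1 hs2)
  -- The L² × L² bound alone makes `B` continuous along the approximations; the L^p norms converge
  -- because p lies between 1 and 2.
  have hlim : Tendsto (fun n => B (ap f hfm n) (ap g hgm n)) atTop (𝓝 (B f g)) := by
    rw [tendsto_iff_norm_sub_tendsto_zero]
    have hz : ∀ h hm (_ : MemL12 h μ),
        Tendsto (fun n => (eLpNorm (⇑(ap h hm n) - h) 2 μ).toReal) atTop (𝓝 0) := fun h hm hh => by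
      have := (ENNReal.tendsto_toReal ENNReal.zero_ne_top).comp
        (hapL h hm hh 2 (by norm_num) le_rfl)
      rwa [ENNReal.toReal_zero] at this
    have hb : Tendsto (fun n => M * (eLpNorm (⇑(ap f hfm n) - f) 2 μ).toReal *
        (eLpNorm (ap g hgm n) 2 μ).toReal + M * (eLpNorm f 2 μ).toReal *
        (eLpNorm (⇑(ap g hgm n) - g) 2 μ).toReal) atTop (𝓝 0) := by
      have t1 := ((hz f hfm hf).const_mul M).mul (hapN g hgm hg 2 (by norm_num) le_rfl)
      have t2 := (hz g hgm hg).const_mul (M * (eLpNorm f 2 μ).toReal)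
      simpa using t1.add t2
    refine squeeze_zero (fun _ => norm_nonneg _) (fun n => ?_) hb
    have mf := SimpleFunc.FinMeasSupp.memL12 (hap f hfm hf n)
    have mg := SimpleFunc.FinMeasSupp.memL12 (hap g hgm hg n)
    have e : B (ap f hfm n) (ap g hgm n) - B f g =
        B (⇑(ap f hfm n) - f) (ap g hgm n) + B f (⇑(ap g hgm n) - g) := by
      rw [hB.sub_left _ _ _ mf hf mg, hB.sub_right _ _ _ hf mg hg]; ring
    rw [e]
    exact (norm_add_le _ _).trans (add_le_add (h2 _ _ (mf.sub hf) mg) (h2 _ _ hf (mg.sub hg)))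
  refine le_of_tendsto_of_tendsto' hlim.norm
    (((hapN f hfm hf _ hp1' hp2').const_mul _).mul (hapN g hgm hg _ hp1' hp2')) fun n => ?_
  exact riesz_thorin_simpleFunc hB hA hM hθ0 hθ1 hp h1 h2 _ _ (hap f hfm hf n) (hap g hgm hg n)

end

/-! ### Fourier multipliers as bilinear forms -/

section

variable {V : Type*} [NormedAddCommGroup V] [InnerProductSpace ℝ V] [FiniteDimensional ℝ V]
  [MeasurableSpace V] [BorelSpace V]

lemma integral_fourierInv_mul_eq {f g : V → ℂ} (hf : Integrable f) (hg : Integrable g) :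
    ∫ x, 𝓕⁻ f x * g x = ∫ x, f x * 𝓕⁻ g x := by
  have := VectorFourier.integral_fourierIntegral_smul_eq_flip (L := -(innerₗ V))
    (μ := volume) (ν := volume) Real.continuous_fourierChar
    (by simp only [LinearMap.neg_apply]; exact continuous_inner.neg) hf hg
  have k1 : ∀ f : V → ℂ,
      VectorFourier.fourierIntegral Real.fourierChar volume (-(innerₗ V)) f = 𝓕⁻ f := by
    intro f; ext w; rw [Real.fourierInv_eq]; simp [VectorFourier.fourierIntegral]
  have k2 : ∀ f : V → ℂ,
      VectorFourier.fourierIntegral Real.fourierChar volume (-(innerₗ V)).flip f = 𝓕⁻ f := by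
    intro f; ext w; rw [Real.fourierInv_eq]
    simp [VectorFourier.fourierIntegral, real_inner_comm]
  rwa [k1, k2] at this

lemma continuous_fourierInv {f : V → ℂ} (hf : Integrable f) : Continuous (𝓕⁻ f) := by
  rw [Real.fourierInv_eq_fourier_comp_neg]
  exact VectorFourier.fourierIntegral_continuous Real.continuous_fourierChar
    (by exact continuous_inner) hf.comp_neg

lemma continuous_fourier {f : V → ℂ} (hf : Integrable f) : Continuous (𝓕 f) :=
  VectorFourier.fourierIntegral_continuous Real.continuous_fourierChar
    (by exact continuous_inner) hf

lemma norm_fourier_le (f : V → ℂ) (x : V) : ‖𝓕 f x‖ ≤ ∫ y, ‖f y‖ :=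
  VectorFourier.norm_fourierIntegral_le_integral_norm _ _ _ _ _

lemma norm_fourierInv_le (f : V → ℂ) (x : V) : ‖𝓕⁻ f x‖ ≤ ∫ y, ‖f y‖ := by
  rw [Real.fourierInv_eq]
  refine (norm_integral_le_integral_norm _).trans (le_of_eq ?_)
  simp

/-- On `L¹ ∩ L²`, the inverse Fourier transform of `L²` is given by the Fourier integral. -/
theorem coeFn_fourierInv_toLp (h : V → ℂ) (h1 : Integrable h) (h2 : MemLp h 2) :
    ((𝓕⁻ (h2.toLp h) : Lp ℂ 2 (volume : Measure V)) : V → ℂ) =ᵐ[volume] 𝓕⁻ h := by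
  refine ae_eq_of_integral_contDiff_smul_eq ((Lp.memLp _).locallyIntegrable (by norm_num))
    (continuous_fourierInv h1).locallyIntegrable ?_
  intro g hg hgs
  have hgs' : HasCompactSupport (fun x => (g x : ℂ)) :=
    hgs.comp_left (g := fun x : ℝ => (x : ℂ)) (by simp)
  have hg' : ContDiff ℝ (⊤ : ℕ∞) (fun x => (g x : ℂ)) := Complex.ofRealCLM.contDiff.comp hg
  let ψ := hgs'.toSchwartzMap hg'
  have e1 := congrArg (fun T => T ψ) (Lp.fourierInv_toTemperedDistribution_eq (h2.toLp h))
  simp only [TemperedDistribution.fourierInv_apply, Lp.toTemperedDistribution_apply] at e1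
  have e2 : ∀ x, ψ x = (g x : ℂ) := fun x => by simp [ψ]
  simp only [e2] at e1
  have e3 : ∫ x, (g x) • (𝓕⁻ (h2.toLp h) : Lp ℂ 2 (volume : Measure V)) x
    = ∫ x, (g x : ℂ) • (𝓕⁻ (h2.toLp h) : Lp ℂ 2 (volume : Measure V)) x := by simp
  rw [e3, ← e1]
  have e4 : ∫ x, (𝓕⁻ ψ) x • (h2.toLp h) x = ∫ x, (𝓕⁻ (fun x => (g x:ℂ))) x * h x := by
    apply integral_congr_ae
    filter_upwards [h2.coeFn_toLp] with x hx
    rw [hx, SchwartzMap.fourierInv_coe, smul_eq_mul]; congr 2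
  rw [e4, integral_fourierInv_mul_eq
    (hg'.continuous.integrable_of_hasCompactSupport hgs') h1]
  simp

lemma eLpNorm_fourierInv {h : V → ℂ} (h1 : Integrable h) (h2 : MemLp h 2) :
    eLpNorm (𝓕⁻ h) 2 volume = eLpNorm h 2 volume := by
  rw [← eLpNorm_congr_ae (coeFn_fourierInv_toLp h h1 h2)]
  have e : ‖(𝓕⁻ (h2.toLp h) : Lp ℂ 2 (volume : Measure V))‖ = ‖h2.toLp h‖ := by
    rw [← Lp.norm_fourier_eq, fourier_fourierInv_eq]
  rw [Lp.norm_def, Lp.norm_toLp,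
    ENNReal.toReal_eq_toReal_iff' (Lp.eLpNorm_ne_top _) h2.eLpNorm_ne_top] at e
  exact e

lemma fourier_eq_fourierInv_neg (h : V → ℂ) : 𝓕 h = fun x => 𝓕⁻ h (-x) := by
  ext x; rw [Real.fourierInv_eq_fourier_neg, neg_neg]

lemma eLpNorm_fourier {h : V → ℂ} (h1 : Integrable h) (h2 : MemLp h 2) :
    eLpNorm (𝓕 h) 2 volume = eLpNorm h 2 volume := by
  rw [fourier_eq_fourierInv_neg, ← eLpNorm_fourierInv h1 h2]
  exact eLpNorm_comp_measurePreserving (continuous_fourierInv h1).aestronglyMeasurable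
    (Measure.measurePreserving_neg volume)

/-- The bilinear form of the Fourier multiplier with symbol `w`. -/
def multForm (w f g : V → ℂ) : ℂ := ∫ ζ, w ζ * 𝓕 f ζ * 𝓕⁻ g ζ

lemma integrable_mul_fourier {w f : V → ℂ} (hw : Integrable w) (hf : Integrable f) :
    Integrable fun ζ => w ζ * 𝓕 f ζ :=
  hw.mul_bdd (c := ∫ y, ‖f y‖) (continuous_fourier hf).aestronglyMeasurable
    (Eventually.of_forall fun x => norm_fourier_le f x)

lemma integrable_multForm {w f g : V → ℂ} (hw : Integrable w) (hf : Integrable f)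
    (hg : Integrable g) : Integrable fun ζ => w ζ * 𝓕 f ζ * 𝓕⁻ g ζ :=
  (integrable_mul_fourier hw hf).mul_bdd (c := ∫ y, ‖g y‖)
    (continuous_fourierInv hg).aestronglyMeasurable
    (Eventually.of_forall fun x => norm_fourierInv_le g x)

lemma fourier_add_fun {f g : V → ℂ} (hf : Integrable f) (hg : Integrable g) (x : V) :
    𝓕 (f + g) x = 𝓕 f x + 𝓕 g x := by
  have := VectorFourier.fourierIntegral_add (e := Real.fourierChar) (L := innerₗ V)
    Real.continuous_fourierChar (by exact continuous_inner) hf hg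
  exact congrFun this x

lemma fourierInv_add_fun {f g : V → ℂ} (hf : Integrable f) (hg : Integrable g) (x : V) :
    𝓕⁻ (f + g) x = 𝓕⁻ f x + 𝓕⁻ g x := by
  simp only [Real.fourierInv_eq_fourier_neg]
  exact fourier_add_fun hf hg _

lemma fourier_smul_fun (c : ℂ) (f : V → ℂ) (x : V) : 𝓕 (c • f) x = c * 𝓕 f x := by
  have := VectorFourier.fourierIntegral_const_smul Real.fourierChar (volume : Measure V)
    (innerₗ V) f c
  exact congrFun this x

lemma fourierInv_smul_fun (c : ℂ) (f : V → ℂ) (x : V) : 𝓕⁻ (c • f) x = c * 𝓕⁻ f x := by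
  simp only [Real.fourierInv_eq_fourier_neg]
  exact fourier_smul_fun c f _

lemma isBilinL12_multForm {w : V → ℂ} (hw : Integrable w) :
    IsBilinL12 (volume : Measure V) (multForm w) where
  add_left f f' g hf hf' hg := by
    have hf := memLp_one_iff_integrable.1 hf.1
    have hf' := memLp_one_iff_integrable.1 hf'.1
    have hg := memLp_one_iff_integrable.1 hg.1
    rw [multForm, multForm, multForm,
      ← integral_add (integrable_multForm hw hf hg) (integrable_multForm hw hf' hg)]
    congr 1; ext ζ; rw [fourier_add_fun hf hf']; ring
  smul_left c f g hf hg := by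
    rw [multForm, multForm, ← integral_const_mul]
    congr 1; ext ζ; rw [fourier_smul_fun]; ring
  add_right f g g' hf hg hg' := by
    have hf := memLp_one_iff_integrable.1 hf.1
    have hg := memLp_one_iff_integrable.1 hg.1
    have hg' := memLp_one_iff_integrable.1 hg'.1
    rw [multForm, multForm, multForm,
      ← integral_add (integrable_multForm hw hf hg) (integrable_multForm hw hf hg')]
    congr 1; ext ζ; rw [fourierInv_add_fun hg hg']; ring
  smul_right c f g hf hg := by
    rw [multForm, multForm, ← integral_const_mul]
    congr 1; ext ζ; rw [fourierInv_smul_fun]; ring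

/-- The convolution theorem is the exchange formula for the inverse transform applied to the
reflected symbol, modulated by the character of z: the transform of that function at x is the kernel
at z - x. -/
lemma fourierInv_mul_fourier {w f : V → ℂ} (hw : Integrable w) (hf : Integrable f) (z : V) :
    𝓕⁻ (fun ζ => w ζ * 𝓕 f ζ) z = ∫ x, 𝓕⁻ w (z - x) * f x := by
  have hw' : Integrable fun ζ => w (-ζ) := hw.comp_neg
  have hc : Continuous fun ζ : V => (Real.fourierChar (-inner ℝ ζ z) : ℂ) :=
    continuous_induced_dom.comp (Real.continuous_fourierChar.comp (by fun_prop))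
  let e : V → ℂ := fun ζ => Real.fourierChar (-inner ℝ ζ z) * w (-ζ)
  have he : Integrable e := hw'.bdd_mul (c := 1) hc.aestronglyMeasurable
    (Eventually.of_forall fun ζ => (Circle.norm_coe _).le)
  have h := integral_fourierInv_mul_eq he hf
  have e1 : 𝓕⁻ (fun ζ => w ζ * 𝓕 f ζ) z = ∫ x, e x * 𝓕⁻ f x := by
    rw [Real.fourierInv_eq, ← integral_neg_eq_self]
    congr 1; ext ζ
    rw [Real.fourierInv_eq_fourier_neg]
    simp [e, Circle.smul_def, mul_assoc]
  rw [e1, ← h]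
  congr 1; ext x
  congr 1
  rw [Real.fourierInv_eq, Real.fourierInv_eq, ← integral_neg_eq_self]
  congr 1; ext ζ
  have : Real.fourierChar (inner ℝ ζ (z - x)) =
      Real.fourierChar (inner ℝ (-ζ) x) * Real.fourierChar (-inner ℝ (-ζ) z) := by
    rw [← AddChar.map_add_eq_mul]
    congr 1
    simp [inner_sub_right]; ring
  simp only [e, Circle.smul_def, smul_eq_mul, neg_neg, this, Circle.coe_mul]
  ring

lemma toReal_eLpNorm_one {f : V → ℂ} (hf : Integrable f) :
    (eLpNorm f 1 volume).toReal = ∫ x, ‖f x‖ := by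
  rw [eLpNorm_one_eq_lintegral_enorm, integral_norm_eq_lintegral_enorm hf.1]

/-- Exchanging the inverse transform turns the form into the pairing of g with the convolution of f
and the kernel, and the kernel is bounded by A. -/
lemma norm_multForm_le_one {w f g : V → ℂ} (hw : Integrable w) {A : ℝ}
    (hA : ∀ z, ‖𝓕⁻ w z‖ ≤ A) (hf : Integrable f) (hg : Integrable g) :
    ‖multForm w f g‖ ≤ A * (eLpNorm f 1 volume).toReal * (eLpNorm g 1 volume).toReal := by
  have h := integral_fourierInv_mul_eq (integrable_mul_fourier hw hf) hg
  rw [multForm, ← h, toReal_eLpNorm_one hf, toReal_eLpNorm_one hg, ← integral_const_mul]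
  refine norm_integral_le_of_norm_le (hg.norm.const_mul _) (Eventually.of_forall fun z => ?_)
  rw [norm_mul, fourierInv_mul_fourier hw hf]
  gcongr
  rw [← integral_const_mul]
  refine norm_integral_le_of_norm_le (hf.norm.const_mul _) (Eventually.of_forall fun x => ?_)
  rw [norm_mul]
  gcongr
  exact hA _

/-- Cauchy–Schwarz on the frequency side, then Plancherel for both factors. -/
lemma norm_multForm_le_two {w f g : V → ℂ} {M : ℝ} (hM0 : 0 ≤ M)
    (hM : ∀ z, ‖w z‖ ≤ M) (hf : MemL12 f volume) (hg : MemL12 g volume) :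
    ‖multForm w f g‖ ≤ M * (eLpNorm f 2 volume).toReal * (eLpNorm g 2 volume).toReal := by
  have if1 := memLp_one_iff_integrable.1 hf.1
  have ig1 := memLp_one_iff_integrable.1 hg.1
  have mF : MemLp (𝓕 f) 2 (volume : Measure V) :=
    ⟨(continuous_fourier if1).aestronglyMeasurable, by rw [eLpNorm_fourier if1 hf.2]; exact hf.2.2⟩
  have mG : MemLp (𝓕⁻ g) 2 (volume : Measure V) :=
    ⟨(continuous_fourierInv ig1).aestronglyMeasurable,
      by rw [eLpNorm_fourierInv ig1 hg.2]; exact hg.2.2⟩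
  have hcs := integral_mul_norm_le_Lp_mul_Lq (μ := (volume : Measure V)) (f := 𝓕 f) (g := 𝓕⁻ g)
    (p := 2) (q := 2) Real.HolderConjugate.two_two (by simpa using mF) (by simpa using mG)
  have eF := mF.eLpNorm_eq_integral_rpow_norm (by simp) (by simp)
  have eG := mG.eLpNorm_eq_integral_rpow_norm (by simp) (by simp)
  rw [eLpNorm_fourier if1 hf.2] at eF
  rw [eLpNorm_fourierInv ig1 hg.2] at eG
  rw [eF, eG, ENNReal.toReal_ofReal (by positivity), ENNReal.toReal_ofReal (by positivity)]
  simp only [ENNReal.toReal_ofNat, ← one_div]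
  have hInteg : Integrable fun ζ => ‖𝓕 f ζ‖ * ‖𝓕⁻ g ζ‖ := mF.norm.integrable_mul mG.norm
  calc ‖multForm w f g‖ ≤ ∫ ζ, M * (‖𝓕 f ζ‖ * ‖𝓕⁻ g ζ‖) := by
        refine norm_integral_le_of_norm_le (hInteg.const_mul _) (Eventually.of_forall fun ζ => ?_)
        rw [norm_mul, norm_mul, mul_assoc]
        gcongr
        exact hM ζ
    _ = M * ∫ ζ, ‖𝓕 f ζ‖ * ‖𝓕⁻ g ζ‖ := integral_const_mul _ _
    _ ≤ _ := by rw [mul_assoc]; gcongr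

/-- Interpolation for a Fourier multiplier with bounded symbol and bounded kernel. -/
lemma norm_multForm_le_interp {w f g : V → ℂ} (hw : Integrable w) {A M θ p : ℝ}
    (hA : ∀ z, ‖𝓕⁻ w z‖ ≤ A) (hM : ∀ z, ‖w z‖ ≤ M)
    (hθ0 : 0 ≤ θ) (hθ1 : θ ≤ 1) (hp : p * (1 + θ) = 2)
    (hfm : Measurable f) (hgm : Measurable g) (hf : MemL12 f volume) (hg : MemL12 g volume) :
    ‖multForm w f g‖ ≤ A ^ θ * M ^ (1 - θ) * (eLpNorm f (ENNReal.ofReal p) volume).toReal *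
      (eLpNorm g (ENNReal.ofReal p) volume).toReal := by
  have hA0 : 0 ≤ A := (norm_nonneg _).trans (hA 0)
  have hM0 : 0 ≤ M := (norm_nonneg _).trans (hM 0)
  exact riesz_thorin (isBilinL12_multForm hw) hA0 hM0 hθ0 hθ1 hp
    (fun f g hf hg => norm_multForm_le_one hw hA (memLp_one_iff_integrable.1 hf.1)
      (memLp_one_iff_integrable.1 hg.1))
    (fun f g hf hg => norm_multForm_le_two hM0 hM hf hg) f g hfm hgm hf hg

end

/-! ### The Hardy–Littlewood–Sobolev inequality on the line -/

lemma lintegral_comp_abs (g : ℝ → ℝ≥0∞) :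
    ∫⁻ x, g |x| = 2 * ∫⁻ x in Set.Ioi 0, g x := by
  rw [← lintegral_add_compl _ (measurableSet_Ioi (a := (0 : ℝ))), Set.compl_Ioi, two_mul]
  congr 1
  · refine setLIntegral_congr_fun measurableSet_Ioi fun x hx => ?_
    simp only [abs_of_pos (Set.mem_Ioi.1 hx)]
  · rw [setLIntegral_congr Iio_ae_eq_Iic.symm]
    have h := (Measure.measurePreserving_neg (volume : Measure ℝ)).setLIntegral_comp_preimage_emb
      (MeasurableEquiv.neg ℝ).measurableEmbedding (fun x => g x) (Set.Ioi 0)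
    rw [← h]
    have e : (Neg.neg ⁻¹' Set.Ioi 0 : Set ℝ) = Set.Iio 0 := by ext; simp
    rw [e]
    refine setLIntegral_congr_fun measurableSet_Iio fun x hx => ?_
    simp only [abs_of_neg (Set.mem_Iio.1 hx)]

/-- The kernel `|x| ^ (-l)` of fractional integration. -/
def riesz (l x : ℝ) : ℝ≥0∞ := ENNReal.ofReal (|x| ^ (-l))

lemma measurable_riesz (l : ℝ) : Measurable (riesz l) := by unfold riesz; fun_prop

lemma riesz_neg (l x : ℝ) : riesz l (-x) = riesz l x := by simp [riesz]

lemma riesz_sub_comm (l s t : ℝ) : riesz l (s - t) = riesz l (t - s) := by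
  rw [← riesz_neg, neg_sub]

lemma lintegral_riesz_near {l R : ℝ} (hl : l < 1) (hR : 0 < R) :
    ∫⁻ x, (if |x| < R then riesz l x else 0) = ENNReal.ofReal (2 * R ^ (1 - l) / (1 - l)) := by
  have h := lintegral_comp_abs fun x => if x < R then ENNReal.ofReal (x ^ (-l)) else 0
  unfold riesz
  rw [h]
  have e : ∫⁻ x in Set.Ioi (0 : ℝ), (if x < R then ENNReal.ofReal (x ^ (-l)) else 0)
      = ∫⁻ x in Set.Ioo 0 R, ENNReal.ofReal (x ^ (-l)) := by
    rw [← lintegral_indicator measurableSet_Ioi, ← lintegral_indicator measurableSet_Ioo]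
    congr 1; ext x
    simp only [Set.indicator, Set.mem_Ioi, Set.mem_Ioo]
    by_cases h1 : 0 < x <;> by_cases h2 : x < R <;> simp [h1, h2]
  rw [e, setLIntegral_congr Ioo_ae_eq_Ioc]
  have hi := intervalIntegral.intervalIntegrable_rpow' (a := 0) (b := R) (r := -l) (by linarith)
  rw [intervalIntegrable_iff_integrableOn_Ioc_of_le hR.le] at hi
  rw [← ofReal_integral_eq_lintegral_ofReal hi, ← intervalIntegral.integral_of_le hR.le,
    integral_rpow (Or.inl (by linarith)), Real.zero_rpow (by linarith),
    ← ENNReal.ofReal_ofNat 2, ← ENNReal.ofReal_mul (by norm_num)]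
  · congr 1
    rw [show -l + 1 = 1 - l by ring]; ring
  · filter_upwards [ae_restrict_mem measurableSet_Ioc] with x hx
    exact Real.rpow_nonneg hx.1.le _

lemma lintegral_riesz_far {l R : ℝ} (hl : 1 < l) (hR : 0 < R) :
    ∫⁻ x, (if |x| < R then 0 else riesz l x) = ENNReal.ofReal (2 * R ^ (1 - l) / (l - 1)) := by
  have h := lintegral_comp_abs fun x => if x < R then 0 else ENNReal.ofReal (x ^ (-l))
  unfold riesz
  rw [h]
  have e : ∫⁻ x in Set.Ioi (0 : ℝ), (if x < R then 0 else ENNReal.ofReal (x ^ (-l)))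
      = ∫⁻ x in Set.Ici R, ENNReal.ofReal (x ^ (-l)) := by
    rw [← lintegral_indicator measurableSet_Ioi, ← lintegral_indicator measurableSet_Ici]
    congr 1; ext x
    simp only [Set.indicator, Set.mem_Ioi, Set.mem_Ici, ← not_lt]
    by_cases h2 : x < R
    · simp [h2]
    · simp [h2, hR.trans_le (not_lt.1 h2)]
  rw [e, setLIntegral_congr Ioi_ae_eq_Ici.symm]
  have hi := integrableOn_Ioi_rpow_of_lt (a := -l) (by linarith) hR
  rw [← ofReal_integral_eq_lintegral_ofReal hi,
    integral_Ioi_rpow_of_lt (by linarith) hR,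
    ← ENNReal.ofReal_ofNat 2, ← ENNReal.ofReal_mul (by norm_num)]
  · congr 1
    rw [show -l + 1 = 1 - l by ring, show l - 1 = -(1 - l) by ring, div_neg]; ring
  · filter_upwards [ae_restrict_mem measurableSet_Ioi] with x hx
    exact Real.rpow_nonneg (hR.trans hx).le _

lemma riesz_rpow {l x s : ℝ} (hs : 0 ≤ s) : riesz l x ^ s = riesz (l * s) x := by
  unfold riesz
  rw [ENNReal.ofReal_rpow_of_nonneg (by positivity) hs, ← Real.rpow_mul (abs_nonneg _)]
  congr 2; ring

/-- The constant in the pointwise estimate behind the Hardy–Littlewood–Sobolev inequality. -/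
def hlsConst (p : ℝ) : ℝ := 2 / (2 / p - 1) + 2 ^ (1 - 1 / p)

lemma hlsConst_pos {p : ℝ} (h1 : 1 < p) (h2 : p < 2) : 0 < hlsConst p := by
  unfold hlsConst
  have : 0 < 2 / p - 1 := by rw [sub_pos, lt_div_iff₀ (by linarith)]; linarith
  positivity

/-- Split the kernel at distance R. Near the origin use b ≤ α and local integrability, which gives α
R^(2/p - 1) up to a constant. Far away use Hölder: the conjugate power of the kernel is |x|^(-2),
which gives R^(-(1 - 1/p)) up to a constant. The two balance at R = α^(-p), each being a multiple of
α^(p-1). -/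
lemma lintegral_truncated_mul_riesz_le {p : ℝ} (h1 : 1 < p) (h2 : p < 2) {b : ℝ → ℝ≥0∞}
    (hb : Measurable b) (hb1 : ∫⁻ t, b t ^ p ≤ 1) (α : ℝ≥0∞) (s : ℝ) :
    ∫⁻ t, (if b t ≤ α then b t * riesz (2 - 2 / p) (s - t) else 0) ≤
      ENNReal.ofReal (hlsConst p) * α ^ (p - 1) := by
  have hp : 0 < p := by linarith
  have hd : 0 < 2 / p - 1 := by rw [sub_pos, lt_div_iff₀ (by linarith)]; linarith
  rcases eq_or_ne α ∞ with rfl | hα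
  · rw [ENNReal.top_rpow_of_pos (by linarith), ENNReal.mul_top]
    · exact le_top
    · simpa using hlsConst_pos h1 h2
  lift α to ℝ≥0 using hα
  rcases eq_or_ne α 0 with rfl | hα0
  · refine le_of_eq_of_le ?_ zero_le
    refine (lintegral_congr fun t => ?_).trans lintegral_zero
    split_ifs with h
    · have : b t = 0 := by simpa using h
      simp [this]
    · rfl
  have hαp : (0 : ℝ) < α := by exact_mod_cast pos_iff_ne_zero.2 hα0
  set R : ℝ := (α : ℝ) ^ (-p) with hR
  have hR0 : 0 < R := by positivity
  set l := 2 - 2 / p with hl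
  have hl1 : l < 1 := by linarith
  have hmeasR : Measurable fun x : ℝ => if |x| < R then (0 : ℝ≥0∞) else riesz l x :=
    Measurable.ite (measurableSet_lt measurable_norm measurable_const) measurable_const
      (measurable_riesz l)
  have hmeasN : Measurable fun x : ℝ => if |x| < R then riesz l x else (0 : ℝ≥0∞) :=
    Measurable.ite (measurableSet_lt measurable_norm measurable_const) (measurable_riesz l)
      measurable_const
  have split : ∀ t, (if b t ≤ α then b t * riesz l (s - t) else 0) ≤
      α * (if |s - t| < R then riesz l (s - t) else 0) +
        b t * (if |s - t| < R then 0 else riesz l (s - t)) := by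
    intro t
    split_ifs with h3 h4
    · simp only [mul_zero, add_zero]; gcongr
    · simp
    · exact zero_le
    · exact zero_le
  refine (lintegral_mono split).trans ?_
  have hsub : Measurable fun t : ℝ => s - t := measurable_const.sub measurable_id
  have hN : Measurable fun t : ℝ => if |s - t| < R then riesz l (s - t) else 0 :=
    hmeasN.comp hsub
  have hF : Measurable fun t : ℝ => if |s - t| < R then 0 else riesz l (s - t) :=
    hmeasR.comp hsub
  rw [lintegral_add_left (hN.const_mul _), lintegral_const_mul _ hN]
  have near : ∫⁻ t, (if |s - t| < R then riesz l (s - t) else 0) =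
      ENNReal.ofReal (2 * R ^ (1 - l) / (1 - l)) := by
    rw [← lintegral_riesz_near hl1 hR0]
    exact lintegral_sub_left_eq_self (fun x => if |x| < R then riesz l x else 0) s
  have conj : p.HolderConjugate (p / (p - 1)) := Real.HolderConjugate.conjExponent h1
  have far : ∫⁻ t, b t * (if |s - t| < R then 0 else riesz l (s - t)) ≤
      ENNReal.ofReal (2 * R ^ (-1 : ℝ)) ^ (1 / (p / (p - 1))) := by
    refine (ENNReal.lintegral_mul_le_Lp_mul_Lq volume conj hb.aemeasurable
      hF.aemeasurable).trans ?_
    have e : ∫⁻ t, (if |s - t| < R then 0 else riesz l (s - t)) ^ (p / (p - 1)) =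
        ENNReal.ofReal (2 * R ^ (-1 : ℝ)) := by
      have h3 := lintegral_riesz_far (l := 2) (by norm_num) hR0
      rw [show (1 - 2 : ℝ) = -1 by norm_num, show (2 - 1 : ℝ) = 1 by norm_num, div_one] at h3
      rw [← h3, ← lintegral_sub_left_eq_self _ s]
      congr 1; ext t
      rw [sub_sub_cancel]
      split_ifs
      · exact ENNReal.zero_rpow_of_pos (div_pos hp (by linarith))
      · rw [riesz_rpow (div_nonneg hp.le (by linarith))]
        congr 1
        rw [hl]
        have : p - 1 ≠ 0 := by linarith
        field_simp
    rw [e]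
    calc _ ≤ (1 : ℝ≥0∞) ^ (1 / p) * ENNReal.ofReal (2 * R ^ (-1 : ℝ)) ^ (1 / (p / (p - 1))) := by
          gcongr
      _ = _ := by simp
  rw [near]
  refine (add_le_add le_rfl far).trans (le_of_eq ?_)
  rw [ENNReal.ofReal_rpow_of_nonneg (by positivity) (by have := conj.symm.pos; positivity),
    ← ENNReal.ofReal_coe_nnreal, ← ENNReal.ofReal_mul hαp.le,
    ← ENNReal.ofReal_add (by have : 0 < 1 - l := by linarith
                             positivity) (by positivity),
    ENNReal.ofReal_rpow_of_pos hαp, ← ENNReal.ofReal_mul (hlsConst_pos h1 h2).le]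
  congr 1
  have e1 : (α : ℝ) * R ^ (1 - l) = (α : ℝ) ^ (p - 1) := by
    rw [hR, ← Real.rpow_mul hαp.le]
    nth_rewrite 1 [← Real.rpow_one (α : ℝ)]
    rw [← Real.rpow_add hαp]
    congr 1
    rw [hl]; field_simp; ring
  have e3 : 1 / (p / (p - 1)) = 1 - 1 / p := by field_simp
  have e2 : (2 * R ^ (-1 : ℝ)) ^ (1 / (p / (p - 1))) = 2 ^ (1 - 1 / p) * (α : ℝ) ^ (p - 1) := by
    rw [e3, Real.mul_rpow (by norm_num) (by positivity), hR, ← Real.rpow_mul hαp.le,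
      ← Real.rpow_mul hαp.le]
    congr 2
    field_simp
  rw [e2, hlsConst, show (1 - l) = 2 / p - 1 by rw [hl]; ring] at *
  rw [add_mul, ← e1]
  ring

/-- With α = a(s) the inner integral is at most a multiple of a(s)^(p-1), and a · a^(p-1) = a^p has
integral at most 1. -/
lemma hls_normalized_half {p : ℝ} (h1 : 1 < p) (h2 : p < 2) {a b : ℝ → ℝ≥0∞}
    (ha : Measurable a) (hb : Measurable b) (ha1 : ∫⁻ t, a t ^ p ≤ 1) (hb1 : ∫⁻ t, b t ^ p ≤ 1) :
    ∫⁻ s, ∫⁻ t, (if b t ≤ a s then a s * b t * riesz (2 - 2 / p) (s - t) else 0) ≤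
      ENNReal.ofReal (hlsConst p) := by
  calc ∫⁻ s, ∫⁻ t, (if b t ≤ a s then a s * b t * riesz (2 - 2 / p) (s - t) else 0)
      ≤ ∫⁻ s, ENNReal.ofReal (hlsConst p) * a s ^ p := by
        refine lintegral_mono fun s => ?_
        have e : ∀ t, (if b t ≤ a s then a s * b t * riesz (2 - 2 / p) (s - t) else 0) =
            a s * (if b t ≤ a s then b t * riesz (2 - 2 / p) (s - t) else 0) := fun t => by
          split_ifs <;> simp [mul_assoc]
        simp only [e]
        rw [lintegral_const_mul]
        · refine (mul_le_mul_right (lintegral_truncated_mul_riesz_le h1 h2 hb hb1 (a s) s) _).trans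
            (le_of_eq ?_)
          rw [mul_left_comm]
          congr 1
          nth_rewrite 1 [← ENNReal.rpow_one (a s)]
          rw [← ENNReal.rpow_add_of_nonneg _ _ zero_le_one (by linarith)]
          congr 1; ring
        · exact Measurable.ite (measurableSet_le hb measurable_const)
            (hb.mul ((measurable_riesz _).comp (measurable_const.sub measurable_id)))
            measurable_const
    _ ≤ ENNReal.ofReal (hlsConst p) * 1 := by
        rw [lintegral_const_mul _ (ha.pow_const _)]; gcongr
    _ = _ := mul_one _

/-- At every (s,t) one of a(s), b(t) dominates the other. Both regions are treated by the same half
estimate because the kernel is even, so no maximal function or interpolation is needed. -/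
lemma hls_normalized {p : ℝ} (h1 : 1 < p) (h2 : p < 2) {a b : ℝ → ℝ≥0∞}
    (ha : Measurable a) (hb : Measurable b) (ha1 : ∫⁻ t, a t ^ p ≤ 1) (hb1 : ∫⁻ t, b t ^ p ≤ 1) :
    ∫⁻ s, ∫⁻ t, a s * b t * riesz (2 - 2 / p) (s - t) ≤ ENNReal.ofReal (2 * hlsConst p) := by
  set k := riesz (2 - 2 / p)
  have hk : Measurable fun x : ℝ × ℝ => k (x.1 - x.2) :=
    (measurable_riesz _).comp (measurable_fst.sub measurable_snd)
  have hm1 : Measurable fun x : ℝ × ℝ => if b x.2 ≤ a x.1 then a x.1 * b x.2 * k (x.1 - x.2) else 0 :=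
    Measurable.ite (measurableSet_le (hb.comp measurable_snd) (ha.comp measurable_fst))
      (((ha.comp measurable_fst).mul (hb.comp measurable_snd)).mul hk) measurable_const
  have hm2 : Measurable fun x : ℝ × ℝ => if a x.1 ≤ b x.2 then b x.2 * a x.1 * k (x.2 - x.1) else 0 :=
    Measurable.ite (measurableSet_le (ha.comp measurable_fst) (hb.comp measurable_snd))
      (((hb.comp measurable_snd).mul (ha.comp measurable_fst)).mul
        ((measurable_riesz _).comp (measurable_snd.sub measurable_fst))) measurable_const
  have hpt : ∀ s t, a s * b t * k (s - t) ≤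
      (if b t ≤ a s then a s * b t * k (s - t) else 0) +
        (if a s ≤ b t then b t * a s * k (t - s) else 0) := by
    intro s t
    rcases le_total (b t) (a s) with h | h
    · rw [if_pos h]; exact le_self_add
    · rw [if_pos h, mul_comm (b t), show k (t - s) = k (s - t) from riesz_sub_comm _ _ _]
      exact le_add_self
  calc ∫⁻ s, ∫⁻ t, a s * b t * k (s - t)
      ≤ ∫⁻ s, ∫⁻ t, ((if b t ≤ a s then a s * b t * k (s - t) else 0) +
        (if a s ≤ b t then b t * a s * k (t - s) else 0)) :=
        lintegral_mono fun s => lintegral_mono fun t => hpt s t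
    _ = (∫⁻ s, ∫⁻ t, (if b t ≤ a s then a s * b t * k (s - t) else 0)) +
        ∫⁻ s, ∫⁻ t, (if a s ≤ b t then b t * a s * k (t - s) else 0) := by
        rw [← lintegral_add_left hm1.lintegral_prod_right']
        congr 1; ext s
        exact lintegral_add_left (hm1.comp measurable_prodMk_left) _
    _ = (∫⁻ s, ∫⁻ t, (if b t ≤ a s then a s * b t * k (s - t) else 0)) +
        ∫⁻ t, ∫⁻ s, (if a s ≤ b t then b t * a s * k (t - s) else 0) := by
        congr 1
        exact lintegral_lintegral_swap hm2.aemeasurable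
    _ ≤ ENNReal.ofReal (hlsConst p) + ENNReal.ofReal (hlsConst p) :=
        add_le_add (hls_normalized_half h1 h2 ha hb ha1 hb1)
          (hls_normalized_half h1 h2 hb ha hb1 ha1)
    _ = _ := by
        rw [← ENNReal.ofReal_add (hlsConst_pos h1 h2).le (hlsConst_pos h1 h2).le, two_mul]

/-- The Hardy–Littlewood–Sobolev inequality on the line, on the diagonal. -/
lemma hls {p : ℝ} (h1 : 1 < p) (h2 : p < 2) {a b : ℝ → ℝ≥0∞}
    (ha : Measurable a) (hb : Measurable b) :
    ∫⁻ s, ∫⁻ t, a s * b t * riesz (2 - 2 / p) (s - t) ≤ ENNReal.ofReal (2 * hlsConst p) *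
      (∫⁻ t, a t ^ p) ^ (1 / p) * (∫⁻ t, b t ^ p) ^ (1 / p) := by
  have hp : 0 < p := by linarith
  have hC : ENNReal.ofReal (2 * hlsConst p) ≠ 0 := by simpa using hlsConst_pos h1 h2
  set X := (∫⁻ t, a t ^ p) ^ (1 / p) with hX
  set Y := (∫⁻ t, b t ^ p) ^ (1 / p) with hY
  have hzero : ∀ c : ℝ → ℝ≥0∞, Measurable c → (∫⁻ t, c t ^ p) ^ (1 / p) = 0 → c =ᵐ[volume] 0 := by
    intro c hc h
    rw [ENNReal.rpow_eq_zero_iff_of_pos (by positivity),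
      lintegral_eq_zero_iff (hc.pow_const _)] at h
    filter_upwards [h] with t ht
    exact (ENNReal.rpow_eq_zero_iff_of_pos hp).1 ht
  by_cases hX0 : X = 0
  · refine le_of_eq_of_le ?_ zero_le
    rw [← lintegral_zero (μ := (volume : Measure ℝ))]
    apply lintegral_congr_ae
    filter_upwards [hzero a ha hX0] with s hs
    simp [hs]
  by_cases hY0 : Y = 0
  · refine le_of_eq_of_le ?_ zero_le
    refine (lintegral_congr fun s => ?_).trans lintegral_zero
    rw [← lintegral_zero (μ := (volume : Measure ℝ))]
    apply lintegral_congr_ae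
    filter_upwards [hzero b hb hY0] with t ht
    simp [ht]
  by_cases hXt : X = ∞
  · rw [hXt, ENNReal.mul_top hC, ENNReal.top_mul hY0]; exact le_top
  by_cases hYt : Y = ∞
  · rw [hYt, ENNReal.mul_top (mul_ne_zero hC hX0)]; exact le_top
  -- Both sides are homogeneous in a and in b, so nonzero finite norms can be scaled to 1.
  have hnorm : ∀ c : ℝ → ℝ≥0∞, Measurable c → (∫⁻ t, c t ^ p) ^ (1 / p) ≠ 0 →
      (∫⁻ t, c t ^ p) ^ (1 / p) ≠ ∞ →
      ∫⁻ t, (((∫⁻ t, c t ^ p) ^ (1 / p))⁻¹ * c t) ^ p ≤ 1 := by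
    intro c hc h0 ht
    simp only [ENNReal.mul_rpow_of_nonneg _ _ hp.le]
    rw [lintegral_const_mul _ (hc.pow_const _), ENNReal.inv_rpow, ← ENNReal.rpow_mul,
      one_div_mul_cancel hp.ne', ENNReal.rpow_one]
    apply ENNReal.inv_mul_le_one
  have key := hls_normalized h1 h2 (ha.const_mul X⁻¹) (hb.const_mul Y⁻¹)
    (hnorm a ha hX0 hXt) (hnorm b hb hY0 hYt)
  have e : ∀ s t, a s * b t * riesz (2 - 2 / p) (s - t) =
      (X * Y) * (X⁻¹ * a s * (Y⁻¹ * b t) * riesz (2 - 2 / p) (s - t)) := fun s t => by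
    calc _ = (X * X⁻¹) * (Y * Y⁻¹) * (a s * b t * riesz (2 - 2 / p) (s - t)) := by
          rw [ENNReal.mul_inv_cancel hX0 hXt, ENNReal.mul_inv_cancel hY0 hYt]; simp
      _ = _ := by ring
  simp only [e]
  have hXY : X * Y ≠ ∞ := ENNReal.mul_ne_top hXt hYt
  simp only [lintegral_const_mul' _ _ hXY]
  calc _ ≤ X * Y * ENNReal.ofReal (2 * hlsConst p) := by gcongr
    _ = _ := by ring

/-! ### The TT* argument -/

section

variable {H : Type*} [NormedAddCommGroup H] [InnerProductSpace ℂ H] [CompleteSpace H]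

lemma enorm_integral_sq_le {F : ℝ → H} (hF : Integrable F) :
    ‖∫ t, F t‖ₑ ^ 2 ≤ ∫⁻ s, ∫⁻ t, ‖inner ℂ (F s) (F t)‖ₑ := by
  have e : ‖∫ t, F t‖ₑ ^ 2 = ‖inner ℂ (∫ t, F t) (∫ t, F t)‖ₑ := by
    rw [inner_self_eq_norm_sq_to_K, enorm_pow]
    congr 1
    rw [← ofReal_norm, ← ofReal_norm, RCLike.norm_ofReal, abs_of_nonneg (norm_nonneg _)]
  rw [e, ← integral_inner hF]
  refine (enorm_integral_le_lintegral_enorm _).trans (lintegral_mono fun s => ?_)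
  rw [← inner_conj_symm, RCLike.enorm_conj, ← integral_inner hF]
  exact enorm_integral_le_lintegral_enorm _

/-- The `TT*` argument: decay of the correlations `⟨v s, v t⟩` bounds `t ↦ ⟨v t, φ⟩` in `L^q`. -/
lemma lintegral_inner_rpow_le {q p A : ℝ} (hp1 : 1 < p) (hp2 : p < 2) (hpq : p.HolderConjugate q)
    {v : ℝ → H} (hv : StronglyMeasurable v) {R : ℝ} (hR : ∀ t, ‖v t‖ ≤ R)
    (hvv : ∀ s t, s ≠ t → ‖inner ℂ (v s) (v t)‖ₑ ≤ ENNReal.ofReal A * riesz (2 / q) (s - t))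
    (φ : H) :
    (∫⁻ t, ‖inner ℂ (v t) φ‖ₑ ^ q) ^ (1 / q) ≤
      ENNReal.ofReal (A * (2 * hlsConst p)) ^ (1 / 2 : ℝ) * ‖φ‖ₑ := by
  have hq0 : 0 < q := hpq.symm.pos
  have hp0 : 0 < p := hpq.pos
  have hq1 : 1 < q := hpq.symm.lt
  set c : ℝ → ℂ := fun t => inner ℂ (v t) φ with hc
  have hcm : StronglyMeasurable c := hv.inner stronglyMeasurable_const
  have hcb : ∀ t, ‖c t‖ ≤ R * ‖φ‖ := fun t =>
    (norm_inner_le_norm _ _).trans (mul_le_mul_of_nonneg_right (hR t) (norm_nonneg _))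
  have hR0 : 0 ≤ R := (norm_nonneg _).trans (hR 0)
  set Kc := ENNReal.ofReal (A * (2 * hlsConst p)) with hKc
  -- On a bounded interval the integral is finite a priori, because v is bounded; that allows the
  -- division at the end. The bound does not depend on N.
  have fin : ∀ N : ℕ, (∫⁻ t in Set.Icc (-N : ℝ) N, ‖c t‖ₑ ^ q) ^ (1 / q) ≤
      Kc ^ (1 / 2 : ℝ) * ‖φ‖ₑ := by
    intro N
    set I := Set.Icc (-N : ℝ) N with hI
    have hIm : MeasurableSet I := measurableSet_Icc
    set X := ∫⁻ t in I, ‖c t‖ₑ ^ q with hX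
    have hXt : X ≠ ∞ := by
      have : X ≤ ∫⁻ t in I, ENNReal.ofReal (R * ‖φ‖) ^ q := by
        refine lintegral_mono fun t => ?_
        gcongr
        rw [← ofReal_norm]
        exact ENNReal.ofReal_le_ofReal (hcb t)
      refine ne_top_of_le_ne_top ?_ this
      rw [lintegral_const]
      refine ENNReal.mul_ne_top (ENNReal.rpow_ne_top_of_nonneg hq0.le ENNReal.ofReal_ne_top) ?_
      simp [hI]
    -- The extremal dual function: |a|^p = |c|^q, and pairing a with c returns |c|^q.
    let a : ℝ → ℂ := I.indicator fun t => ((‖c t‖ ^ (q - 2) : ℝ) : ℂ) * c t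
    have ham : StronglyMeasurable a := by
      refine StronglyMeasurable.indicator ?_ hIm
      exact ((hcm.norm.measurable.pow_const _).complex_ofReal.stronglyMeasurable).mul hcm
    have han : ∀ t ∈ I, ‖a t‖ = ‖c t‖ ^ (q - 1) := fun t ht => by
      simp only [a, Set.indicator_of_mem ht, norm_mul, Complex.norm_real]
      rw [Real.norm_of_nonneg (by positivity)]
      rcases eq_or_ne ‖c t‖ 0 with h0 | h0
      · rw [h0, mul_zero, Real.zero_rpow (by linarith)]
      · nth_rewrite 2 [← Real.rpow_one ‖c t‖]
        rw [← Real.rpow_add (lt_of_le_of_ne (norm_nonneg _) h0.symm)]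
        congr 1; ring
    have han' : ∀ t ∉ I, a t = 0 := fun t ht => Set.indicator_of_notMem ht _
    have haI : Integrable fun t => a t • v t := by
      have : IntegrableOn (fun t => a t • v t) I := by
        refine Measure.integrableOn_of_bounded (M := (R * ‖φ‖) ^ (q - 1) * R) (by simp [hI])
          (ham.smul hv).aestronglyMeasurable ?_
        filter_upwards [ae_restrict_mem hIm] with t ht
        rw [norm_smul, han t ht]
        exact mul_le_mul (Real.rpow_le_rpow (norm_nonneg _) (hcb t) (by linarith)) (hR t)
          (norm_nonneg _) (by positivity)
      refine (integrableOn_iff_integrable_of_support_subset ?_).1 this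
      intro t ht
      by_contra h
      exact ht (by simp [han' t h])
    have hac : ∀ t, ENNReal.ofReal (‖inner ℂ (a t • v t) φ‖) = I.indicator (fun t => ‖c t‖ₑ ^ q) t ∧
        inner ℂ (a t • v t) φ = ((‖inner ℂ (a t • v t) φ‖ : ℝ) : ℂ) := by
      intro t
      by_cases ht : t ∈ I
      · have e : inner ℂ (a t • v t) φ = ((‖c t‖ ^ q : ℝ) : ℂ) := by
          rw [inner_smul_left]
          change (starRingEnd ℂ) (a t) * c t = _
          simp only [a, Set.indicator_of_mem ht, map_mul, Complex.conj_ofReal]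
          rw [mul_assoc, Complex.conj_mul', ← Complex.ofReal_pow, ← Complex.ofReal_mul]
          congr 1
          rcases eq_or_ne ‖c t‖ 0 with h0 | h0
          · rw [h0, Real.zero_rpow hq0.ne']; simp
          · rw [← Real.rpow_natCast, ← Real.rpow_add (lt_of_le_of_ne (norm_nonneg _) h0.symm)]
            congr 1; push_cast; ring
        rw [e, Complex.norm_real, Real.norm_of_nonneg (by positivity), Set.indicator_of_mem ht]
        refine ⟨?_, rfl⟩
        rw [← ENNReal.ofReal_rpow_of_nonneg (norm_nonneg _) hq0.le, ofReal_norm]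
      · simp [han' t ht, ht]
    have hXV : X ≤ ‖∫ t, a t • v t‖ₑ * ‖φ‖ₑ := by
      have hInteg : Integrable fun t => inner ℂ (a t • v t) φ := haI.inner_const φ
      have e1 : X = ENNReal.ofReal (∫ t, ‖inner ℂ (a t • v t) φ‖) := by
        rw [ofReal_integral_eq_lintegral_ofReal hInteg.norm
          (Eventually.of_forall fun _ => norm_nonneg _)]
        simp only [fun t => (hac t).1]
        rw [lintegral_indicator hIm]
      have e2 : ((∫ t, ‖inner ℂ (a t • v t) φ‖ : ℝ) : ℂ) = inner ℂ (∫ t, a t • v t) φ := by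
        rw [← integral_complex_ofReal, ← inner_conj_symm, ← integral_inner haI, ← integral_conj]
        congr 1; ext t
        rw [inner_conj_symm]
        exact (hac t).2.symm
      have e3 : ∫ t, ‖inner ℂ (a t • v t) φ‖ ≤ ‖∫ t, a t • v t‖ * ‖φ‖ := by
        refine le_trans ?_ (norm_inner_le_norm (𝕜 := ℂ) _ _)
        rw [← e2, Complex.norm_real]
        exact le_abs_self _
      rw [e1, ← ofReal_norm, ← ofReal_norm, ← ENNReal.ofReal_mul (norm_nonneg _)]
      exact ENNReal.ofReal_le_ofReal e3
    have hVV : ‖∫ t, a t • v t‖ₑ ^ 2 ≤ Kc * X ^ (1 / p) * X ^ (1 / p) := by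
      refine (enorm_integral_sq_le haI).trans ?_
      have e2q : 2 / q = 2 - 2 / p := by
        have := hpq.inv_add_inv_eq_one
        rw [div_eq_mul_inv, div_eq_mul_inv]; linarith
      have hA : ENNReal.ofReal A ≠ ∞ := ENNReal.ofReal_ne_top
      have haX : ∫⁻ t, ‖a t‖ₑ ^ p = X := by
        rw [hX, ← lintegral_indicator hIm]
        congr 1; ext t
        by_cases ht : t ∈ I
        · rw [Set.indicator_of_mem ht, ← ofReal_norm, ← ofReal_norm, han t ht,
            ENNReal.ofReal_rpow_of_nonneg (by positivity) hp0.le,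
            ENNReal.ofReal_rpow_of_nonneg (by positivity) hq0.le,
            ← Real.rpow_mul (norm_nonneg _), hpq.symm.sub_one_mul_conj]
        · rw [Set.indicator_of_notMem ht, han' t ht]; simp [hp0]
      calc ∫⁻ s, ∫⁻ t, ‖inner ℂ (a s • v s) (a t • v t)‖ₑ
          ≤ ∫⁻ s, ∫⁻ t, ENNReal.ofReal A * (‖a s‖ₑ * ‖a t‖ₑ * riesz (2 / q) (s - t)) := by
            refine lintegral_mono fun s => lintegral_mono_ae ?_
            -- The correlation bound is assumed only off the diagonal, which is a null set.
            have : ∀ᵐ t : ℝ, t ≠ s := by simp [ae_iff]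
            filter_upwards [this] with t ht
            rw [inner_smul_left, inner_smul_right, enorm_mul, enorm_mul, RCLike.enorm_conj]
            calc _ ≤ ‖a s‖ₑ * (‖a t‖ₑ * (ENNReal.ofReal A * riesz (2 / q) (s - t))) := by
                  gcongr; exact hvv s t ht.symm
              _ = _ := by ring
        _ = ENNReal.ofReal A * ∫⁻ s, ∫⁻ t, ‖a s‖ₑ * ‖a t‖ₑ * riesz (2 / q) (s - t) := by
            simp only [lintegral_const_mul' _ _ hA]
        _ ≤ ENNReal.ofReal A * (ENNReal.ofReal (2 * hlsConst p) * X ^ (1 / p) * X ^ (1 / p)) := by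
            gcongr
            rw [e2q, ← haX]
            exact hls hp1 hp2 ham.enorm ham.enorm
        _ = _ := by
            rw [hKc, mul_comm A, ENNReal.ofReal_mul (q := A)
              (by have := hlsConst_pos hp1 hp2; positivity)]
            ring
    have hV : ‖∫ t, a t • v t‖ₑ ≤ Kc ^ (1 / 2 : ℝ) * X ^ (1 / p) := by
      have : ‖∫ t, a t • v t‖ₑ ^ 2 ≤ (Kc ^ (1 / 2 : ℝ) * X ^ (1 / p)) ^ 2 := by
        refine hVV.trans (le_of_eq ?_)
        rw [mul_pow, ← ENNReal.rpow_natCast (Kc ^ _), ← ENNReal.rpow_mul]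
        simp
        ring
      exact (ENNReal.pow_le_pow_left_iff two_ne_zero).1 this
    rcases eq_or_ne X 0 with hX0 | hX0
    · rw [hX0, ENNReal.zero_rpow_of_pos (by positivity)]; exact zero_le
    have hfin : X ^ (1 / p) ≠ ∞ := ENNReal.rpow_ne_top_of_nonneg (by positivity) hXt
    have hne : X ^ (1 / p) ≠ 0 := by
      rw [Ne, ENNReal.rpow_eq_zero_iff_of_pos (by positivity)]; exact hX0
    have eX : X = X ^ (1 / p) * X ^ (1 / q) := by
      rw [← ENNReal.rpow_add _ _ hX0 hXt]
      have := hpq.inv_add_inv_eq_one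
      rw [one_div, one_div, this, ENNReal.rpow_one]
    have : X ^ (1 / p) * X ^ (1 / q) ≤ X ^ (1 / p) * (Kc ^ (1 / 2 : ℝ) * ‖φ‖ₑ) := by
      rw [← eX]
      refine hXV.trans ((mul_le_mul_left hV _).trans (le_of_eq ?_))
      ring
    exact (ENNReal.mul_le_mul_iff_right hne hfin).1 this
  have hmono : Monotone fun N : ℕ => Set.Icc (-N : ℝ) N := fun m n h =>
    Set.Icc_subset_Icc (by simpa using h) (by simpa using h)
  have hU : ⋃ N : ℕ, Set.Icc (-N : ℝ) N = Set.univ := by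
    ext x
    simp only [Set.mem_iUnion, Set.mem_Icc, Set.mem_univ, iff_true]
    obtain ⟨N, hN⟩ := exists_nat_ge |x|
    exact ⟨N, (abs_le.1 hN).1, (abs_le.1 hN).2⟩
  rw [← setLIntegral_univ, ← hU, setLIntegral_iUnion_of_directed _ hmono.directed_le,
    one_div, ENNReal.rpow_inv_le_iff hq0]
  refine iSup_le fun N => (ENNReal.rpow_inv_le_iff hq0).1 ?_
  rw [← one_div]
  exact fin N

end

/-! ### Oscillatory integrals -/

/-- The first derivative test of van der Corput. -/
lemma van_der_corput_first {ψ ψ₁ ψ₂ : ℝ → ℝ} {u v l : ℝ} (huv : u ≤ v) (hl : 0 < l)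
    (h1 : ∀ x ∈ Set.Icc u v, HasDerivAt ψ (ψ₁ x) x)
    (h2 : ∀ x ∈ Set.Icc u v, HasDerivAt ψ₁ (ψ₂ x) x) (hc : ContinuousOn ψ₂ (Set.Icc u v))
    (hs : (∀ x ∈ Set.Icc u v, 0 ≤ ψ₂ x) ∨ (∀ x ∈ Set.Icc u v, ψ₂ x ≤ 0))
    (hb : ∀ x ∈ Set.Icc u v, l ≤ |ψ₁ x|) :
    ‖∫ x in u..v, Complex.exp (Complex.I * ψ x)‖ ≤ 4 / l := by
  have hI : Set.uIcc u v = Set.Icc u v := Set.uIcc_of_le huv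
  have hne : ∀ x ∈ Set.Icc u v, ψ₁ x ≠ 0 := fun x hx h0 => by
    have := hb x hx; rw [h0, abs_zero] at this; linarith
  have hneC : ∀ x ∈ Set.Icc u v, (ψ₁ x : ℂ) ≠ 0 := fun x hx => by exact_mod_cast hne x hx
  have cψ : ContinuousOn ψ (Set.Icc u v) := fun x hx => (h1 x hx).continuousAt.continuousWithinAt
  have cψ₁ : ContinuousOn ψ₁ (Set.Icc u v) := fun x hx => (h2 x hx).continuousAt.continuousWithinAt
  let G : ℝ → ℂ := fun x => Complex.exp (Complex.I * ψ x) / (Complex.I * ψ₁ x)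
  let E : ℝ → ℂ := fun x => Complex.exp (Complex.I * ψ x)
  -- Integration by parts: the boundary function `G` has derivative `E - D`. The error `D` has
  -- modulus |ψ₂|/ψ₁², the absolute value of the derivative of 1/ψ₁, and since ψ₂ has one sign its
  -- integral telescopes.
  let D : ℝ → ℂ := fun x => Complex.exp (Complex.I * ψ x) * (ψ₂ x / (Complex.I * ψ₁ x ^ 2))
  have hG : ∀ x ∈ Set.Icc u v, HasDerivAt G (E x - D x) x := by
    intro x hx
    have d1 : HasDerivAt (fun x => Complex.exp (Complex.I * ψ x))
        (Complex.exp (Complex.I * ψ x) * (Complex.I * ψ₁ x)) x :=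
      ((h1 x hx).ofReal_comp.const_mul Complex.I).cexp
    have d2 : HasDerivAt (fun x => Complex.I * (ψ₁ x : ℂ)) (Complex.I * ψ₂ x) x :=
      (h2 x hx).ofReal_comp.const_mul Complex.I
    have hn : Complex.I * (ψ₁ x : ℂ) ≠ 0 := mul_ne_zero Complex.I_ne_zero (hneC x hx)
    refine (d1.div d2 hn).congr_deriv ?_
    have := hneC x hx
    simp only [E, D]
    field_simp
  have cE : ContinuousOn E (Set.Icc u v) := by
    have : ContinuousOn (fun x => (ψ x : ℂ)) (Set.Icc u v) := Complex.continuous_ofReal.comp_continuousOn cψ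
    exact (continuousOn_const.mul this).cexp
  have cD : ContinuousOn D (Set.Icc u v) := by
    refine cE.mul ((Complex.continuous_ofReal.comp_continuousOn hc).div
      (continuousOn_const.mul ((Complex.continuous_ofReal.comp_continuousOn cψ₁).pow 2)) ?_)
    intro x hx
    exact mul_ne_zero Complex.I_ne_zero (pow_ne_zero _ (hneC x hx))
  have iE : IntervalIntegrable E volume u v := by
    apply ContinuousOn.intervalIntegrable; rwa [hI]
  have iD : IntervalIntegrable D volume u v := by
    apply ContinuousOn.intervalIntegrable; rwa [hI]
  have hInteg := intervalIntegral.integral_eq_sub_of_hasDerivAt (a := u) (b := v)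
    (fun x hx => hG x (by rwa [hI] at hx)) (iE.sub iD)
  rw [intervalIntegral.integral_sub iE iD] at hInteg
  have hE : ∫ x in u..v, E x = G v - G u + ∫ x in u..v, D x := by rw [← hInteg]; ring
  have hGn : ∀ x ∈ Set.Icc u v, ‖G x‖ ≤ 1 / l := fun x hx => by
    simp only [G, norm_div, norm_mul, Complex.norm_I, one_mul, Complex.norm_real]
    rw [mul_comm, Complex.norm_exp_ofReal_mul_I]
    exact one_div_le_one_div_of_le hl (hb x hx)
  have hinv : ∀ x ∈ Set.Icc u v, |1 / ψ₁ x| ≤ 1 / l := fun x hx => by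
    rw [abs_div, abs_one]; exact one_div_le_one_div_of_le hl (hb x hx)
  have mu : u ∈ Set.Icc u v := Set.left_mem_Icc.2 huv
  have mv : v ∈ Set.Icc u v := Set.right_mem_Icc.2 huv
  have cd : ContinuousOn (fun x => ψ₂ x / ψ₁ x ^ 2) (Set.Icc u v) :=
    hc.div (cψ₁.pow 2) fun x hx => pow_ne_zero _ (hne x hx)
  have hprim : ∫ x in u..v, ψ₂ x / ψ₁ x ^ 2 = 1 / ψ₁ u - 1 / ψ₁ v := by
    have := intervalIntegral.integral_eq_sub_of_hasDerivAt (a := u) (b := v)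
      (f := fun x => -(1 / ψ₁ x)) (f' := fun x => ψ₂ x / ψ₁ x ^ 2) (fun x hx => ?_)
      (by apply ContinuousOn.intervalIntegrable; rwa [hI])
    · rw [this]; ring
    · rw [hI] at hx
      simp only [one_div]
      refine ((h2 x hx).inv (hne x hx)).neg.congr_deriv ?_
      ring
  have hDn : ‖∫ x in u..v, D x‖ ≤ 2 / l := by
    have hDx : ∀ x ∈ Set.Icc u v, ‖D x‖ = |ψ₂ x / ψ₁ x ^ 2| := fun x hx => by
      simp only [D, norm_mul, norm_div, Complex.norm_I, one_mul, norm_pow, Complex.norm_real]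
      rw [mul_comm Complex.I, Complex.norm_exp_ofReal_mul_I, one_mul]
      simp [abs_div]
    have hle : ‖∫ x in u..v, D x‖ ≤ ∫ x in u..v, |ψ₂ x / ψ₁ x ^ 2| := by
      refine (intervalIntegral.norm_integral_le_integral_norm huv).trans (le_of_eq ?_)
      refine intervalIntegral.integral_congr fun x hx => ?_
      rw [hI] at hx
      exact hDx x hx
    have h3 := (abs_le.1 (hinv u mu))
    have h4 := (abs_le.1 (hinv v mv))
    refine hle.trans ?_
    rcases hs with hs | hs
    · rw [intervalIntegral.integral_congr (g := fun x => ψ₂ x / ψ₁ x ^ 2), hprim]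
      · have : 2 / l = 1 / l + 1 / l := by ring
        linarith
      · intro x hx
        rw [hI] at hx
        exact abs_of_nonneg (div_nonneg (hs x hx) (sq_nonneg _))
    · rw [intervalIntegral.integral_congr (g := fun x => -(ψ₂ x / ψ₁ x ^ 2)),
        intervalIntegral.integral_neg, hprim]
      · have : 2 / l = 1 / l + 1 / l := by ring
        linarith
      · intro x hx
        rw [hI] at hx
        exact abs_of_nonpos (div_nonpos_of_nonpos_of_nonneg (hs x hx) (sq_nonneg _))
  change ‖∫ x in u..v, E x‖ ≤ 4 / l
  rw [hE]
  calc _ ≤ ‖G v‖ + ‖G u‖ + ‖∫ x in u..v, D x‖ :=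
        (norm_add_le _ _).trans (add_le_add_left (norm_sub_le _ _) _)
    _ ≤ 1 / l + 1 / l + 2 / l := add_le_add (add_le_add (hGn v mv) (hGn u mu)) hDn
    _ = _ := by ring

lemma norm_integral_exp_le (ψ : ℝ → ℝ) {u v : ℝ} (huv : u ≤ v) :
    ‖∫ x in u..v, Complex.exp (Complex.I * ψ x)‖ ≤ v - u := by
  have := intervalIntegral.norm_integral_le_of_norm_le_const (a := u) (b := v) (C := 1)
    (f := fun x => Complex.exp (Complex.I * ψ x)) fun x _ => by
      rw [mul_comm, Complex.norm_exp_ofReal_mul_I]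
  rwa [one_mul, abs_of_nonneg (sub_nonneg.2 huv)] at this

/-- The second derivative test of van der Corput. -/
lemma van_der_corput_second {ψ ψ₁ ψ₂ : ℝ → ℝ} {u v l : ℝ} (huv : u ≤ v) (hl : 0 < l)
    (h1 : ∀ x ∈ Set.Icc u v, HasDerivAt ψ (ψ₁ x) x)
    (h2 : ∀ x ∈ Set.Icc u v, HasDerivAt ψ₁ (ψ₂ x) x) (hc : ContinuousOn ψ₂ (Set.Icc u v))
    (hb : ∀ x ∈ Set.Icc u v, l ≤ ψ₂ x) :
    ‖∫ x in u..v, Complex.exp (Complex.I * ψ x)‖ ≤ 10 / √l := by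
  set m := √l with hm
  have hm0 : 0 < m := Real.sqrt_pos.2 hl
  have hml : m * m = l := Real.mul_self_sqrt hl.le
  have cψ : ContinuousOn ψ (Set.Icc u v) := fun x hx => (h1 x hx).continuousAt.continuousWithinAt
  have cψ₁ : ContinuousOn ψ₁ (Set.Icc u v) := fun x hx => (h2 x hx).continuousAt.continuousWithinAt
  have mu : u ∈ Set.Icc u v := Set.left_mem_Icc.2 huv
  have mv : v ∈ Set.Icc u v := Set.right_mem_Icc.2 huv
  have grow : ∀ x ∈ Set.Icc u v, ∀ y ∈ Set.Icc u v, x ≤ y → l * (y - x) ≤ ψ₁ y - ψ₁ x := by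
    intro x hx y hy hxy
    refine Convex.mul_sub_le_image_sub_of_le_deriv (convex_Icc u v) cψ₁ ?_ ?_ x hx y hy hxy
    · intro z hz
      exact (h2 z (interior_subset hz)).differentiableAt.differentiableWithinAt
    · intro z hz
      rw [(h2 z (interior_subset hz)).deriv]
      exact hb z (interior_subset hz)
  -- The derivative ψ₁ increases with slope at least l, so x₀ is its zero, or the end point nearest
  -- to one. At distance 1/√l from x₀ one has |ψ₁| ≥ √l. The two outer pieces cost 4/√l each and the
  -- middle one its length 2/√l.
  obtain ⟨x₀, hx₀, hr, hlft⟩ : ∃ x₀ ∈ Set.Icc u v, (x₀ = v ∨ 0 ≤ ψ₁ x₀) ∧ (x₀ = u ∨ ψ₁ x₀ ≤ 0) := by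
    rcases le_total 0 (ψ₁ u) with h | h
    · exact ⟨u, mu, Or.inr h, Or.inl rfl⟩
    rcases le_total (ψ₁ v) 0 with h' | h'
    · exact ⟨v, mv, Or.inl rfl, Or.inr h'⟩
    · obtain ⟨x, hx, hx0⟩ := intermediate_value_Icc huv cψ₁ (Set.mem_Icc.2 ⟨h, h'⟩)
      exact ⟨x, hx, Or.inr hx0.ge, Or.inr hx0.le⟩
  set a := max u (x₀ - 1 / m) with ha
  set b := min v (x₀ + 1 / m) with hb'
  have hm1 : 0 < 1 / m := by positivity
  have hua : u ≤ a := le_max_left _ _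
  have hax : a ≤ x₀ := max_le hx₀.1 (by linarith)
  have hxb : x₀ ≤ b := le_min hx₀.2 (by linarith)
  have hbv : b ≤ v := min_le_left _ _
  have hsub1 : Set.Icc u a ⊆ Set.Icc u v := Set.Icc_subset_Icc le_rfl (by linarith)
  have hsub2 : Set.Icc b v ⊆ Set.Icc u v := Set.Icc_subset_Icc (by linarith) le_rfl
  have cE : ContinuousOn (fun x => Complex.exp (Complex.I * ψ x)) (Set.Icc u v) :=
    (continuousOn_const.mul (Complex.continuous_ofReal.comp_continuousOn cψ)).cexp
  have ii : ∀ x y, u ≤ x → x ≤ y → y ≤ v →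
      IntervalIntegrable (fun x => Complex.exp (Complex.I * ψ x)) volume x y :=
    fun x y hx hxy hy => by
      apply ContinuousOn.intervalIntegrable
      rw [Set.uIcc_of_le hxy]
      exact cE.mono (Set.Icc_subset_Icc hx hy)
  have hlm : l * (1 / m) = m := by rw [← hml]; field_simp
  have I1 : ‖∫ x in u..a, Complex.exp (Complex.I * ψ x)‖ ≤ 4 / m := by
    rcases le_total (x₀ - 1 / m) u with h | h
    · have : a = u := max_eq_left h
      rw [this, intervalIntegral.integral_same, norm_zero]; positivity
    · have haeq : a = x₀ - 1 / m := max_eq_right h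
      have hx0 : ψ₁ x₀ ≤ 0 := by
        rcases hlft with h' | h'
        · rw [h'] at h; linarith
        · exact h'
      refine van_der_corput_first hua hm0 (fun x hx => h1 x (hsub1 hx))
        (fun x hx => h2 x (hsub1 hx)) (hc.mono hsub1)
        (Or.inl fun x hx => hl.le.trans (hb x (hsub1 hx))) fun x hx => ?_
      have hxa := hx.2
      have h3 := grow x (hsub1 hx) x₀ hx₀ (hx.2.trans hax)
      have h4 : l * (1 / m) ≤ l * (x₀ - x) := mul_le_mul_of_nonneg_left (by linarith) hl.le
      rw [abs_of_nonpos (by linarith)]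
      linarith
  have I3 : ‖∫ x in b..v, Complex.exp (Complex.I * ψ x)‖ ≤ 4 / m := by
    rcases le_total v (x₀ + 1 / m) with h | h
    · have : b = v := min_eq_left h
      rw [this, intervalIntegral.integral_same, norm_zero]; positivity
    · have hbeq : b = x₀ + 1 / m := min_eq_right h
      have hx0 : 0 ≤ ψ₁ x₀ := by
        rcases hr with h' | h'
        · rw [h'] at h; linarith
        · exact h'
      refine van_der_corput_first hbv hm0 (fun x hx => h1 x (hsub2 hx))
        (fun x hx => h2 x (hsub2 hx)) (hc.mono hsub2)
        (Or.inl fun x hx => hl.le.trans (hb x (hsub2 hx))) fun x hx => ?_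
      have hxa := hx.1
      have h3 := grow x₀ hx₀ x (hsub2 hx) (hxb.trans hx.1)
      have h4 : l * (1 / m) ≤ l * (x - x₀) := mul_le_mul_of_nonneg_left (by linarith) hl.le
      rw [abs_of_nonneg (by linarith)]
      linarith
  have I2 : ‖∫ x in a..b, Complex.exp (Complex.I * ψ x)‖ ≤ 2 / m := by
    refine (norm_integral_exp_le ψ (hax.trans hxb)).trans ?_
    have h3 : x₀ - 1 / m ≤ a := le_max_right _ _
    have h4 : b ≤ x₀ + 1 / m := min_le_right _ _
    have : 2 / m = 1 / m + 1 / m := by ring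
    linarith
  rw [← intervalIntegral.integral_add_adjacent_intervals
    (ii u a le_rfl hua (by linarith)) (ii a v hua (by linarith) le_rfl),
    ← intervalIntegral.integral_add_adjacent_intervals
    (ii a b hua (by linarith) hbv) (ii b v (by linarith) hbv le_rfl)]
  calc _ ≤ 4 / m + (2 / m + 4 / m) :=
        (norm_add_le _ _).trans (add_le_add I1 ((norm_add_le _ _).trans (add_le_add I2 I3)))
    _ = _ := by ring

/-- The bound has to be uniform in a. For a ≤ 0 the second derivative is at least b everywhere. For
a > 0 it can vanish, but then both terms of the first derivative are positive, so it is at least √b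
beyond 1/√b and the first derivative test applies there; the initial piece has length at most 1/√b.
-/
lemma norm_integral_exp_airy_phase_le {a b u v : ℝ} (hb : 0 < b) (hu : 0 < u) (huv : u ≤ v) :
    ‖∫ w in u..v, Complex.exp (Complex.I * (b * w ^ 2 + a * w ^ (2 / 3 : ℝ) : ℝ))‖ ≤ 10 / √b := by
  set ψ : ℝ → ℝ := fun w => b * w ^ 2 + a * w ^ (2 / 3 : ℝ) with hψ
  set ψ₁ : ℝ → ℝ := fun w => b * (2 * w) + a * (2 / 3 * w ^ (-1 / 3 : ℝ)) with hψ₁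
  set ψ₂ : ℝ → ℝ := fun w => b * 2 - a * (2 / 9 * w ^ (-4 / 3 : ℝ)) with hψ₂
  have h1 : ∀ x, 0 < x → HasDerivAt ψ (ψ₁ x) x := fun x hx => by
    have d := (Real.hasDerivAt_rpow_const (x := x) (p := 2 / 3) (Or.inl hx.ne')).const_mul a
    have d2 := (hasDerivAt_pow 2 x).const_mul b
    refine (d2.add d).congr_deriv ?_
    simp only [hψ₁]; norm_num
  have h2 : ∀ x, 0 < x → HasDerivAt ψ₁ (ψ₂ x) x := fun x hx => by
    have d := ((Real.hasDerivAt_rpow_const (x := x) (p := -1 / 3) (Or.inl hx.ne')).const_mul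
      (2 / 3)).const_mul a
    have d2 := ((hasDerivAt_id x).const_mul 2).const_mul b
    refine (d2.add d).congr_deriv ?_
    simp only [hψ₂]
    rw [show (-1 / 3 - 1 : ℝ) = -4 / 3 by norm_num]; ring
  have c2 : ContinuousOn ψ₂ (Set.Ioi 0) := fun x hx => by
    have : ContinuousAt (fun w : ℝ => w ^ (-4 / 3 : ℝ)) x :=
      Real.continuousAt_rpow_const _ _ (Or.inl (ne_of_gt hx))
    exact (continuousAt_const.sub (continuousAt_const.mul
      (continuousAt_const.mul this))).continuousWithinAt
  have hpos : ∀ {c d x : ℝ}, 0 < c → x ∈ Set.Icc c d → 0 < x := fun hc hx => hc.trans_le hx.1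
  have hsb : 0 < √b := Real.sqrt_pos.2 hb
  have hsb2 : √b * √b = b := Real.mul_self_sqrt hb.le
  change ‖∫ w in u..v, Complex.exp (Complex.I * (ψ w : ℝ))‖ ≤ 10 / √b
  rcases le_or_gt a 0 with ha | ha
  · have := van_der_corput_second (l := b) huv hb (fun x hx => h1 x (hpos hu hx))
      (fun x hx => h2 x (hpos hu hx)) (c2.mono fun x hx => hpos hu hx) fun x hx => ?_
    · exact this
    · simp only [hψ₂]
      have : 0 ≤ x ^ (-4 / 3 : ℝ) := Real.rpow_nonneg (hpos hu hx).le _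
      nlinarith [mul_nonneg (neg_nonneg.2 ha) this]
  have cE : ContinuousOn (fun x => Complex.exp (Complex.I * ψ x)) (Set.Ioi 0) := fun x hx => by
    have : ContinuousAt (fun x => (ψ x : ℂ)) x :=
      Complex.continuous_ofReal.continuousAt.comp (h1 x hx).continuousAt
    exact (continuousAt_const.mul this).cexp.continuousWithinAt
  have ii : ∀ x y, 0 < x → x ≤ y →
      IntervalIntegrable (fun x => Complex.exp (Complex.I * ψ x)) volume x y :=
    fun x y hx hxy => by
      apply ContinuousOn.intervalIntegrable
      rw [Set.uIcc_of_le hxy]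
      exact cE.mono fun z hz => hpos hx hz
  set w₁ := 1 / √b with hw₁
  have hw₁0 : 0 < w₁ := by positivity
  have hbig : ∀ x, w₁ ≤ x → √b ≤ |ψ₁ x| := fun x hx => by
    have hx0 : 0 < x := hw₁0.trans_le hx
    have h3 : 0 ≤ a * (2 / 3 * x ^ (-1 / 3 : ℝ)) := by positivity
    have h4 : b * w₁ = √b := by rw [hw₁]; field_simp; rw [sq, hsb2]
    have h5 : b * w₁ ≤ b * x := mul_le_mul_of_nonneg_left hx hb.le
    refine le_trans ?_ (le_abs_self _)
    simp only [hψ₁]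
    nlinarith
  -- The only zero of ψ₂. The first derivative test needs ψ₂ of one sign, so the tail is cut here,
  -- at the cost of 4/√b + 4/√b.
  set ws : ℝ := (a / (9 * b)) ^ (3 / 4 : ℝ) with hws
  have hws0 : 0 < ws := by positivity
  have hwss : a * (2 / 9 * ws ^ (-4 / 3 : ℝ)) = b * 2 := by
    rw [hws, ← Real.rpow_mul (by positivity), show (3 / 4 * (-4 / 3) : ℝ) = -1 by norm_num,
      Real.rpow_neg_one]
    field_simp
  have hneg : ∀ x, 0 < x → x ≤ ws → ψ₂ x ≤ 0 := fun x hx hxs => by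
    have : ws ^ (-4 / 3 : ℝ) ≤ x ^ (-4 / 3 : ℝ) :=
      Real.rpow_le_rpow_of_nonpos hx hxs (by norm_num)
    simp only [hψ₂]
    nlinarith [mul_le_mul_of_nonneg_left this ha.le]
  have hposi : ∀ x, ws ≤ x → 0 ≤ ψ₂ x := fun x hxs => by
    have : x ^ (-4 / 3 : ℝ) ≤ ws ^ (-4 / 3 : ℝ) :=
      Real.rpow_le_rpow_of_nonpos hws0 hxs (by norm_num)
    simp only [hψ₂]
    nlinarith [mul_le_mul_of_nonneg_left this ha.le]
  have tail : ∀ c d, w₁ ≤ c → c ≤ d → (d ≤ ws ∨ ws ≤ c) →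
      ‖∫ w in c..d, Complex.exp (Complex.I * (ψ w : ℝ))‖ ≤ 4 / √b := by
    intro c d hc hcd hor
    have hc0 : 0 < c := hw₁0.trans_le hc
    refine van_der_corput_first hcd hsb (fun x hx => h1 x (hpos hc0 hx))
      (fun x hx => h2 x (hpos hc0 hx)) (c2.mono fun x hx => hpos hc0 hx) ?_
      (fun x hx => hbig x (hc.trans hx.1))
    rcases hor with h | h
    · exact Or.inr fun x hx => hneg x (hpos hc0 hx) (hx.2.trans h)
    · exact Or.inl fun x hx => hposi x (h.trans hx.1)
  have tail2 : ∀ c, w₁ ≤ c → c ≤ v →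
      ‖∫ w in c..v, Complex.exp (Complex.I * (ψ w : ℝ))‖ ≤ 8 / √b := by
    intro c hc hcv
    have h48 : 4 / √b ≤ 8 / √b := by gcongr; norm_num
    rcases le_total v ws with h | h
    · exact (tail c v hc hcv (Or.inl h)).trans h48
    rcases le_total ws c with h' | h'
    · exact (tail c v hc hcv (Or.inr h')).trans h48
    rw [← intervalIntegral.integral_add_adjacent_intervals
      (ii c ws (hw₁0.trans_le hc) h') (ii ws v hws0 h)]
    calc _ ≤ 4 / √b + 4 / √b := (norm_add_le _ _).trans (add_le_add
          (tail c ws hc h' (Or.inl le_rfl)) (tail ws v (hc.trans h') h (Or.inr le_rfl)))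
      _ = _ := by ring
  rcases le_total w₁ u with h | h
  · refine (tail2 u h huv).trans ?_
    gcongr; norm_num
  rcases le_total v w₁ with h' | h'
  · refine (norm_integral_exp_le ψ huv).trans ?_
    have : w₁ ≤ 10 / √b := by rw [hw₁]; gcongr; norm_num
    linarith
  rw [← intervalIntegral.integral_add_adjacent_intervals (ii u w₁ hu h) (ii w₁ v hw₁0 h')]
  calc _ ≤ w₁ + 8 / √b := (norm_add_le _ _).trans (add_le_add
          ((norm_integral_exp_le ψ h).trans (by linarith)) (tail2 w₁ le_rfl h'))
    _ = 9 / √b := by rw [hw₁]; ring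
    _ ≤ _ := by gcongr; norm_num

/-- The substitution w = s^(3/2) absorbs √s and turns the cubic phase into b w² + a w^(2/3).
Negative b reduces to positive b by conjugation. The constant is (2/3)·10 ≤ 7. -/
lemma norm_integral_sqrt_mul_exp_le {a b u v : ℝ} (hb : b ≠ 0) (hu : 0 < u) (huv : u ≤ v) :
    ‖∫ s in u..v, ((√s : ℝ) : ℂ) * Complex.exp (Complex.I * (a * s + b * s ^ 3 : ℝ))‖ ≤
      7 / √|b| := by
  have pos : ∀ {a b : ℝ}, 0 < b →
      ‖∫ s in u..v, ((√s : ℝ) : ℂ) * Complex.exp (Complex.I * (a * s + b * s ^ 3 : ℝ))‖ ≤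
        7 / √b := by
    intro a b hb
    set g : ℝ → ℂ := fun w => Complex.exp (Complex.I * (b * w ^ 2 + a * w ^ (2 / 3 : ℝ) : ℝ))
    have hd : ∀ s ∈ Set.uIcc u v,
        HasDerivAt (fun s : ℝ => s ^ (3 / 2 : ℝ)) (3 / 2 * s ^ (1 / 2 : ℝ)) s := fun s hs => by
      have d := Real.hasDerivAt_rpow_const (x := s) (p := 3 / 2) (Or.inr (by norm_num))
      refine d.congr_deriv ?_
      norm_num
    have key := intervalIntegral.integral_deriv_smul_comp (g := g) hd ?_ ?_
    · have e : ∀ s ∈ Set.uIcc u v, ((√s : ℝ) : ℂ) *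
          Complex.exp (Complex.I * (a * s + b * s ^ 3 : ℝ)) =
          (2 / 3 : ℂ) * ((3 / 2 * s ^ (1 / 2 : ℝ)) • (g ∘ fun s : ℝ => s ^ (3 / 2 : ℝ)) s) := by
        intro s hs
        rw [Set.uIcc_of_le huv] at hs
        have hs0 : 0 < s := hu.trans_le hs.1
        have e1 : (s ^ (3 / 2 : ℝ)) ^ 2 = s ^ 3 := by
          rw [← Real.rpow_natCast, ← Real.rpow_mul hs0.le, ← Real.rpow_natCast]
          norm_num
        have e2 : (s ^ (3 / 2 : ℝ)) ^ (2 / 3 : ℝ) = s := by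
          rw [← Real.rpow_mul hs0.le]; norm_num
        simp only [g, Function.comp_apply, e1, e2, Complex.real_smul, ← Real.sqrt_eq_rpow]
        rw [add_comm (a * s)]
        push_cast
        ring
      rw [intervalIntegral.integral_congr e, intervalIntegral.integral_const_mul, key, norm_mul]
      have hu' : 0 < u ^ (3 / 2 : ℝ) := by positivity
      have huv' : u ^ (3 / 2 : ℝ) ≤ v ^ (3 / 2 : ℝ) := Real.rpow_le_rpow hu.le huv (by norm_num)
      calc _ ≤ 2 / 3 * (10 / √b) := by
            have := norm_integral_exp_airy_phase_le (a := a) hb hu' huv'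
            have h23 : ‖(2 / 3 : ℂ)‖ = 2 / 3 := by norm_num
            rw [h23]
            gcongr
        _ = (20 / 3) / √b := by ring
        _ ≤ _ := by gcongr; norm_num
    · have : Continuous fun s : ℝ => 3 / 2 * s ^ (1 / 2 : ℝ) :=
        continuous_const.mul (Real.continuous_rpow_const (by norm_num))
      exact this.continuousOn
    · have h23 : Continuous fun w : ℝ => w ^ (2 / 3 : ℝ) := Real.continuous_rpow_const (by norm_num)
      have : Continuous g := by
        simp only [g]
        fun_prop
      exact this
  rcases lt_or_gt_of_ne hb with h | h
  · have := pos (a := -a) (b := -b) (by linarith)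
    rw [abs_of_neg h]
    refine le_trans (le_of_eq ?_) this
    rw [← RCLike.norm_conj, intervalIntegral.integral_of_le huv, intervalIntegral.integral_of_le huv,
      ← integral_conj]
    congr 2
    ext s
    simp only [map_mul, Complex.conj_ofReal, ← Complex.exp_conj, Complex.conj_I]
    congr 2
    push_cast; ring
  · rw [abs_of_pos h]; exact pos h

/-- Summation by parts: a decreasing weight does not spoil a bound for all partial integrals. -/
lemma norm_integral_mul_le_of_antitone {g : ℝ → ℂ} {h h' : ℝ → ℝ} {u v A : ℝ} (huv : u ≤ v)
    (hg : Continuous g) (hA : ∀ x ∈ Set.Icc u v, ‖∫ s in u..x, g s‖ ≤ A)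
    (hh : ∀ x ∈ Set.Icc u v, HasDerivAt h (h' x) x) (hc : ContinuousOn h' (Set.Icc u v))
    (hneg : ∀ x ∈ Set.Icc u v, h' x ≤ 0) (hpos : ∀ x ∈ Set.Icc u v, 0 ≤ h x) :
    ‖∫ s in u..v, (h s : ℂ) * g s‖ ≤ A * h u := by
  have hI : Set.uIcc u v = Set.Icc u v := Set.uIcc_of_le huv
  have mv : v ∈ Set.Icc u v := Set.right_mem_Icc.2 huv
  have mu : u ∈ Set.Icc u v := Set.left_mem_Icc.2 huv
  have hA0 : 0 ≤ A := (norm_nonneg _).trans (hA u mu)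
  set G : ℝ → ℂ := fun x => ∫ s in u..x, g s with hG
  have hGd : ∀ x, HasDerivAt G (g x) x := fun x =>
    intervalIntegral.integral_hasDerivAt_right (hg.intervalIntegrable _ _)
      hg.stronglyMeasurable.stronglyMeasurableAtFilter hg.continuousAt
  have hcC : ContinuousOn (fun x => (h' x : ℂ)) (Set.Icc u v) :=
    Complex.continuous_ofReal.comp_continuousOn hc
  have hGc : Continuous G := continuous_iff_continuousAt.2 fun x => (hGd x).continuousAt
  have key := intervalIntegral.integral_mul_deriv_eq_deriv_mul (a := u) (b := v)
    (u := fun x => (h x : ℂ)) (u' := fun x => (h' x : ℂ)) (v := G) (v' := g)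
    (fun x hx => (hh x (by rwa [hI] at hx)).ofReal_comp) (fun x _ => hGd x)
    (by apply ContinuousOn.intervalIntegrable; rwa [hI]) (hg.intervalIntegrable _ _)
  have hGu : G u = 0 := by simp [hG]
  rw [key, hGu, mul_zero, sub_zero]
  have hii : IntervalIntegrable h' volume u v := by
    apply ContinuousOn.intervalIntegrable; rwa [hI]
  have hd : ∫ x in u..v, h' x = h v - h u :=
    intervalIntegral.integral_eq_sub_of_hasDerivAt (fun x hx => hh x (by rwa [hI] at hx)) hii
  have b2 : ‖∫ x in u..v, (h' x : ℂ) * G x‖ ≤ A * (h u - h v) := by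
    have e : A * (h u - h v) = ∫ x in u..v, A * (-h' x) := by
      rw [intervalIntegral.integral_const_mul, intervalIntegral.integral_neg, hd]; ring
    rw [e]
    refine intervalIntegral.norm_integral_le_of_norm_le huv ?_ (hii.neg.const_mul A)
    refine Eventually.of_forall fun x hx => ?_
    have hx' : x ∈ Set.Icc u v := ⟨hx.1.le, hx.2⟩
    rw [norm_mul, Complex.norm_real, Real.norm_eq_abs, abs_of_nonpos (hneg x hx'), mul_comm]
    exact mul_le_mul_of_nonneg_right (hA x hx') (neg_nonneg.2 (hneg x hx'))
  have b1 : ‖(h v : ℂ) * G v‖ ≤ A * h v := by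
    rw [norm_mul, Complex.norm_real, Real.norm_eq_abs, abs_of_nonneg (hpos v mv), mul_comm]
    exact mul_le_mul_of_nonneg_right (hA v mv) (hpos v mv)
  calc _ ≤ A * h v + A * (h u - h v) := (norm_sub_le _ _).trans (add_le_add b1 b2)
    _ = _ := by ring

/-! ### Coordinates on the plane -/

/-- The point of the plane with the given coordinates. -/
def pt (w : ℝ × ℝ) : Plane := !₂[w.1, w.2]

@[simp] lemma pt_zero (w : ℝ × ℝ) : pt w 0 = w.1 := rfl

@[simp] lemma pt_one (w : ℝ × ℝ) : pt w 1 = w.2 := rfl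

lemma continuous_pt : Continuous pt := by
  unfold pt
  refine (PiLp.continuous_toLp 2 _).comp ?_
  refine continuous_pi fun i => ?_
  fin_cases i
  · exact continuous_fst
  · exact continuous_snd

/-- The plane as a product of two lines. -/
def planeEquiv : ℝ × ℝ ≃ᵐ Plane :=
  (MeasurableEquiv.finTwoArrow (α := ℝ)).symm.trans (MeasurableEquiv.toLp 2 (Fin 2 → ℝ))

lemma measurePreserving_planeEquiv :
    MeasurePreserving planeEquiv (volume : Measure (ℝ × ℝ)) (volume : Measure Plane) :=
  ((volume_preserving_finTwoArrow ℝ).symm _).trans (PiLp.volume_preserving_toLp (Fin 2))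

lemma measurePreserving_pt :
    MeasurePreserving pt (volume : Measure (ℝ × ℝ)) (volume : Measure Plane) :=
  measurePreserving_planeEquiv

lemma measurableEmbedding_pt : MeasurableEmbedding pt := planeEquiv.measurableEmbedding

lemma integrable_comp_pt {E : Type*} [NormedAddCommGroup E] {F : Plane → E} :
    Integrable (fun w => F (pt w)) ↔ Integrable F :=
  measurePreserving_pt.integrable_comp_emb measurableEmbedding_pt

lemma integral_plane {E : Type*} [NormedAddCommGroup E] [NormedSpace ℝ E] {F : Plane → E}
    (hF : Integrable F) : ∫ ζ, F ζ = ∫ x, ∫ y, F (pt (x, y)) := by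
  rw [← measurePreserving_pt.integral_comp measurableEmbedding_pt]
  exact integral_prod _ (integrable_comp_pt.2 hF)

lemma lintegral_plane {F : Plane → ℝ≥0∞} (hF : Measurable F) :
    ∫⁻ ζ, F ζ = ∫⁻ x, ∫⁻ y, F (pt (x, y)) := by
  rw [← measurePreserving_pt.lintegral_comp hF]
  exact lintegral_prod _ (hF.comp continuous_pt.measurable).aemeasurable

lemma inner_plane (a b : Plane) : inner ℝ a b = a 0 * b 0 + a 1 * b 1 := by
  simp [PiLp.inner_apply, Fin.sum_univ_two, mul_comm]

/-! ### Gaussian integrals and the dispersive estimate -/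

section Gaussian

lemma fourierInv_gaussian {b : ℂ} (hb : 0 < b.re) :
    𝓕⁻ (fun x : ℝ => Complex.exp (-Real.pi * b * x ^ 2)) =
      fun t : ℝ => 1 / b ^ (1 / 2 : ℂ) * Complex.exp (-Real.pi / b * t ^ 2) := by
  ext t
  rw [Real.fourierInv_eq_fourier_neg, fourier_gaussian_pi hb]
  simp

lemma integrable_gaussian {b : ℂ} (hb : 0 < b.re) :
    Integrable fun x : ℝ => Complex.exp (-Real.pi * b * x ^ 2) := by
  have := integrable_cexp_quadratic (b := Real.pi * b) (by
    rw [Complex.re_ofReal_mul]; positivity) 0 0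
  simpa using this

lemma re_inv_pos {b : ℂ} (hb : 0 < b.re) : 0 < (b⁻¹).re := by
  have : b ≠ 0 := fun h => by simp [h] at hb
  rw [Complex.inv_re]
  exact div_pos hb (Complex.normSq_pos.2 this)

lemma norm_exp_neg_pi_mul (b : ℂ) (x : ℝ) :
    ‖Complex.exp (-Real.pi * b * x ^ 2)‖ = Real.exp (-(Real.pi * b.re * x ^ 2)) := by
  rw [Complex.norm_exp]
  congr 1
  have : -Real.pi * b * x ^ 2 = ((-(Real.pi * x ^ 2) : ℝ) : ℂ) * b := by push_cast; ring
  rw [this, Complex.re_ofReal_mul]; ring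

lemma norm_gaussian_le {b : ℂ} (hb : 0 ≤ b.re) (x : ℝ) :
    ‖Complex.exp (-Real.pi * b * x ^ 2)‖ ≤ 1 := by
  rw [norm_exp_neg_pi_mul, Real.exp_le_one_iff]
  have := Real.pi_pos
  have : 0 ≤ Real.pi * b.re * x ^ 2 := by positivity
  linarith

lemma norm_one_div_cpow_half (b : ℂ) :
    ‖1 / b ^ (1 / 2 : ℂ)‖ = ‖b‖ ^ (-(1 / 2) : ℝ) := by
  rw [norm_div, norm_one, Real.rpow_neg (norm_nonneg _), one_div]
  congr 1
  have := Complex.norm_cpow_real b (1 / 2)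
  push_cast at this
  exact this

lemma norm_fourierInv_gaussian_le {b : ℂ} (hb : 0 < b.re) (t : ℝ) :
    ‖𝓕⁻ (fun x : ℝ => Complex.exp (-Real.pi * b * x ^ 2)) t‖ ≤ ‖b‖ ^ (-(1 / 2) : ℝ) := by
  rw [fourierInv_gaussian hb, norm_mul, norm_one_div_cpow_half]
  have := norm_gaussian_le (re_inv_pos hb).le t
  rw [← div_eq_mul_inv] at this
  exact mul_le_of_le_one_right (by positivity) this

end Gaussian

/-- For fixed first frequency `x`, the regularized symbol is the Gaussian `exp (-π σ y²)`. -/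
def gaussParam (ε δ t x : ℝ) : ℂ := 2 * (δ / |x| + Complex.I * (ε * t / x))

/-- The part of the regularized symbol that depends on the first frequency only. -/
def xSymbol (γ u v t x : ℝ) : ℂ :=
  if u ≤ |x| ∧ |x| < v then
    ((|x| ^ (-γ) : ℝ) : ℂ) * Complex.exp (Complex.I * (8 * Real.pi ^ 3 * t * x ^ 3 : ℝ)) else 0

/-- The symbol of `D_x^{-γ} U(t)`, cut off to `u ≤ |ζ₀| < v` and regularized in `ζ₁`. -/
def regSymbol (ε γ δ u v t : ℝ) (ζ : Plane) : ℂ :=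
  xSymbol γ u v t (ζ 0) * Complex.exp (-Real.pi * gaussParam ε δ t (ζ 0) * (ζ 1 : ℝ) ^ 2)

/-- The modulus of `regSymbol`. -/
def regWeight (γ δ u v : ℝ) (ζ : Plane) : ℝ :=
  if u ≤ |ζ 0| ∧ |ζ 0| < v then
    |ζ 0| ^ (-γ) * Real.exp (-(2 * Real.pi * δ * (ζ 1) ^ 2 / |ζ 0|)) else 0

lemma gaussParam_re (ε δ t x : ℝ) : (gaussParam ε δ t x).re = 2 * δ / |x| := by
  unfold gaussParam
  have : (2 * (δ / |x| + Complex.I * (ε * t / x)) : ℂ) =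
      ((2 * δ / |x| : ℝ) : ℂ) + ((2 * (ε * t / x) : ℝ) : ℂ) * Complex.I := by
    push_cast; ring
  rw [this, Complex.add_re, Complex.ofReal_re, Complex.re_ofReal_mul]
  simp

lemma gaussParam_im (ε δ t x : ℝ) : (gaussParam ε δ t x).im = 2 * (ε * t / x) := by
  unfold gaussParam
  have : (2 * (δ / |x| + Complex.I * (ε * t / x)) : ℂ) =
      ((2 * δ / |x| : ℝ) : ℂ) + ((2 * (ε * t / x) : ℝ) : ℂ) * Complex.I := by
    push_cast; ring
  rw [this, Complex.add_im, Complex.ofReal_im, Complex.im_ofReal_mul]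
  simp

/-- In the variable ζ = (ξ,μ)/(2π) the term tξ³ becomes 8π³tζ₀³ and εtμ²/ξ becomes 2πεtζ₁²/ζ₀; the
latter is the imaginary part of the Gaussian parameter, so the regularization only changes the
modulus. -/
lemma regSymbol_eq {ε γ δ u v t : ℝ} (hu : 0 < u) (ζ : Plane) :
    regSymbol ε γ δ u v t ζ = regWeight γ δ u v ζ * flowSymbol ε t ζ := by
  unfold regSymbol regWeight xSymbol flowSymbol
  split_ifs with h
  · have hx : ζ 0 ≠ 0 := fun h0 => by
      rw [h0, abs_zero] at h; linarith [h.1]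
    push_cast
    rw [mul_assoc (((|ζ 0| ^ (-γ) : ℝ)) : ℂ), mul_assoc (((|ζ 0| ^ (-γ) : ℝ)) : ℂ),
      ← Complex.exp_add, ← Complex.exp_add]
    congr 2
    unfold gaussParam omega
    have hx' : (ζ 0 : ℂ) ≠ 0 := by exact_mod_cast hx
    have hx'' : ((|ζ 0| : ℝ) : ℂ) ≠ 0 := Complex.ofReal_ne_zero.2 (abs_pos.2 hx).ne'
    have hpi : (Real.pi : ℂ) ≠ 0 := by exact_mod_cast Real.pi_ne_zero
    push_cast
    field_simp
    ring
  · simp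

lemma regWeight_nonneg (γ δ u v : ℝ) (ζ : Plane) : 0 ≤ regWeight γ δ u v ζ := by
  unfold regWeight; split_ifs <;> positivity

lemma norm_regSymbol {ε γ δ u v t : ℝ} (hu : 0 < u) (ζ : Plane) :
    ‖regSymbol ε γ δ u v t ζ‖ = regWeight γ δ u v ζ := by
  rw [regSymbol_eq hu, norm_mul, norm_flowSymbol, mul_one, Complex.norm_real,
    Real.norm_of_nonneg (regWeight_nonneg _ _ _ _ _)]

lemma measurable_regWeight (γ δ u v : ℝ) : Measurable (regWeight γ δ u v) := by
  unfold regWeight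
  have h0 : Measurable fun ζ : Plane => |ζ 0| := by fun_prop
  exact Measurable.ite ((measurableSet_le measurable_const h0).inter
    (measurableSet_lt h0 measurable_const)) (by fun_prop) measurable_const

lemma measurable_regSymbol {ε γ δ u v t : ℝ} (hu : 0 < u) :
    Measurable (regSymbol ε γ δ u v t) := by
  have : regSymbol ε γ δ u v t = fun ζ => (regWeight γ δ u v ζ : ℂ) * flowSymbol ε t ζ :=
    funext fun ζ => regSymbol_eq hu ζ
  rw [this]
  exact (measurable_regWeight γ δ u v).complex_ofReal.mul (measurable_flowSymbol ε t)

lemma rpow_neg_le_of_le {γ u x : ℝ} (hγ : 0 ≤ γ) (hu : 0 < u) (h : u ≤ x) :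
    x ^ (-γ) ≤ u ^ (-γ) := Real.rpow_le_rpow_of_nonpos hu h (by linarith)

lemma regWeight_le {γ δ u v : ℝ} (hγ : 0 ≤ γ) (hδ : 0 ≤ δ) (hu : 0 < u) (ζ : Plane) :
    regWeight γ δ u v ζ ≤ u ^ (-γ) := by
  unfold regWeight
  split_ifs with h
  · have h1 := rpow_neg_le_of_le hγ hu h.1
    have h2 : Real.exp (-(2 * Real.pi * δ * (ζ 1) ^ 2 / |ζ 0|)) ≤ 1 := by
      rw [Real.exp_le_one_iff]
      have := Real.pi_pos
      have : 0 ≤ 2 * Real.pi * δ * (ζ 1) ^ 2 / |ζ 0| := by positivity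
      linarith
    calc _ ≤ u ^ (-γ) * 1 := by gcongr
      _ = _ := mul_one _
  · positivity

lemma integrable_regSymbol {ε γ δ u v t : ℝ} (hγ : 0 ≤ γ) (hδ : 0 < δ) (hu : 0 < u) (hv : 0 < v) :
    Integrable (regSymbol ε γ δ u v t) := by
  rw [← integrable_comp_pt]
  have h1 : Integrable fun x : ℝ => (Set.Icc (-v) v).indicator (fun _ => u ^ (-γ)) x := by
    rw [integrable_indicator_iff measurableSet_Icc]
    exact integrableOn_const (by simp)
  -- On the annulus |ζ₀| < v, so the Gaussian in ζ₁ decays at least at the rate δ/v.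
  have h2 : Integrable fun y : ℝ => Real.exp (-(2 * Real.pi * δ / v) * y ^ 2) :=
    integrable_exp_neg_mul_sq (by have := Real.pi_pos; positivity)
  refine (h1.mul_prod h2).mono'
    ((measurable_regSymbol hu).comp continuous_pt.measurable).aestronglyMeasurable
    (Eventually.of_forall fun w => ?_)
  rw [norm_regSymbol hu]
  change _ ≤ (Set.Icc (-v) v).indicator (fun _ => u ^ (-γ)) w.1 *
    Real.exp (-(2 * Real.pi * δ / v) * w.2 ^ 2)
  by_cases h : u ≤ |w.1| ∧ |w.1| < v
  · have e : regWeight γ δ u v (pt w) = |w.1| ^ (-γ) *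
        Real.exp (-(2 * Real.pi * δ * w.2 ^ 2 / |w.1|)) := if_pos h
    rw [e]
    have hm : w.1 ∈ Set.Icc (-v) v := ⟨by linarith [neg_abs_le w.1], by linarith [le_abs_self w.1]⟩
    rw [Set.indicator_of_mem hm]
    have hw : 0 < |w.1| := hu.trans_le h.1
    have := Real.pi_pos
    refine mul_le_mul (rpow_neg_le_of_le hγ hu h.1) (Real.exp_le_exp.2 ?_) (Real.exp_pos _).le
      (by positivity)
    rw [neg_mul, neg_le_neg_iff, div_mul_eq_mul_div]
    gcongr
    exact h.2.le
  · have e : regWeight γ δ u v (pt w) = 0 := if_neg h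
    rw [e]
    have : 0 ≤ (Set.Icc (-v) v).indicator (fun _ => u ^ (-γ)) w.1 :=
      Set.indicator_nonneg (fun _ _ => by positivity) _
    positivity

/-- The kernel of the regularized propagator, as a density in the first frequency `x`. -/
def kernelDensity (ε γ δ t : ℝ) (z : ℝ × ℝ) (x : ℝ) : ℂ :=
  ((|x| ^ (-γ) : ℝ) : ℂ) * Complex.exp (Complex.I * (8 * Real.pi ^ 3 * t * x ^ 3 : ℝ)) *
    Complex.exp (Complex.I * (2 * Real.pi * x * z.1 : ℝ)) *
    𝓕⁻ (fun y : ℝ => Complex.exp (-Real.pi * gaussParam ε δ t x * y ^ 2)) z.2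

lemma fourierInv_regSymbol {ε γ δ u v t : ℝ} (hγ : 0 ≤ γ) (hδ : 0 < δ) (hu : 0 < u) (hv : 0 < v)
    (z : Plane) :
    𝓕⁻ (regSymbol ε γ δ u v t) z =
      ∫ x, if u ≤ |x| ∧ |x| < v then kernelDensity ε γ δ t (z 0, z 1) x else 0 := by
  rw [Real.fourierInv_eq', integral_plane]
  · congr 1; ext x
    have e : ∀ y : ℝ, Complex.exp ((2 * Real.pi * inner ℝ (pt (x, y)) z : ℝ) * Complex.I) •
        regSymbol ε γ δ u v t (pt (x, y)) =
        (xSymbol γ u v t x * Complex.exp (Complex.I * (2 * Real.pi * x * z 0 : ℝ))) *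
        (Complex.exp ((2 * Real.pi * inner ℝ y (z 1) : ℝ) * Complex.I) •
          Complex.exp (-Real.pi * gaussParam ε δ t x * (y : ℝ) ^ 2)) := fun y => by
      rw [inner_plane, regSymbol]
      simp only [pt_zero, pt_one, smul_eq_mul]
      have : Complex.exp ((2 * Real.pi * (x * z 0 + y * z 1) : ℝ) * Complex.I) =
          Complex.exp (Complex.I * (2 * Real.pi * x * z 0 : ℝ)) *
          Complex.exp ((2 * Real.pi * inner ℝ y (z 1) : ℝ) * Complex.I) := by
        rw [← Complex.exp_add]
        congr 1
        simp only [RCLike.inner_apply, conj_trivial]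
        push_cast; ring
      rw [this]; ring
    simp only [e]
    rw [integral_const_mul, ← Real.fourierInv_eq']
    unfold xSymbol kernelDensity
    split_ifs
    · rfl
    · simp
  · have : Continuous fun ζ : Plane =>
        Complex.exp ((2 * Real.pi * inner ℝ ζ z : ℝ) * Complex.I) := by fun_prop
    refine (integrable_regSymbol hγ hδ hu hv).bdd_mul (c := 1) this.aestronglyMeasurable
      (Eventually.of_forall fun ζ => ?_)
    rw [Complex.norm_exp_ofReal_mul_I]

/-- Negative first frequencies are positive ones for the reversed time and the reflected point, so
only the half-line x > 0 has to be estimated. -/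
lemma kernelDensity_neg (ε γ δ t : ℝ) (z : ℝ × ℝ) (x : ℝ) :
    kernelDensity ε γ δ t z (-x) = kernelDensity ε γ δ (-t) (-z.1, z.2) x := by
  have hg : gaussParam ε δ t (-x) = gaussParam ε δ (-t) x := by
    unfold gaussParam
    rw [abs_neg]
    push_cast
    rw [div_neg, mul_neg (ε : ℂ), neg_div]
  have h1 : 8 * Real.pi ^ 3 * t * (-x) ^ 3 = 8 * Real.pi ^ 3 * (-t) * x ^ 3 := by ring
  have h2 : 2 * Real.pi * (-x) * z.1 = 2 * Real.pi * x * (-z.1) := by ring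
  unfold kernelDensity
  rw [abs_neg, hg, h1, h2]

/-- The regularization δ/|x| has the same homogeneity as t/x, so for x > 0 the Gaussian parameter is
c/x with c independent of x. Its transform is then √x/√c times an exponential of a linear function
of x: the imaginary part of the exponent joins the phase, and the real part is the decreasing factor
e^{-kx}. -/
lemma kernelDensity_of_pos {ε γ δ t : ℝ} (hδ : 0 < δ) (z : ℝ × ℝ) :
    ∃ (κ : ℂ) (k m : ℝ), ‖κ‖ ≤ ‖(2 * (δ + Complex.I * (ε * t)) : ℂ)‖ ^ (-(1 / 2) : ℝ) ∧ 0 ≤ k ∧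
      ∀ x, 0 < x → kernelDensity ε γ δ t z x =
        κ * (((x ^ (-γ) * Real.exp (-(k * x)) : ℝ) : ℂ) * (((√x : ℝ) : ℂ) *
          Complex.exp (Complex.I * (m * x + 8 * Real.pi ^ 3 * t * x ^ 3 : ℝ)))) := by
  set c : ℂ := 2 * (δ + Complex.I * (ε * t)) with hc
  have hcre : 0 < c.re := by
    have : c = ((2 * δ : ℝ) : ℂ) + ((2 * (ε * t) : ℝ) : ℂ) * Complex.I := by
      rw [hc]; push_cast; ring
    rw [this, Complex.add_re, Complex.ofReal_re, Complex.re_ofReal_mul]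
    simpa using hδ
  have hc0 : c ≠ 0 := fun h => by simp [h] at hcre
  set w : ℂ := (Real.pi * z.2 ^ 2 : ℝ) * c⁻¹ with hw
  have hwre : 0 ≤ w.re := by
    rw [hw, Complex.re_ofReal_mul]
    have := re_inv_pos hcre
    have := Real.pi_pos
    positivity
  refine ⟨1 / c ^ (1 / 2 : ℂ), w.re, -w.im + 2 * Real.pi * z.1, (norm_one_div_cpow_half c).le,
    hwre, fun x hx => ?_⟩
  have hx' : (x : ℂ) ≠ 0 := by exact_mod_cast hx.ne'
  have hg : gaussParam ε δ t x = c * ((x⁻¹ : ℝ) : ℂ) := by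
    unfold gaussParam
    rw [hc, abs_of_pos hx]; push_cast; field_simp
  have hgre : 0 < (gaussParam ε δ t x).re := by
    rw [gaussParam_re, abs_of_pos hx]; positivity
  have hpow : (1 : ℂ) / (gaussParam ε δ t x) ^ (1 / 2 : ℂ) =
      1 / c ^ (1 / 2 : ℂ) * ((√x : ℝ) : ℂ) := by
    have hxi : 0 < x⁻¹ := inv_pos.2 hx
    rw [hg, Complex.cpow_def_of_ne_zero (mul_ne_zero hc0 (by exact_mod_cast hxi.ne')),
      Complex.log_mul_ofReal _ hxi _ hc0, Complex.cpow_def_of_ne_zero hc0, add_mul,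
      Complex.exp_add, Real.log_inv, Real.sqrt_eq_rpow, Real.rpow_def_of_pos hx]
    push_cast
    rw [neg_mul, Complex.exp_neg]
    have := Complex.exp_ne_zero (Complex.log c * (1 / 2))
    field_simp
  have hexp : Complex.exp (-Real.pi / gaussParam ε δ t x * z.2 ^ 2) =
      ((Real.exp (-(w.re * x)) : ℝ) : ℂ) * Complex.exp (Complex.I * (-w.im * x : ℝ)) := by
    push_cast
    rw [← Complex.exp_add]
    congr 1
    have h1 : -Real.pi / gaussParam ε δ t x * z.2 ^ 2 = -w * x := by
      rw [hg, hw]; push_cast; field_simp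
    rw [h1]
    nth_rewrite 1 [← Complex.re_add_im w]
    ring
  unfold kernelDensity
  rw [fourierInv_gaussian hgre]
  beta_reduce
  rw [hpow, hexp, abs_of_pos hx]
  have h3 : Complex.exp (Complex.I * ((-w.im + 2 * Real.pi * z.1) * x +
      8 * Real.pi ^ 3 * t * x ^ 3 : ℝ)) =
      Complex.exp (Complex.I * (8 * Real.pi ^ 3 * t * x ^ 3 : ℝ)) *
      Complex.exp (Complex.I * (2 * Real.pi * x * z.1 : ℝ)) *
      Complex.exp (Complex.I * (-w.im * x : ℝ)) := by
    rw [← Complex.exp_add, ← Complex.exp_add]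
    congr 1; push_cast; ring
  rw [h3]
  push_cast
  ring

lemma norm_integral_sqrt_mul_exp_le_trivial {m b u v : ℝ} (hu : 0 < u) (huv : u ≤ v) :
    ‖∫ s in u..v, ((√s : ℝ) : ℂ) * Complex.exp (Complex.I * (m * s + b * s ^ 3 : ℝ))‖ ≤
      v ^ (3 / 2 : ℝ) := by
  have hv : 0 < v := hu.trans_le huv
  have := intervalIntegral.norm_integral_le_of_norm_le_const (a := u) (b := v) (C := √v)
    (f := fun s => ((√s : ℝ) : ℂ) * Complex.exp (Complex.I * (m * s + b * s ^ 3 : ℝ)))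
    fun s hs => by
      rw [Set.uIoc_of_le huv] at hs
      rw [norm_mul, mul_comm Complex.I, Complex.norm_exp_ofReal_mul_I, mul_one, Complex.norm_real,
        Real.norm_of_nonneg (Real.sqrt_nonneg _)]
      exact Real.sqrt_le_sqrt hs.2
  refine this.trans ?_
  rw [abs_of_nonneg (by linarith)]
  calc √v * (v - u) ≤ √v * v := by gcongr; linarith
    _ = _ := by
      rw [Real.sqrt_eq_rpow]
      nth_rewrite 2 [← Real.rpow_one v]
      rw [← Real.rpow_add hv]; norm_num

/-- Keeping only the imaginary part of c makes the bound uniform in the regularization δ. -/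
lemma norm_kernelConst_le {ε δ t : ℝ} (hε : |ε| = 1) (ht : t ≠ 0) :
    ‖(2 * (δ + Complex.I * (ε * t)) : ℂ)‖ ^ (-(1 / 2) : ℝ) ≤ |t| ^ (-(1 / 2) : ℝ) := by
  refine Real.rpow_le_rpow_of_nonpos (abs_pos.2 ht) ?_ (by norm_num)
  have h1 : |t| = |((δ : ℂ) + Complex.I * (ε * t)).im| := by
    have : ((δ : ℂ) + Complex.I * (ε * t)) = (δ : ℂ) + ((ε * t : ℝ) : ℂ) * Complex.I := by
      push_cast; ring
    rw [this, Complex.add_im, Complex.im_ofReal_mul]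
    simp [abs_mul, hε]
  rw [norm_mul, h1]
  have h2 := Complex.abs_im_le_norm ((δ : ℂ) + Complex.I * (ε * t))
  have h3 : ‖(2 : ℂ)‖ = 2 := by simp
  rw [h3]
  linarith [norm_nonneg ((δ : ℂ) + Complex.I * (ε * t))]

/-- The weight x^(-γ) e^{-kx} is decreasing, so summation by parts costs only its value at u. The
partial integrals are bounded by oscillation, where 8π³ ≥ 1 is dropped, and also trivially by
v^(3/2); keeping both is what makes the dyadic sum converge. -/
lemma norm_integral_kernelDensity_le {ε γ δ u v t : ℝ} (hε : |ε| = 1) (hγ : 0 ≤ γ) (hδ : 0 < δ)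
    (hu : 0 < u) (huv : u ≤ v) (ht : t ≠ 0) (z : ℝ × ℝ) :
    ‖∫ x in u..v, kernelDensity ε γ δ t z x‖ ≤
      |t| ^ (-(1 / 2) : ℝ) * (u ^ (-γ) * min (7 * |t| ^ (-(1 / 2) : ℝ)) (v ^ (3 / 2 : ℝ))) := by
  obtain ⟨κ, k, m, hκ, hk, hK⟩ := kernelDensity_of_pos (ε := ε) (γ := γ) (t := t) hδ z
  have hpos : ∀ x ∈ Set.Icc u v, 0 < x := fun x hx => hu.trans_le hx.1
  have hb : 8 * Real.pi ^ 3 * t ≠ 0 := by have := Real.pi_pos; positivity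
  set g : ℝ → ℂ := fun x => ((√x : ℝ) : ℂ) *
    Complex.exp (Complex.I * (m * x + 8 * Real.pi ^ 3 * t * x ^ 3 : ℝ)) with hg
  set h : ℝ → ℝ := fun x => x ^ (-γ) * Real.exp (-(k * x)) with hh
  have e : ∫ x in u..v, kernelDensity ε γ δ t z x = κ * ∫ x in u..v, (h x : ℂ) * g x := by
    rw [← intervalIntegral.integral_const_mul]
    refine intervalIntegral.integral_congr fun x hx => ?_
    rw [Set.uIcc_of_le huv] at hx
    exact hK x (hpos x hx)
  have hgc : Continuous g := by
    have : Continuous fun x : ℝ => ((√x : ℝ) : ℂ) :=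
      Complex.continuous_ofReal.comp Real.continuous_sqrt
    simp only [hg]; fun_prop
  have hA : ∀ x ∈ Set.Icc u v, ‖∫ s in u..x, g s‖ ≤
      min (7 * |t| ^ (-(1 / 2) : ℝ)) (v ^ (3 / 2 : ℝ)) := by
    intro x hx
    refine le_min ?_ ?_
    · refine (norm_integral_sqrt_mul_exp_le hb hu hx.1).trans ?_
      rw [Real.rpow_neg (abs_nonneg _), ← Real.sqrt_eq_rpow, ← div_eq_mul_inv]
      have h1 : 1 ≤ 8 * Real.pi ^ 3 := by
        have := Real.pi_gt_three
        have : 1 ≤ Real.pi ^ 3 := one_le_pow₀ (by linarith)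
        linarith
      have h2 : |t| ≤ |8 * Real.pi ^ 3 * t| := by
        rw [abs_mul (8 * Real.pi ^ 3), abs_of_pos (show 0 < 8 * Real.pi ^ 3 by linarith)]
        nlinarith [abs_nonneg t]
      have h3 : 0 < √|t| := Real.sqrt_pos.2 (abs_pos.2 ht)
      gcongr
    · refine (norm_integral_sqrt_mul_exp_le_trivial hu hx.1).trans ?_
      have := hpos x hx
      have := hx.2
      gcongr
  have hd : ∀ x ∈ Set.Icc u v, HasDerivAt h
      (-γ * x ^ (-γ - 1) * Real.exp (-(k * x)) + x ^ (-γ) * (Real.exp (-(k * x)) * -k)) x := by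
    intro x hx
    have d1 := Real.hasDerivAt_rpow_const (x := x) (p := -γ) (Or.inl (hpos x hx).ne')
    have d2 : HasDerivAt (fun x => Real.exp (-(k * x))) (Real.exp (-(k * x)) * -k) x := by
      refine (((hasDerivAt_id x).const_mul k).neg.exp).congr_deriv ?_
      simp
    exact d1.mul d2
  have key := norm_integral_mul_le_of_antitone huv hgc hA hd ?_ ?_ ?_
  · rw [e, norm_mul]
    have hhu : h u ≤ u ^ (-γ) := by
      simp only [hh]
      have : Real.exp (-(k * u)) ≤ 1 := by
        rw [Real.exp_le_one_iff]
        have : 0 ≤ k * u := by positivity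
        linarith
      calc _ ≤ u ^ (-γ) * 1 := by gcongr
        _ = _ := mul_one _
    have hmin : 0 ≤ min (7 * |t| ^ (-(1 / 2) : ℝ)) (v ^ (3 / 2 : ℝ)) :=
      le_min (by positivity) (Real.rpow_nonneg (hu.le.trans huv) _)
    refine mul_le_mul (hκ.trans (norm_kernelConst_le hε ht)) (key.trans ?_) (norm_nonneg _)
      (by positivity)
    rw [mul_comm (u ^ (-γ))]
    gcongr
  · intro x hx
    have c1 : ContinuousAt (fun x : ℝ => x ^ (-γ - 1)) x :=
      Real.continuousAt_rpow_const _ _ (Or.inl (hpos x hx).ne')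
    have c2 : ContinuousAt (fun x : ℝ => x ^ (-γ)) x :=
      Real.continuousAt_rpow_const _ _ (Or.inl (hpos x hx).ne')
    have c3 : ContinuousAt (fun x : ℝ => Real.exp (-(k * x))) x := by fun_prop
    exact (((continuousAt_const.mul c1).mul c3).add
      (c2.mul (c3.mul continuousAt_const))).continuousWithinAt
  · intro x hx
    have := hpos x hx
    have h1 : 0 ≤ γ * x ^ (-γ - 1) * Real.exp (-(k * x)) := by positivity
    have h2 : 0 ≤ x ^ (-γ) * (Real.exp (-(k * x)) * k) := by positivity
    linarith
  · intro x hx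
    have := hpos x hx
    positivity

/-- The dispersive estimate for the regularized propagator. -/
lemma norm_fourierInv_regSymbol_le {ε γ δ u v t : ℝ} (hε : |ε| = 1) (hγ : 0 ≤ γ) (hδ : 0 < δ)
    (hu : 0 < u) (huv : u ≤ v) (ht : t ≠ 0) (z : Plane) :
    ‖𝓕⁻ (regSymbol ε γ δ u v t) z‖ ≤
      2 * (|t| ^ (-(1 / 2) : ℝ) * (u ^ (-γ) *
        min (7 * |t| ^ (-(1 / 2) : ℝ)) (v ^ (3 / 2 : ℝ)))) := by
  rw [fourierInv_regSymbol hγ hδ hu (hu.trans_le huv)]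
  set Z : ℝ × ℝ := (z 0, z 1)
  set F : ℝ → ℂ := fun x => if u ≤ |x| ∧ |x| < v then kernelDensity ε γ δ t Z x else 0 with hF
  have half : ∀ (t : ℝ) (Z : ℝ × ℝ), ∫ x in Set.Ioi 0,
      (if u ≤ |x| ∧ |x| < v then kernelDensity ε γ δ t Z x else 0) =
      ∫ x in u..v, kernelDensity ε γ δ t Z x := by
    intro t Z
    rw [intervalIntegral.integral_of_le huv, ← integral_Ico_eq_integral_Ioc,
      ← integral_indicator measurableSet_Ioi, ← integral_indicator measurableSet_Ico]
    congr 1; ext x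
    simp only [Set.indicator, Set.mem_Ioi, Set.mem_Ico]
    by_cases hx : 0 < x
    · simp [hx, abs_of_pos hx]
    · have : ¬ u ≤ x := fun h => hx (hu.trans_le h)
      simp [hx, this]
  -- If `F` were not integrable its integral would be 0 by convention, so integrability need not be
  -- proved.
  by_cases hFi : Integrable F
  · have hsplit : ∫ x, F x = (∫ x in Set.Ioi 0, F x) + ∫ x in Set.Ioi 0, F (-x) := by
      rw [integral_comp_neg_Ioi, neg_zero, ← integral_add_compl measurableSet_Ioi hFi,
        Set.compl_Ioi]
    have hneg : ∀ x, F (-x) =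
        if u ≤ |x| ∧ |x| < v then kernelDensity ε γ δ (-t) (-Z.1, Z.2) x else 0 := fun x => by
      simp only [hF, abs_neg, kernelDensity_neg]
    rw [hsplit]
    simp only [hneg]
    rw [half, half]
    refine (norm_add_le _ _).trans ?_
    have h1 := norm_integral_kernelDensity_le hε hγ hδ hu huv ht Z
    have h2 := norm_integral_kernelDensity_le hε hγ hδ hu huv (neg_ne_zero.2 ht) (-Z.1, Z.2)
    rw [abs_neg] at h2
    linarith
  · rw [integral_undef hFi, norm_zero]
    have : 0 ≤ min (7 * |t| ^ (-(1 / 2) : ℝ)) (v ^ (3 / 2 : ℝ)) :=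
      le_min (by positivity) (Real.rpow_nonneg (hu.le.trans huv) _)
    positivity

/-! ### Fixed-time decay: dyadic summation in the interior of the admissible region -/

lemma summable_pow_natAbs {ρ : ℝ} (h0 : 0 ≤ ρ) (h1 : ρ < 1) :
    Summable fun j : ℤ => ρ ^ j.natAbs := by
  refine Summable.of_nat_of_neg ?_ ?_
  · simpa using summable_geometric_of_lt_one h0 h1
  · simpa using summable_geometric_of_lt_one h0 h1

lemma sum_two_rpow_neg_abs_le {κ : ℝ} (hκ : 0 < κ) (c : ℝ) (n : ℕ) :
    ∑ i ∈ Finset.range n, (2 : ℝ) ^ (-(κ * |(i : ℝ) - c|)) ≤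
      2 ^ κ * ∑' j : ℤ, ((2 : ℝ) ^ (-κ)) ^ j.natAbs := by
  set ρ : ℝ := 2 ^ (-κ) with hρ
  have hρ0 : 0 < ρ := by positivity
  have hρ1 : ρ < 1 := Real.rpow_lt_one_of_one_lt_of_neg (by norm_num) (by linarith)
  have hs := summable_pow_natAbs hρ0.le hρ1
  -- Moving the centre to an integer changes each exponent by at most κ, whence the factor 2^κ.
  set J : ℤ := ⌊c⌋ with hJ
  have hterm : ∀ i : ℕ, (2 : ℝ) ^ (-(κ * |(i : ℝ) - c|)) ≤ 2 ^ κ * ρ ^ ((i : ℤ) - J).natAbs := by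
    intro i
    have e : ρ ^ ((i : ℤ) - J).natAbs = (2 : ℝ) ^ (-(κ * |(i : ℝ) - J|)) := by
      rw [hρ, ← Real.rpow_natCast, ← Real.rpow_mul (by norm_num), Nat.cast_natAbs]
      push_cast
      rw [neg_mul]
    rw [e, ← Real.rpow_add (by norm_num)]
    refine Real.rpow_le_rpow_of_exponent_le (by norm_num) ?_
    have h1 : |(i : ℝ) - J| ≤ |(i : ℝ) - c| + 1 := by
      have : |c - J| ≤ 1 := by
        rw [abs_le]
        have := Int.floor_le c
        have := Int.lt_floor_add_one c
        constructor <;> linarith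
      calc |(i : ℝ) - J| = |((i : ℝ) - c) + (c - J)| := by ring_nf
        _ ≤ |(i : ℝ) - c| + |c - J| := abs_add_le _ _
        _ ≤ _ := by linarith
    nlinarith
  calc _ ≤ ∑ i ∈ Finset.range n, 2 ^ κ * ρ ^ ((i : ℤ) - J).natAbs :=
        Finset.sum_le_sum fun i _ => hterm i
    _ = 2 ^ κ * ∑ i ∈ Finset.range n, ρ ^ ((i : ℤ) - J).natAbs := by rw [Finset.mul_sum]
    _ ≤ _ := by
        gcongr
        have hinj : Function.Injective fun i : ℕ => (i : ℤ) - J := fun a b h => by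
          simpa using h
        have := hs.sum_le_tsum ((Finset.range n).map ⟨_, hinj⟩) fun j _ => by positivity
        simpa using this

/-- The two entries of the minimum cross at y = x₀. Above x₀ the weight decays like 2^{-γy}; below
it the product grows like 2^{(a-γ)y}. On either side this is geometric decay in |y - x₀|. -/
lemma two_rpow_mul_min_le {γ a : ℝ} (ha : 0 < a) (x₀ y : ℝ) :
    (2 : ℝ) ^ (-(γ * y)) * min (2 ^ (a * x₀)) (2 ^ (a * y)) ≤
      (2 ^ (a * x₀)) ^ (1 - γ / a) * 2 ^ (-(min γ (a - γ) * |y - x₀|)) := by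
  rw [← Real.rpow_mul (by norm_num), ← Real.rpow_add (by norm_num)]
  have e : a * x₀ * (1 - γ / a) = (a - γ) * x₀ := by field_simp
  rw [e]
  rcases le_total x₀ y with h | h
  · rw [abs_of_nonneg (by linarith)]
    refine (mul_le_mul_of_nonneg_left (min_le_left _ _) (by positivity)).trans ?_
    rw [← Real.rpow_add (by norm_num)]
    refine Real.rpow_le_rpow_of_exponent_le (by norm_num) ?_
    nlinarith [mul_le_mul_of_nonneg_right (min_le_left γ (a - γ)) (sub_nonneg.2 h)]
  · rw [abs_of_nonpos (by linarith)]
    refine (mul_le_mul_of_nonneg_left (min_le_right _ _) (by positivity)).trans ?_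
    rw [← Real.rpow_add (by norm_num)]
    refine Real.rpow_le_rpow_of_exponent_le (by norm_num) ?_
    nlinarith [mul_le_mul_of_nonneg_right (min_le_right γ (a - γ)) (sub_nonneg.2 h)]

/-- A dyadic sum with a geometric gain on both sides of its largest term. -/
lemma exists_dyadic_sum_le {γ a : ℝ} (hγ : 0 < γ) (ha : γ < a) :
    ∃ C : ℝ, 0 ≤ C ∧ ∀ (X : ℝ), 0 < X → ∀ (M n : ℕ),
      ∑ i ∈ Finset.range n, (2 : ℝ) ^ (-(γ * ((i : ℝ) - M))) * min X (2 ^ (a * ((i : ℝ) - M))) ≤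
        C * X ^ (1 - γ / a) := by
  have ha0 : 0 < a := hγ.trans ha
  set κ := min γ (a - γ) with hκ
  have hκ0 : 0 < κ := lt_min hγ (by linarith)
  refine ⟨2 ^ κ * ∑' j : ℤ, ((2 : ℝ) ^ (-κ)) ^ j.natAbs,
    mul_nonneg (by positivity) (tsum_nonneg fun _ => by positivity), fun X hX M n => ?_⟩
  set x₀ := Real.logb 2 X / a with hx₀
  have hXe : X = 2 ^ (a * x₀) := by
    rw [hx₀, mul_div_cancel₀ _ ha0.ne', Real.rpow_logb (by norm_num) (by norm_num) hX]
  have h1 : ∀ i : ℕ, (2 : ℝ) ^ (-(γ * ((i : ℝ) - M))) * min X (2 ^ (a * ((i : ℝ) - M))) ≤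
      X ^ (1 - γ / a) * 2 ^ (-(κ * |(i : ℝ) - (M + x₀)|)) := fun i => by
    have := two_rpow_mul_min_le (γ := γ) ha0 x₀ ((i : ℝ) - M)
    rw [← hXe] at this
    rwa [show (i : ℝ) - (M + x₀) = (i : ℝ) - M - x₀ by ring]
  calc _ ≤ ∑ i ∈ Finset.range n, X ^ (1 - γ / a) * 2 ^ (-(κ * |(i : ℝ) - (M + x₀)|)) :=
        Finset.sum_le_sum fun i _ => h1 i
    _ = X ^ (1 - γ / a) * ∑ i ∈ Finset.range n, 2 ^ (-(κ * |(i : ℝ) - (M + x₀)|)) := by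
        rw [Finset.mul_sum]
    _ ≤ X ^ (1 - γ / a) * (2 ^ κ * ∑' j : ℤ, ((2 : ℝ) ^ (-κ)) ^ j.natAbs) := by
        gcongr
        exact sum_two_rpow_neg_abs_le hκ0 _ n
    _ = _ := by ring

/-- The fixed-time decay estimate in `L^p × L^p`, uniform in the regularization. -/
def HasDecay (ε γ l p C : ℝ) : Prop :=
  ∀ (δ : ℝ) (M : ℕ) (t : ℝ) (f g : Plane → ℂ), 0 < δ → t ≠ 0 → Continuous f → HasCompactSupport f →
    Continuous g → HasCompactSupport g →
    ‖multForm (regSymbol ε γ δ (2 ^ (-(M : ℝ))) (2 ^ (M : ℝ)) t) f g‖ ≤ C * |t| ^ (-l) *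
      (eLpNorm f (ENNReal.ofReal p) volume).toReal * (eLpNorm g (ENNReal.ofReal p) volume).toReal

lemma memL12_of_hasCompactSupport {V : Type*} [NormedAddCommGroup V] [InnerProductSpace ℝ V]
    [FiniteDimensional ℝ V] [MeasurableSpace V] [BorelSpace V] {f : V → ℂ} (hf : Continuous f)
    (h : HasCompactSupport f) : MemL12 f volume :=
  ⟨hf.memLp_of_hasCompactSupport h, hf.memLp_of_hasCompactSupport h⟩

/-- Interpolation with weight θ on the dispersive kernel bound and 1 - θ on the bound u^(-γ) of the
symbol. Both contain u^(-γ), so its full power survives. The constant 14 is 2·7, raised to a power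
at most 1. -/
lemma norm_multForm_regSymbol_le {ε γ δ u v t θ p : ℝ} (hε : |ε| = 1) (hγ : 0 ≤ γ) (hδ : 0 < δ)
    (hu : 0 < u) (huv : u ≤ v) (ht : t ≠ 0) (hθ0 : 0 ≤ θ) (hθ1 : θ ≤ 1) (hp : p * (1 + θ) = 2)
    {f g : Plane → ℂ} (hf : Continuous f) (hfs : HasCompactSupport f) (hg : Continuous g)
    (hgs : HasCompactSupport g) :
    ‖multForm (regSymbol ε γ δ u v t) f g‖ ≤
      14 * (|t| ^ (-(θ / 2)) * (u ^ (-γ) * min (|t| ^ (-(θ / 2))) (v ^ (3 / 2 * θ)))) *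
      (eLpNorm f (ENNReal.ofReal p) volume).toReal *
      (eLpNorm g (ENNReal.ofReal p) volume).toReal := by
  have hv : 0 < v := hu.trans_le huv
  have ht' : 0 < |t| := abs_pos.2 ht
  have hw := integrable_regSymbol (ε := ε) (t := t) hγ hδ hu hv
  refine (norm_multForm_le_interp hw (norm_fourierInv_regSymbol_le hε hγ hδ hu huv ht)
    (M := u ^ (-γ)) (fun z => by rw [norm_regSymbol hu]; exact regWeight_le hγ hδ.le hu z)
    hθ0 hθ1 hp hf.measurable hg.measurable (memL12_of_hasCompactSupport hf hfs)
    (memL12_of_hasCompactSupport hg hgs)).trans ?_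
  refine mul_le_mul_of_nonneg_right (mul_le_mul_of_nonneg_right ?_ ENNReal.toReal_nonneg)
    ENNReal.toReal_nonneg
  set T := |t| ^ (-(1 / 2) : ℝ) with hT
  have hT0 : 0 < T := by positivity
  have hTθ : T ^ θ = |t| ^ (-(θ / 2)) := by
    rw [hT, ← Real.rpow_mul ht'.le]; congr 1; ring
  set W := v ^ (3 / 2 : ℝ) with hW
  have hW0 : 0 < W := by positivity
  have hWθ : W ^ θ = v ^ (3 / 2 * θ) := by rw [hW, ← Real.rpow_mul hv.le]
  have hmin0 : 0 < min T W := lt_min hT0 hW0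
  have h7 : min (7 * T) W ≤ 7 * min T W := by
    rcases le_total T W with h | h
    · rw [min_eq_left h]; exact min_le_left _ _
    · rw [min_eq_right h]; exact (min_le_right _ _).trans (by linarith)
  have hminθ : (min T W) ^ θ = min (|t| ^ (-(θ / 2))) (v ^ (3 / 2 * θ)) := by
    rw [← hTθ, ← hWθ]
    rcases le_total T W with h | h
    · rw [min_eq_left h, min_eq_left (Real.rpow_le_rpow hT0.le h hθ0)]
    · rw [min_eq_right h, min_eq_right (Real.rpow_le_rpow hW0.le h hθ0)]
  set U := u ^ (-γ) with hU
  have hU0 : 0 < U := by positivity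
  calc (2 * (T * (U * min (7 * T) W))) ^ θ * U ^ (1 - θ)
      ≤ (14 * (T * (U * min T W))) ^ θ * U ^ (1 - θ) := by
        have : 0 ≤ min (7 * T) W := le_min (by positivity) hW0.le
        have h3 : 2 * (T * (U * min (7 * T) W)) ≤ 14 * (T * (U * min T W)) := by
          calc _ ≤ 2 * (T * (U * (7 * min T W))) := by gcongr
            _ = _ := by ring
        gcongr
    _ = 14 ^ θ * (T ^ θ * (U ^ θ * U ^ (1 - θ) * (min T W) ^ θ)) := by
        rw [Real.mul_rpow (by norm_num) (by positivity), Real.mul_rpow hT0.le (by positivity),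
          Real.mul_rpow hU0.le hmin0.le]
        ring
    _ = 14 ^ θ * (T ^ θ * (U * (min T W) ^ θ)) := by
        rw [← Real.rpow_add hU0]; simp
    _ ≤ 14 * (T ^ θ * (U * (min T W) ^ θ)) := by
        gcongr
        calc (14 : ℝ) ^ θ ≤ 14 ^ (1 : ℝ) := Real.rpow_le_rpow_of_exponent_le (by norm_num) hθ1
          _ = 14 := Real.rpow_one _
    _ = _ := by rw [hTθ, hminθ]

lemma two_rpow_neg_le (M : ℕ) : (2 : ℝ) ^ (-(M : ℝ)) ≤ 2 ^ (M : ℝ) :=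
  Real.rpow_le_rpow_of_exponent_le (by norm_num) (by have : (0 : ℝ) ≤ M := by positivity
                                                     linarith)

/-- Without a weight in ξ, the annulus 2^(-M) ≤ |ζ₀| < 2^M is taken in one piece and the oscillation
bound gives |t|^(-θ/2) twice. -/
lemma hasDecay_zero {ε θ p : ℝ} (hε : |ε| = 1) (hθ0 : 0 ≤ θ) (hθ1 : θ ≤ 1)
    (hp : p * (1 + θ) = 2) : HasDecay ε 0 θ p 14 := by
  intro δ M t f g hδ ht hf hfs hg hgs
  refine (norm_multForm_regSymbol_le hε le_rfl hδ (by positivity) (two_rpow_neg_le M) ht hθ0 hθ1 hp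
    hf hfs hg hgs).trans ?_
  have ht' : 0 < |t| := abs_pos.2 ht
  gcongr
  rw [neg_zero, Real.rpow_zero, one_mul]
  calc _ ≤ |t| ^ (-(θ / 2)) * |t| ^ (-(θ / 2)) := by gcongr; exact min_le_left _ _
    _ = _ := by rw [← Real.rpow_add ht']; congr 1; ring

/-- The annuli are half-open, so adjacent ones add up without overlap. -/
lemma regSymbol_add {ε γ δ u v w t : ℝ} (huv : u ≤ v) (hvw : v ≤ w) :
    regSymbol ε γ δ u w t = regSymbol ε γ δ u v t + regSymbol ε γ δ v w t := by
  ext ζ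
  simp only [Pi.add_apply, regSymbol, ← add_mul]
  congr 1
  unfold xSymbol
  by_cases h1 : u ≤ |ζ 0|
  · by_cases h2 : |ζ 0| < v
    · simp [h1, h2, h2.trans_le hvw, not_le.2 h2]
    · simp [h1, h2, not_lt.1 h2]
  · have : ¬ v ≤ |ζ 0| := fun h => h1 (huv.trans h)
    simp [h1, this]

lemma regSymbol_self (ε γ δ u t : ℝ) : regSymbol ε γ δ u u t = 0 := by
  ext ζ
  have : ¬ (u ≤ |ζ 0| ∧ |ζ 0| < u) := fun h => absurd h.1 (not_le.2 h.2)
  simp [regSymbol, xSymbol, this]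

lemma multForm_add_symbol {V : Type*} [NormedAddCommGroup V] [InnerProductSpace ℝ V]
    [FiniteDimensional ℝ V] [MeasurableSpace V] [BorelSpace V] {w w' f g : V → ℂ}
    (hw : Integrable w) (hw' : Integrable w') (hf : Integrable f) (hg : Integrable g) :
    multForm (w + w') f g = multForm w f g + multForm w' f g := by
  rw [multForm, multForm, multForm,
    ← integral_add (integrable_multForm hw hf hg) (integrable_multForm hw' hf hg)]
  congr 1; ext ζ; rw [Pi.add_apply]; ring

/-- Each dyadic annulus contributes |t|^(-θ/2) 2^(-γj) min(X, 2^(3θj/2)) with X = |t|^(-θ/2). The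
sum over j is of order X^(1 - 2γ/(3θ)), and X · X^(1 - 2γ/(3θ)) = |t|^(-(θ - γ/3)). -/
lemma exists_hasDecay_interior {ε θ γ p : ℝ} (hε : |ε| = 1) (hθ1 : θ ≤ 1)
    (hγ0 : 0 < γ) (hγ : γ < 3 / 2 * θ) (hp : p * (1 + θ) = 2) :
    ∃ C, 0 ≤ C ∧ HasDecay ε γ (θ - γ / 3) p C := by
  have hθ0 : 0 < θ := by linarith
  obtain ⟨C, hC0, hC⟩ := exists_dyadic_sum_le hγ0 hγ
  refine ⟨14 * 3 * C, by positivity, ?_⟩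
  intro δ M t f g hδ ht hf hfs hg hgs
  have ht' : 0 < |t| := abs_pos.2 ht
  set X := |t| ^ (-(θ / 2)) with hX
  have hX0 : 0 < X := by positivity
  set N := (eLpNorm f (ENNReal.ofReal p) volume).toReal *
      (eLpNorm g (ENNReal.ofReal p) volume).toReal with hN
  have hN0 : 0 ≤ N := by positivity
  have hfi := memLp_one_iff_integrable.1 (memL12_of_hasCompactSupport hf hfs).1
  have hgi := memLp_one_iff_integrable.1 (memL12_of_hasCompactSupport hg hgs).1
  have step : ∀ n : ℕ, ‖multForm (regSymbol ε γ δ (2 ^ (-(M : ℝ))) (2 ^ ((n : ℝ) - M)) t) f g‖ ≤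
      (∑ i ∈ Finset.range n, (2 : ℝ) ^ (-(γ * ((i : ℝ) - M))) *
        min X (2 ^ (3 / 2 * θ * ((i : ℝ) - M)))) * (14 * 3 * X * N) := by
    intro n
    induction n with
    | zero =>
      simp only [Nat.cast_zero, zero_sub, regSymbol_self, Finset.range_zero, Finset.sum_empty,
        zero_mul]
      simp [multForm]
    | succ n ih =>
      have le1 : (2 : ℝ) ^ (-(M : ℝ)) ≤ 2 ^ ((n : ℝ) - M) :=
        Real.rpow_le_rpow_of_exponent_le (by norm_num) (by have : (0 : ℝ) ≤ n := by positivity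
                                                           linarith)
      have le2 : (2 : ℝ) ^ ((n : ℝ) - M) ≤ 2 ^ (((n + 1 : ℕ) : ℝ) - M) :=
        Real.rpow_le_rpow_of_exponent_le (by norm_num) (by push_cast; linarith)
      rw [regSymbol_add le1 le2, multForm_add_symbol
        (integrable_regSymbol hγ0.le hδ (by positivity) (by positivity))
        (integrable_regSymbol hγ0.le hδ (by positivity) (by positivity)) hfi hgi,
        Finset.sum_range_succ, add_mul]
      refine (norm_add_le _ _).trans (add_le_add ih ?_)
      refine (norm_multForm_regSymbol_le hε hγ0.le hδ (by positivity) le2 ht hθ0.le hθ1 hp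
        hf hfs hg hgs).trans ?_
      rw [mul_assoc (14 * _), ← hN, ← hX]
      have e1 : ((2 : ℝ) ^ ((n : ℝ) - M)) ^ (-γ) = 2 ^ (-(γ * ((n : ℝ) - M))) := by
        rw [← Real.rpow_mul (by norm_num)]; congr 1; ring
      -- The outer radius is twice the inner one; 2^(3θ/2) ≤ 2^(3/2) ≤ 3 lets the inner radius be
      -- used in the minimum.
      have e2 : ((2 : ℝ) ^ (((n + 1 : ℕ) : ℝ) - M)) ^ (3 / 2 * θ) ≤
          3 * 2 ^ (3 / 2 * θ * ((n : ℝ) - M)) := by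
        rw [← Real.rpow_mul (by norm_num)]
        have : (((n + 1 : ℕ) : ℝ) - M) * (3 / 2 * θ) = 3 / 2 * θ + 3 / 2 * θ * ((n : ℝ) - M) := by
          push_cast; ring
        rw [this, Real.rpow_add (by norm_num)]
        gcongr
        have h8 : ((2 : ℝ) ^ (3 / 2 : ℝ)) ≤ 3 := by
          have : ((2 : ℝ) ^ (3 / 2 : ℝ)) ^ 2 ≤ 3 ^ 2 := by
            rw [← Real.rpow_natCast, ← Real.rpow_mul (by norm_num)]; norm_num
          exact (pow_le_pow_iff_left₀ (by positivity) (by norm_num) two_ne_zero).1 this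
        exact (Real.rpow_le_rpow_of_exponent_le (by norm_num) (by linarith)).trans h8
      have e3 : min X (((2 : ℝ) ^ (((n + 1 : ℕ) : ℝ) - M)) ^ (3 / 2 * θ)) ≤
          3 * min X (2 ^ (3 / 2 * θ * ((n : ℝ) - M))) := by
        rcases le_total X (2 ^ (3 / 2 * θ * ((n : ℝ) - M))) with h | h
        · rw [min_eq_left h]; exact (min_le_left _ _).trans (by linarith)
        · rw [min_eq_right h]; exact (min_le_right _ _).trans e2
      rw [e1]
      calc _ ≤ 14 * (X * (2 ^ (-(γ * ((n : ℝ) - M))) *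
            (3 * min X (2 ^ (3 / 2 * θ * ((n : ℝ) - M)))))) * N := by gcongr
        _ = _ := by ring
  have h2 := step (2 * M)
  have e : (((2 * M : ℕ) : ℝ) - M) = M := by push_cast; ring
  rw [e] at h2
  refine h2.trans ?_
  calc _ ≤ (C * X ^ (1 - γ / (3 / 2 * θ))) * (14 * 3 * X * N) := by
        gcongr
        exact hC X hX0 M (2 * M)
    _ = 14 * 3 * C * (X ^ (1 - γ / (3 / 2 * θ)) * X) * N := by ring
    _ = 14 * 3 * C * |t| ^ (-(θ - γ / 3)) * N := by
        congr 2
        nth_rewrite 2 [← Real.rpow_one X]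
        rw [← Real.rpow_add hX0, hX, ← Real.rpow_mul ht'.le]
        congr 1
        field_simp
        ring
    _ = _ := by rw [hN]; ring

/-! ### Fixed-time decay on the boundary line of the admissible region -/

lemma conj_fourier {V : Type*} [NormedAddCommGroup V] [InnerProductSpace ℝ V]
    [FiniteDimensional ℝ V] [MeasurableSpace V] [BorelSpace V] (h : V → ℂ) (ζ : V) :
    (starRingEnd ℂ) (𝓕 h ζ) = 𝓕⁻ (fun z => (starRingEnd ℂ) (h z)) ζ := by
  rw [Real.fourier_eq, Real.fourierInv_eq, ← integral_conj]
  congr 1; ext z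
  simp only [Circle.smul_def, smul_eq_mul, map_mul, AddChar.map_neg_eq_inv,
    Circle.coe_inv_eq_conj, Complex.conj_conj]

lemma lintegral_rpow_mul_exp_neg {a r : ℝ} (ha : 0 < a) (hr : 0 < r) :
    ∫⁻ x in Set.Ioi (0 : ℝ), ENNReal.ofReal (x ^ (a - 1) * Real.exp (-(r * x))) =
      ENNReal.ofReal ((1 / r) ^ a * Real.Gamma a) := by
  have hi : IntegrableOn (fun x : ℝ => x ^ (a - 1) * Real.exp (-(r * x))) (Set.Ioi 0) := by
    have := integrableOn_rpow_mul_exp_neg_mul_rpow (s := a - 1) (p := 1) (b := r) (by linarith)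
      one_pos hr
    simpa using this
  rw [← Real.integral_rpow_mul_exp_neg_mul_Ioi ha hr, ofReal_integral_eq_lintegral_ofReal hi]
  filter_upwards [ae_restrict_mem measurableSet_Ioi] with x hx
  have : (0 : ℝ) < x := hx
  positivity

lemma lintegral_rpow_mul_exp_neg_inv {a r : ℝ} (ha : 0 < a) (hr : 0 < r) :
    ∫⁻ x in Set.Ioi (0 : ℝ), ENNReal.ofReal (x ^ (-a - 1) * Real.exp (-(r / x))) =
      ENNReal.ofReal ((1 / r) ^ a * Real.Gamma a) := by
  have hi : IntegrableOn (fun x : ℝ => x ^ (a - 1) * Real.exp (-(r * x))) (Set.Ioi 0) := by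
    have := integrableOn_rpow_mul_exp_neg_mul_rpow (s := a - 1) (p := 1) (b := r) (by linarith)
      one_pos hr
    simpa using this
  have e : Set.EqOn (fun x : ℝ => (|(-1 : ℝ)| * x ^ ((-1 : ℝ) - 1)) •
      (fun x : ℝ => x ^ (a - 1) * Real.exp (-(r * x))) (x ^ (-1 : ℝ)))
      (fun x => x ^ (-a - 1) * Real.exp (-(r / x))) (Set.Ioi 0) := fun x hx => by
    have hx : (0 : ℝ) < x := hx
    simp only [abs_neg, abs_one, one_mul, smul_eq_mul]
    rw [← Real.rpow_mul hx.le, ← mul_assoc, ← Real.rpow_add hx, Real.rpow_neg_one, div_eq_mul_inv]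
    congr 2; ring
  have hi' : IntegrableOn (fun x : ℝ => x ^ (-a - 1) * Real.exp (-(r / x))) (Set.Ioi 0) := by
    rw [← integrableOn_Ioi_comp_rpow_iff (p := -1) _ (by norm_num)] at hi
    exact hi.congr_fun e measurableSet_Ioi
  have h := integral_comp_rpow_Ioi (fun x : ℝ => x ^ (a - 1) * Real.exp (-(r * x)))
    (p := -1) (by norm_num)
  rw [setIntegral_congr_fun measurableSet_Ioi e] at h
  rw [← Real.integral_rpow_mul_exp_neg_mul_Ioi ha hr, ← h,
    ofReal_integral_eq_lintegral_ofReal hi']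
  filter_upwards [ae_restrict_mem measurableSet_Ioi] with x hx
  have : (0 : ℝ) < x := hx
  positivity

/-- The left side is the multiplier form of a Gaussian tested on h and its conjugate. Passing to the
kernel side gives the transformed Gaussian, and all phases are then discarded. -/
lemma lintegral_gaussian_mul_fourier_le {l : ℝ} (hl : 0 < l) {h : ℝ → ℂ} (hh : Integrable h) :
    ∫⁻ ξ : ℝ, ENNReal.ofReal (Real.exp (-(Real.pi * ξ ^ 2 * l))) * ‖𝓕 h ξ‖ₑ ^ 2 ≤
      ∫⁻ z, ∫⁻ x, ‖h z‖ₑ * ‖h x‖ₑ *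
        ENNReal.ofReal (l ^ (-(1 / 2) : ℝ) * Real.exp (-(Real.pi * (z - x) ^ 2 / l))) := by
  set w : ℝ → ℂ := fun ξ => Complex.exp (-Real.pi * (l : ℂ) * ξ ^ 2) with hw
  have hl' : 0 < (l : ℂ).re := hl
  have hwi : Integrable w := integrable_gaussian hl'
  have hhc : Integrable fun x => (starRingEnd ℂ) (h x) :=
    (Complex.conjCLE.toContinuousLinearMap).integrable_comp hh
  have hwn : ∀ z, ‖𝓕⁻ w z‖ = l ^ (-(1 / 2) : ℝ) * Real.exp (-(Real.pi * z ^ 2 / l)) := fun z => by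
    rw [hw, fourierInv_gaussian hl']
    rw [norm_mul, norm_one_div_cpow_half, Complex.norm_real, Real.norm_of_nonneg hl.le]
    have : -(Real.pi : ℂ) / l * z ^ 2 = ((-(Real.pi * z ^ 2 / l) : ℝ) : ℂ) := by push_cast; ring
    rw [this, Complex.norm_exp_ofReal]
  have e1 : ∀ ξ : ℝ, w ξ * 𝓕 h ξ * 𝓕⁻ (fun x => (starRingEnd ℂ) (h x)) ξ =
      ((Real.exp (-(Real.pi * ξ ^ 2 * l)) * ‖𝓕 h ξ‖ ^ 2 : ℝ) : ℂ) := fun ξ => by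
    rw [← conj_fourier, mul_assoc, Complex.mul_conj, hw, Complex.normSq_eq_norm_sq]
    push_cast
    congr 2; ring
  have hInteg := integrable_multForm hwi hh hhc
  have e2 : ∫⁻ ξ : ℝ, ENNReal.ofReal (Real.exp (-(Real.pi * ξ ^ 2 * l))) * ‖𝓕 h ξ‖ₑ ^ 2 =
      ‖multForm w h (fun x => (starRingEnd ℂ) (h x))‖ₑ := by
    rw [multForm]
    simp only [e1] at hInteg ⊢
    rw [integral_complex_ofReal]
    have hInteg' : Integrable fun ξ : ℝ => Real.exp (-(Real.pi * ξ ^ 2 * l)) * ‖𝓕 h ξ‖ ^ 2 := by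
      refine hInteg.re.congr (Eventually.of_forall fun ξ => ?_)
      exact Complex.ofReal_re _
    have h0 : 0 ≤ ∫ ξ : ℝ, Real.exp (-(Real.pi * ξ ^ 2 * l)) * ‖𝓕 h ξ‖ ^ 2 :=
      integral_nonneg fun ξ => by positivity
    rw [← ofReal_norm, Complex.norm_real, Real.norm_of_nonneg h0,
      ofReal_integral_eq_lintegral_ofReal hInteg' (Eventually.of_forall fun ξ => by positivity)]
    congr 1; ext ξ
    rw [ENNReal.ofReal_mul (by positivity), ENNReal.ofReal_pow (norm_nonneg _),
      ofReal_norm]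
  rw [e2, multForm, ← integral_fourierInv_mul_eq (integrable_mul_fourier hwi hh) hhc]
  refine (enorm_integral_le_lintegral_enorm _).trans (lintegral_mono fun z => ?_)
  rw [enorm_mul, fourierInv_mul_fourier hwi hh, mul_comm, RCLike.enorm_conj]
  have : ∀ x, ‖h z‖ₑ * ‖h x‖ₑ *
        ENNReal.ofReal (l ^ (-(1 / 2) : ℝ) * Real.exp (-(Real.pi * (z - x) ^ 2 / l))) =
      ‖h z‖ₑ * ‖𝓕⁻ w (z - x) * h x‖ₑ := fun x => by
    rw [enorm_mul, ← hwn, ofReal_norm]; ring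
  simp only [this]
  rw [lintegral_const_mul' _ _ enorm_ne_top]
  gcongr
  exact enorm_integral_le_lintegral_enorm _

/-- The Hardy–Littlewood–Sobolev inequality on the Fourier side, on the line. -/
lemma exists_lintegral_riesz_mul_fourier_le {θ p : ℝ} (hθ0 : 0 < θ) (hθ1 : θ < 1)
    (hp : p * (1 + θ) = 2) :
    ∃ C : ℝ≥0, ∀ h : ℝ → ℂ, Measurable h → Integrable h →
      ∫⁻ ξ, riesz θ ξ * ‖𝓕 h ξ‖ₑ ^ 2 ≤ C * (∫⁻ x, ‖h x‖ₑ ^ p) ^ (2 / p) := by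
  have hp' : p = 2 / (1 + θ) := by field_simp; linarith
  have hp1 : 1 < p := by rw [hp', lt_div_iff₀ (by linarith)]; linarith
  have hp2 : p < 2 := by rw [hp', div_lt_iff₀ (by linarith)]; linarith
  -- The weight |ξ|^(-2a) is a superposition of Gaussians e^{-πξ²l} with density l^(a-1). The
  -- transformed Gaussians bring l^(-1/2), and a - 1 - 1/2 = -b - 1, so they superpose to |x|^(-2b).
  -- Since 2b = 1 - θ = 2 - 2/p, this is exactly the kernel of the diagonal Hardy–Littlewood–Sobolev
  -- inequality.
  set a := θ / 2 with ha
  have ha0 : 0 < a := by positivity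
  set b := (1 - θ) / 2 with hb
  have hb0 : 0 < b := by rw [hb]; linarith
  have hpi := Real.pi_pos
  set k₁ := (1 / Real.pi) ^ a * Real.Gamma a with hk₁
  set k₂ := (1 / Real.pi) ^ b * Real.Gamma b with hk₂
  have hk₁0 : 0 < k₁ := mul_pos (by positivity) (Real.Gamma_pos_of_pos ha0)
  have hk₂0 : 0 < k₂ := mul_pos (by positivity) (Real.Gamma_pos_of_pos hb0)
  have hpow : ∀ (s x : ℝ), x ≠ 0 → (1 / (Real.pi * x ^ 2)) ^ s * Real.Gamma s =
      (1 / Real.pi) ^ s * Real.Gamma s * |x| ^ (-(2 * s)) := fun s x hx => by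
    have hx : 0 < |x| := abs_pos.2 hx
    rw [← sq_abs x, one_div, mul_inv, Real.mul_rpow (by positivity) (by positivity),
      ← Real.rpow_natCast, ← Real.rpow_neg hx.le, ← Real.rpow_mul hx.le]
    push_cast
    rw [show -2 * s = -(2 * s) by ring, one_div]; ring
  set K := k₁⁻¹ * k₂ * (2 * hlsConst p) with hK
  have hK0 : 0 ≤ K := by have := hlsConst_pos hp1 hp2; positivity
  refine ⟨K.toNNReal, fun h hm hi => ?_⟩
  have hF : Measurable fun ξ => ‖𝓕 h ξ‖ₑ ^ 2 := ((continuous_fourier hi).measurable.enorm).pow_const 2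
  have key : ENNReal.ofReal k₁ * ∫⁻ ξ, riesz θ ξ * ‖𝓕 h ξ‖ₑ ^ 2 ≤
      ENNReal.ofReal k₂ * ∫⁻ z, ∫⁻ x, ‖h z‖ₑ * ‖h x‖ₑ * riesz (2 - 2 / p) (z - x) := by
    calc ENNReal.ofReal k₁ * ∫⁻ ξ, riesz θ ξ * ‖𝓕 h ξ‖ₑ ^ 2
        = ∫⁻ ξ, ∫⁻ l in Set.Ioi (0 : ℝ),
            ENNReal.ofReal (l ^ (a - 1) * Real.exp (-(Real.pi * ξ ^ 2 * l))) * ‖𝓕 h ξ‖ₑ ^ 2 := by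
          rw [← lintegral_const_mul' _ _ ENNReal.ofReal_ne_top]
          refine lintegral_congr_ae ?_
          filter_upwards [Measure.ae_ne volume (0 : ℝ)] with ξ hξ
          rw [lintegral_mul_const _ (by fun_prop), lintegral_rpow_mul_exp_neg ha0 (by positivity),
            hpow a ξ hξ, ← hk₁, ENNReal.ofReal_mul hk₁0.le, riesz, mul_assoc]
          congr 5
          rw [ha]; ring
      _ = ∫⁻ l in Set.Ioi (0 : ℝ), ∫⁻ ξ,
            ENNReal.ofReal (l ^ (a - 1) * Real.exp (-(Real.pi * ξ ^ 2 * l))) * ‖𝓕 h ξ‖ₑ ^ 2 := by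
          refine lintegral_lintegral_swap ?_
          refine Measurable.aemeasurable ?_
          refine Measurable.mul (by fun_prop) (hF.comp measurable_fst)
      _ ≤ ∫⁻ l in Set.Ioi (0 : ℝ), ∫⁻ z, ∫⁻ x, ‖h z‖ₑ * ‖h x‖ₑ *
            ENNReal.ofReal (l ^ (-b - 1) * Real.exp (-(Real.pi * (z - x) ^ 2 / l))) := by
          refine lintegral_mono_ae ?_
          filter_upwards [ae_restrict_mem measurableSet_Ioi] with l hl
          have hl : (0 : ℝ) < l := hl
          have e1 : ∀ ξ : ℝ, ENNReal.ofReal (l ^ (a - 1) * Real.exp (-(Real.pi * ξ ^ 2 * l))) *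
              ‖𝓕 h ξ‖ₑ ^ 2 = ENNReal.ofReal (l ^ (a - 1)) *
              (ENNReal.ofReal (Real.exp (-(Real.pi * ξ ^ 2 * l))) * ‖𝓕 h ξ‖ₑ ^ 2) := fun ξ => by
            rw [ENNReal.ofReal_mul (by positivity), mul_assoc]
          have e2 : ∀ z x : ℝ, ‖h z‖ₑ * ‖h x‖ₑ *
              ENNReal.ofReal (l ^ (-b - 1) * Real.exp (-(Real.pi * (z - x) ^ 2 / l))) =
              ENNReal.ofReal (l ^ (a - 1)) * (‖h z‖ₑ * ‖h x‖ₑ * ENNReal.ofReal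
              (l ^ (-(1 / 2) : ℝ) * Real.exp (-(Real.pi * (z - x) ^ 2 / l)))) := fun z x => by
            have : l ^ (-b - 1) = l ^ (a - 1) * l ^ (-(1 / 2) : ℝ) := by
              rw [← Real.rpow_add hl]; congr 1; rw [ha, hb]; ring
            rw [this, mul_assoc (l ^ (a - 1)), ENNReal.ofReal_mul (by positivity)]; ring
          simp only [e1, e2]
          rw [lintegral_const_mul' _ _ ENNReal.ofReal_ne_top]
          simp only [lintegral_const_mul' _ _ (ENNReal.ofReal_ne_top (r := l ^ (a - 1)))]
          exact mul_le_mul_right (lintegral_gaussian_mul_fourier_le hl hi) _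
      _ = ∫⁻ z, ∫⁻ x, ∫⁻ l in Set.Ioi (0 : ℝ), ‖h z‖ₑ * ‖h x‖ₑ *
            ENNReal.ofReal (l ^ (-b - 1) * Real.exp (-(Real.pi * (z - x) ^ 2 / l))) := by
          have hme : Measurable fun x => ‖h x‖ₑ := hm.enorm
          have hm3 : Measurable fun w : (ℝ × ℝ) × ℝ => ‖h w.1.2‖ₑ * ‖h w.2‖ₑ * ENNReal.ofReal
              (w.1.1 ^ (-b - 1) * Real.exp (-(Real.pi * (w.1.2 - w.2) ^ 2 / w.1.1))) :=
            ((hme.comp (by fun_prop)).mul (hme.comp (by fun_prop))).mul (by fun_prop)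
          rw [lintegral_lintegral_swap]
          · congr 1; ext z
            rw [lintegral_lintegral_swap]
            exact ((measurable_const.mul (hme.comp measurable_snd)).mul
              (by fun_prop)).aemeasurable
          · exact hm3.lintegral_prod_right.aemeasurable
      _ = ∫⁻ z, ∫⁻ x, ENNReal.ofReal k₂ * (‖h z‖ₑ * ‖h x‖ₑ * riesz (2 - 2 / p) (z - x)) := by
          congr 1; ext z
          refine lintegral_congr_ae ?_
          filter_upwards [Measure.ae_ne volume z] with x hx
          have hzx : z - x ≠ 0 := sub_ne_zero.2 (Ne.symm hx)
          rw [lintegral_const_mul' _ _ (ENNReal.mul_ne_top enorm_ne_top enorm_ne_top),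
            lintegral_rpow_mul_exp_neg_inv hb0 (by positivity), hpow b _ hzx, ← hk₂,
            ENNReal.ofReal_mul hk₂0.le, riesz]
          have : -(2 * b) = -(2 - 2 / p) := by rw [hb, hp']; field_simp; ring
          rw [this]; ring
      _ = _ := by
          simp only [lintegral_const_mul' _ _ (ENNReal.ofReal_ne_top (r := k₂))]
  have hhls := hls hp1 hp2 hm.enorm hm.enorm
  set N := (∫⁻ x, ‖h x‖ₑ ^ p) with hN
  have hNN : N ^ (1 / p) * N ^ (1 / p) = N ^ (2 / p) := by
    rw [← ENNReal.rpow_add_of_nonneg _ _ (by positivity) (by positivity)]; congr 1; ring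
  have hk1' : ENNReal.ofReal k₁ ≠ 0 := by simpa using hk₁0
  calc ∫⁻ ξ, riesz θ ξ * ‖𝓕 h ξ‖ₑ ^ 2
      = (ENNReal.ofReal k₁)⁻¹ * (ENNReal.ofReal k₁ * ∫⁻ ξ, riesz θ ξ * ‖𝓕 h ξ‖ₑ ^ 2) := by
        rw [← mul_assoc, ENNReal.inv_mul_cancel hk1' ENNReal.ofReal_ne_top, one_mul]
    _ ≤ (ENNReal.ofReal k₁)⁻¹ * (ENNReal.ofReal k₂ * (ENNReal.ofReal (2 * hlsConst p) *
          N ^ (1 / p) * N ^ (1 / p))) := by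
        exact mul_le_mul_right (key.trans (mul_le_mul_right hhls _)) _
    _ = _ := by
        rw [mul_assoc (ENNReal.ofReal (2 * hlsConst p)), hNN]
        change _ = ENNReal.ofReal K * _
        rw [hK, ENNReal.ofReal_mul (mul_pos (inv_pos.2 hk₁0) hk₂0).le,
          ENNReal.ofReal_mul (inv_pos.2 hk₁0).le, ENNReal.ofReal_inv_of_pos hk₁0]
        ring

/-- Minkowski's integral inequality for the exponent `s ≥ 1`, if the left-hand side is finite. -/
lemma lintegral_lintegral_rpow_le {α β : Type*} [MeasurableSpace α] [MeasurableSpace β]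
    {μ : Measure α} {ν : Measure β} [SFinite μ] [SFinite ν] {s : ℝ} (hs : 1 < s)
    {F : α → β → ℝ≥0∞} (hF : Measurable (Function.uncurry F))
    (hfin : ∫⁻ x, (∫⁻ y, F x y ∂ν) ^ s ∂μ ≠ ∞) :
    (∫⁻ x, (∫⁻ y, F x y ∂ν) ^ s ∂μ) ^ (1 / s) ≤ ∫⁻ y, (∫⁻ x, F x y ^ s ∂μ) ^ (1 / s) ∂ν := by
  set N := ∫⁻ x, (∫⁻ y, F x y ∂ν) ^ s ∂μ with hN
  set K := ∫⁻ y, (∫⁻ x, F x y ^ s ∂μ) ^ (1 / s) ∂ν with hK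
  have hA : Measurable fun x => ∫⁻ y, F x y ∂ν := hF.lintegral_prod_right
  set A := fun x => ∫⁻ y, F x y ∂ν with hAdef
  have hconj : s.HolderConjugate (s / (s - 1)) := Real.HolderConjugate.conjExponent hs
  have hs1 : 0 < s - 1 := by linarith
  -- One factor of the s-th power is expanded as an integral in y; Tonelli and Hölder in x follow.
  -- Dividing by the power of N is where finiteness enters.
  have h1 : N ≤ K * N ^ (1 - 1 / s) := by
    calc N = ∫⁻ x, ∫⁻ y, F x y * A x ^ (s - 1) ∂ν ∂μ := by
          rw [hN]
          congr 1; ext x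
          have hFx : Measurable fun y => F x y := hF.comp measurable_prodMk_left
          rw [lintegral_mul_const _ hFx]
          change A x ^ s = A x * A x ^ (s - 1)
          nth_rewrite 2 [← ENNReal.rpow_one (A x)]
          rw [← ENNReal.rpow_add_of_nonneg _ _ (by norm_num) hs1.le]; congr 1; ring
      _ = ∫⁻ y, ∫⁻ x, F x y * A x ^ (s - 1) ∂μ ∂ν := by
          rw [lintegral_lintegral_swap]
          exact (hF.mul ((hA.comp measurable_fst).pow_const _)).aemeasurable
      _ ≤ ∫⁻ y, (∫⁻ x, F x y ^ s ∂μ) ^ (1 / s) * N ^ (1 - 1 / s) ∂ν := by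
          refine lintegral_mono fun y => ?_
          refine (ENNReal.lintegral_mul_le_Lp_mul_Lq μ hconj
            (hF.comp measurable_prodMk_right).aemeasurable
            (hA.pow_const _).aemeasurable).trans (le_of_eq ?_)
          congr 1
          have e : ∀ x, (A x ^ (s - 1)) ^ (s / (s - 1)) = A x ^ s := fun x => by
            rw [← ENNReal.rpow_mul]; congr 1; field_simp
          simp only [e]
          congr 1
          field_simp
      _ = _ := lintegral_mul_const' _ _ (ENNReal.rpow_ne_top_of_nonneg
            (by rw [sub_nonneg, div_le_one (by linarith)]; exact hs.le) hfin)
  by_cases h0 : N = 0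
  · rw [h0, ENNReal.zero_rpow_of_pos (by positivity)]; exact zero_le
  have hne : N ^ (1 - 1 / s) ≠ 0 := by simp [h0, hfin]
  have hnt : N ^ (1 - 1 / s) ≠ ∞ := by simp [h0, hfin]
  rw [← ENNReal.mul_le_mul_iff_left hne hnt]
  refine le_trans (le_of_eq ?_) h1
  rw [← ENNReal.rpow_add _ _ h0 hfin]
  simp

/-- The Fourier transform in the first variable. -/
def partialFourier (f : Plane → ℂ) (x y : ℝ) : ℂ := 𝓕 (fun x' : ℝ => f (pt (x', y))) x

lemma fourier_pt {f : Plane → ℂ} (hf : Integrable f) (x y : ℝ) :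
    𝓕 f (pt (x, y)) = 𝓕 (partialFourier f x) y := by
  have hc : Continuous fun z : Plane =>
      Complex.exp ((-2 * Real.pi * inner ℝ z (pt (x, y)) : ℝ) * Complex.I) := by fun_prop
  have hi : Integrable fun z : Plane =>
      Complex.exp ((-2 * Real.pi * inner ℝ z (pt (x, y)) : ℝ) * Complex.I) • f z :=
    hf.bdd_mul (c := 1) hc.aestronglyMeasurable
      (Eventually.of_forall fun z => (Complex.norm_exp_ofReal_mul_I _).le)
  rw [Real.fourier_eq', ← measurePreserving_pt.integral_comp measurableEmbedding_pt,
    Real.fourier_eq']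
  refine (integral_prod_symm _ (integrable_comp_pt.2 hi)).trans ?_
  congr 1; ext y'
  rw [partialFourier, Real.fourier_eq', smul_eq_mul, ← integral_const_mul]
  congr 1; ext x'
  rw [inner_plane, smul_eq_mul, smul_eq_mul, ← mul_assoc, ← Complex.exp_add]
  congr 2
  simp only [pt_zero, pt_one, RCLike.inner_apply, conj_trivial]
  push_cast; ring

lemma fourierInv_pt {g : Plane → ℂ} (hg : Integrable g) (x y : ℝ) :
    𝓕⁻ g (pt (x, y)) = 𝓕⁻ (partialFourier g (-x)) y := by
  have e : -pt (x, y) = pt (-x, -y) := by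
    ext i; fin_cases i <;> rfl
  rw [Real.fourierInv_eq_fourier_neg, e, fourier_pt hg, Real.fourierInv_eq_fourier_neg]

lemma measurable_partialFourier {f : Plane → ℂ} (hf : Continuous f) :
    Measurable (Function.uncurry (partialFourier f)) := by
  have : Function.uncurry (partialFourier f) = fun w : ℝ × ℝ => ∫ x' : ℝ,
      Complex.exp ((-2 * Real.pi * (x' * w.1) : ℝ) * Complex.I) • f (pt (x', w.2)) := by
    ext w
    simp only [Function.uncurry, partialFourier, Real.fourier_eq', RCLike.inner_apply, conj_trivial]
    congr 1; ext x'; rw [mul_comm x' w.1]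
  rw [this]
  refine StronglyMeasurable.measurable (StronglyMeasurable.integral_prod_right
    (f := fun (w : ℝ × ℝ) (x' : ℝ) =>
      Complex.exp ((-2 * Real.pi * (x' * w.1) : ℝ) * Complex.I) • f (pt (x', w.2))) ?_)
  refine Continuous.stronglyMeasurable ?_
  have : Continuous fun q : (ℝ × ℝ) × ℝ => pt (q.2, q.1.2) :=
    continuous_pt.comp (by fun_prop)
  have h2 : Continuous fun q : (ℝ × ℝ) × ℝ =>
      Complex.exp ((-2 * Real.pi * (q.2 * q.1.1) : ℝ) * Complex.I) := by fun_prop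
  exact h2.smul (hf.comp this)

lemma exists_bound_of_hasCompactSupport {f : Plane → ℂ} (hf : Continuous f)
    (hfs : HasCompactSupport f) :
    ∃ B R : ℝ, 0 ≤ B ∧ 0 ≤ R ∧ (∀ z, ‖f z‖ ≤ B) ∧ ∀ x y : ℝ, R < |x| ∨ R < |y| → f (pt (x, y)) = 0 := by
  obtain ⟨B, hB⟩ := hf.bounded_above_of_compact_support hfs
  obtain ⟨R, hR⟩ := hfs.isCompact.isBounded.exists_norm_le
  refine ⟨B, |R|, (norm_nonneg _).trans (hB 0), abs_nonneg _, hB, fun x y h => ?_⟩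
  by_contra h0
  have h1 := hR _ (subset_tsupport f h0)
  have h2 : |x| ≤ ‖pt (x, y)‖ := by simpa using PiLp.norm_apply_le (pt (x, y)) 0
  have h3 : |y| ≤ ‖pt (x, y)‖ := by simpa using PiLp.norm_apply_le (pt (x, y)) 1
  have := le_abs_self R
  rcases h with h | h <;> linarith

lemma exists_norm_partialFourier_le {f : Plane → ℂ} (hf : Continuous f)
    (hfs : HasCompactSupport f) :
    ∃ K R : ℝ, 0 ≤ K ∧ ∀ x y, ‖partialFourier f x y‖ ≤ (Set.Icc (-R) R).indicator (fun _ => K) y := by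
  obtain ⟨B, R, hB0, hR0, hB, hR⟩ := exists_bound_of_hasCompactSupport hf hfs
  refine ⟨B * (2 * R), R, by positivity, fun x y => ?_⟩
  by_cases hy : y ∈ Set.Icc (-R) R
  · rw [Set.indicator_of_mem hy]
    refine (norm_fourier_le _ _).trans ?_
    have : ∀ x', ‖f (pt (x', y))‖ ≤ (Set.Icc (-R) R).indicator (fun _ => B) x' := fun x' => by
      by_cases hx : x' ∈ Set.Icc (-R) R
      · rw [Set.indicator_of_mem hx]; exact hB _
      · rw [Set.indicator_of_notMem hx, hR x' y (Or.inl (by rw [← not_le, abs_le]; exact hx)),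
          norm_zero]
    refine (integral_mono_of_nonneg (Eventually.of_forall fun _ => norm_nonneg _) ?_
      (Eventually.of_forall this)).trans (le_of_eq ?_)
    · rw [integrable_indicator_iff measurableSet_Icc]
      exact integrableOn_const (by simp)
    · rw [integral_indicator measurableSet_Icc, setIntegral_const, measureReal_def,
        Real.volume_Icc, ENNReal.toReal_ofReal (by linarith), smul_eq_mul]
      ring
  · rw [Set.indicator_of_notMem hy]
    have : ∀ x', f (pt (x', y)) = 0 := fun x' =>
      hR x' y (Or.inr (by rw [← not_le, abs_le]; exact hy))
    simp only [partialFourier, this]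
    rw [Real.fourier_eq']; simp

lemma integrable_slice {f : Plane → ℂ} (hf : Continuous f) (hfs : HasCompactSupport f) (y : ℝ) :
    Integrable fun x : ℝ => f (pt (x, y)) := by
  obtain ⟨B, R, hB0, hR0, hB, hR⟩ := exists_bound_of_hasCompactSupport hf hfs
  have hc : Continuous fun x : ℝ => f (pt (x, y)) := hf.comp (continuous_pt.comp (by fun_prop))
  refine hc.integrable_of_hasCompactSupport (HasCompactSupport.intro (isCompact_Icc (a := -R) (b := R))
    fun x hx => hR x y (Or.inl (by rw [← not_le, abs_le]; exact hx)))

lemma memLp_indicator_Icc_const (R K : ℝ) (p : ℝ≥0∞) :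
    MemLp ((Set.Icc (-R) R).indicator fun _ : ℝ => K) p := by
  have : volume (Set.Icc (-R) R) ≠ ∞ := measure_Icc_lt_top.ne
  exact memLp_indicator_const p measurableSet_Icc K (Or.inr this)

lemma memLp_partialFourier {f : Plane → ℂ} (hf : Continuous f) (hfs : HasCompactSupport f)
    (p : ℝ≥0∞) (x : ℝ) : MemLp (partialFourier f x) p := by
  obtain ⟨K, R, hK0, hK⟩ := exists_norm_partialFourier_le hf hfs
  have hk := memLp_indicator_Icc_const R K p
  have hm : Measurable (partialFourier f x) := (measurable_partialFourier hf).of_uncurry_left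
  refine hk.of_le hm.aestronglyMeasurable (Eventually.of_forall fun y => ?_)
  exact (hK x y).trans (Real.le_norm_self _)

lemma eLpNorm_ofReal_eq {α E : Type*} [MeasurableSpace α] [NormedAddCommGroup E] {μ : Measure α}
    {p : ℝ} (hp : 0 < p) (f : α → E) :
    eLpNorm f (ENNReal.ofReal p) μ = (∫⁻ x, ‖f x‖ₑ ^ p ∂μ) ^ (1 / p) := by
  rw [eLpNorm_eq_lintegral_rpow_enorm_toReal (by simpa using hp) ENNReal.ofReal_ne_top,
    ENNReal.toReal_ofReal hp.le]

/-- Minkowski with exponent 2/p > 1 moves the weighted L² norm in the frequency x inside the L^p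
norm in y; the one-dimensional inequality is then applied on each horizontal line. The annulus
serves only to make the left side finite beforehand, and the constant does not depend on it. -/
lemma exists_lintegral_riesz_mul_partialFourier_le {θ p : ℝ} (hθ0 : 0 < θ) (hθ1 : θ < 1)
    (hp : p * (1 + θ) = 2) :
    ∃ C : ℝ≥0, ∀ (u v : ℝ), 0 < u → ∀ f : Plane → ℂ, Continuous f → HasCompactSupport f →
      ∫⁻ x in {x | u ≤ |x| ∧ |x| < v}, riesz θ x *
        eLpNorm (partialFourier f x) (ENNReal.ofReal p) volume ^ (2 : ℝ) ≤
      C * eLpNorm f (ENNReal.ofReal p) volume ^ (2 : ℝ) := by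
  have hp' : p = 2 / (1 + θ) := by field_simp; linarith
  have hp1 : 1 < p := by rw [hp', lt_div_iff₀ (by linarith)]; linarith
  have hp2 : p < 2 := by rw [hp', div_lt_iff₀ (by linarith)]; linarith
  have hp0 : 0 < p := by linarith
  obtain ⟨C, hC⟩ := exists_lintegral_riesz_mul_fourier_le hθ0 hθ1 hp
  refine ⟨C, fun u v hu f hf hfs => ?_⟩
  set S : Set ℝ := {x | u ≤ |x| ∧ |x| < v} with hS
  have hSm : MeasurableSet S := (measurableSet_le measurable_const measurable_id.abs).inter
    (measurableSet_lt measurable_id.abs measurable_const)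
  set ν : Measure ℝ := (volume.restrict S).withDensity (riesz θ) with hν
  have hνi : ∀ h : ℝ → ℝ≥0∞, Measurable h → ∫⁻ x, h x ∂ν = ∫⁻ x in S, riesz θ x * h x := fun h hh => by
    rw [hν, lintegral_withDensity_eq_lintegral_mul _ (measurable_riesz θ) hh]; rfl
  have hmF := measurable_partialFourier hf
  have hmE : Measurable (Function.uncurry fun x y => ‖partialFourier f x y‖ₑ ^ p) :=
    hmF.enorm.pow_const p
  have hsq : ∀ x, eLpNorm (partialFourier f x) (ENNReal.ofReal p) volume ^ (2 : ℝ) =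
      (∫⁻ y, ‖partialFourier f x y‖ₑ ^ p) ^ (2 / p) := fun x => by
    rw [eLpNorm_ofReal_eq hp0, ← ENNReal.rpow_mul]; congr 1; ring
  have hA : Measurable fun x => ∫⁻ y, ‖partialFourier f x y‖ₑ ^ p := hmE.lintegral_prod_right
  simp only [hsq]
  rw [← hνi _ (hA.pow_const _)]
  have hfin : ∫⁻ x, (∫⁻ y, ‖partialFourier f x y‖ₑ ^ p) ^ (2 / p) ∂ν ≠ ∞ := by
    obtain ⟨K, R, hK0, hK⟩ := exists_norm_partialFourier_le hf hfs
    set Q := (∫⁻ y, ‖(Set.Icc (-R) R).indicator (fun _ : ℝ => K) y‖ₑ ^ p) ^ (2 / p) with hQ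
    have hQt : Q ≠ ∞ := by
      have h1 := (memLp_indicator_Icc_const R K (ENNReal.ofReal p)).2.ne
      rw [eLpNorm_ofReal_eq hp0] at h1
      have : Q = ((∫⁻ y, ‖(Set.Icc (-R) R).indicator (fun _ : ℝ => K) y‖ₑ ^ p) ^ (1 / p)) ^ (2 : ℝ) := by
        rw [hQ, ← ENNReal.rpow_mul]; congr 1; ring
      rw [this]
      exact ENNReal.rpow_ne_top_of_nonneg (by norm_num) h1
    have hle : ∫⁻ x, (∫⁻ y, ‖partialFourier f x y‖ₑ ^ p) ^ (2 / p) ∂ν ≤ ∫⁻ _, Q ∂ν := by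
      refine lintegral_mono fun x => ?_
      refine ENNReal.rpow_le_rpow (lintegral_mono fun y => ?_) (by positivity)
      refine ENNReal.rpow_le_rpow ?_ hp0.le
      rw [enorm_le_iff_norm_le]
      exact (hK x y).trans (Real.le_norm_self _)
    refine ne_top_of_le_ne_top ?_ hle
    rw [hνi _ measurable_const]
    have : ∫⁻ x in S, riesz θ x * Q ≤ ∫⁻ _ in Set.Icc (-v) v, ENNReal.ofReal (u ^ (-θ)) * Q := by
      refine (setLIntegral_mono' (g := fun _ => ENNReal.ofReal (u ^ (-θ)) * Q) hSm
        fun x hx => ?_).trans (lintegral_mono_set fun x hx => ?_)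
      · refine mul_le_mul_left (ENNReal.ofReal_le_ofReal ?_) _
        exact rpow_neg_le_of_le hθ0.le hu hx.1
      · have : |x| < v := hx.2
        exact ⟨by linarith [neg_abs_le x], by linarith [le_abs_self x]⟩
    refine ne_top_of_le_ne_top ?_ this
    rw [setLIntegral_const]
    exact ENNReal.mul_ne_top (ENNReal.mul_ne_top ENNReal.ofReal_ne_top hQt) (by simp)
  have hmink := lintegral_lintegral_rpow_le (s := 2 / p) (by rw [lt_div_iff₀ hp0]; linarith)
    hmE hfin
  have hin : ∀ y, (∫⁻ x, (‖partialFourier f x y‖ₑ ^ p) ^ (2 / p) ∂ν) ^ (1 / (2 / p)) ≤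
      (C : ℝ≥0∞) ^ (p / 2) * ∫⁻ x, ‖f (pt (x, y))‖ₑ ^ p := fun y => by
    have hsl : Measurable fun x : ℝ => f (pt (x, y)) :=
      (hf.comp (continuous_pt.comp (by fun_prop))).measurable
    have h1 := hC _ hsl (integrable_slice hf hfs y)
    have hmy : Measurable fun x => partialFourier f x y := hmF.of_uncurry_right
    have e1 : ∀ x, (‖partialFourier f x y‖ₑ ^ p) ^ (2 / p) = ‖partialFourier f x y‖ₑ ^ 2 := fun x => by
      rw [← ENNReal.rpow_mul, mul_div_cancel₀ _ hp0.ne']; simp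
    simp only [e1]
    rw [hνi _ (hmy.enorm.pow_const 2), one_div_div]
    refine (ENNReal.rpow_le_rpow ((setLIntegral_le_lintegral _ _).trans h1) (by positivity)).trans
      (le_of_eq ?_)
    rw [ENNReal.mul_rpow_of_nonneg _ _ (by positivity), ← ENNReal.rpow_mul,
      show 2 / p * (p / 2) = 1 by field_simp, ENNReal.rpow_one]
  have hfm : Measurable fun z => ‖f z‖ₑ ^ p := hf.measurable.enorm.pow_const p
  have htot := hmink.trans (lintegral_mono hin)
  have hfub : ∫⁻ y, ∫⁻ x, ‖f (pt (x, y))‖ₑ ^ p = ∫⁻ z, ‖f z‖ₑ ^ p := by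
    rw [lintegral_plane hfm, lintegral_lintegral_swap]
    exact (hfm.comp (continuous_pt.measurable.comp measurable_swap)).aemeasurable
  rw [lintegral_const_mul' _ _ (ENNReal.rpow_ne_top_of_nonneg (by positivity) ENNReal.coe_ne_top),
    hfub, one_div_div] at htot
  have h2 := ENNReal.rpow_le_rpow htot (z := 2 / p) (by positivity)
  rw [← ENNReal.rpow_mul, show p / 2 * (2 / p) = 1 by field_simp, ENNReal.rpow_one,
    ENNReal.mul_rpow_of_nonneg _ _ (by positivity), ← ENNReal.rpow_mul,
    show p / 2 * (2 / p) = 1 by field_simp, ENNReal.rpow_one] at h2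
  refine h2.trans (le_of_eq ?_)
  rw [eLpNorm_ofReal_eq hp0, ← ENNReal.rpow_mul]
  congr 2; ring

lemma setLIntegral_neg_abs (u v : ℝ) (h : ℝ → ℝ≥0∞) :
    ∫⁻ x in {x | u ≤ |x| ∧ |x| < v}, h (-x) = ∫⁻ x in {x | u ≤ |x| ∧ |x| < v}, h x := by
  have hSm : MeasurableSet {x : ℝ | u ≤ |x| ∧ |x| < v} :=
    (measurableSet_le measurable_const measurable_id.abs).inter
    (measurableSet_lt measurable_id.abs measurable_const)
  rw [← lintegral_indicator hSm, ← lintegral_indicator hSm,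
    ← lintegral_neg_eq_self (f := Set.indicator _ _)]
  congr 1; ext x
  by_cases hx : u ≤ |x| ∧ |x| < v
  · rw [Set.indicator_of_mem (by simpa using hx), Set.indicator_of_mem (by simpa using hx)]; simp
  · rw [Set.indicator_of_notMem (by simpa using hx), Set.indicator_of_notMem (by simpa using hx)]

/-- For a fixed first frequency the form is a one-dimensional Gaussian multiplier acting in y. The
sign in `partialFourier g (-x)` comes from the inverse transform of g. -/
lemma multForm_regSymbol_eq {ε γ δ u v t : ℝ} (hγ : 0 ≤ γ) (hδ : 0 < δ) (hu : 0 < u) (hv : 0 < v)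
    {f g : Plane → ℂ} (hf : Integrable f) (hg : Integrable g) :
    multForm (regSymbol ε γ δ u v t) f g = ∫ x, xSymbol γ u v t x *
      multForm (fun y : ℝ => Complex.exp (-Real.pi * gaussParam ε δ t x * y ^ 2))
        (partialFourier f x) (partialFourier g (-x)) := by
  rw [multForm, integral_plane (integrable_multForm (integrable_regSymbol hγ hδ hu hv) hf hg)]
  congr 1; ext x
  rw [multForm, ← integral_const_mul]
  congr 1; ext y
  rw [fourier_pt hf, fourierInv_pt hg, regSymbol]
  simp only [pt_zero, pt_one]
  ring

/-- A one-dimensional Schrödinger estimate at time of order t/x: the kernel is at most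
(|x|/|t|)^(1/2), the symbol at most 1, and interpolation gives the power θ. -/
lemma norm_multForm_gaussian_le {ε δ t x θ p : ℝ} (hε : |ε| = 1) (hδ : 0 < δ) (hx : x ≠ 0)
    (ht : t ≠ 0) (hθ0 : 0 ≤ θ) (hθ1 : θ ≤ 1) (hp : p * (1 + θ) = 2)
    {f g : ℝ → ℂ} (hfm : Measurable f) (hgm : Measurable g) (hf : MemL12 f volume)
    (hg : MemL12 g volume) :
    ‖multForm (fun y : ℝ => Complex.exp (-Real.pi * gaussParam ε δ t x * y ^ 2)) f g‖ ≤
      |t| ^ (-(θ / 2)) * |x| ^ (θ / 2) * (eLpNorm f (ENNReal.ofReal p) volume).toReal *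
        (eLpNorm g (ENNReal.ofReal p) volume).toReal := by
  have hx0 : 0 < |x| := abs_pos.2 hx
  have ht0 : 0 < |t| := abs_pos.2 ht
  have hre : 0 < (gaussParam ε δ t x).re := by rw [gaussParam_re]; positivity
  refine (norm_multForm_le_interp (integrable_gaussian hre) (norm_fourierInv_gaussian_le hre)
    (norm_gaussian_le hre.le) hθ0 hθ1 hp hfm hgm hf hg).trans ?_
  refine mul_le_mul_of_nonneg_right (mul_le_mul_of_nonneg_right ?_ ENNReal.toReal_nonneg)
    ENNReal.toReal_nonneg
  rw [Real.one_rpow, mul_one, ← Real.rpow_mul (norm_nonneg _)]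
  have hn : |t| / |x| ≤ ‖gaussParam ε δ t x‖ := by
    refine le_trans ?_ (Complex.abs_im_le_norm _)
    rw [gaussParam_im, abs_mul, abs_div, abs_mul, hε, one_mul, abs_of_pos (by norm_num : (0:ℝ) < 2)]
    have : 0 ≤ |t| / |x| := by positivity
    linarith
  calc ‖gaussParam ε δ t x‖ ^ (-(1 / 2) * θ) ≤ (|t| / |x|) ^ (-(1 / 2) * θ) :=
        Real.rpow_le_rpow_of_nonpos (by positivity) hn (by linarith)
    _ = _ := by
        rw [Real.div_rpow ht0.le hx0.le, div_eq_mul_inv, ← Real.rpow_neg hx0.le]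
        congr 2 <;> ring

/-- The decay estimate on the boundary line of the admissible region. -/
lemma exists_hasDecay_endpoint {ε θ p : ℝ} (hε : |ε| = 1) (hθ0 : 0 < θ) (hθ1 : θ < 1)
    (hp : p * (1 + θ) = 2) : ∃ C, 0 ≤ C ∧ HasDecay ε (3 / 2 * θ) (θ / 2) p C := by
  have hp' : p = 2 / (1 + θ) := by field_simp; linarith
  have hp1 : 1 < p := by rw [hp', lt_div_iff₀ (by linarith)]; linarith
  have hp0 : 0 < p := by linarith
  obtain ⟨C, hC⟩ := exists_lintegral_riesz_mul_partialFourier_le hθ0 hθ1 hp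
  refine ⟨C, C.2, fun δ M t f g hδ ht hf hfs hg hgs => ?_⟩
  set u : ℝ := 2 ^ (-(M : ℝ)) with hu
  set v : ℝ := 2 ^ (M : ℝ) with hv
  have hu0 : 0 < u := by positivity
  have hv0 : 0 < v := by positivity
  have ht0 : 0 < |t| := abs_pos.2 ht
  set S : Set ℝ := {x | u ≤ |x| ∧ |x| < v} with hS
  have hSm : MeasurableSet S := (measurableSet_le measurable_const measurable_id.abs).inter
    (measurableSet_lt measurable_id.abs measurable_const)
  have hfi := memLp_one_iff_integrable.1 (memL12_of_hasCompactSupport hf hfs).1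
  have hgi := memLp_one_iff_integrable.1 (memL12_of_hasCompactSupport hg hgs).1
  set P := ENNReal.ofReal p with hP
  have hfP : eLpNorm f P volume ≠ ∞ := (hf.memLp_of_hasCompactSupport hfs).2.ne
  have hgP : eLpNorm g P volume ≠ ∞ := (hg.memLp_of_hasCompactSupport hgs).2.ne
  have hmN : ∀ {h : Plane → ℂ}, Continuous h →
      Measurable fun x => eLpNorm (partialFourier h x) P volume := fun {h} hh => by
    simp only [hP, eLpNorm_ofReal_eq hp0]
    exact (((measurable_partialFourier hh).enorm.pow_const p).lintegral_prod_right').pow_const _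
  have hmf := hmN hf
  have hmg : Measurable fun x => eLpNorm (partialFourier g (-x)) P volume :=
    (hmN hg).comp measurable_neg
  have key : ‖multForm (regSymbol ε (3 / 2 * θ) δ u v t) f g‖ₑ ≤
      ENNReal.ofReal (|t| ^ (-(θ / 2))) * (C * (eLpNorm f P volume * eLpNorm g P volume)) := by
    rw [multForm_regSymbol_eq (by positivity) hδ hu0 hv0 hfi hgi]
    calc _ ≤ ∫⁻ x, ‖xSymbol (3 / 2 * θ) u v t x *
          multForm (fun y : ℝ => Complex.exp (-Real.pi * gaussParam ε δ t x * y ^ 2))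
          (partialFourier f x) (partialFourier g (-x))‖ₑ := enorm_integral_le_lintegral_enorm _
      _ ≤ ∫⁻ x, S.indicator (fun x => ENNReal.ofReal (|t| ^ (-(θ / 2))) *
          ((riesz (θ / 2) x * eLpNorm (partialFourier f x) P volume) *
            (riesz (θ / 2) x * eLpNorm (partialFourier g (-x)) P volume))) x := by
          refine lintegral_mono fun x => ?_
          by_cases hx : u ≤ |x| ∧ |x| < v
          · rw [Set.indicator_of_mem (show x ∈ S from hx)]
            have hx0 : 0 < |x| := hu0.trans_le hx.1
            have hxn : ‖xSymbol (3 / 2 * θ) u v t x‖ = |x| ^ (-(3 / 2 * θ)) := by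
              rw [xSymbol, if_pos hx, norm_mul, mul_comm Complex.I, Complex.norm_exp_ofReal_mul_I,
                mul_one, Complex.norm_real, Real.norm_of_nonneg (by positivity)]
            have hA := memLp_partialFourier hf hfs P x
            have hB := memLp_partialFourier hg hgs P (-x)
            have hle := norm_multForm_gaussian_le hε hδ (abs_pos.1 hx0) ht hθ0.le hθ1.le hp
              (measurable_partialFourier hf).of_uncurry_left
              (measurable_partialFourier hg).of_uncurry_left
              ⟨memLp_partialFourier hf hfs 1 x, memLp_partialFourier hf hfs 2 x⟩
              ⟨memLp_partialFourier hg hgs 1 (-x), memLp_partialFourier hg hgs 2 (-x)⟩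
            rw [← ofReal_norm, norm_mul, hxn]
            have h2 := mul_le_mul_of_nonneg_left hle (by positivity : 0 ≤ |x| ^ (-(3 / 2 * θ)))
            refine (ENNReal.ofReal_le_ofReal h2).trans (le_of_eq ?_)
            have e1 : |x| ^ (-(3 / 2 * θ)) * (|t| ^ (-(θ / 2)) * |x| ^ (θ / 2) *
                (eLpNorm (partialFourier f x) P volume).toReal *
                (eLpNorm (partialFourier g (-x)) P volume).toReal) =
                |t| ^ (-(θ / 2)) * ((|x| ^ (-(θ / 2)) *
                (eLpNorm (partialFourier f x) P volume).toReal) * (|x| ^ (-(θ / 2)) *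
                (eLpNorm (partialFourier g (-x)) P volume).toReal)) := by
              -- The weight of D_x and the growth from the Schrödinger estimate combine to |x|^(-θ),
              -- shared equally between f and g for Cauchy–Schwarz.
              have : |x| ^ (-(3 / 2 * θ)) * |x| ^ (θ / 2) = |x| ^ (-(θ / 2)) * |x| ^ (-(θ / 2)) := by
                rw [← Real.rpow_add hx0, ← Real.rpow_add hx0]; congr 1; ring
              linear_combination (|t| ^ (-(θ / 2)) *
                (eLpNorm (partialFourier f x) P volume).toReal *
                (eLpNorm (partialFourier g (-x)) P volume).toReal) * this
            erw [e1]
            rw [ENNReal.ofReal_mul (by positivity), ENNReal.ofReal_mul (by positivity),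
              ENNReal.ofReal_mul (by positivity), ENNReal.ofReal_mul (by positivity),
              ENNReal.ofReal_toReal hA.2.ne, ENNReal.ofReal_toReal hB.2.ne]
            rfl
          · rw [Set.indicator_of_notMem (show x ∉ S from hx), xSymbol, if_neg hx]; simp
      _ = ENNReal.ofReal (|t| ^ (-(θ / 2))) * ∫⁻ x in S,
          ((riesz (θ / 2) x * eLpNorm (partialFourier f x) P volume) *
            (riesz (θ / 2) x * eLpNorm (partialFourier g (-x)) P volume)) := by
          rw [lintegral_indicator hSm, lintegral_const_mul' _ _ ENNReal.ofReal_ne_top]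
      _ ≤ _ := by
          refine mul_le_mul_right ?_ _
          have hr2 : ∀ (x : ℝ) (b : ℝ≥0∞), (riesz (θ / 2) x * b) ^ (2 : ℝ) =
              riesz θ x * b ^ (2 : ℝ) := fun x b => by
            rw [ENNReal.mul_rpow_of_nonneg _ _ (by norm_num), riesz_rpow (by norm_num)]
            congr 2; ring
          refine (ENNReal.lintegral_mul_le_Lp_mul_Lq _ Real.HolderConjugate.two_two
            ((measurable_riesz _).mul hmf).aemeasurable
            ((measurable_riesz _).mul hmg).aemeasurable).trans ?_
          simp only [Pi.mul_apply, hr2]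
          have h1 := hC u v hu0 f hf hfs
          have h2 := hC u v hu0 g hg hgs
          have e2 : ∫⁻ x in S, riesz θ x * eLpNorm (partialFourier g (-x)) P volume ^ (2 : ℝ) =
              ∫⁻ x in S, riesz θ x * eLpNorm (partialFourier g x) P volume ^ (2 : ℝ) := by
            rw [hS, ← setLIntegral_neg_abs]
            simp only [riesz_neg, neg_neg]
          rw [e2]
          have h3 := mul_le_mul' (ENNReal.rpow_le_rpow h1 (z := 1 / 2) (by norm_num))
            (ENNReal.rpow_le_rpow h2 (z := 1 / 2) (by norm_num))
          refine h3.trans (le_of_eq ?_)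
          rw [ENNReal.mul_rpow_of_nonneg _ _ (by norm_num),
            ENNReal.mul_rpow_of_nonneg _ _ (by norm_num), ← ENNReal.rpow_mul, ← ENNReal.rpow_mul]
          have hcc : (C : ℝ≥0∞) ^ (1 / 2 : ℝ) * (C : ℝ≥0∞) ^ (1 / 2 : ℝ) = C := by
            rw [← ENNReal.rpow_add_of_nonneg _ _ (by norm_num) (by norm_num)]
            norm_num
          norm_num
          nth_rewrite 3 [← hcc]
          norm_num
          ring
  have hfin : ENNReal.ofReal (|t| ^ (-(θ / 2))) *
      (C * (eLpNorm f P volume * eLpNorm g P volume)) ≠ ∞ :=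
    ENNReal.mul_ne_top ENNReal.ofReal_ne_top
      (ENNReal.mul_ne_top ENNReal.coe_ne_top (ENNReal.mul_ne_top hfP hgP))
  have h := ENNReal.toReal_mono hfin key
  rw [toReal_enorm, ENNReal.toReal_mul, ENNReal.toReal_mul, ENNReal.toReal_mul,
    ENNReal.toReal_ofReal (by positivity), ENNReal.coe_toReal] at h
  refine h.trans (le_of_eq ?_)
  ring

/-! ### The TT* argument for a supremum of test vectors -/

section Selection

variable {H : Type*} [NormedAddCommGroup H] [InnerProductSpace ℂ H]

/-- At each `t`, one of the first vectors `v k t` that is most correlated with `φ`. -/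
def bestVector (v : ℕ → ℝ → H) (φ : H) : ℕ → ℝ → H
  | 0 => v 0
  | K + 1 => fun t => if ‖inner ℂ (bestVector v φ K t) φ‖ < ‖inner ℂ (v (K + 1) t) φ‖ then
      v (K + 1) t else bestVector v φ K t

lemma stronglyMeasurable_bestVector {v : ℕ → ℝ → H} (hv : ∀ k, StronglyMeasurable (v k)) (φ : H)
    (K : ℕ) : StronglyMeasurable (bestVector v φ K) := by
  induction K with
  | zero => exact hv 0
  | succ K ih =>
    refine StronglyMeasurable.ite (measurableSet_lt ?_ ?_) (hv _) ih
    · exact (ih.inner stronglyMeasurable_const).norm.measurable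
    · exact ((hv _).inner stronglyMeasurable_const).norm.measurable

lemma exists_bestVector_eq (v : ℕ → ℝ → H) (φ : H) (K : ℕ) (t : ℝ) :
    ∃ k ≤ K, bestVector v φ K t = v k t := by
  induction K with
  | zero => exact ⟨0, le_rfl, rfl⟩
  | succ K ih =>
    by_cases h : ‖inner ℂ (bestVector v φ K t) φ‖ < ‖inner ℂ (v (K + 1) t) φ‖
    · exact ⟨K + 1, le_rfl, if_pos h⟩
    · obtain ⟨k, hk, e⟩ := ih
      exact ⟨k, hk.trans K.le_succ, (if_neg h).trans e⟩

lemma le_bestVector_succ (v : ℕ → ℝ → H) (φ : H) (K : ℕ) (t : ℝ) :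
    ‖inner ℂ (bestVector v φ K t) φ‖ ≤ ‖inner ℂ (bestVector v φ (K + 1) t) φ‖ ∧
      ‖inner ℂ (v (K + 1) t) φ‖ ≤ ‖inner ℂ (bestVector v φ (K + 1) t) φ‖ := by
  by_cases h : ‖inner ℂ (bestVector v φ K t) φ‖ < ‖inner ℂ (v (K + 1) t) φ‖
  · have e : bestVector v φ (K + 1) t = v (K + 1) t := if_pos h
    rw [e]; exact ⟨h.le, le_rfl⟩
  · have e : bestVector v φ (K + 1) t = bestVector v φ K t := if_neg h
    rw [e]; exact ⟨le_rfl, not_lt.1 h⟩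

/-- The `TT*` argument for the supremum over a countable family. -/
lemma lintegral_iSup_inner_rpow_le [CompleteSpace H] {q p A : ℝ} (hp1 : 1 < p) (hp2 : p < 2)
    (hpq : p.HolderConjugate q) {v : ℕ → ℝ → H} (hv : ∀ k, StronglyMeasurable (v k)) {R : ℕ → ℝ}
    (hR : ∀ k t, ‖v k t‖ ≤ R k)
    (hvv : ∀ k l s t, s ≠ t →
      ‖inner ℂ (v k s) (v l t)‖ₑ ≤ ENNReal.ofReal A * riesz (2 / q) (s - t))
    (φ : H) :
    (∫⁻ t, (⨆ k, ‖inner ℂ (v k t) φ‖ₑ) ^ q) ^ (1 / q) ≤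
      ENNReal.ofReal (A * (2 * hlsConst p)) ^ (1 / 2 : ℝ) * ‖φ‖ₑ := by
  have hq0 : 0 < q := hpq.symm.pos
  set V := bestVector v φ with hV
  have hVm := fun K => stronglyMeasurable_bestVector hv φ K
  have hmono : ∀ t, Monotone fun K => ‖inner ℂ (V K t) φ‖ₑ := fun t =>
    monotone_nat_of_le_succ fun K => enorm_le_iff_norm_le.2 (le_bestVector_succ v φ K t).1
  have hsup : ∀ t, ⨆ k, ‖inner ℂ (v k t) φ‖ₑ ≤ ⨆ K, ‖inner ℂ (V K t) φ‖ₑ := fun t => by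
    refine iSup_mono fun k => ?_
    cases k with
    | zero => exact le_rfl
    | succ k => exact enorm_le_iff_norm_le.2 (le_bestVector_succ v φ k t).2
  have hK : ∀ K, ∫⁻ t, ‖inner ℂ (V K t) φ‖ₑ ^ q ≤
      (ENNReal.ofReal (A * (2 * hlsConst p)) ^ (1 / 2 : ℝ) * ‖φ‖ₑ) ^ q := fun K => by
    -- This bound grows with K, but the TT* estimate uses boundedness only qualitatively; its
    -- constant sees only the correlations, which hold for any selection.
    have hb : ∀ t, ‖V K t‖ ≤ ∑ k ∈ Finset.range (K + 1), R k := fun t => by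
      obtain ⟨k, hk, e⟩ := exists_bestVector_eq v φ K t
      rw [hV, e]
      refine (hR k t).trans (Finset.single_le_sum (f := R) (fun i _ => (norm_nonneg _).trans (hR i 0))
        (Finset.mem_range.2 (Nat.lt_succ_of_le hk)))
    have h := lintegral_inner_rpow_le hp1 hp2 hpq (hVm K) hb (A := A) (fun s t hst => by
      obtain ⟨k, -, e⟩ := exists_bestVector_eq v φ K s
      obtain ⟨l, -, e'⟩ := exists_bestVector_eq v φ K t
      rw [e, e']
      exact hvv k l s t hst) φ
    have := ENNReal.rpow_le_rpow h hq0.le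
    rwa [← ENNReal.rpow_mul, one_div_mul_cancel hq0.ne', ENNReal.rpow_one] at this
  have hlim : ∫⁻ t, (⨆ K, ‖inner ℂ (V K t) φ‖ₑ) ^ q ≤
      (ENNReal.ofReal (A * (2 * hlsConst p)) ^ (1 / 2 : ℝ) * ‖φ‖ₑ) ^ q := by
    have e : ∀ t, (⨆ K, ‖inner ℂ (V K t) φ‖ₑ) ^ q = ⨆ K, ‖inner ℂ (V K t) φ‖ₑ ^ q := fun t =>
      (ENNReal.orderIsoRpow q hq0).map_iSup _
    simp only [e]
    rw [lintegral_iSup]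
    · exact iSup_le hK
    · exact fun K => (((hVm K).inner stronglyMeasurable_const).enorm).pow_const q
    · exact fun i j hij t => ENNReal.rpow_le_rpow (hmono t hij) hq0.le
  rw [one_div, ENNReal.rpow_inv_le_iff hq0]
  refine (lintegral_mono fun t => ENNReal.rpow_le_rpow (hsup t) hq0.le).trans hlim

end Selection

/-! ### Duality and norming sequences -/

section Duality

variable {α : Type*} [MeasurableSpace α] {μ : Measure α}

lemma eLpNorm_le_of_forall_integral_mul_le_of_ne_top {F : α → ℂ} {r P : ℝ≥0∞} [r.HolderConjugate P]
    (hr2 : 2 ≤ r) (hrt : r ≠ ∞) (hF : MemLp F r μ) {B : ℝ≥0∞}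
    (h : ∀ G : α → ℂ, MemLp G P μ → ‖∫ z, F z * G z ∂μ‖ₑ ≤ B * eLpNorm G P μ) :
    eLpNorm F r μ ≤ B := by
  have hr0 : r ≠ 0 := fun h => by simp [h] at hr2
  have hs2 : 2 ≤ r.toReal := by simpa using ENNReal.toReal_mono hrt hr2
  have hsp : r.toReal.HolderConjugate P.toReal :=
    ENNReal.HolderConjugate.toReal (by linarith)
  have hP0 : P ≠ 0 := fun h => by have := hsp.symm.pos; simp [h] at this
  have hPt : P ≠ ∞ := fun h => by have := hsp.symm.pos; simp [h] at this
  set s := r.toReal with hs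
  set p := P.toReal with hp
  have hs0 : 0 < s := by linarith
  have hp0 : 0 < p := hsp.symm.pos
  set G : α → ℂ := fun z => (starRingEnd ℂ) (F z) * ((‖F z‖ ^ (s - 2) : ℝ) : ℂ) with hG
  have hGm : AEStronglyMeasurable G μ := by
    have h1 : AEStronglyMeasurable (fun z => ((‖F z‖ ^ (s - 2) : ℝ) : ℂ)) μ :=
      ((hF.1.norm.aemeasurable.pow_const _).complex_ofReal).aestronglyMeasurable
    exact (RCLike.continuous_conj.comp_aestronglyMeasurable hF.1).mul h1
  have hGn : ∀ z, ‖G z‖ₑ ^ p = ‖F z‖ₑ ^ s := fun z => by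
    have e : ‖G z‖ = ‖F z‖ ^ (s - 1) := by
      rw [hG]
      simp only [norm_mul, RCLike.norm_conj, Complex.norm_real]
      rw [Real.norm_of_nonneg (by positivity)]
      rcases eq_or_lt_of_le (norm_nonneg (F z)) with h0 | h0
      · rw [← h0, Real.zero_rpow (x := s - 1) (by linarith), zero_mul]
      · nth_rewrite 1 [← Real.rpow_one ‖F z‖]
        rw [← Real.rpow_add h0]; congr 1; ring
    rw [← ofReal_norm, e, ← ENNReal.ofReal_rpow_of_nonneg (norm_nonneg _) (by linarith), ofReal_norm,
      ← ENNReal.rpow_mul]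
    congr 1
    have := hsp.sub_one_mul_conj
    linarith
  set X := ∫⁻ z, ‖F z‖ₑ ^ s ∂μ with hX
  have hFX : eLpNorm F r μ = X ^ (1 / s) := eLpNorm_eq_lintegral_rpow_enorm_toReal hr0 hrt
  have hGX : eLpNorm G P μ = X ^ (1 / p) := by
    rw [eLpNorm_eq_lintegral_rpow_enorm_toReal hP0 hPt, hX, ← hp]; simp only [hGn]
  have hXt : X ≠ ∞ := by
    intro hx
    have := hF.2.ne
    rw [hFX, hx, ENNReal.top_rpow_of_pos (by positivity)] at this
    exact this rfl
  have hGL : MemLp G P μ :=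
    ⟨hGm, by rw [hGX]; exact (ENNReal.rpow_ne_top_of_nonneg (by positivity) hXt).lt_top⟩
  have hInteg : ‖∫ z, F z * G z ∂μ‖ₑ = X := by
    have e : ∀ z, F z * G z = ((‖F z‖ ^ s : ℝ) : ℂ) := fun z => by
      rw [hG]
      simp only
      rw [← mul_assoc, Complex.mul_conj, Complex.normSq_eq_norm_sq, ← Complex.ofReal_mul]
      congr 1
      rcases eq_or_lt_of_le (norm_nonneg (F z)) with h0 | h0
      · rw [← h0, Real.zero_rpow hs0.ne']; simp
      · rw [← Real.rpow_natCast, ← Real.rpow_add h0]; congr 1; push_cast; ring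
    simp only [e]
    rw [integral_complex_ofReal, ← ofReal_norm, Complex.norm_real,
      Real.norm_of_nonneg (integral_nonneg fun _ => by positivity),
      ofReal_integral_eq_lintegral_ofReal (hF.integrable_norm_rpow hr0 hrt)
        (Eventually.of_forall fun _ => by positivity)]
    congr 1; ext z
    rw [← ENNReal.ofReal_rpow_of_nonneg (norm_nonneg _) hs0.le, ofReal_norm]
  have h1 := h G hGL
  rw [hInteg, hGX] at h1
  rw [hFX]
  by_cases hX0 : X = 0
  · rw [hX0, ENNReal.zero_rpow_of_pos (by positivity)]; exact zero_le
  have hne : X ^ (1 / p) ≠ 0 := by simp [hX0, hXt]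
  have hnt : X ^ (1 / p) ≠ ∞ := ENNReal.rpow_ne_top_of_nonneg (by positivity) hXt
  rw [← ENNReal.mul_le_mul_iff_left hne hnt]
  refine le_trans (le_of_eq ?_) h1
  rw [← ENNReal.rpow_add _ _ hX0 hXt, one_div, one_div, hsp.inv_add_inv_eq_one, ENNReal.rpow_one]

/-- If |F| > B on a set of positive measure, test with the conjugate phase of F on a subset of
finite positive measure. -/
lemma eLpNorm_top_le_of_forall_integral_mul_le [SigmaFinite μ] {F : α → ℂ} (hFm : Measurable F)
    (hF : MemLp F ∞ μ) {B : ℝ≥0∞}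
    (h : ∀ G : α → ℂ, MemLp G 1 μ → ‖∫ z, F z * G z ∂μ‖ₑ ≤ B * eLpNorm G 1 μ) :
    eLpNorm F ∞ μ ≤ B := by
  by_contra hlt
  rw [not_le] at hlt
  have hBt : B ≠ ∞ := ne_top_of_lt hlt
  set S := {z | B < ‖F z‖ₑ} with hS
  have hSm : MeasurableSet S := measurableSet_lt measurable_const hFm.enorm
  have hS0 : 0 < μ S := by
    rw [pos_iff_ne_zero]
    intro h0
    have : ∀ᵐ z ∂μ, ‖F z‖ₑ ≤ B := by
      rw [ae_iff]; simpa [hS, not_le] using h0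
    have := essSup_le_of_ae_le B this
    rw [eLpNorm_exponent_top] at hlt
    exact absurd this (not_le.2 hlt)
  obtain ⟨A, hAm, hAS, hA0, hAt⟩ := Measure.exists_subset_measure_lt_top hSm hS0
  set G : α → ℂ := A.indicator fun z => (starRingEnd ℂ) (F z) * ((‖F z‖⁻¹ : ℝ) : ℂ) with hG
  have hGm : Measurable G :=
    ((RCLike.continuous_conj.measurable.comp hFm).mul hFm.norm.inv.complex_ofReal).indicator hAm
  have hFpos : ∀ z ∈ A, 0 < ‖F z‖ := fun z hz => by
    have : B < ‖F z‖ₑ := hAS hz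
    rw [norm_pos_iff]
    intro h0
    simp [h0] at this
  have hGn : ∀ z, ‖G z‖ₑ = A.indicator (fun _ => (1 : ℝ≥0∞)) z := fun z => by
    by_cases hz : z ∈ A
    · rw [Set.indicator_of_mem hz, hG, Set.indicator_of_mem hz, ← ofReal_norm, norm_mul,
        RCLike.norm_conj, Complex.norm_real, norm_inv, norm_norm,
        mul_inv_cancel₀ (hFpos z hz).ne', ENNReal.ofReal_one]
    · rw [Set.indicator_of_notMem hz, hG, Set.indicator_of_notMem hz, enorm_zero]
  have hG1 : eLpNorm G 1 μ = μ A := by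
    rw [eLpNorm_one_eq_lintegral_enorm]
    simp only [hGn]
    rw [lintegral_indicator_const hAm, one_mul]
  have hGL : MemLp G 1 μ := ⟨hGm.aestronglyMeasurable, by rw [hG1]; exact hAt⟩
  have h1 := h G hGL
  rw [hG1] at h1
  have e : ∀ z, F z * G z = ((A.indicator (fun z => ‖F z‖) z : ℝ) : ℂ) := fun z => by
    by_cases hz : z ∈ A
    · rw [Set.indicator_of_mem hz, hG, Set.indicator_of_mem hz, ← mul_assoc, Complex.mul_conj,
        Complex.normSq_eq_norm_sq, ← Complex.ofReal_mul]
      congr 1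
      have := (hFpos z hz).ne'
      field_simp
    · rw [Set.indicator_of_notMem hz, hG, Set.indicator_of_notMem hz]; simp
  have hFA : IntegrableOn (fun z => ‖F z‖) A μ := by
    have hGF : Integrable (fun z => F z * G z) μ := by
      have : Integrable (F * G) μ := MemLp.integrable_mul hF hGL
      exact this
    simp only [e] at hGF
    rw [← integrable_indicator_iff hAm]
    refine hGF.re.congr (Eventually.of_forall fun z => ?_)
    exact Complex.ofReal_re _
  have hInteg : ‖∫ z, F z * G z ∂μ‖ₑ = ∫⁻ z in A, ‖F z‖ₑ ∂μ := by
    simp only [e]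
    rw [integral_complex_ofReal, integral_indicator hAm, ← ofReal_norm, Complex.norm_real,
      Real.norm_of_nonneg (integral_nonneg fun _ => by positivity),
      ofReal_integral_eq_lintegral_ofReal hFA (Eventually.of_forall fun _ => by positivity)]
    simp only [ofReal_norm]
  rw [hInteg] at h1
  have h2 : B * μ A < ∫⁻ z in A, ‖F z‖ₑ ∂μ := by
    have := setLIntegral_strict_mono (μ := μ) hAm hA0.ne' hFm.enorm
      (f := fun _ => B) (by rw [setLIntegral_const]; exact ENNReal.mul_ne_top hBt hAt.ne)
      (Eventually.of_forall fun z hz => hAS hz)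
    rwa [setLIntegral_const] at this
  exact absurd h1 (not_le.2 h2)

lemma eLpNorm_le_of_forall_integral_mul_le [SigmaFinite μ] {F : α → ℂ} (hFm : Measurable F)
    {r P : ℝ≥0∞} [r.HolderConjugate P] (hr2 : 2 ≤ r) (hF : MemLp F r μ) {B : ℝ≥0∞}
    (h : ∀ G : α → ℂ, MemLp G P μ → ‖∫ z, F z * G z ∂μ‖ₑ ≤ B * eLpNorm G P μ) :
    eLpNorm F r μ ≤ B := by
  by_cases hrt : r = ∞
  · subst hrt
    have hP : P = 1 := by
      have := ENNReal.HolderConjugate.inv_add_inv_eq_one ∞ P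
      simpa using this
    subst hP
    exact eLpNorm_top_le_of_forall_integral_mul_le hFm hF h
  · exact eLpNorm_le_of_forall_integral_mul_le_of_ne_top hr2 hrt hF h

end Duality

/-- A countable family of test functions that computes the `L^r` norm. -/
lemma exists_norming_sequence {r P : ℝ≥0∞} [r.HolderConjugate P] (hr2 : 2 ≤ r) :
    ∃ h : ℕ → Plane → ℂ, (∀ k, Continuous (h k)) ∧ (∀ k, HasCompactSupport (h k)) ∧
      (∀ k, eLpNorm (h k) P volume ≤ 1) ∧
      ∀ F : Plane → ℂ, Measurable F → MemLp F r volume → ∀ B : ℝ≥0∞,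
        (∀ k, ‖∫ z, F z * h k z‖ₑ ≤ B) → eLpNorm F r volume ≤ B := by
  have hr1 : 1 ≤ r := le_trans (by norm_num) hr2
  have hinv := ENNReal.HolderConjugate.inv_add_inv_eq_one r P
  have hP1 : 1 ≤ P := by
    rw [← ENNReal.inv_le_one, ← hinv]
    exact le_add_self
  -- The dual exponent is finite because r ≥ 2. Hence compactly supported continuous functions are
  -- dense in L^P, and L^P is separable, even when r = ∞.
  have hPt : P ≠ ∞ := fun h => by
    rw [h, ENNReal.inv_top, add_zero, ENNReal.inv_eq_one] at hinv
    rw [hinv] at hr2; norm_num at hr2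
  have : Fact (1 ≤ P) := ⟨hP1⟩
  have : Fact (1 ≤ r) := ⟨hr1⟩
  have : Fact (P ≠ ∞) := ⟨hPt⟩
  let S : Set (Lp ℂ P (volume : Measure Plane)) :=
    {g | ∃ h : Plane → ℂ, Continuous h ∧ HasCompactSupport h ∧ g =ᵐ[volume] h}
  have hSd : Dense S := by
    intro g
    rw [EMetric.mem_closure_iff]
    intro η hη
    obtain ⟨h, hs, hle, hc, hL⟩ := (Lp.memLp g).exists_hasCompactSupport_eLpNorm_sub_le hPt
      (ENNReal.half_pos hη.ne').ne'
    refine ⟨hL.toLp h, ⟨h, hc, hs, hL.coeFn_toLp⟩, ?_⟩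
    by_cases hηt : η = ∞
    · rw [hηt]; exact edist_lt_top _ _
    refine lt_of_le_of_lt ?_ (ENNReal.half_lt_self hη.ne' hηt)
    rw [Lp.edist_def]
    refine le_trans (le_of_eq (eLpNorm_congr_ae ?_)) hle
    filter_upwards [hL.coeFn_toLp] with z hz
    simp [hz]
  obtain ⟨D, hDS, hDc, hDd⟩ := hSd.exists_countable_dense_subset
  obtain ⟨d, rfl⟩ := hDc.exists_eq_range hDd.nonempty
  have hd : ∀ k, ∃ h : Plane → ℂ, Continuous h ∧ HasCompactSupport h ∧ d k =ᵐ[volume] h :=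
    fun k => hDS ⟨k, rfl⟩
  choose h hc hs he using hd
  refine ⟨fun k => ((‖d k‖⁻¹ : ℝ) : ℂ) • h k, fun k => (hc k).const_smul _,
    fun k => (hs k).smul_left, fun k => ?_, fun F hFm hF B hB => ?_⟩
  · rw [eLpNorm_const_smul, ← eLpNorm_congr_ae (he k), ← Lp.enorm_def]
    rw [← ofReal_norm, ← ofReal_norm, Complex.norm_real, norm_inv, norm_norm,
      ← ENNReal.ofReal_mul (by positivity), ← ENNReal.ofReal_one]
    exact ENNReal.ofReal_le_ofReal (inv_mul_le_one)
  · by_cases hBt : B = ∞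
    · rw [hBt]; exact le_top
    refine eLpNorm_le_of_forall_integral_mul_le (P := P) hFm hr2 hF fun G hG => ?_
    set Fl := hF.toLp F with hFl
    let T : Lp ℂ P (volume : Measure Plane) →L[ℂ] ℂ :=
      (ContinuousLinearMap.mul ℂ ℂ).lpPairing volume r P Fl
    have hT : ∀ g : Lp ℂ P (volume : Measure Plane), T g = ∫ z, F z * g z := fun g => by
      change (ContinuousLinearMap.mul ℂ ℂ).lpPairing volume r P Fl g = _
      rw [ContinuousLinearMap.lpPairing_eq_integral]
      refine integral_congr_ae ?_
      filter_upwards [hF.coeFn_toLp] with z hz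
      simp [hFl, hz]
    -- Pairing with F ∈ L^r is continuous on L^P, so the inequality is a closed condition and
    -- extends from the dense sequence. A zero vector in the sequence is normalized by 0⁻¹ = 0 and
    -- treated separately.
    have hcl : ∀ g, ‖T g‖ ≤ B.toReal * ‖g‖ := by
      have hclosed : IsClosed {g | ‖T g‖ ≤ B.toReal * ‖g‖} :=
        isClosed_le (by fun_prop) (by fun_prop)
      have hsub : Set.range d ⊆ {g | ‖T g‖ ≤ B.toReal * ‖g‖} := by
        rintro _ ⟨k, rfl⟩
        have e1 : T (d k) = ∫ z, F z * h k z := by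
          rw [hT]
          refine integral_congr_ae ?_
          filter_upwards [he k] with z hz
          rw [hz]
        have e2 : ∫ z, F z * (((‖d k‖⁻¹ : ℝ) : ℂ) • h k) z = ((‖d k‖⁻¹ : ℝ) : ℂ) * T (d k) := by
          rw [e1, ← integral_const_mul]
          congr 1; ext z; simp; ring
        have h3 := ENNReal.toReal_mono hBt (hB k)
        rw [e2, toReal_enorm, norm_mul, Complex.norm_real, norm_inv, norm_norm] at h3
        change ‖T (d k)‖ ≤ B.toReal * ‖d k‖
        rcases eq_or_ne (d k) 0 with h0 | h0
        · rw [h0]; simp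
        · have : 0 < ‖d k‖ := norm_pos_iff.2 h0
          rwa [inv_mul_le_iff₀ this, mul_comm] at h3
      have := hclosed.closure_subset_iff.2 hsub
      rw [hDd.closure_eq] at this
      exact fun g => this (Set.mem_univ g)
    have h4 := hcl (hG.toLp G)
    rw [hT] at h4
    have e5 : ∫ z, F z * (hG.toLp G) z = ∫ z, F z * G z := by
      refine integral_congr_ae ?_
      filter_upwards [hG.coeFn_toLp] with z hz
      rw [hz]
    rw [e5, Lp.norm_toLp, ← ENNReal.toReal_mul] at h4
    rw [← ofReal_norm]
    exact ENNReal.ofReal_le_of_le_toReal h4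

/-! ### The evolution on L² and its frequency truncations -/

/-- The Hilbert space `L²(ℝ²)`. -/
abbrev HPlane : Type := Lp ℂ 2 (volume : Measure Plane)

lemma flowSymbol_add (ε s t : ℝ) (ζ : Plane) :
    flowSymbol ε (s + t) ζ = flowSymbol ε s ζ * flowSymbol ε t ζ := by
  rw [flowSymbol, flowSymbol, flowSymbol, ← Complex.exp_add]
  congr 1; push_cast; ring

lemma conj_flowSymbol (ε t : ℝ) (ζ : Plane) :
    (starRingEnd ℂ) (flowSymbol ε t ζ) = flowSymbol ε (-t) ζ := by
  rw [flowSymbol, flowSymbol, ← Complex.exp_conj, map_mul, Complex.conj_I, Complex.conj_ofReal]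
  congr 1; push_cast; ring

lemma flowSymbol_zero (ε : ℝ) (ζ : Plane) : flowSymbol ε 0 ζ = 1 := by
  simp [flowSymbol]

lemma continuous_flowSymbol_time (ε : ℝ) (ζ : Plane) : Continuous fun t => flowSymbol ε t ζ := by
  unfold flowSymbol
  fun_prop

/-- The free evolution on the Fourier side. -/
def flowMul (ε t : ℝ) (g : HPlane) : HPlane := (memLp_flowSymbol_mul ε t g).toLp _

lemma coeFn_flowMul (ε t : ℝ) (g : HPlane) :
    flowMul ε t g =ᵐ[volume] fun ζ => flowSymbol ε t ζ * g ζ :=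
  (memLp_flowSymbol_mul ε t g).coeFn_toLp

lemma inner_flowMul (ε s t : ℝ) (g g' : HPlane) :
    inner ℂ (flowMul ε s g) (flowMul ε t g') =
      ∫ ζ, flowSymbol ε (t - s) ζ * (inner ℂ (g ζ) (g' ζ)) := by
  rw [L2.inner_def]
  refine integral_congr_ae ?_
  filter_upwards [coeFn_flowMul ε s g, coeFn_flowMul ε t g'] with ζ h1 h2
  rw [h1, h2, sub_eq_add_neg, flowSymbol_add, ← conj_flowSymbol]
  simp only [RCLike.inner_apply, map_mul]
  ring

lemma norm_flowMul (ε t : ℝ) (g : HPlane) : ‖flowMul ε t g‖ = ‖g‖ := by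
  rw [flowMul, Lp.norm_toLp, Lp.norm_def]
  congr 1
  refine eLpNorm_congr_norm_ae (Eventually.of_forall fun ζ => ?_)
  rw [norm_mul, norm_flowSymbol, one_mul]

/-- The squared distance between two times is 2‖g‖² - 2 Re A(s - t), where A is the autocorrelation
of g; A is continuous by dominated convergence. This supplies the measurability in time needed for
TT*. -/
lemma continuous_flowMul (ε : ℝ) (g : HPlane) : Continuous fun t => flowMul ε t g := by
  set A : ℝ → ℂ := fun τ => ∫ ζ, flowSymbol ε τ ζ * (inner ℂ (g ζ) (g ζ)) with hA
  have hAc : Continuous A := by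
    refine continuous_of_dominated (bound := fun ζ => ‖inner ℂ (g ζ) (g ζ)‖) (fun τ => ?_)
      (fun τ => Eventually.of_forall fun ζ => ?_) (L2.integrable_inner g g).norm
      (Eventually.of_forall fun ζ => (continuous_flowSymbol_time ε ζ).mul continuous_const)
    · exact (measurable_flowSymbol ε τ).aestronglyMeasurable.mul (L2.integrable_inner g g).1
    · rw [norm_mul, norm_flowSymbol, one_mul]
  have hA0 : A 0 = (‖g‖ : ℂ) ^ 2 := by
    rw [hA]
    simp only [flowSymbol_zero, one_mul]
    rw [← L2.inner_def, inner_self_eq_norm_sq_to_K]; rfl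
  rw [continuous_iff_continuousAt]
  intro s
  rw [ContinuousAt, tendsto_iff_norm_sub_tendsto_zero]
  have e : ∀ t, ‖flowMul ε t g - flowMul ε s g‖ ^ 2 = 2 * ‖g‖ ^ 2 - 2 * (A (s - t)).re := fun t => by
    rw [@norm_sub_sq ℂ, norm_flowMul, norm_flowMul, inner_flowMul]
    change ‖g‖ ^ 2 - 2 * (A (s - t)).re + ‖g‖ ^ 2 = _
    ring
  have h1 : Tendsto (fun t => ‖flowMul ε t g - flowMul ε s g‖ ^ 2) (𝓝 s) (𝓝 0) := by
    simp only [e]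
    have hc : Continuous fun t => 2 * ‖g‖ ^ 2 - 2 * (A (s - t)).re := by fun_prop
    have := hc.tendsto s
    rw [sub_self, hA0] at this
    convert this using 2
    norm_cast
    ring
  have h2 := (Real.continuous_sqrt.tendsto 0).comp h1
  rw [Real.sqrt_zero] at h2
  refine h2.congr fun t => ?_
  exact Real.sqrt_sq (norm_nonneg _)

lemma fourier_flow (ε t : ℝ) (φ : HPlane) : 𝓕 (flow ε t φ) = flowMul ε t (𝓕 φ) :=
  fourier_fourierInv_eq _

lemma memLp_dxSymbol (γ : ℝ) (n : ℕ) (p : ℝ≥0∞) : MemLp (dxSymbol γ n) p volume := by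
  have := memLp_dxSymbol_mul 0 γ 0 n p
  simpa only [flowSymbol_zero, mul_one] using this

/-- `D_x^{-γ} U(t) φ`, cut off in frequency. -/
def dxFlow (ε γ : ℝ) (n : ℕ) (φ : HPlane) (t : ℝ) (z : Plane) : ℂ := dxTrunc γ n (flow ε t φ) z

/-- The Fourier transform of `D_x^{-γ} U(t) φ`, cut off in frequency. -/
def dxFlowHat (ε γ : ℝ) (n : ℕ) (φ : HPlane) (t : ℝ) (ζ : Plane) : ℂ :=
  dxSymbol γ n ζ * (flowSymbol ε t ζ * (𝓕 φ : HPlane) ζ)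

lemma memLp_dxFlowHat (ε γ : ℝ) (n : ℕ) (φ : HPlane) (t : ℝ) :
    MemLp (dxFlowHat ε γ n φ t) 2 volume :=
  (memLp_flowSymbol_mul ε t (𝓕 φ)).mul (memLp_dxSymbol γ n ∞)

lemma integrable_dxFlowHat (ε γ : ℝ) (n : ℕ) (φ : HPlane) (t : ℝ) :
    Integrable (dxFlowHat ε γ n φ t) :=
  MemLp.integrable_mul (memLp_dxSymbol γ n 2) (memLp_flowSymbol_mul ε t (𝓕 φ))

lemma dxFlow_eq (ε γ : ℝ) (n : ℕ) (φ : HPlane) (t : ℝ) (z : Plane) :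
    dxFlow ε γ n φ t z = 𝓕⁻ (dxFlowHat ε γ n φ t) z := by
  rw [dxFlow, dxTrunc, fourier_flow, Real.fourierInv_eq, Real.fourierInv_eq]
  refine integral_congr_ae ?_
  filter_upwards [coeFn_flowMul ε t (𝓕 φ)] with ζ h
  rw [h]; rfl

lemma continuous_dxFlow (ε γ : ℝ) (n : ℕ) (φ : HPlane) :
    Continuous (Function.uncurry (dxFlow ε γ n φ)) := by
  have e : Function.uncurry (dxFlow ε γ n φ) = fun w : ℝ × Plane =>
      ∫ ζ, (Real.fourierChar (inner ℝ ζ w.2) : ℂ) * dxFlowHat ε γ n φ w.1 ζ := by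
    ext w
    rw [Function.uncurry, dxFlow_eq, Real.fourierInv_eq]; rfl
  rw [e]
  have hch : ∀ z : Plane, Continuous fun ζ : Plane => (Real.fourierChar (inner ℝ ζ z) : ℂ) :=
    fun z => continuous_induced_dom.comp (Real.continuous_fourierChar.comp (by fun_prop))
  refine continuous_of_dominated (bound := fun ζ => ‖dxFlowHat ε γ n φ 0 ζ‖) (fun w => ?_)
    (fun w => Eventually.of_forall fun ζ => ?_) (integrable_dxFlowHat ε γ n φ 0).norm
    (Eventually.of_forall fun ζ => ?_)
  · exact (hch w.2).aestronglyMeasurable.mul (integrable_dxFlowHat ε γ n φ w.1).1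
  · rw [norm_mul, Circle.norm_coe, one_mul, dxFlowHat, dxFlowHat, norm_mul, norm_mul, norm_mul,
      norm_mul, norm_flowSymbol, norm_flowSymbol]
  · refine Continuous.mul ?_ ?_
    · exact continuous_induced_dom.comp (Real.continuous_fourierChar.comp (by fun_prop))
    · exact continuous_const.mul
        (((continuous_flowSymbol_time ε ζ).comp continuous_fst).mul continuous_const)

lemma continuous_dxFlow_right (ε γ : ℝ) (n : ℕ) (φ : HPlane) (t : ℝ) :
    Continuous (dxFlow ε γ n φ t) :=
  (continuous_dxFlow ε γ n φ).uncurry_left t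

lemma norm_dxFlow_le (ε γ : ℝ) (n : ℕ) (φ : HPlane) (t : ℝ) (z : Plane) :
    ‖dxFlow ε γ n φ t z‖ ≤ ∫ ζ, ‖dxFlowHat ε γ n φ t ζ‖ := by
  rw [dxFlow_eq]; exact norm_fourierInv_le _ _

lemma eLpNorm_two_dxFlow (ε γ : ℝ) (n : ℕ) (φ : HPlane) (t : ℝ) :
    eLpNorm (dxFlow ε γ n φ t) 2 volume = eLpNorm (dxFlowHat ε γ n φ t) 2 volume := by
  have e : dxFlow ε γ n φ t = 𝓕⁻ (dxFlowHat ε γ n φ t) := funext (dxFlow_eq ε γ n φ t)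
  rw [e, eLpNorm_fourierInv (integrable_dxFlowHat ε γ n φ t) (memLp_dxFlowHat ε γ n φ t)]

/-- The truncated evolution is square integrable and bounded, so |u|^r ≤ ‖u‖_∞^(r-2) |u|². -/
lemma memLp_dxFlow (ε γ : ℝ) (n : ℕ) (φ : HPlane) (t : ℝ) {r : ℝ≥0∞} (hr : 2 ≤ r) :
    MemLp (dxFlow ε γ n φ t) r volume := by
  have h2 : MemLp (dxFlow ε γ n φ t) 2 volume :=
    ⟨(continuous_dxFlow_right ε γ n φ t).aestronglyMeasurable,
      by rw [eLpNorm_two_dxFlow]; exact (memLp_dxFlowHat ε γ n φ t).2⟩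
  have hi : MemLp (dxFlow ε γ n φ t) ∞ volume :=
    memLp_top_of_bound (continuous_dxFlow_right ε γ n φ t).aestronglyMeasurable _
      (Eventually.of_forall (norm_dxFlow_le ε γ n φ t))
  by_cases hrt : r = ∞
  · rwa [hrt]
  · have := hi.1
    refine ⟨hi.1, ?_⟩
    have hr0 : r ≠ 0 := fun h => by simp [h] at hr
    have hs2 : 2 ≤ r.toReal := by simpa using ENNReal.toReal_mono hrt hr
    set B := ∫ ζ, ‖dxFlowHat ε γ n φ t ζ‖ with hB
    rw [eLpNorm_lt_top_iff_lintegral_rpow_enorm_lt_top hr0 hrt]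
    have h2' := (eLpNorm_lt_top_iff_lintegral_rpow_enorm_lt_top (by simp) (by simp)).1 h2.2
    have hle : ∀ z, ‖dxFlow ε γ n φ t z‖ₑ ^ r.toReal ≤
        ENNReal.ofReal B ^ (r.toReal - 2) * ‖dxFlow ε γ n φ t z‖ₑ ^ (2 : ℝ) := fun z => by
      have : r.toReal = (r.toReal - 2) + 2 := by ring
      nth_rewrite 1 [this]
      rw [ENNReal.rpow_add_of_nonneg _ _ (by linarith) (by norm_num)]
      refine mul_le_mul_left (ENNReal.rpow_le_rpow ?_ (by linarith)) _
      rw [← ofReal_norm]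
      exact ENNReal.ofReal_le_ofReal (norm_dxFlow_le ε γ n φ t z)
    refine (lintegral_mono hle).trans_lt ?_
    rw [lintegral_const_mul' _ _ (ENNReal.rpow_ne_top_of_nonneg (by linarith) ENNReal.ofReal_ne_top)]
    refine ENNReal.mul_lt_top
      (ENNReal.rpow_ne_top_of_nonneg (by linarith) ENNReal.ofReal_ne_top).lt_top ?_
    simpa using h2'

lemma integral_dxFlow_mul (ε γ : ℝ) (n : ℕ) (φ : HPlane) (t : ℝ) {h : Plane → ℂ}
    (hh : Integrable h) :
    ∫ z, dxFlow ε γ n φ t z * h z = ∫ ζ, dxFlowHat ε γ n φ t ζ * 𝓕⁻ h ζ := by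
  simp only [dxFlow_eq]
  exact integral_fourierInv_mul_eq (integrable_dxFlowHat ε γ n φ t) hh

section EvalVec

/-- The Fourier transform of the vector of `L²` that represents evaluation of `dxFlow` at a
point. -/
def evalHat (ε γ : ℝ) (n : ℕ) (t : ℝ) (z ζ : Plane) : ℂ :=
  (starRingEnd ℂ) (Real.fourierChar (inner ℝ ζ z) * (dxSymbol γ n ζ * flowSymbol ε t ζ))

lemma memLp_evalHat (ε γ : ℝ) (n : ℕ) (t : ℝ) (z : Plane) (p : ℝ≥0∞) :
    MemLp (evalHat ε γ n t z) p volume := by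
  refine (memLp_dxSymbol_mul ε γ t n p).of_le ?_ (Eventually.of_forall fun ζ => by
    simp only [evalHat, RCLike.norm_conj, norm_mul, Circle.norm_coe, one_mul, le_refl])
  have h3 : Measurable fun ζ : Plane => (Real.fourierChar (inner ℝ ζ z) : ℂ) :=
    (continuous_induced_dom.comp (Real.continuous_fourierChar.comp
      (by fun_prop : Continuous fun ζ : Plane => inner ℝ ζ z))).measurable
  exact (Complex.continuous_conj.measurable.comp
    (h3.mul (measurable_dxSymbol_mul ε γ t n))).aestronglyMeasurable

/-- The vector of `L²` that represents evaluation of `dxFlow` at a point. -/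
def evalVec (ε γ : ℝ) (n : ℕ) (t : ℝ) (z : Plane) : HPlane := 𝓕⁻ ((memLp_evalHat ε γ n t z 2).toLp _)

lemma dxFlow_eq_inner (ε γ : ℝ) (n : ℕ) (φ : HPlane) (t : ℝ) (z : Plane) :
    dxFlow ε γ n φ t z = inner ℂ (evalVec ε γ n t z) φ := by
  rw [← Lp.inner_fourier_eq, evalVec, fourier_fourierInv_eq, L2.inner_def, dxFlow_eq,
    Real.fourierInv_eq]
  refine integral_congr_ae ?_
  filter_upwards [(memLp_evalHat ε γ n t z 2).coeFn_toLp] with ζ h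
  rw [h]
  simp [evalHat, dxFlowHat, Circle.smul_def]
  ring

lemma dxFlow_add (ε γ : ℝ) (n : ℕ) (φ ψ : HPlane) (t : ℝ) (z : Plane) :
    dxFlow ε γ n (φ + ψ) t z = dxFlow ε γ n φ t z + dxFlow ε γ n ψ t z := by
  simp only [dxFlow_eq_inner, inner_add_right]

lemma dxFlow_smul (ε γ : ℝ) (n : ℕ) (c : ℂ) (φ : HPlane) (t : ℝ) (z : Plane) :
    dxFlow ε γ n (c • φ) t z = c * dxFlow ε γ n φ t z := by
  simp only [dxFlow_eq_inner, inner_smul_right]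

lemma continuous_dxFlow_vec (ε γ : ℝ) (n : ℕ) (t : ℝ) (z : Plane) :
    Continuous fun φ => dxFlow ε γ n φ t z := by
  simp only [dxFlow_eq_inner]
  fun_prop

end EvalVec

section Tail

lemma measurableSet_freqBox (n : ℕ) : MeasurableSet (freqBox n) := by
  unfold freqBox; measurability

lemma memLp_indicator_compl (n : ℕ) (g : HPlane) :
    MemLp ((freqBox n)ᶜ.indicator g) 2 volume :=
  (Lp.memLp g).indicator (measurableSet_freqBox n).compl

/-- The part of `φ` with frequencies outside the box number `n`. -/
def freqTail (n : ℕ) (φ : HPlane) : HPlane := 𝓕⁻ ((memLp_indicator_compl n (𝓕 φ)).toLp _)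

lemma coeFn_fourier_freqTail (n : ℕ) (φ : HPlane) :
    (𝓕 (freqTail n φ) : HPlane) =ᵐ[volume] (freqBox n)ᶜ.indicator (𝓕 φ : HPlane) := by
  rw [freqTail, fourier_fourierInv_eq]
  exact (memLp_indicator_compl n (𝓕 φ)).coeFn_toLp

lemma freqTail_sub (n : ℕ) (φ ψ : HPlane) :
    freqTail n (φ - ψ) = freqTail n φ - freqTail n ψ := by
  have hF : ∀ a b : HPlane, 𝓕 (a - b) = 𝓕 a - 𝓕 b := fun a b => by
    rw [sub_eq_add_neg, FourierTransform.fourier_add, FourierTransform.fourier_neg, sub_eq_add_neg]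
  have hinj : Function.Injective (fun a : HPlane => (𝓕 a : HPlane)) := fun a b h => by
    have := congrArg (fun a : HPlane => (𝓕⁻ a : HPlane)) h
    simpa only [fourierInv_fourier_eq] using this
  apply hinj
  apply Lp.ext
  beta_reduce
  rw [hF (freqTail n φ)]
  filter_upwards [coeFn_fourier_freqTail n (φ - ψ), coeFn_fourier_freqTail n φ,
    coeFn_fourier_freqTail n ψ, Lp.coeFn_sub (𝓕 (freqTail n φ)) (𝓕 (freqTail n ψ)),
    Lp.coeFn_sub (𝓕 φ) (𝓕 ψ)] with ζ h1 h2 h3 h4 h5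
  rw [h1, h4, Pi.sub_apply, h2, h3, hF φ ψ]
  by_cases hζ : ζ ∈ (freqBox n)ᶜ
  · rw [Set.indicator_of_mem hζ, Set.indicator_of_mem hζ, Set.indicator_of_mem hζ, h5]; rfl
  · rw [Set.indicator_of_notMem hζ, Set.indicator_of_notMem hζ, Set.indicator_of_notMem hζ,
      sub_zero]

lemma norm_freqTail (n : ℕ) (φ : HPlane) :
    ‖freqTail n φ‖ = (eLpNorm ((freqBox n)ᶜ.indicator (𝓕 φ : HPlane)) 2 volume).toReal := by
  rw [← Lp.norm_fourier_eq, Lp.norm_def, eLpNorm_congr_ae (coeFn_fourier_freqTail n φ)]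

lemma norm_freqTail_le (n : ℕ) (φ : HPlane) : ‖freqTail n φ‖ ≤ ‖φ‖ := by
  rw [norm_freqTail, ← Lp.norm_fourier_eq φ, Lp.norm_def]
  exact ENNReal.toReal_mono (Lp.memLp _).2.ne (eLpNorm_indicator_le _)

lemma eventually_mem_freqBox {ζ : Plane} (h : ζ 0 ≠ 0) : ∀ᶠ n in atTop, ζ ∈ freqBox n := by
  have h0 : 0 < |2 * Real.pi * ζ 0| := abs_pos.2 (mul_ne_zero (by positivity) h)
  have h1 := tendsto_inv_atTop_nhds_zero_nat (𝕜 := ℝ)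
  filter_upwards [h1.eventually_le_const h0,
    tendsto_natCast_atTop_atTop.eventually_ge_atTop |2 * Real.pi * ζ 0|,
    tendsto_natCast_atTop_atTop.eventually_ge_atTop |2 * Real.pi * ζ 1|] with n a b c
  exact ⟨a, b, c⟩

lemma ae_zero_ne_zero : ∀ᵐ ζ : Plane, ζ 0 ≠ 0 := by
  have hms : MeasurableSet {ζ : Plane | ζ 0 ≠ 0} :=
    (measurableSet_eq_fun (by fun_prop) measurable_const).compl
  rw [← measurePreserving_pt.map_eq, ae_map_iff measurePreserving_pt.measurable.aemeasurable hms]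
  have : ∀ᵐ x : ℝ, x ≠ 0 := Measure.ae_ne volume 0
  exact (Measure.quasiMeasurePreserving_fst (μ := (volume : Measure ℝ))
    (ν := (volume : Measure ℝ))).ae this

/-- The boxes eventually contain every frequency with ξ ≠ 0, hence almost every frequency; dominated
convergence does the rest. -/
lemma tendsto_freqTail (φ : HPlane) : Tendsto (fun n => freqTail n φ) atTop (𝓝 0) := by
  rw [tendsto_zero_iff_norm_tendsto_zero]
  have hL := (eLpNorm_lt_top_iff_lintegral_rpow_enorm_lt_top (by simp) (by simp)).1
    (Lp.memLp (𝓕 φ : HPlane)).2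
  have h : Tendsto (fun n => ∫⁻ ζ, ‖(freqBox n)ᶜ.indicator (𝓕 φ : HPlane) ζ‖ₑ ^ (2 : ℝ)) atTop
      (𝓝 (∫⁻ _ : Plane, 0)) := by
    refine tendsto_lintegral_of_dominated_convergence' (fun ζ => ‖(𝓕 φ : HPlane) ζ‖ₑ ^ (2 : ℝ))
      (fun n => ?_) (fun n => Eventually.of_forall fun ζ => ?_) (by simpa using hL.ne) ?_
    · exact (memLp_indicator_compl n (𝓕 φ)).1.enorm.pow_const _
    · exact ENNReal.rpow_le_rpow (enorm_indicator_le_enorm_self _ _) (by norm_num)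
    · filter_upwards [ae_zero_ne_zero] with ζ hζ
      refine tendsto_const_nhds.congr' ?_
      filter_upwards [eventually_mem_freqBox hζ] with n hn
      rw [Set.indicator_of_notMem (by simpa using hn)]; simp
  rw [lintegral_zero] at h
  have e : ∀ n, ‖freqTail n φ‖ =
      ((∫⁻ ζ, ‖(freqBox n)ᶜ.indicator (𝓕 φ : HPlane) ζ‖ₑ ^ (2 : ℝ)) ^ (1 / 2 : ℝ)).toReal :=
    fun n => by
      rw [norm_freqTail, eLpNorm_eq_lintegral_rpow_enorm_toReal (by simp) (by simp)]; simp
  simp only [e]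
  have h2 := (ENNReal.continuous_rpow_const (y := (1 / 2 : ℝ))).tendsto 0 |>.comp h
  rw [ENNReal.zero_rpow_of_pos (by norm_num)] at h2
  exact (ENNReal.tendsto_toReal ENNReal.zero_ne_top).comp h2

/-- The case m = 0 must be excluded: since 0⁻¹ = 0, the box number 0 is the origin alone, which lies
in no later box. -/
lemma freqBox_subset {m n : ℕ} (hm : 1 ≤ m) (h : m ≤ n) : freqBox m ⊆ freqBox n := by
  intro ζ hζ
  have hm' : (1 : ℝ) ≤ m := by exact_mod_cast hm
  have h' : (m : ℝ) ≤ n := by exact_mod_cast h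
  refine ⟨?_, hζ.2.1.trans h', hζ.2.2.trans h'⟩
  exact le_trans (inv_anti₀ (by linarith) h') hζ.1

/-- The boxes are nested, so P_n - P_m = P_n(1 - P_m). Any estimate uniform in n, applied to the
tail of φ, therefore makes the truncations a Cauchy sequence. -/
lemma dxFlow_sub_dxFlow (ε γ : ℝ) {m n : ℕ} (hm : 1 ≤ m) (h : m ≤ n) (φ : HPlane) (t : ℝ)
    (z : Plane) :
    dxFlow ε γ n φ t z - dxFlow ε γ m φ t z = dxFlow ε γ n (freqTail m φ) t z := by
  have hch : Continuous fun ζ : Plane => (Real.fourierChar (inner ℝ ζ z) : ℂ) :=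
    continuous_induced_dom.comp (Real.continuous_fourierChar.comp (by fun_prop))
  have hi : ∀ k, Integrable fun ζ =>
      (Real.fourierChar (inner ℝ ζ z) : ℂ) * dxFlowHat ε γ k φ t ζ := fun k =>
    (integrable_dxFlowHat ε γ k φ t).bdd_mul (c := 1) hch.aestronglyMeasurable
      (Eventually.of_forall fun ζ => (Circle.norm_coe _).le)
  simp only [dxFlow_eq, Real.fourierInv_eq, Circle.smul_def, smul_eq_mul]
  rw [← integral_sub (hi n) (hi m)]
  refine integral_congr_ae ?_
  filter_upwards [coeFn_fourier_freqTail m φ] with ζ hζ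
  rw [← mul_sub, dxFlowHat, dxFlowHat, dxFlowHat, hζ]
  congr 1
  by_cases hb : ζ ∈ freqBox m
  · have hn := freqBox_subset hm h hb
    rw [Set.indicator_of_notMem (by simpa using hb), dxSymbol, dxSymbol, Set.indicator_of_mem hb,
      Set.indicator_of_mem hn]
    ring
  · rw [Set.indicator_of_mem (show ζ ∈ (freqBox m)ᶜ from hb), dxSymbol, dxSymbol,
      Set.indicator_of_notMem hb]
    ring

end Tail

/-! ### The homogeneous estimate for the truncated evolution -/

lemma toReal_inv_mem {r : ℝ≥0∞} (hr : 2 ≤ r) : 0 ≤ (r⁻¹).toReal ∧ (r⁻¹).toReal ≤ 1 / 2 := by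
  refine ⟨ENNReal.toReal_nonneg, ?_⟩
  have h : r⁻¹ ≤ 2⁻¹ := ENNReal.inv_le_inv.2 hr
  simpa using ENNReal.toReal_mono (by simp) h

lemma inv_ne_top_of_two_le {r : ℝ≥0∞} (hr : 2 ≤ r) : r⁻¹ ≠ ∞ := by
  rw [ENNReal.inv_ne_top]
  intro h; simp [h] at hr

/-- With q = 2 the inequality 1/q ≤ 1/2 - 1/r forces r = ∞, which is the excluded pair. -/
lemma IsAdmissible.two_lt {q r : ℝ≥0∞} (h : IsAdmissible q r) : 2 < q := by
  obtain ⟨hq, hr, -, h2, h3, -⟩ := h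
  refine lt_of_le_of_ne hq fun e => ?_
  subst e
  have hR := toReal_inv_mem hr
  have h4 : (r⁻¹).toReal = 0 := by
    have : ((2 : ℝ≥0∞)⁻¹).toReal = 1 / 2 := by simp
    rw [this] at h2; linarith
  rw [ENNReal.toReal_eq_zero_iff] at h4
  rcases h4 with h4 | h4
  · rw [ENNReal.inv_eq_zero] at h4
    exact h3 (by rw [h4])
  · exact inv_ne_top_of_two_le hr h4

lemma IsAdmissible.eq_of_eq_top {q r : ℝ≥0∞} (h : IsAdmissible q r) (hq : q = ∞) :
    r = 2 ∧ beta q r = 0 := by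
  obtain ⟨-, hr, h1, -, -, -⟩ := h
  have hR := toReal_inv_mem hr
  subst hq
  simp only [ENNReal.inv_top, ENNReal.toReal_zero] at h1
  have hR2 : (r⁻¹).toReal = 1 / 2 := by linarith
  constructor
  · have : r⁻¹ = 2⁻¹ := by
      rw [← ENNReal.toReal_eq_toReal_iff' (inv_ne_top_of_two_le hr) (by simp), hR2]; simp
    simpa using this
  · simp [beta, hR2]

/-- Put θ = 1 - 2/r. Equality in the upper bound for 1/q means β = 0; equality in the lower one
means 2β = 3θ/2; strict inequality in both puts 2β in the interior range. In every case the decay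
exponent is θ - 2β/3 = 2/q. On the lower line θ = 1 would mean (q,r) = (4,∞). -/
lemma exists_hasDecay {ε : ℝ} (hε : |ε| = 1) {q r : ℝ≥0∞} (h : IsAdmissible q r) (hq : q ≠ ∞) :
    ∃ C, 0 ≤ C ∧
      HasDecay ε (2 * beta q r) (2 * (q⁻¹).toReal) (1 / (1 - (r⁻¹).toReal)) C := by
  obtain ⟨hq2, hr, h1, h2, h3, h4⟩ := h
  obtain ⟨hR0, hR1⟩ := toReal_inv_mem hr
  have hQ0 : 0 < (q⁻¹).toReal :=
    ENNReal.toReal_pos (by simpa using hq) (inv_ne_top_of_two_le hq2)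
  unfold beta
  set R := (r⁻¹).toReal with hR
  set Q := (q⁻¹).toReal with hQ
  set θ := 1 - 2 * R with hθ
  have hθ0 : 0 < θ := by rw [hθ]; linarith
  have hθ1 : θ ≤ 1 := by rw [hθ]; linarith
  have hp : 1 / (1 - R) * (1 + θ) = 2 := by
    rw [hθ]
    have : 1 - R ≠ 0 := by linarith
    field_simp; ring
  rcases eq_or_lt_of_le h2 with e | hlt
  · have e1 : 2 * (3 * (1 / 2 - R - Q)) = 0 := by rw [e]; ring
    have e2 : 2 * Q = θ := by rw [e, hθ]; ring
    rw [e1, e2]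
    exact ⟨14, by norm_num, hasDecay_zero hε hθ0.le hθ1 hp⟩
  · rcases eq_or_lt_of_le h1 with e | hlt'
    · have e1 : 2 * (3 * (1 / 2 - R - Q)) = 3 / 2 * θ := by rw [← e, hθ]; ring
      have e2 : 2 * Q = θ / 2 := by rw [← e, hθ]; ring
      rw [e1, e2]
      refine exists_hasDecay_endpoint hε hθ0 (lt_of_le_of_ne hθ1 fun h5 => ?_) hp
      have hR' : R = 0 := by rw [hθ] at h5; linarith
      have hQ' : Q = 1 / 4 := by rw [hR'] at e; linarith
      have hr' : r = ∞ := by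
        rw [hR, ENNReal.toReal_eq_zero_iff] at hR'
        rcases hR' with h | h
        · simpa using h
        · exact absurd h (inv_ne_top_of_two_le hr)
      have hq' : q = 4 := by
        have : q⁻¹ = 4⁻¹ := by
          rw [← ENNReal.toReal_eq_toReal_iff' (inv_ne_top_of_two_le hq2) (by simp), ← hQ, hQ']
          simp
        simpa using this
      exact h4 (by rw [hr', hq'])
    · have e2 : 2 * Q = θ - 2 * (3 * (1 / 2 - R - Q)) / 3 := by rw [hθ]; ring
      rw [e2]
      refine exists_hasDecay_interior hε hθ1 (by linarith) ?_ hp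
      rw [hθ]; linarith

lemma holderConjugate_ofReal {r : ℝ≥0∞} (hr : 2 ≤ r) :
    r.HolderConjugate (ENNReal.ofReal (1 / (1 - (r⁻¹).toReal))) := by
  obtain ⟨hR0, hR1⟩ := toReal_inv_mem hr
  rw [ENNReal.holderConjugate_iff, ← ENNReal.ofReal_inv_of_pos (by
    have : 0 < 1 - (r⁻¹).toReal := by linarith
    positivity), one_div, inv_inv, ← ENNReal.ofReal_toReal (inv_ne_top_of_two_le hr),
    ENNReal.toReal_ofReal hR0, ← ENNReal.ofReal_add hR0 (by linarith)]
  simp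

/-- The sharp box is dominated by a regularized weight. On the box |ζ₁| ≤ n and 1/|ζ₀| ≤ 2πn, so
this δ keeps the Gaussian exponent at most 1, and e^{-1} ≥ 1/4. The radii 2^{±(n+3)} suffice because
2πn ≤ 8·2^n. Passing from |2πζ₀| to |ζ₀| is free as β ≥ 0. -/
lemma sq_norm_dxSymbol_le {β : ℝ} (hβ : 0 ≤ β) {n : ℕ} (hn : 1 ≤ n) (ζ : Plane) :
    ‖dxSymbol β n ζ‖ ^ 2 ≤ 4 * regWeight (2 * β) (1 / (4 * Real.pi ^ 2 * n ^ 3))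
      (2 ^ (-((n + 3 : ℕ) : ℝ))) (2 ^ ((n + 3 : ℕ) : ℝ)) ζ := by
  by_cases hζ : ζ ∈ freqBox n
  · rw [dxSymbol, Set.indicator_of_mem hζ, Complex.norm_real, Real.norm_of_nonneg (by positivity)]
    obtain ⟨h1, h2, h3⟩ := hζ
    have hpi := Real.pi_gt_three
    have hpi4 := Real.pi_lt_four
    have hn' : (1 : ℝ) ≤ n := by exact_mod_cast hn
    rw [abs_mul, abs_of_pos (by positivity : 0 < 2 * Real.pi)] at h1 h2 h3 ⊢
    set x := |ζ 0| with hx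
    have hx0 : 0 < x := by
      by_contra hc
      have : x = 0 := le_antisymm (not_lt.1 hc) (abs_nonneg _)
      rw [this, mul_zero] at h1
      have : 0 < (n : ℝ)⁻¹ := by positivity
      linarith
    have hpow : (n : ℝ) < 2 ^ n := by exact_mod_cast Nat.lt_two_pow_self
    have hM : (2 : ℝ) ^ ((n + 3 : ℕ) : ℝ) = 8 * 2 ^ n := by
      rw [Real.rpow_natCast, pow_add]; ring
    have hMinv : (2 : ℝ) ^ (-((n + 3 : ℕ) : ℝ)) = (8 * 2 ^ n)⁻¹ := by
      rw [Real.rpow_neg (by norm_num), hM]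
    have hxinv : x⁻¹ ≤ 2 * Real.pi * n := by
      rw [inv_le_comm₀ hx0 (by positivity)]
      rw [mul_inv, inv_mul_le_iff₀ (by positivity)]
      exact h1
    have hc : (2 : ℝ) ^ (-((n + 3 : ℕ) : ℝ)) ≤ x ∧ x < 2 ^ ((n + 3 : ℕ) : ℝ) := by
      rw [hM, hMinv]
      constructor
      · rw [inv_le_comm₀ (by positivity) hx0]
        refine hxinv.trans ?_
        nlinarith
      · nlinarith
    rw [regWeight, if_pos hc, ← hx]
    have hexp : 1 / 4 ≤ Real.exp (-(2 * Real.pi * (1 / (4 * Real.pi ^ 2 * n ^ 3)) * (ζ 1) ^ 2 / x)) := by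
      have hle : 2 * Real.pi * (1 / (4 * Real.pi ^ 2 * n ^ 3)) * (ζ 1) ^ 2 / x ≤ 1 := by
        have hz1 : |ζ 1| ≤ n := by
          have := abs_nonneg (ζ 1)
          nlinarith
        have hz2 : (ζ 1) ^ 2 ≤ (n : ℝ) ^ 2 := by
          rw [← sq_abs]; exact pow_le_pow_left₀ (abs_nonneg _) hz1 2
        calc 2 * Real.pi * (1 / (4 * Real.pi ^ 2 * n ^ 3)) * (ζ 1) ^ 2 / x
            = 2 * Real.pi * (1 / (4 * Real.pi ^ 2 * n ^ 3)) * ((ζ 1) ^ 2 * x⁻¹) := by ring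
          _ ≤ 2 * Real.pi * (1 / (4 * Real.pi ^ 2 * n ^ 3)) *
              ((n : ℝ) ^ 2 * (2 * Real.pi * n)) := by gcongr
          _ = 1 := by field_simp; ring
      calc (1 / 4 : ℝ) ≤ Real.exp (-1) := by
            rw [Real.exp_neg, one_div]
            refine inv_anti₀ (Real.exp_pos _) ?_
            have := Real.exp_one_lt_d9
            linarith
        _ ≤ _ := Real.exp_le_exp.2 (by linarith)
    have hb : (2 * Real.pi * x) ^ (-β) ≤ x ^ (-β) :=
      rpow_neg_le_of_le hβ hx0 (by nlinarith)
    calc ((2 * Real.pi * x) ^ (-β)) ^ 2 ≤ (x ^ (-β)) ^ 2 := by gcongr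
      _ = x ^ (-(2 * β)) := by
          rw [← Real.rpow_natCast, ← Real.rpow_mul hx0.le]; congr 1; push_cast; ring
      _ = 4 * (x ^ (-(2 * β)) * (1 / 4)) := by ring
      _ ≤ _ := by gcongr
  · rw [dxSymbol, Set.indicator_of_notMem hζ, norm_zero]
    have := regWeight_nonneg (2 * β) (1 / (4 * Real.pi ^ 2 * n ^ 3))
      (2 ^ (-((n + 3 : ℕ) : ℝ))) (2 ^ ((n + 3 : ℕ) : ℝ)) ζ
    linarith

lemma enorm_le_ofReal_mul_riesz {C l x : ℝ} (hC : 0 ≤ C) {c : ℂ} (h : ‖c‖ ≤ C * |x| ^ (-l)) :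
    ‖c‖ₑ ≤ ENNReal.ofReal C * riesz l x := by
  rw [← ofReal_norm, riesz, ← ENNReal.ofReal_mul hC]
  exact ENNReal.ofReal_le_ofReal h

lemma conj_fourierInv (h : Plane → ℂ) (ζ : Plane) :
    (starRingEnd ℂ) (𝓕 (fun z => (starRingEnd ℂ) (h z)) ζ) = 𝓕⁻ h ζ := by
  rw [conj_fourier]; simp

/-- The homogeneous Strichartz estimate on the whole line for the truncated evolution and finite
`q`. -/
lemma exists_strichartz_of_ne_top {ε : ℝ} (hε : |ε| = 1) {q r : ℝ≥0∞} (h : IsAdmissible q r)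
    (hq : q ≠ ∞) :
    ∃ C : ℝ≥0, ∀ n : ℕ, 1 ≤ n → ∀ φ : HPlane,
      eLpNorm (fun t => eLpNorm (dxFlow ε (beta q r) n φ t) r volume) q volume ≤ C * ‖φ‖ₑ := by
  obtain ⟨C, hC0, hC⟩ := exists_hasDecay hε h hq
  have hβ : 0 ≤ beta q r := by
    have := h.2.2.2.1
    unfold beta; linarith
  have hq2 : 2 < q.toReal := by
    have := ENNReal.toReal_strict_mono hq h.two_lt
    simpa using this
  have hr := h.2.1
  set β := beta q r with hβd
  set s := q.toReal with hs
  set p := s.conjExponent with hp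
  have hps : p.HolderConjugate s := (Real.HolderConjugate.conjExponent (by linarith)).symm
  have hp1 : 1 < p := hps.lt
  have hp2 : p < 2 := by
    rw [hp, Real.conjExponent, div_lt_iff₀ (by linarith)]; linarith
  have hQ : 2 * (q⁻¹).toReal = 2 / s := by rw [ENNReal.toReal_inv]; ring
  have hP := holderConjugate_ofReal hr
  set P := ENNReal.ofReal (1 / (1 - (r⁻¹).toReal)) with hPd
  obtain ⟨hk, hkc, hks, hk1, hknorm⟩ := exists_norming_sequence (r := r) (P := P) hr
  set K := ENNReal.ofReal (C * (2 * hlsConst p)) ^ (1 / 2 : ℝ) with hK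
  have hKt : K ≠ ∞ := ENNReal.rpow_ne_top_of_nonneg (by norm_num) ENNReal.ofReal_ne_top
  refine ⟨K.toNNReal * 2, fun n hn φ => ?_⟩
  set M : ℕ := n + 3 with hM
  set δ : ℝ := 1 / (4 * Real.pi ^ 2 * n ^ 3) with hδ
  have hn0 : (0 : ℝ) < n := by exact_mod_cast hn
  have hδ0 : 0 < δ := by have := Real.pi_pos; positivity
  set u : ℝ := 2 ^ (-(M : ℝ)) with hu
  set v : ℝ := 2 ^ (M : ℝ) with hv
  have hu0 : 0 < u := by positivity
  set W := regWeight (2 * β) δ u v with hW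
  have hW0 : ∀ ζ, 0 ≤ W ζ := regWeight_nonneg _ _ _ _
  have hWm : Measurable W := measurable_regWeight _ _ _ _
  have hWle : ∀ ζ, W ζ ≤ u ^ (-(2 * β)) := regWeight_le (by linarith) hδ0.le hu0
  -- TT* squares the symbol, so its square root is used here: the correlations then carry the weight
  -- W itself, with exponent 2β, for which the decay is known.
  set w : Plane → ℝ := fun ζ => √(W ζ) with hw
  have hwm : Measurable w := hWm.sqrt
  have hdw : ∀ ζ, ‖dxSymbol β n ζ‖ ≤ 2 * w ζ := fun ζ => by
    have h1 := sq_norm_dxSymbol_le hβ hn ζ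
    rw [hw]
    refine (pow_le_pow_iff_left₀ (norm_nonneg _) (by positivity) two_ne_zero).1 ?_
    rw [mul_pow, Real.sq_sqrt (hW0 ζ), show (2 : ℝ) ^ 2 = 4 by norm_num]
    exact h1
  -- The quotient is bounded by 2 and is moved onto φ, which is harmless in L²; thus the sharp
  -- cutoff never meets an L^p norm. Where w = 0 the box symbol vanishes too, so division by zero
  -- does no damage.
  set m : Plane → ℂ := fun ζ => dxSymbol β n ζ / (w ζ : ℂ) with hm
  have hmm : Measurable m := (measurable_dxSymbol β n).div hwm.complex_ofReal
  have hmw : ∀ ζ, m ζ * (w ζ : ℂ) = dxSymbol β n ζ := fun ζ => by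
    rcases eq_or_ne (w ζ) 0 with h0 | h0
    · have := hdw ζ
      rw [h0, mul_zero] at this
      rw [h0, norm_le_zero_iff.1 this]; simp
    · exact div_mul_cancel₀ _ (by exact_mod_cast h0)
  have hmn : ∀ ζ, ‖m ζ‖ ≤ 2 := fun ζ => by
    rw [hm]
    simp only [norm_div, Complex.norm_real]
    have hw0 : 0 ≤ w ζ := Real.sqrt_nonneg _
    rw [Real.norm_of_nonneg hw0]
    exact div_le_of_le_mul₀ hw0 (by norm_num) (hdw ζ)
  have hφL : MemLp (fun ζ => m ζ * (𝓕 φ : HPlane) ζ) 2 volume := by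
    refine (Lp.memLp (𝓕 φ : HPlane)).of_le_mul (c := 2)
      (hmm.aestronglyMeasurable.mul (Lp.aestronglyMeasurable _)) (Eventually.of_forall fun ζ => ?_)
    rw [norm_mul]
    exact mul_le_mul_of_nonneg_right (hmn ζ) (norm_nonneg _)
  set φ' : HPlane := hφL.toLp _ with hφ'
  have hφ'n : ‖φ'‖ₑ ≤ 2 * ‖φ‖ₑ := by
    have h1 : ‖φ'‖ ≤ 2 * ‖φ‖ := by
      rw [← Lp.norm_fourier_eq φ]
      refine Lp.norm_le_mul_norm_of_ae_le_mul ?_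
      filter_upwards [hφL.coeFn_toLp] with ζ hζ
      rw [hφ', hζ, norm_mul]
      exact mul_le_mul_of_nonneg_right (hmn ζ) (norm_nonneg _)
    have h2 := ENNReal.ofReal_le_ofReal h1
    rw [ENNReal.ofReal_mul (by norm_num), ofReal_norm, ofReal_norm] at h2
    simpa using h2
  have hci : ∀ k, MemL12 (fun z => (starRingEnd ℂ) (hk k z)) volume := fun k =>
    memL12_of_hasCompactSupport (Complex.continuous_conj.comp (hkc k))
      ((hks k).comp_left (map_zero _))
  have hci1 : ∀ k, Integrable fun z => (starRingEnd ℂ) (hk k z) := fun k =>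
    memLp_one_iff_integrable.1 (hci k).1
  have hki1 : ∀ k, Integrable (hk k) := fun k =>
    memLp_one_iff_integrable.1 (memL12_of_hasCompactSupport (hkc k) (hks k)).1
  have haL : ∀ k, MemLp (fun ζ => (w ζ : ℂ) * 𝓕 (fun z => (starRingEnd ℂ) (hk k z)) ζ) 2
      (volume : Measure Plane) := fun k => by
    have hF : MemLp (𝓕 fun z => (starRingEnd ℂ) (hk k z)) 2 (volume : Measure Plane) :=
      ⟨(continuous_fourier (hci1 k)).aestronglyMeasurable, by
        rw [eLpNorm_fourier (hci1 k) (hci k).2]; exact (hci k).2.2⟩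
    refine hF.of_le_mul (c := √(u ^ (-(2 * β))))
      (hwm.complex_ofReal.aestronglyMeasurable.mul hF.1) (Eventually.of_forall fun ζ => ?_)
    rw [norm_mul, Complex.norm_real, Real.norm_of_nonneg (Real.sqrt_nonneg _)]
    exact mul_le_mul_of_nonneg_right (Real.sqrt_le_sqrt (hWle ζ)) (norm_nonneg _)
  set a : ℕ → HPlane := fun k => (haL k).toLp _ with ha
  -- Testing the evolution at time t against h_k is a correlation in L² with the vector of index k
  -- transported to time -t.
  have hinner : ∀ k t, inner ℂ (flowMul ε (-t) (a k)) φ' =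
      ∫ z, dxFlow ε β n φ t z * hk k z := fun k t => by
    rw [integral_dxFlow_mul _ _ _ _ _ (hki1 k), L2.inner_def]
    refine integral_congr_ae ?_
    filter_upwards [coeFn_flowMul ε (-t) (a k), (haL k).coeFn_toLp, hφL.coeFn_toLp] with ζ h1 h2 h3
    rw [h1, ha, h2, hφ', h3, RCLike.inner_apply, map_mul, map_mul, conj_fourierInv,
      conj_flowSymbol, neg_neg, Complex.conj_ofReal, dxFlowHat, ← hmw]
    ring
  -- The correlation of two transported test vectors is the multiplier form at time s' - t. The test
  -- functions have L^{r'} norm at most 1, so only the decay |s' - t|^(-2/q) is left.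
  have hcorr : ∀ k l (s' t : ℝ), s' ≠ t → ‖inner ℂ (flowMul ε (-s') (a k)) (flowMul ε (-t) (a l))‖ₑ ≤
      ENNReal.ofReal C * riesz (2 / s) (s' - t) := fun k l s' t hst => by
    have e : inner ℂ (flowMul ε (-s') (a k)) (flowMul ε (-t) (a l)) =
        multForm (regSymbol ε (2 * β) δ u v (s' - t)) (fun z => (starRingEnd ℂ) (hk l z)) (hk k) := by
      rw [inner_flowMul, multForm]
      refine integral_congr_ae ?_
      filter_upwards [(haL k).coeFn_toLp, (haL l).coeFn_toLp] with ζ h1 h2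
      rw [ha]
      simp only
      rw [h1, h2, RCLike.inner_apply, map_mul, conj_fourierInv, Complex.conj_ofReal,
        regSymbol_eq hu0, show -t - -s' = s' - t by ring]
      have : (w ζ : ℂ) * (w ζ : ℂ) = (W ζ : ℂ) := by
        rw [← Complex.ofReal_mul, Real.mul_self_sqrt (hW0 ζ)]
      rw [← hW, ← this]
      ring
    refine enorm_le_ofReal_mul_riesz hC0 ?_
    rw [e, ← hQ]
    refine (hC δ M (s' - t) _ _ hδ0 (sub_ne_zero.2 hst) (Complex.continuous_conj.comp (hkc l))
      ((hks l).comp_left (map_zero _)) (hkc k) (hks k)).trans ?_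
    have n1 : (eLpNorm (fun z => (starRingEnd ℂ) (hk l z)) P volume).toReal ≤ 1 := by
      have : eLpNorm (fun z => (starRingEnd ℂ) (hk l z)) P volume = eLpNorm (hk l) P volume :=
        eLpNorm_congr_norm_ae (Eventually.of_forall fun z => RCLike.norm_conj _)
      rw [this]
      exact ENNReal.toReal_mono ENNReal.one_ne_top (hk1 l)
    have n2 : (eLpNorm (hk k) P volume).toReal ≤ 1 :=
      ENNReal.toReal_mono ENNReal.one_ne_top (hk1 k)
    have h0 : 0 ≤ C * |s' - t| ^ (-(2 * (q⁻¹).toReal)) := by positivity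
    calc _ ≤ C * |s' - t| ^ (-(2 * (q⁻¹).toReal)) * 1 * 1 := by
          refine mul_le_mul (mul_le_mul_of_nonneg_left n1 h0) n2 ENNReal.toReal_nonneg (by linarith)
      _ = _ := by ring
  have hTT := lintegral_iSup_inner_rpow_le hp1 hp2 hps (v := fun k t => flowMul ε (-t) (a k))
    (fun k => ((continuous_flowMul ε (a k)).comp continuous_neg).stronglyMeasurable)
    (R := fun k => ‖a k‖) (fun k t => (norm_flowMul ε (-t) (a k)).le) hcorr φ'
  have hq0 : q ≠ 0 := fun h0 => by simp [hs, h0] at hq2; linarith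
  rw [eLpNorm_eq_lintegral_rpow_enorm_toReal hq0 hq]
  calc _ ≤ (∫⁻ t, (⨆ k, ‖inner ℂ (flowMul ε (-t) (a k)) φ'‖ₑ) ^ s) ^ (1 / s) := by
        refine ENNReal.rpow_le_rpow (lintegral_mono fun t => ?_) (by positivity)
        refine ENNReal.rpow_le_rpow ?_ (by linarith)
        rw [enorm_eq_self]
        refine hknorm _ (continuous_dxFlow_right ε β n φ t).measurable (memLp_dxFlow ε β n φ t hr) _
          fun k => ?_
        rw [← hinner]
        exact le_iSup (fun k => ‖inner ℂ (flowMul ε (-t) (a k)) φ'‖ₑ) k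
    _ ≤ K * ‖φ'‖ₑ := hTT
    _ ≤ K * (2 * ‖φ‖ₑ) := by gcongr
    _ = _ := by
        rw [ENNReal.coe_mul, ENNReal.coe_toNNReal hKt, mul_assoc]; rfl

lemma eLpNorm_two_dxFlow_zero_le (ε : ℝ) (n : ℕ) (φ : HPlane) (t : ℝ) :
    eLpNorm (dxFlow ε 0 n φ t) 2 volume ≤ ‖φ‖ₑ := by
  rw [eLpNorm_two_dxFlow]
  have h : ‖φ‖ₑ = eLpNorm (𝓕 φ : HPlane) 2 volume := by
    rw [← Lp.enorm_def, ← ofReal_norm, ← ofReal_norm, Lp.norm_fourier_eq]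
  rw [h]
  refine eLpNorm_mono fun ζ => ?_
  rw [dxFlowHat, norm_mul, norm_mul, norm_flowSymbol, one_mul]
  refine mul_le_of_le_one_left (norm_nonneg _) ?_
  rw [dxSymbol]
  refine (norm_indicator_le_norm_self _ _).trans ?_
  simp

/-- The homogeneous Strichartz estimate on the whole line for the truncated evolution. -/
theorem exists_strichartz {ε : ℝ} (hε : |ε| = 1) {q r : ℝ≥0∞} (h : IsAdmissible q r) :
    ∃ C : ℝ≥0, ∀ n : ℕ, 1 ≤ n → ∀ φ : HPlane,
      eLpNorm (fun t => eLpNorm (dxFlow ε (beta q r) n φ t) r volume) q volume ≤ C * ‖φ‖ₑ := by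
  by_cases hq : q = ∞
  · obtain ⟨hr, hβ⟩ := h.eq_of_eq_top hq
    refine ⟨1, fun n _ φ => ?_⟩
    rw [hβ, hr, hq, eLpNorm_exponent_top, ENNReal.coe_one, one_mul]
    refine essSup_le_of_ae_le _ (Eventually.of_forall fun t => ?_)
    simpa using eLpNorm_two_dxFlow_zero_le ε n φ t
  · exact exists_strichartz_of_ne_top hε h hq

/-! ### Mixed norm spaces and their completeness -/

section ENNRealValued

variable {α : Type*} [MeasurableSpace α] {μ : Measure α}

lemma eLpNorm_const_mul_le {c : ℝ≥0∞} (hc : c ≠ ∞) (g : α → ℝ≥0∞) (q : ℝ≥0∞) :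
    eLpNorm (fun t => c * g t) q μ ≤ c * eLpNorm g q μ := by
  lift c to ℝ≥0 using hc
  exact eLpNorm_le_nnreal_smul_eLpNorm_of_ae_le_mul' (Eventually.of_forall fun t => by simp) q

/-- Minkowski for the partial sums, then monotone convergence; for q = ∞ it is a pointwise bound
outside a null set. -/
lemma eLpNorm_tsum_le {q : ℝ≥0∞} (hq : 1 ≤ q) {g : ℕ → α → ℝ≥0∞} (hg : ∀ k, Measurable (g k)) :
    eLpNorm (fun t => ∑' k, g k t) q μ ≤ ∑' k, eLpNorm (g k) q μ := by
  have hq0 : q ≠ 0 := (zero_lt_one.trans_le hq).ne'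
  by_cases hqt : q = ∞
  · subst hqt
    simp only [eLpNorm_exponent_top, eLpNormEssSup, enorm_eq_self]
    refine essSup_le_of_ae_le _ ?_
    have h : ∀ᵐ t ∂μ, ∀ k, g k t ≤ essSup (g k) μ := ae_all_iff.2 fun k => ae_le_essSup
    filter_upwards [h] with t ht
    exact ENNReal.tsum_le_tsum ht
  · have hs0 : 0 < q.toReal := ENNReal.toReal_pos hq0 hqt
    set S : ℕ → α → ℝ≥0∞ := fun K t => ∑ k ∈ Finset.range K, g k t with hS
    have hSm : ∀ K, Measurable (S K) := fun K => Finset.measurable_sum _ fun k _ => hg k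
    have hle : ∀ K, ∫⁻ t, S K t ^ q.toReal ∂μ ≤ (∑' k, eLpNorm (g k) q μ) ^ q.toReal := fun K => by
      have h1 := eLpNorm_sum_le (f := g) (s := Finset.range K) (μ := μ)
        (fun k _ => (hg k).aestronglyMeasurable) hq
      have h2 := h1.trans (ENNReal.sum_le_tsum (Finset.range K))
      have e : (∑ k ∈ Finset.range K, g k) = S K := by ext t; simp [hS]
      rw [e, eLpNorm_eq_lintegral_rpow_enorm_toReal hq0 hqt, one_div,
        ENNReal.rpow_inv_le_iff hs0] at h2
      simpa using h2
    rw [eLpNorm_eq_lintegral_rpow_enorm_toReal hq0 hqt, one_div, ENNReal.rpow_inv_le_iff hs0]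
    have e : ∀ t, ‖∑' k, g k t‖ₑ ^ q.toReal = ⨆ K, S K t ^ q.toReal := fun t => by
      rw [enorm_eq_self, ENNReal.tsum_eq_iSup_nat]
      exact (ENNReal.orderIsoRpow _ hs0).map_iSup _
    simp only [e]
    rw [lintegral_iSup (fun K => (hSm K).pow_const _)]
    · exact iSup_le hle
    · intro i j hij t
      exact ENNReal.rpow_le_rpow (Finset.sum_le_sum_of_subset (Finset.range_mono hij)) hs0.le

lemma ae_lt_top_of_eLpNorm_ne_top {q : ℝ≥0∞} (hq : 1 ≤ q) {g : α → ℝ≥0∞} (hg : Measurable g)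
    (h : eLpNorm g q μ ≠ ∞) : ∀ᵐ t ∂μ, g t < ∞ := by
  have hq0 : q ≠ 0 := (zero_lt_one.trans_le hq).ne'
  by_cases hqt : q = ∞
  · subst hqt
    simp only [eLpNorm_exponent_top, eLpNormEssSup, enorm_eq_self] at h
    filter_upwards [ae_le_essSup (f := g)] with t ht
    exact ht.trans_lt h.lt_top
  · have hs0 : 0 < q.toReal := ENNReal.toReal_pos hq0 hqt
    have h1 := (eLpNorm_lt_top_iff_lintegral_rpow_enorm_lt_top hq0 hqt).1 h.lt_top
    simp only [enorm_eq_self] at h1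
    filter_upwards [ae_lt_top (hg.pow_const _) h1.ne] with t ht
    by_contra hc
    rw [not_lt, top_le_iff] at hc
    rw [hc, ENNReal.top_rpow_of_pos hs0] at ht
    exact lt_irrefl _ ht

end ENNRealValued

/-- The norm of `L^q(μ; L^r(ℝ²))`. -/
def mixN (q r : ℝ≥0∞) (μ : Measure ℝ) (u : ℝ → Plane → ℂ) : ℝ≥0∞ :=
  eLpNorm (fun t => eLpNorm (u t) r volume) q μ

lemma measurable_eLpNorm_section {u : ℝ → Plane → ℂ} (hu : StronglyMeasurable (Function.uncurry u))
    (r : ℝ≥0∞) : Measurable fun t => eLpNorm (u t) r volume := by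
  have hm : Measurable (Function.uncurry fun t z => ‖u t z‖ₑ) := hu.enorm
  by_cases hr0 : r = 0
  · simp [hr0]
  by_cases hrt : r = ∞
  · subst hrt
    simp only [eLpNorm_exponent_top]
    refine measurable_of_Iic fun a => ?_
    -- The essential supremum is at most a exactly when the section of a superlevel set is null, and
    -- the measure of sections is measurable in t.
    have e : (fun t => eLpNormEssSup (u t) volume) ⁻¹' Set.Iic a =
        (fun t => volume (Prod.mk t ⁻¹' {w : ℝ × Plane | a < ‖u w.1 w.2‖ₑ})) ⁻¹' {0} := by
      ext t
      simp only [Set.mem_preimage, Set.mem_Iic, Set.mem_singleton_iff]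
      constructor
      · intro h
        have := (ae_le_eLpNormEssSup (f := u t) (μ := volume)).mono fun z hz => hz.trans h
        rw [ae_iff] at this
        simpa [not_le] using this
      · intro h
        refine essSup_le_of_ae_le a ?_
        change ∀ᵐ z, ‖u t z‖ₑ ≤ a
        rw [ae_iff]
        simpa [not_le] using h
    rw [e]
    exact measurable_measure_prodMk_left (measurableSet_lt measurable_const hm)
      (measurableSet_singleton 0)
  · simp only [eLpNorm_eq_lintegral_rpow_enorm_toReal hr0 hrt]
    exact ((hm.pow_const _).lintegral_prod_right').pow_const _

lemma mixN_le_add {q r : ℝ≥0∞} (hq : 1 ≤ q) (hr : 1 ≤ r) {μ : Measure ℝ} {u v w : ℝ → Plane → ℂ}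
    (hv : StronglyMeasurable (Function.uncurry v)) (hw : StronglyMeasurable (Function.uncurry w))
    (h : ∀ t z, u t z = v t z + w t z) :
    mixN q r μ u ≤ mixN q r μ v + mixN q r μ w := by
  refine le_trans ?_ (eLpNorm_add_le (measurable_eLpNorm_section hv r).aestronglyMeasurable
    (measurable_eLpNorm_section hw r).aestronglyMeasurable hq)
  refine eLpNorm_mono_enorm fun t => ?_
  rw [enorm_eq_self, enorm_eq_self, Pi.add_apply]
  have e : u t = v t + w t := funext (h t)
  rw [e]
  exact eLpNorm_add_le (hv.of_uncurry_left).aestronglyMeasurable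
    (hw.of_uncurry_left).aestronglyMeasurable hr

lemma mixN_sub_comm (q r : ℝ≥0∞) (μ : Measure ℝ) (u v : ℝ → Plane → ℂ) :
    mixN q r μ (fun t z => u t z - v t z) = mixN q r μ (fun t z => v t z - u t z) := by
  unfold mixN
  congr 1; ext t
  exact eLpNorm_sub_comm (u t) (v t) r volume

/-- Completeness of the mixed norm spaces. -/
theorem exists_mixN_limit {q r : ℝ≥0∞} (hq : 1 ≤ q) (hr : 1 ≤ r) {μ : Measure ℝ}
    {u : ℕ → ℝ → Plane → ℂ} (hu : ∀ n, StronglyMeasurable (Function.uncurry (u n)))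
    (hc : ∀ η : ℝ≥0∞, 0 < η → ∃ N, ∀ m n, N ≤ m → m ≤ n →
      mixN q r μ (fun t z => u n t z - u m t z) ≤ η) :
    ∃ v : ℝ → Plane → ℂ, StronglyMeasurable (Function.uncurry v) ∧
      Tendsto (fun n => mixN q r μ fun t z => u n t z - v t z) atTop (𝓝 0) := by
  have hη : ∀ k : ℕ, 0 < ((4 : ℝ≥0∞)⁻¹) ^ k := fun k => ENNReal.pow_pos (by simp) k
  choose N hN using fun k : ℕ => hc _ (hη k)
  set ν : ℕ → ℕ := fun k => ∑ i ∈ Finset.range (k + 1), N i with hν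
  have hνN : ∀ k, N k ≤ ν k := fun k =>
    Finset.single_le_sum (f := N) (fun _ _ => Nat.zero_le _) (Finset.mem_range.2 k.lt_succ_self)
  have hνm : Monotone ν := fun i j hij =>
    Finset.sum_le_sum_of_subset (Finset.range_mono (Nat.succ_le_succ hij))
  set f : ℕ → ℝ → Plane → ℂ := fun k => u (ν k) with hf
  have hfm : ∀ k, StronglyMeasurable (Function.uncurry (f k)) := fun k => hu _
  set G : ℕ → ℝ → ℝ≥0∞ := fun k t => eLpNorm (f (k + 1) t - f k t) r volume with hG
  have hdm : ∀ k l, StronglyMeasurable (Function.uncurry fun t z => f k t z - f l t z) :=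
    fun k l => (hfm k).sub (hfm l)
  have hGm : ∀ k, Measurable (G k) := fun k => measurable_eLpNorm_section (hdm (k + 1) k) r
  have hGle : ∀ k, eLpNorm (G k) q μ ≤ ((4 : ℝ≥0∞)⁻¹) ^ k := fun k =>
    hN k (ν k) (ν (k + 1)) (hνN k) (hνm k.le_succ)
  -- The increments are at most 4^(-k) in norm, so even after multiplication by 2^k they are
  -- summable in L^q. At almost every t the sections then converge at the geometric rate 2^(-k)
  -- A(t).
  set A : ℝ → ℝ≥0∞ := fun t => ∑' k, 2 ^ k * G k t with hA
  have hAm : Measurable A := Measurable.tsum fun k => (hGm k).const_mul _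
  have hAle : eLpNorm A q μ ≤ 2 := by
    refine (eLpNorm_tsum_le hq fun k => (hGm k).const_mul _).trans ?_
    have : ∀ k : ℕ, eLpNorm (fun t => 2 ^ k * G k t) q μ ≤ ((2 : ℝ≥0∞)⁻¹) ^ k := fun k => by
      refine (eLpNorm_const_mul_le (ENNReal.pow_ne_top (by simp)) _ _).trans ?_
      refine (mul_le_mul_right (hGle k) _).trans (le_of_eq ?_)
      rw [← mul_pow]
      congr 1
      rw [show (4 : ℝ≥0∞) = 2 * 2 by norm_num, ENNReal.mul_inv (by simp) (by simp), ← mul_assoc,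
        ENNReal.mul_inv_cancel (by simp) (by simp), one_mul]
    refine (ENNReal.tsum_le_tsum this).trans (le_of_eq ?_)
    rw [ENNReal.tsum_geometric]
    simp
  have hAt : ∀ᵐ t ∂μ, A t < ∞ :=
    ae_lt_top_of_eLpNorm_ne_top hq hAm (ne_top_of_le_ne_top (by simp) hAle)
  have hstep : ∀ t k j, eLpNorm (f (k + j) t - f k t) r volume ≤ ((2 : ℝ≥0∞)⁻¹) ^ k * A t := by
    intro t k j
    have h1 : eLpNorm (f (k + j) t - f k t) r volume ≤ ∑ i ∈ Finset.range j, G (k + i) t := by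
      induction j with
      | zero => simp
      | succ j ih =>
        rw [Finset.sum_range_succ]
        have e : f (k + (j + 1)) t - f k t = (f (k + j) t - f k t) +
            (f (k + j + 1) t - f (k + j) t) := by
          rw [show k + (j + 1) = k + j + 1 by ring]; abel
        rw [e]
        refine (eLpNorm_add_le (hdm _ _).of_uncurry_left.aestronglyMeasurable
          (hdm _ _).of_uncurry_left.aestronglyMeasurable hr).trans ?_
        exact add_le_add ih le_rfl
    refine h1.trans ?_
    have h2 : ∀ i, G (k + i) t ≤ ((2 : ℝ≥0∞)⁻¹) ^ k * (2 ^ (k + i) * G (k + i) t) := fun i => by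
      rw [← mul_assoc, pow_add, ← mul_assoc, ← mul_pow, ENNReal.inv_mul_cancel (by simp) (by simp),
        one_pow, one_mul]
      exact le_mul_of_one_le_left zero_le (one_le_pow₀ (by norm_num))
    refine (Finset.sum_le_sum fun i _ => h2 i).trans ?_
    rw [← Finset.mul_sum]
    refine mul_le_mul_right ?_ _
    have h3 := ENNReal.sum_le_tsum (f := fun i => 2 ^ i * G i t)
      ((Finset.range j).map (addLeftEmbedding k))
    rw [Finset.sum_map] at h3
    exact h3
  -- The limit is taken pointwise in (t,z), not as a family of L^r classes, so that it is jointly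
  -- measurable.
  set v : ℝ → Plane → ℂ := fun t z => limUnder atTop fun k => f k t z with hv
  have hvm : StronglyMeasurable (Function.uncurry v) :=
    StronglyMeasurable.limUnder (l := atTop) (f := fun k => Function.uncurry (f k)) hfm
  have hlim : ∀ᵐ t ∂μ, ∀ k, eLpNorm (f k t - v t) r volume ≤ ((2 : ℝ≥0∞)⁻¹) ^ k * A t := by
    filter_upwards [hAt] with t ht
    have hcau : ∀ᵐ z : Plane, ∃ l, Tendsto (fun k => f k t z) atTop (𝓝 l) := by
      -- The added 1 makes the required inequality strict even where A(t) = 0.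
      refine Lp.ae_tendsto_of_cauchy_eLpNorm (p := r) (B := fun k => ((2 : ℝ≥0∞)⁻¹) ^ k * (2 * A t + 1))
        (fun k => (hfm k).of_uncurry_left.aestronglyMeasurable) hr ?_ ?_
      · rw [ENNReal.tsum_mul_right, ENNReal.tsum_geometric]
        refine ENNReal.mul_ne_top (by simp) ?_
        exact ENNReal.add_ne_top.2 ⟨ENNReal.mul_ne_top (by simp) ht.ne, by simp⟩
      · intro K n m hn hm
        obtain ⟨i, rfl⟩ := Nat.exists_eq_add_of_le hn
        obtain ⟨j, rfl⟩ := Nat.exists_eq_add_of_le hm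
        have e : f (K + i) t - f (K + j) t = (f (K + i) t - f K t) - (f (K + j) t - f K t) := by abel
        rw [e]
        have hfin : ((2 : ℝ≥0∞)⁻¹) ^ K * A t + ((2 : ℝ≥0∞)⁻¹) ^ K * A t ≠ ∞ := by
          have : ((2 : ℝ≥0∞)⁻¹) ^ K * A t ≠ ∞ :=
            ENNReal.mul_ne_top (ENNReal.pow_ne_top (by simp)) ht.ne
          exact ENNReal.add_ne_top.2 ⟨this, this⟩
        refine (eLpNorm_sub_le (hdm _ _).of_uncurry_left.aestronglyMeasurable
          (hdm _ _).of_uncurry_left.aestronglyMeasurable hr).trans_lt ?_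
        refine (add_le_add (hstep t K i) (hstep t K j)).trans_lt ?_
        have e2 : ((2 : ℝ≥0∞)⁻¹) ^ K * (2 * A t + 1) =
            (((2 : ℝ≥0∞)⁻¹) ^ K * A t + ((2 : ℝ≥0∞)⁻¹) ^ K * A t) + ((2 : ℝ≥0∞)⁻¹) ^ K := by ring
        rw [e2]
        exact ENNReal.lt_add_right hfin (ENNReal.pow_pos (by simp) K).ne'
    have hten : ∀ᵐ z : Plane, Tendsto (fun k => f k t z) atTop (𝓝 (v t z)) := by
      filter_upwards [hcau] with z hz
      exact tendsto_nhds_limUnder hz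
    intro k
    have h1 := Lp.eLpNorm_lim_le_liminf_eLpNorm (p := r) (μ := (volume : Measure Plane))
      (f := fun j => f (k + j) t - f k t)
      (fun j => (hdm _ _).of_uncurry_left.aestronglyMeasurable) (v t - f k t) (by
        filter_upwards [hten] with z hz
        have h2 := (tendsto_add_atTop_iff_nat k).2 hz
        have h3 := h2.sub_const (f k t z)
        refine h3.congr fun j => ?_
        rw [add_comm j k]; rfl)
    rw [eLpNorm_sub_comm]
    refine h1.trans ?_
    refine liminf_le_of_frequently_le' (Frequently.of_forall fun j => hstep t k j)
  have hsub : ∀ k, mixN q r μ (fun t z => f k t z - v t z) ≤ ((2 : ℝ≥0∞)⁻¹) ^ k * 2 := fun k => by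
    refine (eLpNorm_mono_enorm_ae (g := fun t => ((2 : ℝ≥0∞)⁻¹) ^ k * A t) ?_).trans
      ((eLpNorm_const_mul_le (ENNReal.pow_ne_top (by simp)) _ _).trans (mul_le_mul_right hAle _))
    filter_upwards [hlim] with t ht
    rw [enorm_eq_self, enorm_eq_self]
    exact ht k
  refine ⟨v, hvm, ?_⟩
  have hpow : Tendsto (fun k : ℕ => ((4 : ℝ≥0∞)⁻¹) ^ k + ((2 : ℝ≥0∞)⁻¹) ^ k * 2) atTop (𝓝 0) := by
    have h4 : Tendsto (fun k : ℕ => ((4 : ℝ≥0∞)⁻¹) ^ k) atTop (𝓝 0) :=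
      ENNReal.tendsto_pow_atTop_nhds_zero_of_lt_one (by
        rw [ENNReal.inv_lt_one]; norm_num)
    have h2 : Tendsto (fun k : ℕ => ((2 : ℝ≥0∞)⁻¹) ^ k) atTop (𝓝 0) :=
      ENNReal.tendsto_pow_atTop_nhds_zero_of_lt_one (by
        rw [ENNReal.inv_lt_one]; norm_num)
    have h5 := ENNReal.Tendsto.mul_const h2 (b := 2) (Or.inr (by simp))
    simpa using h4.add h5
  rw [ENNReal.tendsto_nhds_zero]
  intro η hη0
  obtain ⟨k, hk⟩ := ((ENNReal.tendsto_nhds_zero.1 hpow) η hη0).exists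
  filter_upwards [eventually_ge_atTop (ν k)] with n hn
  refine le_trans ?_ hk
  refine (mixN_le_add hq hr (v := fun t z => u n t z - f k t z) (w := fun t z => f k t z - v t z)
    ((hu n).sub (hfm k)) ((hfm k).sub hvm) fun t z => by ring).trans ?_
  exact add_le_add (hN k (ν k) n (hνN k) hn) (hsub k)

lemma mixN_le_of_tendsto {q r : ℝ≥0∞} (hq : 1 ≤ q) (hr : 1 ≤ r) {μ : Measure ℝ}
    {u : ℕ → ℝ → Plane → ℂ} {v : ℝ → Plane → ℂ}
    (hu : ∀ n, StronglyMeasurable (Function.uncurry (u n)))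
    (hv : StronglyMeasurable (Function.uncurry v))
    (h : Tendsto (fun n => mixN q r μ fun t z => u n t z - v t z) atTop (𝓝 0)) {B : ℝ≥0∞}
    (hB : ∀ n, 1 ≤ n → mixN q r μ (u n) ≤ B) : mixN q r μ v ≤ B := by
  have h1 : ∀ᶠ n in atTop, mixN q r μ v ≤ (mixN q r μ fun t z => u n t z - v t z) + B := by
    filter_upwards [eventually_ge_atTop 1] with n hn
    refine (mixN_le_add (v := fun t z => v t z - u n t z) (w := u n) hq hr (hv.sub (hu n)) (hu n)
      fun t z => by ring).trans ?_
    rw [mixN_sub_comm]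
    exact add_le_add le_rfl (hB n hn)
  have h2 := h.add_const B
  rw [zero_add] at h2
  exact ge_of_tendsto h2 h1

/-! ### The limit of the truncated evolutions -/

lemma mixedNorm_le_mixN (q r T : ℝ≥0∞) (u : ℝ → Plane → ℂ) :
    mixedNorm q r T u ≤ mixN q r volume u :=
  eLpNorm_mono_measure _ Measure.restrict_le_self

lemma stronglyMeasurable_dxFlow (ε γ : ℝ) (n : ℕ) (φ : HPlane) :
    StronglyMeasurable (Function.uncurry (dxFlow ε γ n φ)) :=
  (continuous_dxFlow ε γ n φ).stronglyMeasurable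

/-- The limit of the truncated evolutions in the mixed norm space. -/
theorem exists_dxFlow_limit {ε γ : ℝ} {q r : ℝ≥0∞} (hq : 1 ≤ q) (hr : 1 ≤ r) {C : ℝ≥0}
    (hC : ∀ n : ℕ, 1 ≤ n → ∀ φ : HPlane, mixN q r volume (dxFlow ε γ n φ) ≤ C * ‖φ‖ₑ)
    (φ : HPlane) :
    ∃ u : ℝ → Plane → ℂ, StronglyMeasurable (Function.uncurry u) ∧
      Tendsto (fun n => mixN q r volume fun t z => dxFlow ε γ n φ t z - u t z) atTop (𝓝 0) ∧
      mixN q r volume u ≤ C * ‖φ‖ₑ := by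
  have htail : Tendsto (fun n => (C : ℝ≥0∞) * ‖freqTail n φ‖ₑ) atTop (𝓝 0) := by
    have h1 := (continuous_enorm.tendsto (0 : HPlane)).comp (tendsto_freqTail φ)
    rw [enorm_zero] at h1
    simpa using ENNReal.Tendsto.const_mul h1 (Or.inr ENNReal.coe_ne_top)
  obtain ⟨u, hum, hut⟩ := exists_mixN_limit hq hr (μ := volume)
    (fun n => stronglyMeasurable_dxFlow ε γ n φ) (fun η hη => by
      obtain ⟨N, hN⟩ := eventually_atTop.1 ((ENNReal.tendsto_nhds_zero.1 htail) η hη)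
      refine ⟨max N 1, fun m n hm hmn => ?_⟩
      have hm1 : 1 ≤ m := (le_max_right _ _).trans hm
      simp only [dxFlow_sub_dxFlow ε γ hm1 hmn]
      exact (hC n (hm1.trans hmn) _).trans (hN m ((le_max_left _ _).trans hm)))
  exact ⟨u, hum, hut, mixN_le_of_tendsto hq hr (fun n => stronglyMeasurable_dxFlow ε γ n φ) hum hut
    fun n hn => hC n hn φ⟩

/-- A single limit on the whole time line serves every T by restriction, which makes the constant
independent of T. -/
theorem exists_isDxFlow {ε : ℝ} (hε : |ε| = 1) {q r : ℝ≥0∞} (h : IsAdmissible q r) :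
    ∃ C : ℝ≥0, ∀ (T : ℝ≥0∞) (φ : HPlane), ∃ u : ℝ → Plane → ℂ,
      IsDxFlow ε (beta q r) q r T φ u ∧ mixedNorm q r T u ≤ C * ‖φ‖ₑ := by
  obtain ⟨C, hC⟩ := exists_strichartz hε h
  have hq : 1 ≤ q := le_trans (by norm_num) h.1
  have hr : 1 ≤ r := le_trans (by norm_num) h.2.1
  refine ⟨C, fun T φ => ?_⟩
  obtain ⟨u, hum, hut, hub⟩ := exists_dxFlow_limit hq hr hC φ
  refine ⟨u, ⟨hum.aestronglyMeasurable, ?_⟩, (mixedNorm_le_mixN q r T u).trans hub⟩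
  exact tendsto_of_tendsto_of_tendsto_of_le_of_le tendsto_const_nhds hut (fun _ => zero_le)
    fun n => mixedNorm_le_mixN q r T _

/-! ### The dual estimate and the Duhamel curve in L² -/

lemma lintegral_mul_le_eLpNorm_mul_eLpNorm {α : Type*} [MeasurableSpace α] {μ : Measure α}
    {q a : ℝ≥0∞} [hqa : q.HolderConjugate a] {f g : α → ℝ≥0∞} (hf : Measurable f)
    (hg : Measurable g) : ∫⁻ x, f x * g x ∂μ ≤ eLpNorm f q μ * eLpNorm g a μ := by
  have hinv := ENNReal.HolderConjugate.inv_add_inv_eq_one q a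
  by_cases hqt : q = ∞
  · have ha : a = 1 := by rw [hqt] at hinv; simpa using hinv
    rw [hqt, ha, eLpNorm_one_eq_lintegral_enorm, eLpNorm_exponent_top,
      ← lintegral_const_mul _ hg.enorm]
    refine lintegral_mono_ae ?_
    filter_upwards [ae_le_eLpNormEssSup (f := f) (μ := μ)] with x hx
    simpa using mul_le_mul_left hx (g x)
  by_cases hat : a = ∞
  · have hq1 : q = 1 := by rw [hat] at hinv; simpa using hinv
    rw [hat, hq1, eLpNorm_one_eq_lintegral_enorm, eLpNorm_exponent_top,
      ← lintegral_mul_const _ hf.enorm]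
    refine lintegral_mono_ae ?_
    filter_upwards [ae_le_eLpNormEssSup (f := g) (μ := μ)] with x hx
    simpa using mul_le_mul_right hx (f x)
  have h := ENNReal.HolderConjugate.toReal_of_ne_top hqt hat
  have hq0 : q ≠ 0 := fun h0 => by have := h.pos; simp [h0] at this
  have ha0 : a ≠ 0 := fun h0 => by have := h.symm.pos; simp [h0] at this
  rw [eLpNorm_eq_lintegral_rpow_enorm_toReal hq0 hqt, eLpNorm_eq_lintegral_rpow_enorm_toReal ha0 hat]
  exact ENNReal.lintegral_mul_le_Lp_mul_Lq μ h hf.aemeasurable hg.aemeasurable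

/-- Hölder's inequality for the mixed norms. -/
lemma lintegral_prod_mul_le {q r a b : ℝ≥0∞} [q.HolderConjugate a] [r.HolderConjugate b]
    {μ : Measure ℝ} [SFinite μ] {w g : ℝ → Plane → ℂ}
    (hw : StronglyMeasurable (Function.uncurry w))
    (hg : StronglyMeasurable (Function.uncurry g)) :
    ∫⁻ x : ℝ × Plane, ‖w x.1 x.2‖ₑ * ‖g x.1 x.2‖ₑ ∂(μ.prod volume) ≤
      mixN q r μ w * mixN a b μ g := by
  have hwm : Measurable (Function.uncurry fun t z => ‖w t z‖ₑ) := hw.enorm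
  have hgm : Measurable (Function.uncurry fun t z => ‖g t z‖ₑ) := hg.enorm
  have hm : Measurable fun x : ℝ × Plane => ‖w x.1 x.2‖ₑ * ‖g x.1 x.2‖ₑ := hwm.mul hgm
  rw [lintegral_prod _ hm.aemeasurable]
  refine le_trans (lintegral_mono fun t => ?_) (lintegral_mul_le_eLpNorm_mul_eLpNorm
    (measurable_eLpNorm_section hw r) (measurable_eLpNorm_section hg b))
  refine (lintegral_mul_le_eLpNorm_mul_eLpNorm (q := r) (a := b) hwm.of_uncurry_left
    hgm.of_uncurry_left).trans (le_of_eq ?_)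
  rw [eLpNorm_enorm, eLpNorm_enorm]

section DuhamelVec

/-- The pairing of `g`, restricted to the times in `J`, with the truncated evolution of `φ`. -/
def pairing (ε γ : ℝ) (g : ℝ → Plane → ℂ) (J : Set ℝ) (n : ℕ) (φ : HPlane) : ℂ :=
  ∫ x : ℝ × Plane, dxFlow ε γ n φ x.1 x.2 * (starRingEnd ℂ) (g x.1 x.2)
    ∂((volume.restrict J).prod volume)

variable {ε γ : ℝ} {q r a b : ℝ≥0∞} [q.HolderConjugate a] [r.HolderConjugate b] {C : ℝ≥0}
  {g : ℝ → Plane → ℂ}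

/-- Hölder in both variables against the homogeneous estimate on the whole line: this is the dual
Strichartz estimate, with absolute values inside. -/
lemma lintegral_pairing_le
    (hC : ∀ n : ℕ, 1 ≤ n → ∀ φ : HPlane, mixN q r volume (dxFlow ε γ n φ) ≤ C * ‖φ‖ₑ)
    (hg : StronglyMeasurable (Function.uncurry g)) (J : Set ℝ) {n : ℕ} (hn : 1 ≤ n) (φ : HPlane) :
    ∫⁻ x : ℝ × Plane, ‖dxFlow ε γ n φ x.1 x.2 * (starRingEnd ℂ) (g x.1 x.2)‖ₑ
      ∂((volume.restrict J).prod volume) ≤ C * ‖φ‖ₑ * mixN a b (volume.restrict J) g := by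
  have e : ∀ x : ℝ × Plane, ‖dxFlow ε γ n φ x.1 x.2 * (starRingEnd ℂ) (g x.1 x.2)‖ₑ =
      ‖dxFlow ε γ n φ x.1 x.2‖ₑ * ‖g x.1 x.2‖ₑ := fun x => by rw [enorm_mul, RCLike.enorm_conj]
  simp only [e]
  refine (lintegral_prod_mul_le (q := q) (r := r) (a := a) (b := b)
    (stronglyMeasurable_dxFlow ε γ n φ) hg).trans ?_
  refine mul_le_mul_left (le_trans ?_ (hC n hn φ)) _
  exact eLpNorm_mono_measure _ Measure.restrict_le_self

lemma stronglyMeasurable_pairing (hg : StronglyMeasurable (Function.uncurry g)) (n : ℕ)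
    (φ : HPlane) : StronglyMeasurable fun x : ℝ × Plane =>
      dxFlow ε γ n φ x.1 x.2 * (starRingEnd ℂ) (g x.1 x.2) :=
  (stronglyMeasurable_dxFlow ε γ n φ).mul (Complex.continuous_conj.comp_stronglyMeasurable hg)

lemma integrable_pairing
    (hC : ∀ n : ℕ, 1 ≤ n → ∀ φ : HPlane, mixN q r volume (dxFlow ε γ n φ) ≤ C * ‖φ‖ₑ)
    (hg : StronglyMeasurable (Function.uncurry g)) {J : Set ℝ}
    (hJ : mixN a b (volume.restrict J) g ≠ ∞) {n : ℕ} (hn : 1 ≤ n) (φ : HPlane) :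
    Integrable (fun x : ℝ × Plane => dxFlow ε γ n φ x.1 x.2 * (starRingEnd ℂ) (g x.1 x.2))
      ((volume.restrict J).prod volume) :=
  ⟨(stronglyMeasurable_pairing hg n φ).aestronglyMeasurable,
    (lintegral_pairing_le (a := a) (b := b) hC hg J hn φ).trans_lt (ENNReal.mul_ne_top
      (ENNReal.mul_ne_top ENNReal.coe_ne_top enorm_ne_top) hJ).lt_top⟩

lemma norm_pairing_le
    (hC : ∀ n : ℕ, 1 ≤ n → ∀ φ : HPlane, mixN q r volume (dxFlow ε γ n φ) ≤ C * ‖φ‖ₑ)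
    (hg : StronglyMeasurable (Function.uncurry g)) {J : Set ℝ}
    (hJ : mixN a b (volume.restrict J) g ≠ ∞) {n : ℕ} (hn : 1 ≤ n) (φ : HPlane) :
    ‖pairing ε γ g J n φ‖ ≤ C * (mixN a b (volume.restrict J) g).toReal * ‖φ‖ := by
  have h := (enorm_integral_le_lintegral_enorm _).trans (lintegral_pairing_le (a := a) (b := b) hC hg J hn φ)
  have h2 := ENNReal.toReal_mono (ENNReal.mul_ne_top
      (ENNReal.mul_ne_top ENNReal.coe_ne_top enorm_ne_top) hJ) h
  rw [toReal_enorm, ENNReal.toReal_mul, ENNReal.toReal_mul, toReal_enorm, ENNReal.coe_toReal] at h2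
  refine h2.trans (le_of_eq ?_)
  ring

lemma pairing_sub_pairing
    (hC : ∀ n : ℕ, 1 ≤ n → ∀ φ : HPlane, mixN q r volume (dxFlow ε γ n φ) ≤ C * ‖φ‖ₑ)
    (hg : StronglyMeasurable (Function.uncurry g)) {J : Set ℝ}
    (hJ : mixN a b (volume.restrict J) g ≠ ∞) {m n : ℕ} (hm : 1 ≤ m) (hmn : m ≤ n) (φ : HPlane) :
    pairing ε γ g J n φ - pairing ε γ g J m φ = pairing ε γ g J n (freqTail m φ) := by
  rw [pairing, pairing, pairing, ← integral_sub (integrable_pairing hC hg hJ (hm.trans hmn) φ)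
    (integrable_pairing hC hg hJ hm φ)]
  congr 1; ext x
  rw [← sub_mul, dxFlow_sub_dxFlow ε γ hm hmn]

/-- The vector `∫_J D_x^{-γ} U(-s) g(s) ds` of `L²`, defined by duality. -/
lemma exists_duhamelVec
    (hC : ∀ n : ℕ, 1 ≤ n → ∀ φ : HPlane, mixN q r volume (dxFlow ε γ n φ) ≤ C * ‖φ‖ₑ)
    (hg : StronglyMeasurable (Function.uncurry g)) {J : Set ℝ}
    (hJ : mixN a b (volume.restrict J) g ≠ ∞) :
    ∃ F : HPlane, ∀ φ, Tendsto (fun n => pairing ε γ g J n φ) atTop (𝓝 (inner ℂ F φ)) := by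
  set K := C * (mixN a b (volume.restrict J) g).toReal with hK
  have hK0 : 0 ≤ K := by positivity
  -- The index is shifted because the bounds start at n = 1. The functionals are uniformly bounded
  -- and converge pointwise, since their differences see only frequency tails; the Riesz
  -- representation of the limit is the vector sought.
  let Λ : ℕ → HPlane →L[ℂ] ℂ := fun n => LinearMap.mkContinuous
    { toFun := fun φ => pairing ε γ g J (n + 1) φ
      map_add' := fun φ ψ => by
        rw [pairing, pairing, pairing, ← integral_add (integrable_pairing hC hg hJ (by simp) φ)
          (integrable_pairing hC hg hJ (by simp) ψ)]
        congr 1; ext x; rw [dxFlow_add, add_mul]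
      map_smul' := fun c φ => by
        rw [pairing, pairing, RingHom.id_apply, smul_eq_mul, ← integral_const_mul]
        congr 1; ext x; rw [dxFlow_smul, mul_assoc] } K
    fun φ => norm_pairing_le hC hg hJ (by simp) φ
  have hΛ : ∀ n φ, Λ n φ = pairing ε γ g J (n + 1) φ := fun n φ => rfl
  have hcau : ∀ φ, ∃ l, Tendsto (fun n => Λ n φ) atTop (𝓝 l) := fun φ => by
    refine cauchySeq_tendsto_of_complete ?_
    rw [Metric.cauchySeq_iff']
    intro η hη
    have ht := ((tendsto_freqTail φ).norm.const_mul K)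
    rw [norm_zero, mul_zero] at ht
    obtain ⟨N, hN⟩ := eventually_atTop.1 (ht.eventually_lt_const hη)
    refine ⟨N, fun n hn => ?_⟩
    rw [dist_eq_norm, hΛ, hΛ, pairing_sub_pairing hC hg hJ (by simp) (by simpa using hn)]
    exact (norm_pairing_le hC hg hJ (by simp) _).trans_lt (hN (N + 1) (by simp))
  choose l hl using hcau
  let L : HPlane →L[ℂ] ℂ := continuousLinearMapOfTendsto Λ (f := l) (tendsto_pi_nhds.2 hl)
  refine ⟨(InnerProductSpace.toDual ℂ HPlane).symm L, fun φ => ?_⟩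
  rw [InnerProductSpace.toDual_symm_apply]
  exact (tendsto_add_atTop_iff_nat (f := fun n => pairing ε γ g J n φ) 1).1 (hl φ)

/-- Test the limit with φ = F and divide by ‖F‖. -/
lemma norm_le_of_tendsto_pairing
    (hC : ∀ n : ℕ, 1 ≤ n → ∀ φ : HPlane, mixN q r volume (dxFlow ε γ n φ) ≤ C * ‖φ‖ₑ)
    (hg : StronglyMeasurable (Function.uncurry g)) {J : Set ℝ}
    (hJ : mixN a b (volume.restrict J) g ≠ ∞) {F : HPlane}
    (hF : ∀ φ, Tendsto (fun n => pairing ε γ g J n φ) atTop (𝓝 (inner ℂ F φ))) :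
    ‖F‖ ≤ C * (mixN a b (volume.restrict J) g).toReal := by
  have h1 := (hF F).norm
  have h2 : ‖inner ℂ F F‖ ≤ C * (mixN a b (volume.restrict J) g).toReal * ‖F‖ := by
    refine le_of_tendsto h1 ?_
    filter_upwards [eventually_ge_atTop 1] with n hn
    exact norm_pairing_le hC hg hJ hn F
  rw [inner_self_eq_norm_sq_to_K, norm_pow, RCLike.norm_ofReal, abs_of_nonneg (norm_nonneg _),
    sq] at h2
  rcases eq_or_lt_of_le (norm_nonneg F) with h0 | h0
  · rw [← h0]; positivity
  · exact le_of_mul_le_mul_right h2 h0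

lemma mixN_restrict_ne_top (hg : mixN a b volume g ≠ ∞) (J : Set ℝ) :
    mixN a b (volume.restrict J) g ≠ ∞ :=
  ne_top_of_le_ne_top hg (eLpNorm_mono_measure _ Measure.restrict_le_self)

lemma pairing_union
    (hC : ∀ n : ℕ, 1 ≤ n → ∀ φ : HPlane, mixN q r volume (dxFlow ε γ n φ) ≤ C * ‖φ‖ₑ)
    (hg : StronglyMeasurable (Function.uncurry g)) (hJ : mixN a b volume g ≠ ∞) {s t : ℝ}
    (hst : s ≤ t) {n : ℕ} (hn : 1 ≤ n) (φ : HPlane) :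
    pairing ε γ g (Set.Iic t) n φ =
      pairing ε γ g (Set.Iic s) n φ + pairing ε γ g (Set.Ioc s t) n φ := by
  have e : volume.restrict (Set.Iic t) = volume.restrict (Set.Iic s) +
      (volume : Measure ℝ).restrict (Set.Ioc s t) := by
    rw [← Measure.restrict_union (Set.Iic_disjoint_Ioc le_rfl) measurableSet_Ioc,
      Set.Iic_union_Ioc_eq_Iic hst]
  rw [pairing, e, Measure.add_prod, integral_add_measure]
  · rfl
  · exact integrable_pairing hC hg (mixN_restrict_ne_top hJ _) hn φ
  · exact integrable_pairing hC hg (mixN_restrict_ne_top hJ _) hn φ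

/-- The curve `t ↦ ∫_{s ≤ t} D_x^{-γ} U(-s) g(s) ds` in `L²`. -/
lemma exists_duhamelCurve
    (hC : ∀ n : ℕ, 1 ≤ n → ∀ φ : HPlane, mixN q r volume (dxFlow ε γ n φ) ≤ C * ‖φ‖ₑ)
    (hg : StronglyMeasurable (Function.uncurry g)) (hJ : mixN a b volume g ≠ ∞) :
    ∃ F : ℝ → HPlane,
      (∀ t φ, Tendsto (fun n => pairing ε γ g (Set.Iic t) n φ) atTop (𝓝 (inner ℂ (F t) φ))) ∧
      (∀ t, ‖F t‖ ≤ C * (mixN a b (volume.restrict (Set.Iic t)) g).toReal) ∧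
      ∀ s t, s ≤ t → ‖F t - F s‖ ≤ C * (mixN a b (volume.restrict (Set.Ioc s t)) g).toReal := by
  choose F hF using fun t : ℝ =>
    exists_duhamelVec hC hg (mixN_restrict_ne_top hJ (Set.Iic t))
  refine ⟨F, hF, fun t => norm_le_of_tendsto_pairing hC hg (mixN_restrict_ne_top hJ _) (hF t),
    fun s t hst => norm_le_of_tendsto_pairing hC hg (mixN_restrict_ne_top hJ _) fun φ => ?_⟩
  rw [inner_sub_left]
  refine ((hF t φ).sub (hF s φ)).congr' ?_
  filter_upwards [eventually_ge_atTop 1] with n hn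
  rw [pairing_union hC hg hJ hst hn]; ring

end DuhamelVec

lemma dxSymbol_mul_dxSymbol (β γ : ℝ) {m n : ℕ} (hn : 1 ≤ n) (hnm : n ≤ m) (ζ : Plane) :
    dxSymbol γ m ζ * dxSymbol β n ζ = dxSymbol (β + γ) n ζ := by
  unfold dxSymbol
  by_cases h : ζ ∈ freqBox n
  · have hpos : 0 < |2 * Real.pi * ζ 0| :=
      lt_of_lt_of_le (inv_pos.2 (by exact_mod_cast hn)) h.1
    rw [Set.indicator_of_mem h, Set.indicator_of_mem h,
      Set.indicator_of_mem (freqBox_subset hn hnm h), ← Complex.ofReal_mul,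
      ← Real.rpow_add hpos]
    rw [neg_add_rev]
  · rw [Set.indicator_of_notMem h, Set.indicator_of_notMem h, mul_zero]

lemma conj_dxSymbol (γ : ℝ) (n : ℕ) (ζ : Plane) :
    (starRingEnd ℂ) (dxSymbol γ n ζ) = dxSymbol γ n ζ := by
  unfold dxSymbol
  by_cases h : ζ ∈ freqBox n
  · rw [Set.indicator_of_mem h, Complex.conj_ofReal]
  · rw [Set.indicator_of_notMem h, map_zero]

/-- Composing the evaluation functional at (t,z) with the evolution at time s yields the Duhamel
kernel. The smaller box n decides the cutoff, the exponents β and γ add, and the times subtract. -/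
lemma conj_dxFlow_evalVec (ε β γ : ℝ) {m n : ℕ} (hn : 1 ≤ n) (hnm : n ≤ m) (s t : ℝ)
    (z w : Plane) :
    (starRingEnd ℂ) (dxFlow ε γ m (evalVec ε β n t z) s w) =
      kernelTrunc ε (β + γ) n (t - s) (z - w) := by
  rw [dxFlow_eq, kernelTrunc, Real.fourierInv_eq, Real.fourierInv_eq, ← integral_conj]
  refine integral_congr_ae ?_
  have hF : (𝓕 (evalVec ε β n t z) : HPlane) = (memLp_evalHat ε β n t z 2).toLp _ :=
    fourier_fourierInv_eq _
  filter_upwards [(memLp_evalHat ε β n t z 2).coeFn_toLp] with ζ h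
  have e : Real.fourierChar (inner ℝ ζ (z - w)) =
      Real.fourierChar (inner ℝ ζ z) * (Real.fourierChar (inner ℝ ζ w))⁻¹ := by
    rw [inner_sub_right, sub_eq_add_neg, AddChar.map_add_eq_mul, AddChar.map_neg_eq_inv]
  rw [dxFlowHat, hF, h, e, evalHat, ← dxSymbol_mul_dxSymbol β γ hn hnm, sub_eq_add_neg,
    flowSymbol_add]
  simp only [Circle.smul_def, smul_eq_mul, map_mul, Complex.conj_conj, Circle.coe_mul,
    Circle.coe_inv_eq_conj, conj_dxSymbol, conj_flowSymbol, neg_neg]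
  ring

/-- The retarded integral, cut off in frequency, is the truncated evolution of the vector
`∫_{s ≤ t} D_x^{-γ} U(-s) g(s) ds`. -/
lemma dxFlow_eq_integral_kernelTrunc {ε β γ : ℝ} {g : ℝ → Plane → ℂ} {t : ℝ} {F : HPlane}
    (hF : ∀ φ, Tendsto (fun n => pairing ε γ g (Set.Iic t) n φ) atTop (𝓝 (inner ℂ F φ)))
    (hi : ∀ (n : ℕ) (φ : HPlane), 1 ≤ n → Integrable (fun x : ℝ × Plane =>
      dxFlow ε γ n φ x.1 x.2 * (starRingEnd ℂ) (g x.1 x.2))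
      ((volume.restrict (Set.Iic t)).prod volume)) {n : ℕ} (hn : 1 ≤ n) (z : Plane) :
    dxFlow ε β n F t z =
      ∫ s in Set.Iic t, ∫ w, kernelTrunc ε (β + γ) n (t - s) (z - w) * g s w := by
  set κ := evalVec ε β n t z with hκ
  have h1 : ∀ m, n ≤ m → pairing ε γ g (Set.Iic t) m κ = (starRingEnd ℂ)
      (∫ s in Set.Iic t, ∫ w, kernelTrunc ε (β + γ) n (t - s) (z - w) * g s w) := fun m hm => by
    rw [pairing, integral_prod _ (hi m κ (hn.trans hm)), ← integral_conj]
    congr 1; ext s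
    rw [← integral_conj]
    congr 1; ext w
    rw [← conj_dxFlow_evalVec ε β γ hn hm, map_mul, Complex.conj_conj]
  -- The vector `κ` has frequencies in box n only, so the pairings are constant in m ≥ n and their
  -- limit is this value.
  have h2 := tendsto_nhds_unique (hF κ) (tendsto_const_nhds.congr'
    (by filter_upwards [eventually_ge_atTop n] with m hm using (h1 m hm).symm))
  rw [dxFlow_eq_inner, ← inner_conj_symm, ← hκ, h2, Complex.conj_conj]

/-! ### Chaining: the Christ–Kiselev argument -/

lemma eLpNorm_rpow_sum_rpow_le {α ι : Type*} [MeasurableSpace α] {μ : Measure α} {q : ℝ≥0∞}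
    {s : ℝ} (hs : 0 < s) (hq : q = ∞ ∨ q = ENNReal.ofReal s) (S : Finset ι) {f : ι → α → ℝ≥0∞}
    (hf : ∀ j, Measurable (f j)) :
    eLpNorm (fun t => (∑ j ∈ S, f j t ^ s) ^ (1 / s)) q μ ≤
      (∑ j ∈ S, eLpNorm (f j) q μ ^ s) ^ (1 / s) := by
  have hs' : 0 ≤ 1 / s := by positivity
  -- For q = ∞ any s works, by monotonicity; for q = s the two sides agree by exchanging the sum and
  -- the integral.
  rcases hq with rfl | rfl
  · simp only [eLpNorm_exponent_top, eLpNormEssSup, enorm_eq_self]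
    refine essSup_le_of_ae_le _ ?_
    have h : ∀ᵐ t ∂μ, ∀ j ∈ S, f j t ≤ essSup (f j) μ :=
      (ae_ball_iff S.countable_toSet).2 fun j _ => ae_le_essSup
    filter_upwards [h] with t ht
    exact ENNReal.rpow_le_rpow
      (Finset.sum_le_sum fun j hj => ENNReal.rpow_le_rpow (ht j hj) hs.le) hs'
  · have h0 : ENNReal.ofReal s ≠ 0 := by simpa using hs
    have key : ∀ x : ℝ≥0∞, (x ^ (1 / s)) ^ s = x := fun x => by
      rw [← ENNReal.rpow_mul, one_div, inv_mul_cancel₀ hs.ne', ENNReal.rpow_one]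
    simp only [eLpNorm_eq_lintegral_rpow_enorm_toReal h0 ENNReal.ofReal_ne_top,
      ENNReal.toReal_ofReal hs.le, enorm_eq_self, key]
    rw [lintegral_finsetSum _ fun j _ => (hf j).pow_const s]

lemma measurable_apply_nat {X Y : Type*} [MeasurableSpace X] [MeasurableSpace Y] {v : ℕ → X → Y}
    {N : X → ℕ} (hv : ∀ j, Measurable (v j)) (hN : Measurable N) :
    Measurable fun x => v (N x) x :=
  (measurable_from_prod_countable_right (f := Function.uncurry v) hv).comp
    (hN.prodMk measurable_id)

section Chaining

variable {ε γ : ℝ} {J : ℕ → ℝ → ℕ} {e : ℕ → ℕ → HPlane} {G : ℝ → HPlane}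

lemma dxFlow_sum {ι : Type*} (ε γ : ℝ) (n : ℕ) (S : Finset ι) (φ : ι → HPlane) (t : ℝ)
    (z : Plane) : dxFlow ε γ n (∑ k ∈ S, φ k) t z = ∑ k ∈ S, dxFlow ε γ n (φ k) t z := by
  simp only [dxFlow_eq_inner, inner_sum]

lemma tendsto_sum_dxFlow
    (hG : ∀ t, Tendsto (fun K => ∑ k ∈ Finset.range K, e k (J k t)) atTop (𝓝 (G t))) (n : ℕ)
    (t : ℝ) (z : Plane) :
    Tendsto (fun K => ∑ k ∈ Finset.range K, dxFlow ε γ n (e k (J k t)) t z) atTop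
      (𝓝 (dxFlow ε γ n (G t) t z)) := by
  have := ((continuous_dxFlow_vec ε γ n t z).tendsto (G t)).comp (hG t)
  refine this.congr fun K => ?_
  exact dxFlow_sum ε γ n _ _ t z

/-- No measurability of the curve G is assumed: at each level only countably many vectors occur and
they are selected by a measurable index, so the partial sums are measurable and converge pointwise.
-/
lemma stronglyMeasurable_dxFlow_curve (hJ : ∀ k, Measurable (J k))
    (hG : ∀ t, Tendsto (fun K => ∑ k ∈ Finset.range K, e k (J k t)) atTop (𝓝 (G t))) (n : ℕ) :
    StronglyMeasurable (Function.uncurry fun t z => dxFlow ε γ n (G t) t z) := by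
  let v : ℕ → ℕ → ℝ × Plane → ℂ := fun k j => Function.uncurry (dxFlow ε γ n (e k j))
  have hvm : ∀ k, Measurable fun x : ℝ × Plane => v k (J k x.1) x := fun k =>
    measurable_apply_nat (fun j => (continuous_dxFlow ε γ n (e k j)).measurable)
      ((hJ k).comp measurable_fst)
  have hsum : ∀ K, Measurable fun x : ℝ × Plane => ∑ k ∈ Finset.range K, v k (J k x.1) x :=
    fun K => Finset.measurable_sum _ fun k _ => hvm k
  have hlim : Tendsto (fun K (x : ℝ × Plane) => ∑ k ∈ Finset.range K, v k (J k x.1) x) atTop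
      (𝓝 (Function.uncurry fun t z => dxFlow ε γ n (G t) t z)) :=
    tendsto_pi_nhds.2 fun x => tendsto_sum_dxFlow hG n x.1 x.2
  exact (measurable_of_tendsto_metrizable hsum hlim).stronglyMeasurable

/-- At level k the vector selected at time t is one of 2^k + 1 fixed vectors. Bounding its
contribution by the ℓ^s sum over all of them removes the dependence on t, so the homogeneous
estimate applies to each vector separately. -/
lemma mixN_dxFlow_curve_le {q r : ℝ≥0∞} (hq1 : 1 ≤ q) (hr : 1 ≤ r) {s : ℝ} (hs : 0 < s)
    (hq : q = ∞ ∨ q = ENNReal.ofReal s) {C : ℝ≥0} {n : ℕ}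
    (hC : ∀ φ : HPlane, mixN q r volume (dxFlow ε γ n φ) ≤ C * ‖φ‖ₑ)
    (hJ2 : ∀ k t, J k t ≤ 2 ^ k)
    (hG : ∀ t, Tendsto (fun K => ∑ k ∈ Finset.range K, e k (J k t)) atTop (𝓝 (G t))) :
    mixN q r volume (fun t z => dxFlow ε γ n (G t) t z) ≤
      C * ∑' k, (∑ j ∈ Finset.range (2 ^ k + 1), ‖e k j‖ₑ ^ s) ^ (1 / s) := by
  have hs' : 0 ≤ 1 / s := by positivity
  set f : ℕ → ℕ → ℝ → ℝ≥0∞ := fun k j t => eLpNorm (dxFlow ε γ n (e k j) t) r volume with hf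
  have hfm : ∀ k j, Measurable (f k j) := fun k j =>
    measurable_eLpNorm_section (stronglyMeasurable_dxFlow ε γ n (e k j)) r
  set Y : ℕ → ℝ → ℝ≥0∞ := fun k t =>
    (∑ j ∈ Finset.range (2 ^ k + 1), f k j t ^ s) ^ (1 / s) with hY
  have hYm : ∀ k, Measurable (Y k) := fun k =>
    (Finset.measurable_sum _ fun j _ => (hfm k j).pow_const s).pow_const _
  have hsingle : ∀ k t, f k (J k t) t ≤ Y k t := fun k t => by
    have h1 : f k (J k t) t = (f k (J k t) t ^ s) ^ (1 / s) := by
      rw [← ENNReal.rpow_mul, one_div, mul_inv_cancel₀ hs.ne', ENNReal.rpow_one]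
    rw [h1]
    refine ENNReal.rpow_le_rpow ?_ hs'
    exact Finset.single_le_sum (f := fun j => f k j t ^ s) (fun _ _ => zero_le)
      (Finset.mem_range.2 (Nat.lt_succ_of_le (hJ2 k t)))
  have hpt : ∀ t, eLpNorm (fun z => dxFlow ε γ n (G t) t z) r volume ≤ ∑' k, Y k t := fun t => by
    refine (Lp.eLpNorm_lim_le_liminf_eLpNorm (f := fun K z =>
      ∑ k ∈ Finset.range K, dxFlow ε γ n (e k (J k t)) t z) (fun K => ?_) _
      (Eventually.of_forall fun z => tendsto_sum_dxFlow hG n t z)).trans ?_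
    · exact (continuous_finsetSum _ fun k _ =>
        continuous_dxFlow_right ε γ n (e k (J k t)) t).aestronglyMeasurable
    · refine liminf_le_of_frequently_le' (Eventually.of_forall fun K => ?_).frequently
      have e1 : (fun z => ∑ k ∈ Finset.range K, dxFlow ε γ n (e k (J k t)) t z) =
          ∑ k ∈ Finset.range K, dxFlow ε γ n (e k (J k t)) t := by ext z; simp
      rw [e1]
      refine (eLpNorm_sum_le (fun k _ => (continuous_dxFlow_right ε γ n
        (e k (J k t)) t).aestronglyMeasurable) hr).trans ?_
      refine (Finset.sum_le_sum fun k _ => hsingle k t).trans ?_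
      exact ENNReal.sum_le_tsum _
  have h1 : mixN q r volume (fun t z => dxFlow ε γ n (G t) t z) ≤
      eLpNorm (fun t => ∑' k, Y k t) q volume :=
    eLpNorm_mono_enorm fun t => by simpa using hpt t
  refine h1.trans ((eLpNorm_tsum_le hq1 hYm).trans ?_)
  rw [← ENNReal.tsum_mul_left]
  refine ENNReal.tsum_le_tsum fun k => ?_
  refine (eLpNorm_rpow_sum_rpow_le hs hq _ (hfm k)).trans ?_
  have h2 : ∀ j, eLpNorm (f k j) q volume ^ s ≤ (C : ℝ≥0∞) ^ s * ‖e k j‖ₑ ^ s := fun j => by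
    rw [← ENNReal.mul_rpow_of_nonneg _ _ hs.le]
    exact ENNReal.rpow_le_rpow (hC (e k j)) hs.le
  refine (ENNReal.rpow_le_rpow (Finset.sum_le_sum fun j _ => h2 j) hs').trans (le_of_eq ?_)
  rw [← Finset.mul_sum, ENNReal.mul_rpow_of_nonneg _ _ hs', ← ENNReal.rpow_mul, one_div,
    mul_inv_cancel₀ hs.ne', ENNReal.rpow_one]

end Chaining

section Dyadic

/-- The number of the dyadic interval of length `2⁻ᵏ` that contains `m t`. -/
def dyadicIndex (m : ℝ → ℝ) (k : ℕ) (t : ℝ) : ℕ := ⌊2 ^ k * m t⌋₊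

variable {m : ℝ → ℝ}

/-- The value 2^k is attained where m = 1; this is why each level has 2^k + 1 indices and not 2^k.
-/
lemma dyadicIndex_le (h1 : ∀ t, m t ≤ 1) (k : ℕ) (t : ℝ) : dyadicIndex m k t ≤ 2 ^ k := by
  have : dyadicIndex m k t ≤ ⌊((2 ^ k : ℕ) : ℝ)⌋₊ := by
    refine Nat.floor_mono ?_
    push_cast
    exact mul_le_of_le_one_right (by positivity) (h1 t)
  rwa [Nat.floor_natCast] at this

lemma dyadicIndex_succ_div (k : ℕ) (t : ℝ) :
    dyadicIndex m (k + 1) t / 2 = dyadicIndex m k t := by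
  have := Nat.floor_div_natCast (2 ^ (k + 1) * m t) 2
  rw [dyadicIndex, dyadicIndex, ← this]
  congr 1
  push_cast
  ring

lemma measurable_dyadicIndex (hm : Monotone m) (k : ℕ) : Measurable (dyadicIndex m k) :=
  Nat.measurable_floor.comp (hm.measurable.const_mul _)

lemma abs_sub_le_of_dyadicIndex_eq (h0 : ∀ t, 0 ≤ m t) {k : ℕ} {s t : ℝ}
    (h : dyadicIndex m k s = dyadicIndex m k t) : |m s - m t| ≤ (2 ^ k)⁻¹ := by
  have hk : (0 : ℝ) < 2 ^ k := by positivity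
  have a1 := Nat.floor_le (mul_nonneg hk.le (h0 s))
  have a2 := Nat.lt_floor_add_one (2 ^ k * m s)
  have b1 := Nat.floor_le (mul_nonneg hk.le (h0 t))
  have b2 := Nat.lt_floor_add_one (2 ^ k * m t)
  change ⌊2 ^ k * m s⌋₊ = ⌊2 ^ k * m t⌋₊ at h
  rw [h] at a1 a2
  have : |2 ^ k * (m s - m t)| ≤ 1 := by
    rw [abs_le]; constructor <;> linarith
  rw [abs_mul, abs_of_pos hk] at this
  rw [← one_div, le_div_iff₀ hk]; linarith

/-- A time whose dyadic index at level `k` is `j`, if there is one. -/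
def dyadicRep (m : ℝ → ℝ) (k j : ℕ) : ℝ := Function.invFun (dyadicIndex m k) j

lemma dyadicIndex_dyadicRep (k : ℕ) (t : ℝ) :
    dyadicIndex m k (dyadicRep m k (dyadicIndex m k t)) = dyadicIndex m k t :=
  Function.invFun_eq ⟨t, rfl⟩

open Classical in
/-- The increments of the dyadic approximations of the curve `G`. -/
def dyadicIncr (m : ℝ → ℝ) (G : ℝ → HPlane) : ℕ → ℕ → HPlane
  | 0, j => G (dyadicRep m 0 j)
  | k + 1, j => if ∃ t, dyadicIndex m (k + 1) t = j then
      G (dyadicRep m (k + 1) j) - G (dyadicRep m k (j / 2)) else 0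

lemma sum_dyadicIncr (G : ℝ → HPlane) (K : ℕ) (t : ℝ) :
    ∑ k ∈ Finset.range (K + 1), dyadicIncr m G k (dyadicIndex m k t) =
      G (dyadicRep m K (dyadicIndex m K t)) := by
  induction K with
  | zero => simp [dyadicIncr]
  | succ K ih =>
    rw [Finset.sum_range_succ, ih, dyadicIncr, if_pos ⟨t, rfl⟩, dyadicIndex_succ_div]
    abel

variable {G : ℝ → HPlane} {L κ : ℝ}

lemma norm_sub_le_of_dyadicIndex_eq (h0 : ∀ t, 0 ≤ m t) (hL : 0 ≤ L) (hκ : 0 < κ)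
    (hG : ∀ s t, ‖G t - G s‖ ≤ L * |m t - m s| ^ κ) {k : ℕ} {s t : ℝ}
    (h : dyadicIndex m k s = dyadicIndex m k t) : ‖G s - G t‖ ≤ L * ((2 ^ k)⁻¹) ^ κ :=
  (hG t s).trans (mul_le_mul_of_nonneg_left (Real.rpow_le_rpow (abs_nonneg _)
    (abs_sub_le_of_dyadicIndex_eq h0 h) hκ.le) hL)

lemma tendsto_sum_dyadicIncr (h0 : ∀ t, 0 ≤ m t) (hL : 0 ≤ L) (hκ : 0 < κ)
    (hG : ∀ s t, ‖G t - G s‖ ≤ L * |m t - m s| ^ κ) (t : ℝ) :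
    Tendsto (fun K => ∑ k ∈ Finset.range K, dyadicIncr m G k (dyadicIndex m k t)) atTop
      (𝓝 (G t)) := by
  rw [← tendsto_add_atTop_iff_nat 1]
  simp only [sum_dyadicIncr]
  rw [tendsto_iff_norm_sub_tendsto_zero]
  have h1 : Tendsto (fun k : ℕ => L * (((2 : ℝ) ^ k)⁻¹) ^ κ) atTop (𝓝 0) := by
    have h2 : Tendsto (fun k : ℕ => (((2 : ℝ) ^ k)⁻¹)) atTop (𝓝 0) :=
      tendsto_inv_atTop_zero.comp (tendsto_pow_atTop_atTop_of_one_lt (by norm_num))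
    have h3 := h2.rpow_const (p := κ) (Or.inr hκ.le)
    rw [Real.zero_rpow hκ.ne'] at h3
    simpa using h3.const_mul L
  exact squeeze_zero (fun _ => norm_nonneg _) (fun k =>
    norm_sub_le_of_dyadicIndex_eq h0 hL hκ hG (dyadicIndex_dyadicRep k t)) h1

/-- A representative and its parent share the index at the coarser level, so m differs by at most
2^(-k) between them. At an index no time attains, the representative is arbitrary; the increment was
set to 0 there, so the bound holds for all j. -/
lemma norm_dyadicIncr_le (h0 : ∀ t, 0 ≤ m t) (hL : 0 ≤ L) (hκ : 0 < κ)
    (hG : ∀ s t, ‖G t - G s‖ ≤ L * |m t - m s| ^ κ) (hG0 : ∀ t, ‖G t‖ ≤ L) (k j : ℕ) :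
    ‖dyadicIncr m G k j‖ ≤ L * (2 ^ κ * (2 ^ (-κ)) ^ k) := by
  have h2 : (1 : ℝ) ≤ 2 ^ κ := Real.one_le_rpow (by norm_num) hκ.le
  cases k with
  | zero =>
    rw [pow_zero, mul_one]
    exact (hG0 _).trans (le_mul_of_one_le_right hL h2)
  | succ k =>
    have e : (2 : ℝ) ^ κ * (2 ^ (-κ)) ^ (k + 1) = ((2 ^ k)⁻¹) ^ κ := by
      rw [pow_succ, mul_left_comm, ← Real.rpow_add (by norm_num), add_neg_cancel,
        Real.rpow_zero, mul_one, ← Real.rpow_natCast, ← Real.rpow_mul (by norm_num),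
        ← Real.rpow_natCast, ← Real.rpow_neg (by norm_num), ← Real.rpow_mul (by norm_num)]
      congr 1; ring
    rw [e, dyadicIncr]
    split_ifs with h
    · obtain ⟨t, rfl⟩ := h
      refine norm_sub_le_of_dyadicIndex_eq h0 hL hκ hG ?_
      rw [dyadicIndex_succ_div, dyadicIndex_dyadicRep, ← dyadicIndex_succ_div,
        dyadicIndex_dyadicRep, dyadicIndex_succ_div]
    · rw [norm_zero]; positivity

end Dyadic

/-- The sum of the sizes of the increments in the chaining argument. -/
def chainConst (s κ : ℝ) : ℝ≥0∞ :=
  ∑' k : ℕ, ENNReal.ofReal (2 ^ (1 / s + κ) * (2 ^ (1 / s - κ)) ^ k)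

lemma chainConst_ne_top {s κ : ℝ} (h : 1 / s < κ) : chainConst s κ ≠ ∞ := by
  have h1 : (2 : ℝ) ^ (1 / s - κ) < 1 :=
    Real.rpow_lt_one_of_one_lt_of_neg (by norm_num) (by linarith)
  have hs : Summable fun k : ℕ => (2 : ℝ) ^ (1 / s + κ) * (2 ^ (1 / s - κ)) ^ k :=
    (summable_geometric_of_lt_one (by positivity) h1).mul_left _
  exact hs.tsum_ofReal_ne_top

/-- There are 2^k + 1 ≤ 2^(k+1) vectors, each of size at most L 2^κ 2^(-κk): the ℓ^s norm is
geometric with ratio 2^(1/s - κ), summable exactly when 1/s < κ. -/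
lemma rpow_sum_enorm_rpow_le {E : Type*} [SeminormedAddCommGroup E] {s κ L : ℝ} (hs : 0 < s)
    (hL : 0 ≤ L) {k : ℕ} {e : ℕ → E} (h : ∀ j, ‖e j‖ ≤ L * (2 ^ κ * (2 ^ (-κ)) ^ k)) :
    (∑ j ∈ Finset.range (2 ^ k + 1), ‖e j‖ₑ ^ s) ^ (1 / s) ≤
      ENNReal.ofReal L * ENNReal.ofReal (2 ^ (1 / s + κ) * (2 ^ (1 / s - κ)) ^ k) := by
  have hs' : 0 ≤ 1 / s := by positivity
  set B : ℝ := L * (2 ^ κ * (2 ^ (-κ)) ^ k) with hB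
  have hB0 : 0 ≤ B := by positivity
  have h1 : ∀ j, ‖e j‖ₑ ^ s ≤ ENNReal.ofReal B ^ s := fun j => by
    refine ENNReal.rpow_le_rpow ?_ hs.le
    rw [← ofReal_norm]
    exact ENNReal.ofReal_le_ofReal (h j)
  have h2 : ∑ j ∈ Finset.range (2 ^ k + 1), ‖e j‖ₑ ^ s ≤
      ENNReal.ofReal (2 ^ (k + 1)) * ENNReal.ofReal B ^ s := by
    refine (Finset.sum_le_sum fun j _ => h1 j).trans ?_
    rw [Finset.sum_const, Finset.card_range, nsmul_eq_mul]
    refine mul_le_mul_left ?_ _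
    rw [← ENNReal.ofReal_natCast]
    refine ENNReal.ofReal_le_ofReal ?_
    push_cast
    have : (1 : ℝ) ≤ 2 ^ k := one_le_pow₀ (by norm_num)
    rw [pow_succ]; linarith
  refine (ENNReal.rpow_le_rpow h2 hs').trans (le_of_eq ?_)
  rw [ENNReal.mul_rpow_of_nonneg _ _ hs', ← ENNReal.rpow_mul, one_div,
    mul_inv_cancel₀ hs.ne', ENNReal.rpow_one, ENNReal.ofReal_rpow_of_nonneg (by positivity)
    (by positivity), ← ENNReal.ofReal_mul (by positivity), ← ENNReal.ofReal_mul hL]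
  congr 1
  rw [hB, ← Real.rpow_natCast, ← Real.rpow_natCast, ← Real.rpow_natCast,
    ← Real.rpow_mul (by norm_num), ← Real.rpow_mul (by norm_num), ← Real.rpow_mul (by norm_num),
    mul_left_comm, ← Real.rpow_add (by norm_num), ← Real.rpow_add (by norm_num),
    ← Real.rpow_add (by norm_num)]
  congr 2
  push_cast
  ring

/-- `freqTail` as an additive map. -/
def freqTailHom (n : ℕ) : HPlane →+ HPlane := AddMonoidHom.ofMapSub (freqTail n) (freqTail_sub n)

lemma continuous_freqTailHom (n : ℕ) : Continuous (freqTailHom n) :=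
  AddMonoidHomClass.continuous_of_bound _ 1 fun φ => by
    rw [one_mul]; exact norm_freqTail_le n φ

lemma tendsto_tsum_of_le {f : ℕ → ℕ → ℝ≥0∞} {B : ℕ → ℝ≥0∞} (hB : ∑' k, B k ≠ ∞)
    (hle : ∀ n k, f n k ≤ B k) (h : ∀ k, Tendsto (fun n => f n k) atTop (𝓝 0)) :
    Tendsto (fun n => ∑' k, f n k) atTop (𝓝 0) := by
  have h1 := tendsto_lintegral_of_dominated_convergence (μ := Measure.count) (F := f)
    (f := fun _ => 0) B (fun n => Measurable.of_discrete)
    (fun n => Eventually.of_forall fun k => hle n k) (by rwa [lintegral_count])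
    (Eventually.of_forall h)
  simpa only [lintegral_count, tsum_zero] using h1

/-- The Christ–Kiselev argument: the limit of the truncated evolutions along a curve in `L²` whose
increments are controlled by a bounded monotone function. -/
theorem exists_dxFlow_curve_limit {ε γ : ℝ} {q r : ℝ≥0∞} (hq1 : 1 ≤ q) (hr : 1 ≤ r) {s κ L : ℝ}
    (hs : 0 < s) (hq : q = ∞ ∨ q = ENNReal.ofReal s) (hsκ : 1 / s < κ) {C : ℝ≥0}
    (hC : ∀ n : ℕ, 1 ≤ n → ∀ φ : HPlane, mixN q r volume (dxFlow ε γ n φ) ≤ C * ‖φ‖ₑ)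
    {m : ℝ → ℝ} (hm : Monotone m) (h0 : ∀ t, 0 ≤ m t) (h1 : ∀ t, m t ≤ 1) (hL : 0 ≤ L)
    {G : ℝ → HPlane} (hG : ∀ s t, ‖G t - G s‖ ≤ L * |m t - m s| ^ κ) (hG0 : ∀ t, ‖G t‖ ≤ L) :
    ∃ u : ℝ → Plane → ℂ, StronglyMeasurable (Function.uncurry u) ∧
      Tendsto (fun n => mixN q r volume fun t z => dxFlow ε γ n (G t) t z - u t z) atTop (𝓝 0) ∧
      mixN q r volume u ≤ C * (ENNReal.ofReal L * chainConst s κ) := by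
  have hκ : 0 < κ := lt_trans (by positivity) hsκ
  set e := dyadicIncr m G with he
  have hlim := tendsto_sum_dyadicIncr h0 hL hκ hG
  have hnorm := norm_dyadicIncr_le h0 hL hκ hG hG0
  have hJm := measurable_dyadicIndex hm
  have hJ2 := dyadicIndex_le h1
  have hmeas : ∀ n, StronglyMeasurable (Function.uncurry fun t z => dxFlow ε γ n (G t) t z) :=
    fun n => stronglyMeasurable_dxFlow_curve hJm hlim n
  have hbound : ∀ n, 1 ≤ n → mixN q r volume (fun t z => dxFlow ε γ n (G t) t z) ≤
      C * (ENNReal.ofReal L * chainConst s κ) := fun n hn => by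
    refine (mixN_dxFlow_curve_le hq1 hr hs hq (hC n hn) hJ2 hlim).trans ?_
    refine mul_le_mul_right ?_ _
    rw [chainConst, ← ENNReal.tsum_mul_left]
    exact ENNReal.tsum_le_tsum fun k => rpow_sum_enorm_rpow_le hs hL (hnorm k)
  -- The chaining sum for the tails of the increments. It is dominated by the convergent sum for the
  -- increments themselves and tends to 0 at each level, hence it tends to 0.
  set R : ℕ → ℝ≥0∞ := fun i =>
    ∑' k, (∑ j ∈ Finset.range (2 ^ k + 1), ‖freqTail i (e k j)‖ₑ ^ s) ^ (1 / s) with hR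
  have hRlim : Tendsto R atTop (𝓝 0) := by
    refine tendsto_tsum_of_le (B := fun k =>
      ENNReal.ofReal L * ENNReal.ofReal (2 ^ (1 / s + κ) * (2 ^ (1 / s - κ)) ^ k)) ?_ ?_ ?_
    · rw [ENNReal.tsum_mul_left]
      exact ENNReal.mul_ne_top ENNReal.ofReal_ne_top (chainConst_ne_top hsκ)
    · exact fun i k => rpow_sum_enorm_rpow_le hs hL fun j =>
        (norm_freqTail_le i _).trans (hnorm k j)
    · intro k
      have t1 : ∀ j, Tendsto (fun i => ‖freqTail i (e k j)‖ₑ ^ s) atTop (𝓝 0) := fun j => by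
        have := (continuous_enorm.tendsto (0 : HPlane)).comp (tendsto_freqTail (e k j))
        rw [enorm_zero] at this
        have h2 := this.ennrpow_const s
        rwa [ENNReal.zero_rpow_of_pos hs] at h2
      have t2 := tendsto_finsetSum (Finset.range (2 ^ k + 1)) fun j _ => t1 j
      rw [Finset.sum_const_zero] at t2
      have t3 := t2.ennrpow_const (1 / s)
      rwa [ENNReal.zero_rpow_of_pos (by positivity)] at t3
  have htail : ∀ i n, 1 ≤ i → i ≤ n →
      -- Taking tails is additive and continuous, so the tails of the increments chain to the tail
      -- of G.
      mixN q r volume (fun t z => dxFlow ε γ n (G t) t z - dxFlow ε γ i (G t) t z) ≤ C * R i :=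
    fun i n hi hin => by
      simp only [dxFlow_sub_dxFlow ε γ hi hin]
      refine mixN_dxFlow_curve_le hq1 hr hs hq (hC n (hi.trans hin)) hJ2
        (e := fun k j => freqTail i (e k j)) (G := fun t => freqTail i (G t)) fun t => ?_
      have := ((continuous_freqTailHom i).tendsto (G t)).comp (hlim t)
      refine this.congr fun K => ?_
      rw [Function.comp_apply, map_sum]; rfl
  have hCR : Tendsto (fun i => (C : ℝ≥0∞) * R i) atTop (𝓝 0) := by
    simpa using ENNReal.Tendsto.const_mul hRlim (Or.inr ENNReal.coe_ne_top)
  obtain ⟨u, hum, hut⟩ := exists_mixN_limit hq1 hr (μ := volume) hmeas (fun η hη => by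
    obtain ⟨N, hN⟩ := eventually_atTop.1 ((ENNReal.tendsto_nhds_zero.1 hCR) η hη)
    refine ⟨max N 1, fun i n hi hin => ?_⟩
    exact (htail i n ((le_max_right _ _).trans hi) hin).trans (hN i ((le_max_left _ _).trans hi)))
  exact ⟨u, hum, hut, mixN_le_of_tendsto hq1 hr hmeas hum hut hbound⟩

/-! ### The mass function of the forcing term -/

section Distribution

variable {a b : ℝ≥0∞} {g : ℝ → Plane → ℂ}

/-- The normalised distribution function of `‖g(s)‖_b ^ a` in time. -/
def massFun (a b : ℝ≥0∞) (g : ℝ → Plane → ℂ) (t : ℝ) : ℝ :=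
  (∫⁻ s in Set.Iic t, eLpNorm (g s) b volume ^ a.toReal).toReal /
    (∫⁻ s, eLpNorm (g s) b volume ^ a.toReal).toReal

lemma lintegral_ne_top_of_mixN (ha : a ≠ 0) (hat : a ≠ ∞) (hg : mixN a b volume g ≠ ∞) :
    ∫⁻ s, eLpNorm (g s) b volume ^ a.toReal ≠ ∞ := by
  have := (eLpNorm_lt_top_iff_lintegral_rpow_enorm_lt_top ha hat).1 hg.lt_top
  simpa using this.ne

lemma toReal_mixN (ha : a ≠ 0) (hat : a ≠ ∞) (μ : Measure ℝ) :
    (mixN a b μ g).toReal =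
      (∫⁻ s, eLpNorm (g s) b volume ^ a.toReal ∂μ).toReal ^ (1 / a.toReal) := by
  rw [mixN, eLpNorm_eq_lintegral_rpow_enorm_toReal ha hat, ← ENNReal.toReal_rpow]
  simp

lemma monotone_massFun (ha : a ≠ 0) (hat : a ≠ ∞) (hg : mixN a b volume g ≠ ∞) :
    Monotone (massFun a b g) := fun s t hst => by
  refine div_le_div_of_nonneg_right ?_ ENNReal.toReal_nonneg
  refine ENNReal.toReal_mono (ne_top_of_le_ne_top (lintegral_ne_top_of_mixN ha hat hg)
    (setLIntegral_le_lintegral _ _)) ?_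
  exact lintegral_mono_set (Set.Iic_subset_Iic.2 hst)

lemma massFun_nonneg (t : ℝ) : 0 ≤ massFun a b g t :=
  div_nonneg ENNReal.toReal_nonneg ENNReal.toReal_nonneg

lemma massFun_le_one (ha : a ≠ 0) (hat : a ≠ ∞) (hg : mixN a b volume g ≠ ∞) (t : ℝ) :
    massFun a b g t ≤ 1 :=
  div_le_one_of_le₀ (ENNReal.toReal_mono (lintegral_ne_top_of_mixN ha hat hg)
    (setLIntegral_le_lintegral _ _)) ENNReal.toReal_nonneg

/-- The a-th power of the norm is additive over disjoint time intervals. If the total mass is 0, the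
quotient defining the mass function is 0 by convention and both sides vanish. -/
lemma toReal_mixN_Ioc (ha : a ≠ 0) (hat : a ≠ ∞) (hg : mixN a b volume g ≠ ∞) {s t : ℝ}
    (hst : s ≤ t) : (mixN a b (volume.restrict (Set.Ioc s t)) g).toReal =
      (mixN a b volume g).toReal * (massFun a b g t - massFun a b g s) ^ (1 / a.toReal) := by
  have hfin := lintegral_ne_top_of_mixN ha hat hg
  have hfin' : ∀ S : Set ℝ, ∫⁻ s in S, eLpNorm (g s) b volume ^ a.toReal ≠ ∞ := fun S =>
    ne_top_of_le_ne_top hfin (setLIntegral_le_lintegral _ _)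
  rw [toReal_mixN ha hat, toReal_mixN ha hat, ← Real.mul_rpow ENNReal.toReal_nonneg
    (sub_nonneg.2 (monotone_massFun ha hat hg hst))]
  congr 1
  have hadd : ∫⁻ x in Set.Iic t, eLpNorm (g x) b volume ^ a.toReal =
      (∫⁻ x in Set.Iic s, eLpNorm (g x) b volume ^ a.toReal) +
        ∫⁻ x in Set.Ioc s t, eLpNorm (g x) b volume ^ a.toReal := by
    rw [← lintegral_union measurableSet_Ioc (Set.Iic_disjoint_Ioc le_rfl),
      Set.Iic_union_Ioc_eq_Iic hst]
  rw [massFun, massFun, hadd, ENNReal.toReal_add (hfin' _) (hfin' _), add_div, add_sub_cancel_left]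
  rcases eq_or_ne (∫⁻ s, eLpNorm (g s) b volume ^ a.toReal).toReal 0 with h | h
  · rw [h, zero_mul]
    refine le_antisymm ?_ ENNReal.toReal_nonneg
    rw [← h]
    exact ENNReal.toReal_mono hfin (setLIntegral_le_lintegral _ _)
  · rw [mul_div_cancel₀ _ h]

end Distribution

/-! ### The inhomogeneous estimate -/

lemma holderConjugate_of_two_lt {q a : ℝ≥0∞} [q.HolderConjugate a] (hq : 2 < q) :
    a ≠ 0 ∧ a ≠ ∞ ∧ 1 / 2 < 1 / a.toReal := by
  have hinv := ENNReal.HolderConjugate.inv_add_inv_eq_one q a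
  have hq2 : q⁻¹ < 2⁻¹ := ENNReal.inv_lt_inv.2 hq
  have hqt : q⁻¹ ≠ ∞ := (hq2.trans (by simp)).ne
  have hat : a⁻¹ ≠ ∞ := fun h => by rw [h] at hinv; simp at hinv
  have h1 := congrArg ENNReal.toReal hinv
  rw [ENNReal.toReal_add hqt hat] at h1
  have h2 : q⁻¹.toReal < 1 / 2 := by
    have := (ENNReal.toReal_lt_toReal hqt (by simp)).2 hq2
    simpa using this
  have h3 : 1 / 2 < 1 / a.toReal := by
    rw [one_div a.toReal, ← ENNReal.toReal_inv]
    simp only [ENNReal.toReal_one] at h1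
    linarith
  refine ⟨fun h => by simp [h] at hat, fun h => ?_, h3⟩
  rw [h] at h3
  norm_num at h3

/-- The inhomogeneous estimate on the whole line. -/
theorem exists_duhamel_limit {ε : ℝ} (hε : |ε| = 1) {q r q₁ r₁ a b : ℝ≥0∞}
    [q₁.HolderConjugate a] [r₁.HolderConjugate b] (h : IsAdmissible q r)
    (h₁ : IsAdmissible q₁ r₁) :
    ∃ C : ℝ≥0, ∀ g : ℝ → Plane → ℂ, StronglyMeasurable (Function.uncurry g) →
      mixN a b volume g ≠ ∞ → ∃ u : ℝ → Plane → ℂ, StronglyMeasurable (Function.uncurry u) ∧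
        Tendsto (fun n => mixN q r volume fun t z => (∫ s in Set.Iic t, ∫ w,
          kernelTrunc ε (beta q r + beta q₁ r₁) n (t - s) (z - w) * g s w) - u t z) atTop (𝓝 0) ∧
        mixN q r volume u ≤ C * mixN a b volume g := by
  obtain ⟨C, hC⟩ := exists_strichartz hε h
  obtain ⟨C₁, hC₁⟩ := exists_strichartz hε h₁
  have hq : 1 ≤ q := le_trans (by norm_num) h.1
  have hr : 1 ≤ r := le_trans (by norm_num) h.2.1
  obtain ⟨ha0, hat, hκ⟩ := holderConjugate_of_two_lt (a := a) h₁.two_lt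
  -- The summation exponent is q when q is finite. For q = ∞ any s ≥ 2 would do, and 2 is taken.
  obtain ⟨s, hs0, hs, hs2⟩ : ∃ s : ℝ, 0 < s ∧ (q = ∞ ∨ q = ENNReal.ofReal s) ∧ 2 ≤ s := by
    by_cases hqt : q = ∞
    · exact ⟨2, by norm_num, Or.inl hqt, le_rfl⟩
    · have h2 : 2 ≤ q.toReal := by simpa using ENNReal.toReal_mono hqt h.1
      exact ⟨q.toReal, by linarith, Or.inr (ENNReal.ofReal_toReal hqt).symm, h2⟩
  -- The strict gap that chaining needs: 1/s ≤ 1/2, while q₁ > 2 makes its conjugate exponent a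
  -- smaller than 2.
  have hsκ : 1 / s < 1 / a.toReal :=
    lt_of_le_of_lt (one_div_le_one_div_of_le (by norm_num) hs2) hκ
  refine ⟨C * (C₁ * (chainConst s (1 / a.toReal)).toNNReal), fun g hg hgN => ?_⟩
  obtain ⟨F, hF, hF0, hFd⟩ := exists_duhamelCurve hC₁ hg hgN
  set N := (mixN a b volume g).toReal with hN
  have hL : 0 ≤ C₁ * N := by positivity
  have hm := monotone_massFun ha0 hat hgN
  have hinc : ∀ x t, x ≤ t → ‖F t - F x‖ ≤
      C₁ * N * |massFun a b g t - massFun a b g x| ^ (1 / a.toReal) := fun x t hxt => by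
    refine (hFd x t hxt).trans (le_of_eq ?_)
    rw [toReal_mixN_Ioc ha0 hat hgN hxt, abs_of_nonneg (sub_nonneg.2 (hm hxt)), mul_assoc]
  obtain ⟨u, hum, hut, hub⟩ := exists_dxFlow_curve_limit hq hr hs0 hs hsκ hC hm massFun_nonneg
    (massFun_le_one ha0 hat hgN) hL (G := F) (fun x t => by
      rcases le_total x t with hxt | hxt
      · exact hinc x t hxt
      · rw [norm_sub_rev, abs_sub_comm]; exact hinc t x hxt)
    (fun t => (hF0 t).trans (mul_le_mul_of_nonneg_left (ENNReal.toReal_mono hgN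
      (eLpNorm_mono_measure _ Measure.restrict_le_self)) C₁.2))
  refine ⟨u, hum, hut.congr' ?_, hub.trans (le_of_eq ?_)⟩
  · filter_upwards [eventually_ge_atTop 1] with n hn
    congr 1; ext t z
    rw [dxFlow_eq_integral_kernelTrunc (hF t) (fun m φ hm1 => integrable_pairing hC₁ hg
      (mixN_restrict_ne_top hgN _) hm1 φ) hn]
  · rw [ENNReal.ofReal_mul C₁.coe_nonneg, ENNReal.ofReal_toReal hgN, ENNReal.ofReal_coe_nnreal]
    push_cast
    rw [ENNReal.coe_toNNReal (chainConst_ne_top hsκ)]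
    ring

lemma measurableSet_timeInterval (T : ℝ≥0∞) : MeasurableSet (timeInterval T) :=
  (measurableSet_lt measurable_const measurable_id).inter
    (measurableSet_lt ENNReal.measurable_ofReal measurable_const)

lemma Ioc_subset_timeInterval {T : ℝ≥0∞} {t : ℝ} (ht : t ∈ timeInterval T) :
    Set.Ioc 0 t ⊆ timeInterval T := fun _ hs =>
  ⟨hs.1, (ENNReal.ofReal_le_ofReal hs.2).trans_lt ht.2⟩

/-- A strongly measurable representative of `f` on the strip, extended by zero. -/
lemma exists_stripExtension {T : ℝ≥0∞} {f : ℝ → Plane → ℂ} (hf : MeasurableOnStrip T f) :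
    ∃ g : ℝ → Plane → ℂ, StronglyMeasurable (Function.uncurry g) ∧
      (∀ t, t ∉ timeInterval T → g t = 0) ∧
      ∀ᵐ t ∂(volume.restrict (timeInterval T)), f t =ᵐ[volume] g t := by
  have hTm := measurableSet_timeInterval T
  refine ⟨fun t z => (Prod.fst ⁻¹' timeInterval T).indicator (hf.mk _) (t, z),
    hf.stronglyMeasurable_mk.indicator (measurable_fst hTm), fun t ht => ?_, ?_⟩
  · ext z
    exact Set.indicator_of_notMem (by simpa using ht) _
  · filter_upwards [Measure.ae_ae_of_ae_prod hf.ae_eq_mk, ae_restrict_mem hTm] with t h1 h2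
    filter_upwards [h1] with z hz
    rw [Set.indicator_of_mem (by simpa using h2)]
    exact hz

lemma mixedNorm_eq_mixN {a b T : ℝ≥0∞} {f g : ℝ → Plane → ℂ}
    (hg0 : ∀ t, t ∉ timeInterval T → g t = 0)
    (hfg : ∀ᵐ t ∂(volume.restrict (timeInterval T)), f t =ᵐ[volume] g t) :
    mixedNorm a b T f = mixN a b volume g := by
  have e : (fun t => eLpNorm (g t) b volume) =
      (timeInterval T).indicator fun t => eLpNorm (g t) b volume := by
    refine (Set.indicator_eq_self.2 fun t ht => ?_).symm
    by_contra h
    rw [Function.mem_support, hg0 t h, eLpNorm_zero] at ht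
    exact ht rfl
  rw [mixN, e, eLpNorm_indicator_eq_eLpNorm_restrict (measurableSet_timeInterval T), mixedNorm]
  refine eLpNorm_congr_ae ?_
  filter_upwards [hfg] with t ht
  exact eLpNorm_congr_ae ht

/-- The extension vanishes before time 0, so integrating over s ≤ t or over (0,t] is the same, and
(0,t] lies in the time interval, where f and its representative agree. -/
lemma duhamelTrunc_eq {T : ℝ≥0∞} {f g : ℝ → Plane → ℂ}
    (hg0 : ∀ t, t ∉ timeInterval T → g t = 0)
    (hfg : ∀ᵐ t ∂(volume.restrict (timeInterval T)), f t =ᵐ[volume] g t) (ε γ : ℝ) (n : ℕ)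
    {t : ℝ} (ht : t ∈ timeInterval T) (z : Plane) :
    duhamelTrunc ε γ n f t z =
      ∫ s in Set.Iic t, ∫ w, kernelTrunc ε γ n (t - s) (z - w) * g s w := by
  rw [duhamelTrunc, intervalIntegral.integral_of_le ht.1.le]
  have h1 : ∫ s in Set.Iic t, ∫ w, kernelTrunc ε γ n (t - s) (z - w) * g s w =
      ∫ s in Set.Ioc 0 t, ∫ w, kernelTrunc ε γ n (t - s) (z - w) * g s w := by
    refine setIntegral_eq_of_subset_of_forall_sdiff_eq_zero measurableSet_Iic
      Set.Ioc_subset_Iic_self fun s hs => ?_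
    rw [hg0 s fun h => hs.2 ⟨h.1, hs.1⟩]
    simp
  rw [h1]
  refine integral_congr_ae ?_
  filter_upwards [ae_restrict_of_ae_restrict_of_subset (Ioc_subset_timeInterval ht) hfg] with s hs
  refine integral_congr_ae ?_
  filter_upwards [hs] with w hw
  rw [hw]

theorem exists_isDxDuhamel {ε : ℝ} (hε : |ε| = 1) {q r q₁ r₁ a b : ℝ≥0∞}
    [q₁.HolderConjugate a] [r₁.HolderConjugate b] (h : IsAdmissible q r)
    (h₁ : IsAdmissible q₁ r₁) :
    ∃ C : ℝ≥0, ∀ (T : ℝ≥0∞) (f : ℝ → Plane → ℂ), MeasurableOnStrip T f →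
      mixedNorm a b T f < ∞ → ∃ u : ℝ → Plane → ℂ,
        IsDxDuhamel ε (beta q r + beta q₁ r₁) q r T f u ∧
        mixedNorm q r T u ≤ C * mixedNorm a b T f := by
  obtain ⟨C, hC⟩ := exists_duhamel_limit (a := a) (b := b) hε h h₁
  refine ⟨C, fun T f hf hfN => ?_⟩
  obtain ⟨g, hgm, hg0, hfg⟩ := exists_stripExtension hf
  have hN : mixedNorm a b T f = mixN a b volume g := mixedNorm_eq_mixN hg0 hfg
  rw [hN] at hfN ⊢
  obtain ⟨u, hum, hut, hub⟩ := hC g hgm hfN.ne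
  refine ⟨u, ⟨hum.aestronglyMeasurable, ?_⟩, (mixedNorm_le_mixN q r T u).trans hub⟩
  refine tendsto_of_tendsto_of_tendsto_of_le_of_le tendsto_const_nhds hut (fun _ => zero_le)
    fun n => le_trans (le_of_eq ?_) (mixedNorm_le_mixN q r T _)
  refine eLpNorm_congr_ae ?_
  filter_upwards [ae_restrict_mem (measurableSet_timeInterval T)] with t ht
  simp only [duhamelTrunc_eq hg0 hfg ε _ n ht]

end KP

end

theorem lemma2p1 (ε : ℝ) (hε : ε = 1 ∨ ε = -1) (q r q₁ r₁ : ℝ≥0∞)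
    (hqr : KP.IsAdmissible q r) (hqr₁ : KP.IsAdmissible q₁ r₁) :
    (∃ C : ℝ≥0, ∀ T : ℝ≥0∞, 0 < T → ∀ φ : Lp ℂ 2 (volume : Measure KP.Plane),
      ∃ u : ℝ → KP.Plane → ℂ, KP.IsDxFlow ε (KP.beta q r) q r T φ u ∧
        KP.mixedNorm q r T u ≤ C * ‖φ‖ₑ) ∧
    (∃ C : ℝ≥0, ∀ T : ℝ≥0∞, 0 < T → ∀ f : ℝ → KP.Plane → ℂ, KP.MeasurableOnStrip T f →
      KP.mixedNorm (ENNReal.conjExponent q₁) (ENNReal.conjExponent r₁) T f < ∞ →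
      ∃ u : ℝ → KP.Plane → ℂ,
        KP.IsDxDuhamel ε (KP.beta q r + KP.beta q₁ r₁) q r T f u ∧
        KP.mixedNorm q r T u ≤
          C * KP.mixedNorm (ENNReal.conjExponent q₁) (ENNReal.conjExponent r₁) T f) := by
  have hε' : |ε| = 1 := by rcases hε with rfl | rfl <;> norm_num
  have hc₁ : q₁.HolderConjugate q₁.conjExponent :=
    ENNReal.HolderConjugate.conjExponent (le_trans (by norm_num) hqr₁.1)
  have hc₂ : r₁.HolderConjugate r₁.conjExponent :=
    ENNReal.HolderConjugate.conjExponent (le_trans (by norm_num) hqr₁.2.1)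
  obtain ⟨C, hC⟩ := KP.exists_isDxFlow hε' hqr
  obtain ⟨C', hC'⟩ := KP.exists_isDxDuhamel (a := q₁.conjExponent) (b := r₁.conjExponent)
    hε' hqr hqr₁
  exact ⟨⟨C, fun T _ φ => hC T φ⟩, ⟨C', fun T _ f => hC' T f⟩⟩
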